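/- **Setting.** Let $k$ be a field and $H$ a quasitriangular Hopf algebra over $k$, with invertible $\mathcal R=\mathcal R^{(1)}\otimes\mathcal R^{(2)}\in H\otimes H$ such that $(\Delta\otimes\mathrm{id})\mathcal R=\mathcal R_{13}\mathcal R_{23}$, $(\mathrm{id}\otimes\Delta)\mathcal R=\mathcal R_{13}\mathcal R_{12}$, $\tau\Delta h=\mathcal R(\Delta h)\mathcal R^{-1}$. Let $\mathcal M_H$ be the braided monoidal category of right $H$-modules, with braiding $\Psi(v\otimes w)=w\triangleleft\mathcal R^{(1)}\otimes v\triangleleft\mathcal R^{(2)}$. Let $C,B$ be braided groups (Hopf algebras) in $\mathcal M_H$, the antipode of $C$ being invertible, that are dually paired: there is a morphism $\mathrm{ev}:C\otimes B\to k$ with $\mathrm{ev}(cd,b)=\mathrm{ev}(d,b_{(1)})\,\mathrm{ev}(c,b_{(2)})$, $\mathrm{ev}(c,ab)=\mathrm{ev}(c_{(2)},a)\,\mathrm{ev}(c_{(1)},b)$, $\mathrm{ev}(1,b)=\epsilon(b)$, $\mathrm{ev}(c,1)=\epsilon(c)$. A *crossed $C$-$B$-bimodule* is an object $V$ of $\mathcal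 M_H$ with a left action $\triangleright$ of $C$ and a right action $\triangleleft$ of $B$, both morphisms of $\mathcal M_H$, such that $$(\triangleright\otimes\mathrm{ev})(\mathrm{id}\otimes\Psi_{C,V}\otimes\mathrm{id})(\mathrm{id}\otimes\mathrm{id}\otimes\triangleleft\otimes\mathrm{id})(\Delta_C\otimes\mathrm{id}\otimes\Delta_B)=(\mathrm{ev}\otimes\triangleleft)(\mathrm{id}\otimes\Psi_{V,B}\otimes\mathrm{id})(\mathrm{id}\otimes\triangleright\otimes\mathrm{id}\otimes\mathrm{id})(\Delta_C\otimes\mathrm{id}\otimes\Delta_B)$$ as morphisms $C\otimes V\otimes B\to V$. Morphisms are morphisms of $\mathcal M_H$ intertwining both actions; with the braided tensor product actions (and $k$ with the counit actions as unit) these objects form a monoidal category ${}_C\mathcal C_B$ with monoidal forgetful functor to $\mathcal M_H$. *Double bosonisation.* For $h\in H$, $c\in C$ put $h\triangleright c=c\triangleleft Sh$, $\bar\Delta c=c_{\bar{(1)}}\otimes c_{\bar{(2)}}=c_{(1)}\triangleleft\mathcal R^{-(1)}\otimes c_{(2)}\triangleleft\mathcal R^{-(2)}$, $\bar S=S_C^{-1}$,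 $\langle c,b\rangle=\mathrm{ev}(c,b)$, and let $\bar C$ be $C$ with the opposite product. A *double bosonisation* $U=U(\bar C,H,B)$ is a Hopf algebra with a Hopf algebra map $H\to U$ and unital algebra maps $\bar C,B\to U$, such that $\bar C\otimes H\otimes B\to U$, $c\otimes h\otimes b\mapsto chb$, is a linear isomorphism, the counit of $U$ restricts to those of $C$ and $B$, and $$hc=(h_{(1)}\triangleright c)h_{(2)},\quad bh=h_{(1)}(b\triangleleft h_{(2)}),\quad \Delta c=c_{\bar{(1)}}\mathcal R^{-(1)}\otimes\mathcal R^{-(2)}\triangleright c_{\bar{(2)}},\quad \Delta b=b_{(1)}\triangleleft\mathcal R^{(1)}\otimes\mathcal R^{(2)}b_{(2)},$$ $$bc=(\mathcal R_1^{(2)}\triangleright c_{\bar{(2)}})\,\mathcal R_2^{(2)}\mathcal R_1^{-(1)}\,(b_{(2)}\triangleleft\mathcal R_2^{-(1)})\,\langle\mathcal R_1^{(1)}\triangleright c_{\bar{(1)}},b_{(1)}\triangleleft\mathcal R_2^{(1)}\rangle\,\langle\mathcal R_1^{-(2)}\triangleright\bar Sc_{\bar{(3)}},b_{(3)}\triangleleft\mathcal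 R_2^{-(2)}\rangle,$$ where $\mathcal R_1,\mathcal R_2$ are two copies of $\mathcal R$. **Proposition.** 1. A double bosonisation $U$ exists. For every such $U$ there is a monoidal equivalence $F$ from ${}_C\mathcal C_B$ to the category of right $U$-modules, together with a monoidal natural isomorphism between the two composite forgetful functors ${}_C\mathcal C_B\to\mathrm{Vec}$ (directly, and through $F$). 2. Suppose $B$ is rigid with dual $C$, i.e. there is $\mathrm{coev}:k\to B\otimes C$, $1\mapsto\sum_a e_a\otimes f^a$, in $\mathcal M_H$ satisfying with $\mathrm{ev}$ the two bend-straightening axioms. Then ${}_C\mathcal C_B$ is braided by $$\Psi_{V,W}\circ(\triangleleft\otimes\triangleright)\circ(\mathrm{id}\otimes S\otimes\mathrm{id}\otimes\mathrm{id})\circ(\mathrm{id}\otimes\mathrm{coev}\otimes\mathrm{id}):V\otimes W\to W\otimes V,$$ $U$ is quasitriangular with $\mathcal R_U=\big(\sum_a f^a\otimes Se_a\big)\cdot\mathcal R$ (product in $U\otimes U$), and $F$ is an equivalence of braided categories for these two braidings. 3. The object $V=B$ of $\mathcal M_H$, with the braided right adjoint action $B\otimes B\xrightarrow{\mathrm{id}\otimes\Delta}B\otimes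 B\otimes B\xrightarrow{\mathrm{id}\otimes S\otimes\mathrm{id}}B\otimes B\otimes B\xrightarrow{\Psi\otimes\mathrm{id}}B\otimes B\otimes B\xrightarrow{\ \cdot\ }B$ of $B$ and the braided left coregular action $C\otimes B\xrightarrow{S^{-1}\otimes\Delta}C\otimes B\otimes B\xrightarrow{\Psi_{C,B}\otimes\mathrm{id}}B\otimes C\otimes B\xrightarrow{\mathrm{id}\otimes\mathrm{ev}}B$ of $C$, is a crossed $C$-$B$-bimodule, and its product and unit make it an algebra in the monoidal category ${}_C\mathcal C_B$. -/

import Mathlib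

open CategoryTheory MonoidalCategory
open scoped MonObj ComonObj HopfObj TensorProduct

universe v w u

noncomputable section

namespace BraidedDouble

section Braided

variable {𝒞 : Type w} [Category.{v} 𝒞] [MonoidalCategory 𝒞] [BraidedCategory 𝒞]

/-- A categorical duality pairing of Hopf algebras (braided groups) in a braided category:
`ev (c d, b) = ev (d, b₁) ev (c, b₂)`, `ev (c, a b) = ev (c₂, a) ev (c₁, b)`, and compatibility with
units and counits. -/
structure DualPairing (C B : 𝒞) [HopfObj C] [HopfObj B] where
  ev : C ⊗ B ⟶ 𝟙_ 𝒞
  one_ev : η[C] ▷ B ≫ ev = (λ_ B).hom ≫ ε[B]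
  ev_one : C ◁ η[B] ≫ ev = (ρ_ C).hom ≫ ε[C]
  mul_ev : μ[C] ▷ B ≫ ev =
    (C ⊗ C) ◁ Δ[B] ≫ (α_ C C (B ⊗ B)).hom ≫
      C ◁ ((α_ C B B).inv ≫ ev ▷ B ≫ (λ_ B).hom) ≫ ev
  ev_mul : C ◁ μ[B] ≫ ev =
    Δ[C] ▷ (B ⊗ B) ≫ (α_ C C (B ⊗ B)).hom ≫
      C ◁ ((α_ C B B).inv ≫ ev ▷ B ≫ (λ_ B).hom) ≫ ev

/-- The braided tensor product `C ⊗ (V ⊗ W) ⟶ V' ⊗ W'` of `l` and `l'`: the coproduct of `C`, then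
the braiding of the second copy of `C` past `V`, then `l ⊗ l'`. -/
def tensorLeftAct {C : 𝒞} [ComonObj C] {V V' W W' : 𝒞} (l : C ⊗ V ⟶ V') (l' : C ⊗ W ⟶ W') :
    C ⊗ (V ⊗ W) ⟶ V' ⊗ W' :=
  Δ[C] ▷ (V ⊗ W) ≫ tensorμ C C V W ≫ (l ⊗ₘ l')

/-- The braided tensor product `(V ⊗ W) ⊗ B ⟶ V' ⊗ W'` of `r` and `r'`: the coproduct of `B`, then
the braiding of `W` past the first copy of `B`, then `r ⊗ r'`. -/
def tensorRightAct {B : 𝒞} [ComonObj B] {V V' W W' : 𝒞} (r : V ⊗ B ⟶ V') (r' : W ⊗ B ⟶ W') :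
    (V ⊗ W) ⊗ B ⟶ V' ⊗ W' :=
  (V ⊗ W) ◁ Δ[B] ≫ tensorμ V W B B ≫ (r ⊗ₘ r')

section act
variable {C : 𝒞}

lemma tensorLeftAct_nat [ComonObj C] {V V' V₁ V₂ W W' W₁ W₂ : 𝒞} (f : V₁ ⟶ V) (g : W₁ ⟶ W)
    (l : C ⊗ V ⟶ V') (l' : C ⊗ W ⟶ W') (f' : V' ⟶ V₂) (g' : W' ⟶ W₂) :
    C ◁ (f ⊗ₘ g) ≫ tensorLeftAct l l' ≫ (f' ⊗ₘ g') =
      tensorLeftAct (C ◁ f ≫ l ≫ f') (C ◁ g ≫ l' ≫ g') := by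
  simp only [tensorLeftAct, Category.assoc]
  rw [whisker_exchange_assoc, tensorμ_natural_right_assoc]
  simp

lemma tensorRightAct_nat [ComonObj C] {V V' V₁ V₂ W W' W₁ W₂ : 𝒞} (f : V₁ ⟶ V) (g : W₁ ⟶ W)
    (l : V ⊗ C ⟶ V') (l' : W ⊗ C ⟶ W') (f' : V' ⟶ V₂) (g' : W' ⟶ W₂) :
    (f ⊗ₘ g) ▷ C ≫ tensorRightAct l l' ≫ (f' ⊗ₘ g') =
      tensorRightAct (f ▷ C ≫ l ≫ f') (g ▷ C ≫ l' ≫ g') := by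
  simp only [tensorRightAct, Category.assoc]
  rw [← whisker_exchange_assoc, tensorμ_natural_left_assoc]
  simp

lemma tensorLeftAct_assoc [ComonObj C] {V V' W W' Z Z' : 𝒞}
    (f : C ⊗ V ⟶ V') (g : C ⊗ W ⟶ W') (h : C ⊗ Z ⟶ Z') :
    C ◁ (α_ V W Z).hom ≫ tensorLeftAct f (tensorLeftAct g h) =
      tensorLeftAct (tensorLeftAct f g) h ≫ (α_ V' W' Z').hom := by
  simp only [tensorLeftAct]
  have h1 : (f ⊗ₘ (Δ[C] ▷ (W ⊗ Z) ≫ tensorμ C C W Z ≫ (g ⊗ₘ h))) =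
      (C ◁ 𝟙 V ⊗ₘ Δ[C] ▷ (W ⊗ Z)) ≫ (𝟙 (C ⊗ V) ⊗ₘ tensorμ C C W Z) ≫ (f ⊗ₘ g ⊗ₘ h) := by
    simp only [tensorHom_comp_tensorHom, whiskerLeft_id, Category.id_comp]
  have h2 : ((Δ[C] ▷ (V ⊗ W) ≫ tensorμ C C V W ≫ (f ⊗ₘ g)) ⊗ₘ h) =
      (Δ[C] ▷ (V ⊗ W) ⊗ₘ C ◁ 𝟙 Z) ≫ (tensorμ C C V W ⊗ₘ 𝟙 (C ⊗ Z)) ≫ ((f ⊗ₘ g) ⊗ₘ h) := by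
    simp only [tensorHom_comp_tensorHom, whiskerLeft_id, Category.id_comp]
  have e1 {Q : 𝒞} (q : _ ⟶ Q) := tensorμ_natural_left_assoc (𝟙 C) Δ[C] V (W ⊗ Z) q
  have e2 {Q : 𝒞} (q : _ ⟶ Q) := tensorμ_natural_left_assoc Δ[C] (𝟙 C) (V ⊗ W) Z q
  have e3 {Q : 𝒞} (q : _ ⟶ Q) := associator_monoidal_assoc C C C V W Z q
  simp only [whiskerLeft_id, id_whiskerRight, id_tensorHom, tensorHom_id] at *
  rw [h1, h2]
  simp only [Category.assoc]
  rw [← e1, ← e2, associator_naturality, e3]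
  simp only [← id_tensorHom, ← tensorHom_id, tensorHom_comp_tensorHom_assoc, Category.assoc,
    Category.id_comp, Category.comp_id]
  have := ComonObj.comul_assoc C
  simp only [← id_tensorHom, ← tensorHom_id] at this
  rw [this]

lemma tensorRightAct_assoc [ComonObj C] {V V' W W' Z Z' : 𝒞}
    (f : V ⊗ C ⟶ V') (g : W ⊗ C ⟶ W') (h : Z ⊗ C ⟶ Z') :
    (α_ V W Z).hom ▷ C ≫ tensorRightAct f (tensorRightAct g h) =
      tensorRightAct (tensorRightAct f g) h ≫ (α_ V' W' Z').hom := by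
  simp only [tensorRightAct]
  have h1 : (f ⊗ₘ ((W ⊗ Z) ◁ Δ[C] ≫ tensorμ W Z C C ≫ (g ⊗ₘ h))) =
      (V ◁ 𝟙 C ⊗ₘ (W ⊗ Z) ◁ Δ[C]) ≫ (𝟙 (V ⊗ C) ⊗ₘ tensorμ W Z C C) ≫ (f ⊗ₘ g ⊗ₘ h) := by
    simp only [tensorHom_comp_tensorHom, whiskerLeft_id, Category.id_comp]
  have h2 : (((V ⊗ W) ◁ Δ[C] ≫ tensorμ V W C C ≫ (f ⊗ₘ g)) ⊗ₘ h) =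
      ((V ⊗ W) ◁ Δ[C] ⊗ₘ Z ◁ 𝟙 C) ≫ (tensorμ V W C C ⊗ₘ 𝟙 (Z ⊗ C)) ≫ ((f ⊗ₘ g) ⊗ₘ h) := by
    simp only [tensorHom_comp_tensorHom, whiskerLeft_id, Category.id_comp]
  have e1 {Q : 𝒞} (q : _ ⟶ Q) := tensorμ_natural_right_assoc V (W ⊗ Z) (𝟙 C) Δ[C] q
  have e2 {Q : 𝒞} (q : _ ⟶ Q) := tensorμ_natural_right_assoc (V ⊗ W) Z Δ[C] (𝟙 C) q
  have e3 {Q : 𝒞} (q : _ ⟶ Q) := associator_monoidal_assoc V W Z C C C q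
  simp only [whiskerLeft_id, id_tensorHom, tensorHom_id] at *
  rw [h1, h2]
  simp only [Category.assoc]
  rw [← e1, ← e2, associator_naturality, e3]
  simp only [← id_tensorHom, ← tensorHom_id, tensorHom_comp_tensorHom_assoc, Category.assoc,
    Category.id_comp, Category.comp_id]
  have := ComonObj.comul_assoc C
  simp only [← id_tensorHom, ← tensorHom_id] at this
  rw [this]

lemma tensorLeftAct_one [BimonObj C] {V W : 𝒞} (l : C ⊗ V ⟶ V) (l' : C ⊗ W ⟶ W)
    (hl : η[C] ▷ V ≫ l = (λ_ V).hom) (hl' : η[C] ▷ W ≫ l' = (λ_ W).hom) :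
    η[C] ▷ (V ⊗ W) ≫ tensorLeftAct l l' = (λ_ (V ⊗ W)).hom := by
  have e {Q : 𝒞} (q : _ ⟶ Q) := tensorμ_natural_left_assoc η[C] η[C] V W q
  rw [tensorLeftAct, ← comp_whiskerRight_assoc, BimonObj.one_comul, MonObj.tensorObj.one_def,
    comp_whiskerRight_assoc, e, tensorHom_comp_tensorHom, hl, hl', tensor_left_unitality]

lemma tensorLeftAct_mul [BimonObj C] {V W : 𝒞} (l : C ⊗ V ⟶ V) (l' : C ⊗ W ⟶ W)
    (hl : μ[C] ▷ V ≫ l = (α_ C C V).hom ≫ C ◁ l ≫ l)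
    (hl' : μ[C] ▷ W ≫ l' = (α_ C C W).hom ≫ C ◁ l' ≫ l') :
    μ[C] ▷ (V ⊗ W) ≫ tensorLeftAct l l' =
      (α_ C C (V ⊗ W)).hom ≫ C ◁ tensorLeftAct l l' ≫ tensorLeftAct l l' := by
  have e {Q : 𝒞} (q : _ ⟶ Q) := tensorμ_natural_left_assoc μ[C] μ[C] V W q
  have e' {Q : 𝒞} (q : _ ⟶ Q) := tensorμ_natural_right_assoc C C l l' q
  have e3 {Q : 𝒞} (q : _ ⟶ Q) := tensor_associativity_assoc C C C C V W q
  have e5 : (Δ[C] ⊗ₘ Δ[C]) = Δ[C] ▷ C ≫ (C ⊗ C) ◁ Δ[C] := MonoidalCategory.tensorHom_def _ _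
  simp only [tensorLeftAct, whiskerLeft_comp, Category.assoc]
  rw [← comp_whiskerRight_assoc, BimonObj.mul_comul, e5, whisker_exchange_assoc,
    whisker_exchange_assoc, whisker_exchange_assoc, e', tensorHom_comp_tensorHom]
  simp only [comp_whiskerRight, Category.assoc]
  rw [e, tensorHom_comp_tensorHom, hl, hl', ← tensorHom_comp_tensorHom, e3]
  simp only [comp_whiskerRight, Category.assoc, ← tensorHom_comp_tensorHom,
    ← tensorHom_comp_tensorHom_assoc]
  simp

lemma tensorRightAct_one [BimonObj C] {V W : 𝒞} (l : V ⊗ C ⟶ V) (l' : W ⊗ C ⟶ W)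
    (hl : V ◁ η[C] ≫ l = (ρ_ V).hom) (hl' : W ◁ η[C] ≫ l' = (ρ_ W).hom) :
    (V ⊗ W) ◁ η[C] ≫ tensorRightAct l l' = (ρ_ (V ⊗ W)).hom := by
  have e {Q : 𝒞} (q : _ ⟶ Q) := tensorμ_natural_right_assoc V W η[C] η[C] q
  rw [tensorRightAct, ← whiskerLeft_comp_assoc, BimonObj.one_comul, MonObj.tensorObj.one_def,
    whiskerLeft_comp_assoc, e, tensorHom_comp_tensorHom, hl, hl', tensor_right_unitality]

lemma tensorRightAct_mul [BimonObj C] {V W : 𝒞} (l : V ⊗ C ⟶ V) (l' : W ⊗ C ⟶ W)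
    (hl : V ◁ μ[C] ≫ l = (α_ V C C).inv ≫ l ▷ C ≫ l)
    (hl' : W ◁ μ[C] ≫ l' = (α_ W C C).inv ≫ l' ▷ C ≫ l') :
    (V ⊗ W) ◁ μ[C] ≫ tensorRightAct l l' =
      (α_ (V ⊗ W) C C).inv ≫ tensorRightAct l l' ▷ C ≫ tensorRightAct l l' := by
  have e {Q : 𝒞} (q : _ ⟶ Q) := tensorμ_natural_right_assoc V W μ[C] μ[C] q
  have e' {Q : 𝒞} (q : _ ⟶ Q) := tensorμ_natural_left_assoc l l' C C q
  have e3 {Q : 𝒞} (q : _ ⟶ Q) := tensor_associativity_assoc V W C C C C q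
  simp only [tensorRightAct, comp_whiskerRight, Category.assoc]
  rw [← whiskerLeft_comp_assoc, BimonObj.mul_comul, ← whisker_exchange_assoc,
    ← whisker_exchange_assoc, ← whisker_exchange_assoc, e', tensorHom_comp_tensorHom]
  simp only [whiskerLeft_comp, Category.assoc]
  rw [e, tensorHom_comp_tensorHom, hl, hl', ← tensorHom_comp_tensorHom]
  have e4 : tensorμ V W (C ⊗ C) (C ⊗ C) ≫ ((α_ V C C).inv ⊗ₘ (α_ W C C).inv) =
      (V ⊗ W) ◁ tensorδ C C C C ≫ (α_ (V ⊗ W) (C ⊗ C) (C ⊗ C)).inv ≫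
        tensorμ V W C C ▷ (C ⊗ C) ≫ tensorμ (V ⊗ C) (W ⊗ C) C C := by
    rw [← cancel_mono ((α_ V C C).hom ⊗ₘ (α_ W C C).hom)]
    simp only [Category.assoc, tensor_associativity, tensorHom_comp_tensorHom, Iso.inv_hom_id]
    rw [Iso.inv_hom_id_assoc, ← whiskerLeft_comp_assoc, tensorδ_tensorμ]
    simp
  rw [reassoc_of% e4, ← whiskerLeft_comp_assoc (V ⊗ W) (tensorμ C C C C), tensorμ_tensorδ]
  simp [MonoidalCategory.tensorHom_def']


/-- The composite
`(l ⊗ ev) ∘ (id ⊗ Ψ_{C,V} ⊗ id) ∘ (id ⊗ id ⊗ r ⊗ id) ∘ (Δ_C ⊗ id ⊗ Δ_B) : C ⊗ V ⊗ B ⟶ V`.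
(`tensorμ X Y Z W` is the braiding of the two middle factors of `(X ⊗ Y) ⊗ (Z ⊗ W)`.) -/
def crossLeft {B : 𝒞} [HopfObj C] [HopfObj B] (ev : C ⊗ B ⟶ 𝟙_ 𝒞) {V : 𝒞} (l : C ⊗ V ⟶ V) (r : V ⊗ B ⟶ V) :
    (C ⊗ V) ⊗ B ⟶ V :=
  (Δ[C] ▷ V ⊗ₘ Δ[B]) ≫ (α_ (C ⊗ C) V (B ⊗ B)).hom ≫
    (C ⊗ C) ◁ ((α_ V B B).inv ≫ r ▷ B) ≫ tensorμ C C V B ≫ (l ⊗ₘ ev) ≫ (ρ_ V).hom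

/-- The composite
`(ev ⊗ r) ∘ (id ⊗ Ψ_{V,B} ⊗ id) ∘ (id ⊗ l ⊗ id ⊗ id) ∘ (Δ_C ⊗ id ⊗ Δ_B) : C ⊗ V ⊗ B ⟶ V`. -/
def crossRight {B : 𝒞} [HopfObj C] [HopfObj B] (ev : C ⊗ B ⟶ 𝟙_ 𝒞) {V : 𝒞} (l : C ⊗ V ⟶ V) (r : V ⊗ B ⟶ V) :
    (C ⊗ V) ⊗ B ⟶ V :=
  (Δ[C] ▷ V ⊗ₘ Δ[B]) ≫ ((α_ C C V).hom ≫ C ◁ l) ▷ (B ⊗ B) ≫ tensorμ C V B B ≫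
    (ev ⊗ₘ r) ≫ (λ_ V).hom

/-- Auxiliary: the braided tensor product of two maps `C ⊗ V ⊗ B ⟶ V'` and `C ⊗ W ⊗ B ⟶ W'`. -/
def jointAct {B : 𝒞} [ComonObj C] [ComonObj B] {V V' W W' : 𝒞} (φ : (C ⊗ V) ⊗ B ⟶ V')
    (ψ : (C ⊗ W) ⊗ B ⟶ W') : (C ⊗ (V ⊗ W)) ⊗ B ⟶ V' ⊗ W' :=
  tensorLeftAct (𝟙 (C ⊗ V)) (𝟙 (C ⊗ W)) ▷ B ≫ tensorRightAct φ ψ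

section jointAct
variable {B : 𝒞}

lemma jointAct_nat [ComonObj C] [ComonObj B] {V V' V₁ V₂ W W' W₁ W₂ : 𝒞} (f : V₁ ⟶ V) (g : W₁ ⟶ W)
    (φ : (C ⊗ V) ⊗ B ⟶ V') (ψ : (C ⊗ W) ⊗ B ⟶ W') (f' : V' ⟶ V₂) (g' : W' ⟶ W₂) :
    (C ◁ (f ⊗ₘ g)) ▷ B ≫ jointAct φ ψ ≫ (f' ⊗ₘ g') =
      jointAct ((C ◁ f) ▷ B ≫ φ ≫ f') ((C ◁ g) ▷ B ≫ ψ ≫ g') := by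
  have h := tensorLeftAct_nat f g (𝟙 (C ⊗ V)) (𝟙 (C ⊗ W)) (𝟙 _) (𝟙 _)
  have h' := tensorLeftAct_nat (𝟙 V₁) (𝟙 W₁) (𝟙 (C ⊗ V₁)) (𝟙 (C ⊗ W₁)) (C ◁ f) (C ◁ g)
  simp only [id_tensorHom_id, whiskerLeft_id, Category.comp_id, Category.id_comp] at h h'
  simp only [jointAct, Category.assoc]
  rw [← comp_whiskerRight_assoc, h, ← h', comp_whiskerRight_assoc, tensorRightAct_nat]

lemma jointAct_assoc [ComonObj C] [ComonObj B] {V V' W W' Z Z' : 𝒞}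
    (φ : (C ⊗ V) ⊗ B ⟶ V') (ψ : (C ⊗ W) ⊗ B ⟶ W') (χ : (C ⊗ Z) ⊗ B ⟶ Z') :
    (C ◁ (α_ V W Z).hom) ▷ B ≫ jointAct φ (jointAct ψ χ) =
      jointAct (jointAct φ ψ) χ ≫ (α_ V' W' Z').hom := by
  have e1 := tensorRightAct_nat (𝟙 (C ⊗ V)) (tensorLeftAct (𝟙 (C ⊗ W)) (𝟙 (C ⊗ Z))) φ
    (tensorRightAct ψ χ) (𝟙 _) (𝟙 _)
  have e2 := tensorRightAct_nat (tensorLeftAct (𝟙 (C ⊗ V)) (𝟙 (C ⊗ W))) (𝟙 (C ⊗ Z))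
    (tensorRightAct φ ψ) χ (𝟙 _) (𝟙 _)
  have e3 := tensorLeftAct_nat (𝟙 V) (𝟙 (W ⊗ Z)) (𝟙 (C ⊗ V)) (𝟙 (C ⊗ (W ⊗ Z))) (𝟙 _)
    (tensorLeftAct (𝟙 (C ⊗ W)) (𝟙 (C ⊗ Z)))
  have e4 := tensorLeftAct_nat (𝟙 (V ⊗ W)) (𝟙 Z) (𝟙 (C ⊗ (V ⊗ W))) (𝟙 (C ⊗ Z))
    (tensorLeftAct (𝟙 (C ⊗ V)) (𝟙 (C ⊗ W))) (𝟙 _)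
  have e5 := tensorLeftAct_assoc (𝟙 (C ⊗ V)) (𝟙 (C ⊗ W)) (𝟙 (C ⊗ Z))
  simp only [id_tensorHom_id, whiskerLeft_id, id_whiskerRight, Category.comp_id,
    Category.id_comp] at e1 e2 e3 e4
  simp only [jointAct]
  rw [← e1, ← e2]
  simp only [← comp_whiskerRight_assoc, Category.assoc]
  rw [e3, e4, e5, comp_whiskerRight_assoc, tensorRightAct_assoc]

lemma jointAct_right [ComonObj C] [ComonObj B] {V V' W W' : 𝒞} (l : C ⊗ V ⟶ V) (r : V ⊗ B ⟶ V')
    (l' : C ⊗ W ⟶ W) (r' : W ⊗ B ⟶ W') :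
    tensorLeftAct l l' ▷ B ≫ tensorRightAct r r' = jointAct (l ▷ B ≫ r) (l' ▷ B ≫ r') := by
  have h := tensorLeftAct_nat (𝟙 V) (𝟙 W) (𝟙 _) (𝟙 _) l l'
  have h' := tensorRightAct_nat l l' r r' (𝟙 _) (𝟙 _)
  simp only [id_tensorHom_id, whiskerLeft_id, Category.comp_id, Category.id_comp] at h h'
  rw [← h, comp_whiskerRight_assoc, h', jointAct]

lemma jointAct_left [ComonObj C] [ComonObj B] {V V' W W' : 𝒞} (l : C ⊗ V ⟶ V') (r : V ⊗ B ⟶ V)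
    (l' : C ⊗ W ⟶ W') (r' : W ⊗ B ⟶ W) :
    (α_ C (V ⊗ W) B).hom ≫ C ◁ tensorRightAct r r' ≫ tensorLeftAct l l' =
      jointAct ((α_ C V B).hom ≫ C ◁ r ≫ l) ((α_ C W B).hom ≫ C ◁ r' ≫ l') := by
  have e' {Q : 𝒞} (q : _ ⟶ Q) := tensorμ_natural_right_assoc C C r r' q
  have e3 {Q : 𝒞} (q : _ ⟶ Q) := tensor_associativity_assoc C C V W B B q
  simp only [jointAct, tensorLeftAct, tensorRightAct, whiskerLeft_comp, Category.assoc,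
    comp_whiskerRight, id_tensorHom_id, id_whiskerRight, Category.id_comp]
  rw [whisker_exchange_assoc, whisker_exchange_assoc, e', ← tensorHom_comp_tensorHom,
    ← whisker_exchange_assoc (tensorμ C C V W) Δ[B], e3, tensorHom_comp_tensorHom,
    whisker_exchange_assoc Δ[C] ((V ⊗ W) ◁ Δ[B])]
  simp

lemma crossLeft_eq [HopfObj C] [HopfObj B] (ev : C ⊗ B ⟶ 𝟙_ 𝒞) {V : 𝒞} (l : C ⊗ V ⟶ V)
    (r : V ⊗ B ⟶ V) :
    crossLeft ev l r = (C ◁ (ρ_ V).inv) ▷ B ≫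
      jointAct ((α_ C V B).hom ≫ C ◁ r ≫ l) ((ρ_ C).hom ▷ B ≫ ev) ≫ (ρ_ V).hom := by
  have n := tensorRightAct_nat (𝟙 (C ⊗ V)) (ρ_ C).hom ((α_ C V B).hom ≫ C ◁ r ≫ l) ev (𝟙 _) (𝟙 _)
  simp only [id_tensorHom_id, id_whiskerRight, Category.comp_id, Category.id_comp] at n
  have m : tensorμ C C V (𝟙_ 𝒞) ≫ (𝟙 (C ⊗ V) ⊗ₘ (ρ_ C).hom) =
      (C ⊗ C) ◁ (ρ_ V).hom ≫ (α_ C C V).hom ≫ C ◁ (β_ C V).hom ≫ (α_ C V C).inv := by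
    simp [tensorμ]
  have t : tensorLeftAct (𝟙 (C ⊗ V)) (𝟙 (C ⊗ 𝟙_ 𝒞)) ≫ (𝟙 (C ⊗ V) ⊗ₘ (ρ_ C).hom) =
      Δ[C] ▷ _ ≫ (C ⊗ C) ◁ (ρ_ V).hom ≫ (α_ C C V).hom ≫ C ◁ (β_ C V).hom ≫ (α_ C V C).inv := by
    rw [← m]; simp [tensorLeftAct]
  have e' {Q : 𝒞} (q : _ ⟶ Q) := tensorμ_natural_right_assoc C C r (𝟙 B) q
  have k : ((α_ C C V).hom ≫ C ◁ (β_ C V).hom ≫ (α_ C V C).inv) ▷ (B ⊗ B) ≫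
      tensorμ (C ⊗ V) C B B ≫ (α_ C V B).hom ▷ (C ⊗ B) = (α_ (C ⊗ C) V (B ⊗ B)).hom ≫
        (C ⊗ C) ◁ (α_ V B B).inv ≫ tensorμ C C (V ⊗ B) B := by
    simp only [tensorμ, BraidedCategory.braiding_tensor_right_hom]
    monoidal
  have k' := reassoc_of% k
  simp only [whiskerLeft_id, tensorHom_id] at e'
  have t' := congrArg (fun z => z ▷ B) t
  simp only [comp_whiskerRight (C := 𝒞) _ _ B] at t'
  rw [jointAct, ← n, Category.assoc, Category.assoc, reassoc_of% t']
  simp only [crossLeft, tensorRightAct, whiskerLeft_comp, Category.assoc]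
  have hd : (C ◁ (ρ_ V).inv) ▷ B ≫ Δ[C] ▷ _ ▷ B ≫ ((C ⊗ C) ◁ (ρ_ V).hom) ▷ B = Δ[C] ▷ V ▷ B := by
    rw [← comp_whiskerRight, ← comp_whiskerRight, ← whisker_exchange, ← whiskerLeft_comp_assoc]
    simp
  rw [reassoc_of% hd, MonoidalCategory.tensorHom_def]
  simp only [Category.assoc, comp_whiskerRight]
  have f1 : ((α_ C V B).hom ≫ C ◁ r ≫ l ⊗ₘ ev) =
      (α_ C V B).hom ▷ (C ⊗ B) ≫ (C ◁ r) ▷ (C ⊗ B) ≫ (l ⊗ₘ ev) := by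
    simp [MonoidalCategory.tensorHom_def]
  rw [e', ← k', f1]
  simp only [Category.assoc, comp_whiskerRight, whisker_exchange_assoc]

lemma crossRight_eq [HopfObj C] [HopfObj B] (ev : C ⊗ B ⟶ 𝟙_ 𝒞) {V : 𝒞} (l : C ⊗ V ⟶ V)
    (r : V ⊗ B ⟶ V) :
    crossRight ev l r = (C ◁ (λ_ V).inv) ▷ B ≫
      jointAct ((ρ_ C).hom ▷ B ≫ ev) (l ▷ B ≫ r) ≫ (λ_ V).hom := by
  have n := tensorRightAct_nat (ρ_ C).hom l ev r (𝟙 _) (𝟙 _)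
  simp only [id_tensorHom_id, id_whiskerRight, Category.comp_id, Category.id_comp] at n
  have m : tensorμ C C (𝟙_ 𝒞) V ≫ ((ρ_ C).hom ⊗ₘ l) =
      (C ⊗ C) ◁ (λ_ V).hom ≫ (α_ C C V).hom ≫ C ◁ l := by
    have m0 : tensorμ C C (𝟙_ 𝒞) V ≫ (ρ_ C).hom ▷ (C ⊗ V) =
        (C ⊗ C) ◁ (λ_ V).hom ≫ (α_ C C V).hom := by
      simp only [tensorμ, braiding_tensorUnit_right]
      monoidal
    rw [MonoidalCategory.tensorHom_def, reassoc_of% m0]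
  have t : tensorLeftAct (𝟙 (C ⊗ 𝟙_ 𝒞)) (𝟙 (C ⊗ V)) ≫ ((ρ_ C).hom ⊗ₘ l) =
      Δ[C] ▷ _ ≫ (C ⊗ C) ◁ (λ_ V).hom ≫ (α_ C C V).hom ≫ C ◁ l := by
    rw [← m]; simp [tensorLeftAct]
  have t' := congrArg (fun z => z ▷ B) t
  simp only [comp_whiskerRight (C := 𝒞) _ _ B] at t'
  rw [jointAct, ← n, Category.assoc, Category.assoc, reassoc_of% t']
  simp only [crossRight, tensorRightAct, whiskerLeft_comp, Category.assoc]
  have hd : (C ◁ (λ_ V).inv) ▷ B ≫ Δ[C] ▷ _ ▷ B ≫ ((C ⊗ C) ◁ (λ_ V).hom) ▷ B = Δ[C] ▷ V ▷ B := by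
    rw [← comp_whiskerRight, ← comp_whiskerRight, ← whisker_exchange, ← whiskerLeft_comp_assoc]
    simp
  rw [reassoc_of% hd, MonoidalCategory.tensorHom_def]
  simp only [Category.assoc, comp_whiskerRight]
  rw [whisker_exchange_assoc, whisker_exchange_assoc]


lemma cross_tensor [HopfObj C] [HopfObj B] (ev : C ⊗ B ⟶ 𝟙_ 𝒞) {V W : 𝒞} (l : C ⊗ V ⟶ V)
    (r : V ⊗ B ⟶ V) (l' : C ⊗ W ⟶ W) (r' : W ⊗ B ⟶ W)
    (h : crossLeft ev l r = crossRight ev l r) (h' : crossLeft ev l' r' = crossRight ev l' r') :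
    crossLeft ev (tensorLeftAct l l') (tensorRightAct r r') =
      crossRight ev (tensorLeftAct l l') (tensorRightAct r r') := by
  rw [crossLeft_eq, crossRight_eq] at h h' ⊢
  rw [jointAct_left, jointAct_right]
  set P := (α_ C V B).hom ≫ C ◁ r ≫ l
  set P' := (α_ C W B).hom ≫ C ◁ r' ≫ l'
  set Q := l ▷ B ≫ r
  set Q' := l' ▷ B ≫ r'
  set E : (C ⊗ 𝟙_ 𝒞) ⊗ B ⟶ 𝟙_ 𝒞 := (ρ_ C).hom ▷ B ≫ ev
  have a1 := jointAct_assoc P P' E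
  have a2 := jointAct_assoc P E Q'
  have a3 := jointAct_assoc E Q Q'
  have n1 := jointAct_nat (𝟙 V) (ρ_ W).inv P (jointAct P' E) (𝟙 _) (ρ_ W).hom
  have n2 := jointAct_nat (𝟙 V) (λ_ W).inv P (jointAct E Q') (𝟙 _) (λ_ W).hom
  have n3 := jointAct_nat (ρ_ V).inv (𝟙 W) (jointAct P E) Q' (ρ_ V).hom (𝟙 _)
  have n4 := jointAct_nat (λ_ V).inv (𝟙 W) (jointAct E Q) Q' (λ_ V).hom (𝟙 _)
  simp only [whiskerLeft_id, id_whiskerRight, Category.comp_id, Category.id_comp,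
    id_tensorHom, tensorHom_id] at n1 n2 n3 n4
  rw [h', ← n2] at n1
  rw [h, ← n4] at n3
  have u1 : (C ◁ (ρ_ (V ⊗ W)).inv) ▷ B = (C ◁ V ◁ (ρ_ W).inv) ▷ B ≫
      (C ◁ (α_ V W (𝟙_ 𝒞)).inv) ▷ B := by
    rw [← comp_whiskerRight, ← whiskerLeft_comp]; simp
  have c {X Y : 𝒞} (f : X ≅ Y) {Q : 𝒞} (q : _ ⟶ Q) :
      (C ◁ f.inv) ▷ B ≫ (C ◁ f.hom) ▷ B ≫ q = q := by
    rw [← comp_whiskerRight_assoc, ← whiskerLeft_comp]; simp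
  have c' {X Y : 𝒞} (f : X ≅ Y) {Q : 𝒞} (q : _ ⟶ Q) :
      (C ◁ f.hom) ▷ B ≫ (C ◁ f.inv) ▷ B ≫ q = q := by
    rw [← comp_whiskerRight_assoc, ← whiskerLeft_comp]; simp
  have b1 : jointAct (jointAct P P') E = (C ◁ (α_ V W (𝟙_ 𝒞)).hom) ▷ B ≫ jointAct P (jointAct P' E) ≫
      (α_ V W (𝟙_ 𝒞)).inv := by rw [reassoc_of% a1]; simp
  have b2 : jointAct P (jointAct E Q') = (C ◁ (α_ V (𝟙_ 𝒞) W).inv) ▷ B ≫ jointAct (jointAct P E) Q' ≫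
      (α_ V (𝟙_ 𝒞) W).hom := by rw [← a2, c]
  have b3 : jointAct E (jointAct Q Q') = (C ◁ (α_ (𝟙_ 𝒞) V W).inv) ▷ B ≫ jointAct (jointAct E Q) Q' ≫
      (α_ (𝟙_ 𝒞) V W).hom := by rw [← a3, c]
  have u2 : (C ◁ V ◁ (λ_ W).inv) ▷ B ≫ (C ◁ (α_ V (𝟙_ 𝒞) W).inv) ▷ B =
      (C ◁ ((ρ_ V).inv ▷ W)) ▷ B := by
    rw [← comp_whiskerRight, ← whiskerLeft_comp]; simp
  have u3 : (C ◁ (λ_ (V ⊗ W)).inv) ▷ B ≫ (C ◁ (α_ (𝟙_ 𝒞) V W).inv) ▷ B =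
      (C ◁ ((λ_ V).inv ▷ W)) ▷ B := by
    rw [← comp_whiskerRight, ← whiskerLeft_comp]; simp
  rw [b1, b3, u1]
  simp only [Category.assoc, c]
  rw [reassoc_of% u3]
  have v1 : (α_ V W (𝟙_ 𝒞)).inv ≫ (ρ_ (V ⊗ W)).hom = V ◁ (ρ_ W).hom := by simp
  have v3 : (α_ (𝟙_ 𝒞) V W).hom ≫ (λ_ (V ⊗ W)).hom = (λ_ V).hom ▷ W := by simp
  have v2 : (α_ V (𝟙_ 𝒞) W).hom ≫ V ◁ (λ_ W).hom = (ρ_ V).hom ▷ W := by simp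
  have c'' : (C ◁ (α_ V W (𝟙_ 𝒞)).inv) ▷ B ≫ (C ◁ (α_ V W (𝟙_ 𝒞)).hom) ▷ B ≫
      jointAct P (jointAct P' E) ≫ V ◁ (ρ_ W).hom = jointAct P (jointAct P' E) ≫ V ◁ (ρ_ W).hom := c _ _
  rw [v1, v3, n1, b2]
  simp only [Category.assoc]
  rw [v2, reassoc_of% u2, n3]

lemma crossLeft_unit [HopfObj C] [HopfObj B] (ev : C ⊗ B ⟶ 𝟙_ 𝒞) :
    crossLeft ev ((ρ_ C).hom ≫ ε[C]) ((λ_ B).hom ≫ ε[B]) = (ρ_ C).hom ▷ B ≫ ev := by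
  rw [crossLeft]
  have m : tensorμ C C (𝟙_ 𝒞) B ≫ ((ρ_ C).hom) ▷ (C ⊗ B) = (C ⊗ C) ◁ (λ_ B).hom ≫ (α_ C C B).hom := by
    simp only [tensorμ, braiding_tensorUnit_right]
    monoidal
  rw [MonoidalCategory.tensorHom_def _ ev, comp_whiskerRight]
  simp only [Category.assoc, comp_whiskerRight, whiskerLeft_comp]
  rw [reassoc_of% m]
  have h1 : Δ[B] ≫ (λ_ (B ⊗ B)).inv ≫ (α_ (𝟙_ 𝒞) B B).inv ≫ (λ_ B).hom ▷ B ≫ ε[B] ▷ B ≫ (λ_ B).hom = 𝟙 _ := by simp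
  have h2 : (α_ (C ⊗ C) (𝟙_ 𝒞) (B ⊗ B)).hom = (ρ_ (C ⊗ C)).hom ▷ (B ⊗ B) ≫ (C ⊗ C) ◁ (λ_ (B ⊗ B)).inv := by
    monoidal
  have h3 : Δ[C] ≫ ε[C] ▷ C = (λ_ C).inv := ComonObj.counit_comul C
  have h4 := congrArg (fun z => z ▷ B) h3
  simp only [comp_whiskerRight (C := 𝒞) _ _ B] at h4
  rw [MonoidalCategory.tensorHom_def', h2]
  simp only [Category.assoc]
  rw [← comp_whiskerRight_assoc, rightUnitor_naturality, whisker_exchange_assoc,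
    comp_whiskerRight_assoc]
  simp only [← whiskerLeft_comp_assoc]
  rw [h1]
  simp [reassoc_of% h4]
  rw [← unitors_equal, Iso.inv_hom_id, Category.comp_id]

lemma crossRight_unit [HopfObj C] [HopfObj B] (ev : C ⊗ B ⟶ 𝟙_ 𝒞) :
    crossRight ev ((ρ_ C).hom ≫ ε[C]) ((λ_ B).hom ≫ ε[B]) = (ρ_ C).hom ▷ B ≫ ev := by
  rw [crossRight]
  have m : tensorμ C (𝟙_ 𝒞) B B ≫ (C ⊗ B) ◁ (λ_ B).hom = (ρ_ C).hom ▷ (B ⊗ B) ≫ (α_ C B B).inv := by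
    simp only [tensorμ, braiding_tensorUnit_left]
    monoidal
  rw [MonoidalCategory.tensorHom_def' ev, whiskerLeft_comp]
  simp only [Category.assoc, comp_whiskerRight, whiskerLeft_comp]
  rw [reassoc_of% m]
  have h1 : Δ[C] ▷ (𝟙_ 𝒞) ≫ (α_ C C (𝟙_ 𝒞)).hom ≫ C ◁ (ρ_ C).hom ≫ C ◁ ε[C] ≫ (ρ_ C).hom = (ρ_ C).hom := by simp
  have h1' := congrArg (fun z => z ▷ (B ⊗ B)) h1
  simp only [comp_whiskerRight (C := 𝒞) _ _ (B ⊗ B)] at h1'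
  rw [MonoidalCategory.tensorHom_def', Category.assoc, reassoc_of% h1', whisker_exchange_assoc]
  have h3 : Δ[B] ≫ B ◁ ε[B] = (ρ_ B).inv := ComonObj.comul_counit B
  simp [← whiskerLeft_comp_assoc C Δ[B], h3, unitors_equal]

end jointAct
end act

variable {C B : 𝒞} [HopfObj C] [HopfObj B]

/-- `l` is a left action of the algebra `C`, `r` is a right action of the algebra `B`, and the two
satisfy the crossing condition. -/
structure IsCrossedBimodule (p : DualPairing C B) {V : 𝒞} (l : C ⊗ V ⟶ V) (r : V ⊗ B ⟶ V) :
    Prop where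
  one_left : η[C] ▷ V ≫ l = (λ_ V).hom
  mul_left : μ[C] ▷ V ≫ l = (α_ C C V).hom ≫ C ◁ l ≫ l
  right_one : V ◁ η[B] ≫ r = (ρ_ V).hom
  right_mul : V ◁ μ[B] ≫ r = (α_ V B B).inv ≫ r ▷ B ≫ r
  crossed : crossLeft p.ev l r = crossRight p.ev l r

lemma IsCrossedBimodule.unit (p : DualPairing C B) :
    IsCrossedBimodule p (V := 𝟙_ 𝒞) ((ρ_ C).hom ≫ ε[C]) ((λ_ B).hom ≫ ε[B]) where
  one_left := by
    simp [unitors_equal]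
  mul_left := by
    simp [MonoidalCategory.tensorHom_def', unitors_equal]
  right_one := by
    simp [unitors_equal]
  right_mul := by
    simp [MonoidalCategory.tensorHom_def]
  crossed := by rw [crossLeft_unit, crossRight_unit]

lemma IsCrossedBimodule.tensor {p : DualPairing C B} {V W : 𝒞} {l : C ⊗ V ⟶ V} {r : V ⊗ B ⟶ V}
    {l' : C ⊗ W ⟶ W} {r' : W ⊗ B ⟶ W} (h : IsCrossedBimodule p l r)
    (h' : IsCrossedBimodule p l' r') :
    IsCrossedBimodule p (tensorLeftAct l l') (tensorRightAct r r') where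
  one_left := tensorLeftAct_one _ _ h.one_left h'.one_left
  mul_left := tensorLeftAct_mul _ _ h.mul_left h'.mul_left
  right_one := tensorRightAct_one _ _ h.right_one h'.right_one
  right_mul := tensorRightAct_mul _ _ h.right_mul h'.right_mul
  crossed := cross_tensor _ _ _ _ _ h.crossed h'.crossed

/-- A braided crossed `C`-`B`-bimodule. -/
structure CrossedBimodule (p : DualPairing C B) where
  V : 𝒞
  left : C ⊗ V ⟶ V
  right : V ⊗ B ⟶ V
  isCrossed : IsCrossedBimodule p left right

namespace CrossedBimodule

variable {p : DualPairing C B}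

/-- Morphisms of the braided category that intertwine the actions of `C` and of `B`. -/
@[ext]
structure Hom (V W : CrossedBimodule p) where
  hom : V.V ⟶ W.V
  left_comm : V.left ≫ hom = C ◁ hom ≫ W.left
  right_comm : V.right ≫ hom = hom ▷ B ≫ W.right

instance : Category (CrossedBimodule p) where
  Hom := Hom
  id V := ⟨𝟙 _, by simp, by simp⟩
  comp f g := ⟨f.hom ≫ g.hom, by
    rw [reassoc_of% f.left_comm, g.left_comm, whiskerLeft_comp_assoc], by
    rw [reassoc_of% f.right_comm, g.right_comm, comp_whiskerRight_assoc]⟩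
  id_comp f := Hom.ext (Category.id_comp _)
  comp_id f := Hom.ext (Category.comp_id _)
  assoc f g h := Hom.ext (Category.assoc _ _ _)

@[ext]
lemma hom_ext {V W : CrossedBimodule p} {f g : V ⟶ W} (h : f.hom = g.hom) : f = g :=
  Hom.ext h

variable (p) in
/-- The forgetful functor to the underlying braided category. -/
def forget : CrossedBimodule p ⥤ 𝒞 where
  obj V := V.V
  map f := f.hom
  map_id _ := rfl
  map_comp _ _ := rfl

instance : (forget p).Faithful where
  map_injective h := Hom.ext h

@[simp]
lemma id_hom (V : CrossedBimodule p) : Hom.hom (𝟙 V) = 𝟙 V.V := rfl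

@[simp]
lemma comp_hom {V W Z : CrossedBimodule p} (f : V ⟶ W) (g : W ⟶ Z) :
    Hom.hom (f ≫ g) = f.hom ≫ g.hom := rfl

def isoMk {V W : CrossedBimodule p} (e : V.V ≅ W.V)
    (hl : V.left ≫ e.hom = C ◁ e.hom ≫ W.left)
    (hr : V.right ≫ e.hom = e.hom ▷ B ≫ W.right) : V ≅ W where
  hom := ⟨e.hom, hl, hr⟩
  inv := ⟨e.inv, by
    rw [← cancel_mono e.hom, Category.assoc, Category.assoc, hl, Iso.inv_hom_id,
      Category.comp_id, whiskerLeft_inv_hom_assoc], by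
    rw [← cancel_mono e.hom, Category.assoc, Category.assoc, hr, Iso.inv_hom_id,
      Category.comp_id, inv_hom_whiskerRight_assoc]⟩
  hom_inv_id := hom_ext e.hom_inv_id
  inv_hom_id := hom_ext e.inv_hom_id

lemma tensorLeftAct_comp {V V' W W' : 𝒞} {l : C ⊗ V ⟶ V} {l' : C ⊗ W ⟶ W} {m : C ⊗ V' ⟶ V'}
    {m' : C ⊗ W' ⟶ W'} {f : V ⟶ V'} {g : W ⟶ W'} (hf : l ≫ f = C ◁ f ≫ m)
    (hg : l' ≫ g = C ◁ g ≫ m') :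
    tensorLeftAct l l' ≫ (f ⊗ₘ g) = C ◁ (f ⊗ₘ g) ≫ tensorLeftAct m m' := by
  have h1 := tensorLeftAct_nat (𝟙 V) (𝟙 W) l l' f g
  have h2 := tensorLeftAct_nat f g m m' (𝟙 _) (𝟙 _)
  simp only [id_tensorHom_id, whiskerLeft_id, Category.id_comp, Category.comp_id] at h1 h2
  rw [h1, h2, hf, hg]

lemma tensorRightAct_comp {V V' W W' : 𝒞} {r : V ⊗ B ⟶ V} {r' : W ⊗ B ⟶ W} {m : V' ⊗ B ⟶ V'}
    {m' : W' ⊗ B ⟶ W'} {f : V ⟶ V'} {g : W ⟶ W'} (hf : r ≫ f = f ▷ B ≫ m)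
    (hg : r' ≫ g = g ▷ B ≫ m') :
    tensorRightAct r r' ≫ (f ⊗ₘ g) = (f ⊗ₘ g) ▷ B ≫ tensorRightAct m m' := by
  have h1 := tensorRightAct_nat (𝟙 V) (𝟙 W) r r' f g
  have h2 := tensorRightAct_nat f g m m' (𝟙 _) (𝟙 _)
  simp only [id_tensorHom_id, id_whiskerRight, Category.id_comp, Category.comp_id] at h1 h2
  rw [h1, h2, hf, hg]

lemma tensorLeftAct_leftUnitor {V : 𝒞} (l : C ⊗ V ⟶ V) :
    tensorLeftAct ((ρ_ C).hom ≫ ε[C]) l ≫ (λ_ V).hom = C ◁ (λ_ V).hom ≫ l := by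
  have m : tensorμ C C (𝟙_ 𝒞) V ≫ (ρ_ C).hom ▷ (C ⊗ V) =
      (C ⊗ C) ◁ (λ_ V).hom ≫ (α_ C C V).hom := by
    simp only [tensorμ, braiding_tensorUnit_right]
    monoidal
  have h : Δ[C] ≫ ε[C] ▷ C = (λ_ C).inv := ComonObj.counit_comul C
  have h' := congrArg (fun z => z ▷ V) h
  simp only [comp_whiskerRight (C := 𝒞) _ _ V] at h'
  rw [tensorLeftAct, MonoidalCategory.tensorHom_def, comp_whiskerRight]
  simp only [Category.assoc]
  rw [reassoc_of% m, ← whisker_exchange_assoc]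
  simp [reassoc_of% h']

lemma tensorLeftAct_rightUnitor {V : 𝒞} (l : C ⊗ V ⟶ V) :
    tensorLeftAct l ((ρ_ C).hom ≫ ε[C]) ≫ (ρ_ V).hom = C ◁ (ρ_ V).hom ≫ l := by
  have m : tensorμ C C V (𝟙_ 𝒞) ≫ (C ⊗ V) ◁ (ρ_ C).hom =
      (C ⊗ C) ◁ (ρ_ V).hom ≫ (α_ C C V).hom ≫ C ◁ (β_ C V).hom ≫ (α_ C V C).inv := by
    simp only [tensorμ]
    monoidal
  have h : Δ[C] ≫ C ◁ ε[C] = (ρ_ C).inv := ComonObj.comul_counit C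
  have h' := congrArg (fun z => z ▷ V) h
  simp only [comp_whiskerRight (C := 𝒞) _ _ V] at h'
  rw [tensorLeftAct, MonoidalCategory.tensorHom_def', whiskerLeft_comp]
  simp only [Category.assoc]
  rw [reassoc_of% m, ← whisker_exchange_assoc]
  have k : (β_ C V).hom ≫ V ◁ ε[C] ≫ (ρ_ V).hom = ε[C] ▷ V ≫ (λ_ V).hom := by
    rw [← BraidedCategory.braiding_naturality_left_assoc]; simp
  have k2 : (α_ C V C).inv ≫ (C ⊗ V) ◁ ε[C] ≫ l ▷ 𝟙_ 𝒞 ≫ (ρ_ V).hom =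
      C ◁ (V ◁ ε[C] ≫ (ρ_ V).hom) ≫ l := by simp
  rw [k2, ← whiskerLeft_comp_assoc C (β_ C V).hom, k]
  have k3 : C ◁ (ε[C] ▷ V ≫ (λ_ V).hom) =
      (α_ C C V).inv ≫ (C ◁ ε[C]) ▷ V ≫ (ρ_ C).hom ▷ V := by
    rw [whiskerLeft_comp, whisker_assoc]; simp
  rw [k3]
  simp only [Category.assoc, Iso.hom_inv_id_assoc, reassoc_of% h']
  simp

lemma tensorRightAct_leftUnitor {V : 𝒞} (r : V ⊗ B ⟶ V) :
    tensorRightAct ((λ_ B).hom ≫ ε[B]) r ≫ (λ_ V).hom = (λ_ V).hom ▷ B ≫ r := by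
  have m : tensorμ (𝟙_ 𝒞) V B B ≫ (λ_ B).hom ▷ (V ⊗ B) =
      (λ_ V).hom ▷ (B ⊗ B) ≫ (α_ V B B).inv ≫ (β_ V B).hom ▷ B ≫ (α_ B V B).hom := by
    simp only [tensorμ]
    monoidal
  have h : Δ[B] ≫ ε[B] ▷ B = (λ_ B).inv := ComonObj.counit_comul B
  rw [tensorRightAct, MonoidalCategory.tensorHom_def, comp_whiskerRight]
  simp only [Category.assoc]
  rw [reassoc_of% m, whisker_exchange_assoc]
  have k : (β_ V B).hom ≫ ε[B] ▷ V ≫ (λ_ V).hom = V ◁ ε[B] ≫ (ρ_ V).hom := by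
    rw [← BraidedCategory.braiding_naturality_right_assoc]; simp
  have k2 : (α_ B V B).hom ≫ ε[B] ▷ (V ⊗ B) ≫ 𝟙_ 𝒞 ◁ r ≫ (λ_ V).hom =
      (ε[B] ▷ V ≫ (λ_ V).hom) ▷ B ≫ r := by simp
  rw [k2, ← comp_whiskerRight_assoc (β_ V B).hom, k]
  simp [← whiskerLeft_comp_assoc V Δ[B], h]

lemma tensorRightAct_rightUnitor {V : 𝒞} (r : V ⊗ B ⟶ V) :
    tensorRightAct r ((λ_ B).hom ≫ ε[B]) ≫ (ρ_ V).hom = (ρ_ V).hom ▷ B ≫ r := by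
  have m : tensorμ V (𝟙_ 𝒞) B B ≫ (V ⊗ B) ◁ (λ_ B).hom =
      (ρ_ V).hom ▷ (B ⊗ B) ≫ (α_ V B B).inv := by
    simp only [tensorμ, braiding_tensorUnit_left]
    monoidal
  have h : Δ[B] ≫ B ◁ ε[B] = (ρ_ B).inv := ComonObj.comul_counit B
  rw [tensorRightAct, MonoidalCategory.tensorHom_def', whiskerLeft_comp]
  simp only [Category.assoc]
  rw [reassoc_of% m, whisker_exchange_assoc]
  simp [← whiskerLeft_comp_assoc V Δ[B], h]

/-- The tensor product of crossed bimodules. -/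
def tensorObj (V W : CrossedBimodule p) : CrossedBimodule p :=
  ⟨V.V ⊗ W.V, tensorLeftAct V.left W.left, tensorRightAct V.right W.right,
    V.isCrossed.tensor W.isCrossed⟩

def tensorHom {V V' W W' : CrossedBimodule p} (f : V ⟶ V') (g : W ⟶ W') :
    tensorObj V W ⟶ tensorObj V' W' :=
  ⟨f.hom ⊗ₘ g.hom, tensorLeftAct_comp f.left_comm g.left_comm,
    tensorRightAct_comp f.right_comm g.right_comm⟩

variable (p) in
/-- The unit object, on which `C` and `B` act through their counits. -/
def unitObj : CrossedBimodule p :=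
  ⟨𝟙_ 𝒞, (ρ_ C).hom ≫ ε[C], (λ_ B).hom ≫ ε[B], .unit p⟩

instance : MonoidalCategoryStruct (CrossedBimodule p) where
  tensorObj := tensorObj
  tensorHom := tensorHom
  whiskerLeft V _ _ f := tensorHom (𝟙 V) f
  whiskerRight f W := tensorHom f (𝟙 W)
  tensorUnit := unitObj p
  associator V W Z := isoMk (α_ V.V W.V Z.V)
    (tensorLeftAct_assoc V.left W.left Z.left).symm
    (tensorRightAct_assoc V.right W.right Z.right).symm
  leftUnitor V := isoMk (λ_ V.V) (tensorLeftAct_leftUnitor V.left)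
    (tensorRightAct_leftUnitor V.right)
  rightUnitor V := isoMk (ρ_ V.V) (tensorLeftAct_rightUnitor V.left)
    (tensorRightAct_rightUnitor V.right)

variable (p) in
def inducing : Monoidal.InducingFunctorData (forget p) where
  μIso V W := Iso.refl _
  εIso := Iso.refl _
  whiskerLeft_eq V _ _ f := by
    change 𝟙 V.V ⊗ₘ f.hom = 𝟙 _ ≫ V.V ◁ f.hom ≫ 𝟙 _; simp
  whiskerRight_eq f W := by
    change f.hom ⊗ₘ 𝟙 W.V = 𝟙 _ ≫ f.hom ▷ W.V ≫ 𝟙 _; simp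
  tensorHom_eq f g := by
    change f.hom ⊗ₘ g.hom = 𝟙 _ ≫ (f.hom ⊗ₘ g.hom) ≫ 𝟙 _; simp
  associator_eq V W Z := by
    change (α_ V.V W.V Z.V).hom =
      (𝟙 _ ≫ (𝟙 _ ⊗ₘ 𝟙 _)) ≫ (α_ V.V W.V Z.V).hom ≫ ((𝟙 _ ⊗ₘ 𝟙 _) ≫ 𝟙 _)
    simp
  leftUnitor_eq V := by
    change (λ_ V.V).hom = (𝟙 _ ≫ (𝟙 _ ⊗ₘ 𝟙 _)) ≫ (λ_ V.V).hom
    simp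
  rightUnitor_eq V := by
    change (ρ_ V.V).hom = (𝟙 _ ≫ (𝟙 _ ⊗ₘ 𝟙 _)) ≫ (ρ_ V.V).hom
    simp

instance : MonoidalCategory (CrossedBimodule p) :=
  Monoidal.induced (forget p) (inducing p)

instance : (forget p).Monoidal :=
  Monoidal.fromInducedMonoidal (forget p) (inducing p)

end CrossedBimodule

/-- The braiding of two crossed bimodules built from a coevaluation `𝟙 ⟶ B ⊗ C`. -/
def rigidBraiding {p : DualPairing C B} (coev : 𝟙_ 𝒞 ⟶ B ⊗ C) (V W : CrossedBimodule p) :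
    V.V ⊗ W.V ⟶ W.V ⊗ V.V :=
  V.V ◁ ((λ_ W.V).inv ≫ coev ▷ W.V ≫ (α_ B C W.V).hom ≫ 𝒮[B] ▷ (C ⊗ W.V)) ≫
    (α_ V.V B (C ⊗ W.V)).inv ≫ (V.right ⊗ₘ W.left) ≫ (β_ V.V W.V).hom

variable (B) in
/-- The braided right adjoint action of `B` on itself, `v ◁ b = (S b₁)_Ψ v_Ψ b₂`. -/
def rightAdjoint : B ⊗ B ⟶ B :=
  B ◁ Δ[B] ≫ (α_ B B B).inv ≫ (B ◁ 𝒮[B] ≫ (β_ B B).hom ≫ μ[B]) ▷ B ≫ μ[B]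

/-- The braided left coregular action of `C` on `B`: braid `S⁻¹ c` past the first output of the
coproduct of `B` and evaluate it against the second one. -/
def leftCoregular [IsIso 𝒮[C]] (p : DualPairing C B) : C ⊗ B ⟶ B :=
  (inv 𝒮[C] ⊗ₘ Δ[B]) ≫ (α_ C B B).inv ≫ (β_ C B).hom ▷ B ≫ (α_ B C B).hom ≫
    B ◁ p.ev ≫ (ρ_ B).hom

end Braided

section Modules

/-- The linear map sending `a ⊗ a'` to the endomorphism `v ⊗ w ↦ f a v ⊗ g a' w`. -/
def tensorEnd {k : Type u} [CommRing k] {A A' V W : Type u} [AddCommGroup A] [Module k A]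
    [AddCommGroup A'] [Module k A'] [AddCommGroup V] [Module k V] [AddCommGroup W] [Module k W]
    (f : A →ₗ[k] Module.End k V) (g : A' →ₗ[k] Module.End k W) :
    A ⊗[k] A' →ₗ[k] Module.End k (V ⊗[k] W) :=
  TensorProduct.homTensorHomMap (RingHom.id k) V W V W ∘ₗ TensorProduct.map f g

section tensorEnd
variable {k : Type u} [CommRing k] {A A' V W : Type u}
variable [AddCommGroup V] [Module k V] [AddCommGroup W] [Module k W]

@[simp]
lemma tensorEnd_tmul [AddCommGroup A] [Module k A]
    [AddCommGroup A'] [Module k A']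
    (f : A →ₗ[k] Module.End k V) (g : A' →ₗ[k] Module.End k W) (a : A) (a' : A') (v : V) (w : W) :
    tensorEnd f g (a ⊗ₜ a') (v ⊗ₜ w) = f a v ⊗ₜ g a' w := rfl

lemma tensorEnd_tmul' [AddCommGroup A] [Module k A]
    [AddCommGroup A'] [Module k A']
    (f : A →ₗ[k] Module.End k V) (g : A' →ₗ[k] Module.End k W) (a : A) (a' : A') :
    tensorEnd f g (a ⊗ₜ a') = TensorProduct.map (f a) (g a') := rfl

lemma tensorEnd_one [Ring A] [Algebra k A] [Ring A'] [Algebra k A']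
    (f : A →ₗ[k] Module.End k V) (g : A' →ₗ[k] Module.End k W) (hf : f 1 = 1) (hg : g 1 = 1) :
    tensorEnd f g 1 = 1 := by
  rw [Algebra.TensorProduct.one_def, tensorEnd_tmul', hf, hg]
  exact TensorProduct.map_one

lemma tensorEnd_mul [Ring A] [Algebra k A] [Ring A'] [Algebra k A']
    (f : A →ₗ[k] Module.End k V) (g : A' →ₗ[k] Module.End k W)
    (hf : ∀ a b, f (a * b) = f b * f a) (hg : ∀ a b, g (a * b) = g b * g a) (x y : A ⊗[k] A') :
    tensorEnd f g (x * y) = tensorEnd f g y * tensorEnd f g x := by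
  induction x with
  | zero => simp
  | add x x' hx hx' => rw [add_mul, map_add, hx, hx', map_add, mul_add]
  | tmul a b =>
    induction y with
    | zero => simp
    | add y y' hy hy' => rw [mul_add, map_add, hy, hy', map_add, add_mul]
    | tmul c d =>
      rw [Algebra.TensorProduct.tmul_mul_tmul, tensorEnd_tmul', tensorEnd_tmul', tensorEnd_tmul',
        hf, hg, TensorProduct.map_mul]

end tensorEnd

/-- A right module over `A`, with `v ◁ a` written `act a v`. -/
structure RMod (k : Type u) [CommRing k] (A : Type u) [Ring A] [Algebra k A] where
  V : ModuleCat.{u} k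
  act : A →ₗ[k] Module.End k V
  act_one : act 1 = 1
  act_mul : ∀ a b, act (a * b) = act b * act a

namespace RMod

variable {k : Type u} [CommRing k] {A : Type u} [Ring A]

/-- Linear maps that commute with the action of `A`. -/
@[ext]
structure Hom [Algebra k A] (V W : RMod k A) where
  hom : V.V ⟶ W.V
  comm : ∀ a v, hom (V.act a v) = W.act a (hom v)

instance [Algebra k A] : Category (RMod k A) where
  Hom := Hom
  id V := ⟨𝟙 _, by simp⟩
  comp f g := ⟨f.hom ≫ g.hom, fun a v => by simp [f.comm, g.comm]⟩
  id_comp f := Hom.ext (Category.id_comp _)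
  comp_id f := Hom.ext (Category.comp_id _)
  assoc f g h := Hom.ext (Category.assoc _ _ _)

@[ext]
lemma hom_ext [Algebra k A] {V W : RMod k A} {f g : V ⟶ W} (h : f.hom = g.hom) : f = g :=
  Hom.ext h

variable (k A) in
/-- The forgetful functor to vector spaces. -/
def forget [Algebra k A] : RMod k A ⥤ ModuleCat.{u} k where
  obj V := V.V
  map f := f.hom
  map_id _ := rfl
  map_comp _ _ := rfl

instance [Algebra k A] : (forget k A).Faithful where
  map_injective h := Hom.ext h

@[simp]
lemma id_hom [Algebra k A] (V : RMod k A) : Hom.hom (𝟙 V) = 𝟙 V.V := rfl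

@[simp]
lemma comp_hom [Algebra k A] {V W Z : RMod k A} (f : V ⟶ W) (g : W ⟶ Z) :
    Hom.hom (f ≫ g) = f.hom ≫ g.hom := rfl

def isoMk [Algebra k A] {V W : RMod k A} (e : V.V ≅ W.V)
    (h : ∀ a v, e.hom (V.act a v) = W.act a (e.hom v)) : V ≅ W where
  hom := ⟨e.hom, h⟩
  inv := ⟨e.inv, fun a v => by
    have := congrArg e.inv (h a (e.inv v))
    simpa using this.symm⟩
  hom_inv_id := hom_ext e.hom_inv_id
  inv_hom_id := hom_ext e.inv_hom_id

variable [Bialgebra k A]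

/-- The tensor product of modules, with `(v ⊗ w) ◁ a = v ◁ a₁ ⊗ w ◁ a₂`. -/
def tensorObj (V W : RMod k A) : RMod k A where
  V := V.V ⊗ W.V
  act := tensorEnd V.act W.act ∘ₗ Coalgebra.comul
  act_one := by
    rw [LinearMap.comp_apply, Bialgebra.comul_one]
    exact tensorEnd_one _ _ V.act_one W.act_one
  act_mul a b := by
    rw [LinearMap.comp_apply, Bialgebra.comul_mul]
    exact tensorEnd_mul _ _ V.act_mul W.act_mul _ _

variable (k A) in
/-- The trivial module `k`, on which `A` acts through its counit. -/
def unitObj : RMod k A where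
  V := 𝟙_ _
  act := LinearMap.toSpanSingleton k (Module.End k k) 1 ∘ₗ Coalgebra.counit
  act_one := by simp
  act_mul a b := by simp [mul_comm, mul_smul]

lemma tensorEnd_comp {A A' : Type u} [AddCommGroup A] [Module k A]
    [AddCommGroup A'] [Module k A'] {V V' W W' : ModuleCat.{u} k}
    (f : A →ₗ[k] Module.End k V) (g : A' →ₗ[k] Module.End k W)
    (f' : A →ₗ[k] Module.End k V') (g' : A' →ₗ[k] Module.End k W')
    (φ : V ⟶ V') (ψ : W ⟶ W') (hφ : ∀ a v, φ (f a v) = f' a (φ v))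
    (hψ : ∀ a v, ψ (g a v) = g' a (ψ v)) (x : A ⊗[k] A') (t : V ⊗[k] W) :
    TensorProduct.map φ.hom ψ.hom (tensorEnd f g x t) =
      tensorEnd f' g' x (TensorProduct.map φ.hom ψ.hom t) := by
  induction x with
  | zero => simp
  | add x y hx hy => simp only [map_add, LinearMap.add_apply, hx, hy]
  | tmul a b =>
    induction t with
    | zero => simp
    | add x y hx hy => simp only [map_add, LinearMap.add_apply, hx, hy]
    | tmul v w =>
      rw [tensorEnd_tmul, TensorProduct.map_tmul, TensorProduct.map_tmul, tensorEnd_tmul]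
      congr 1
      · exact hφ _ _
      · exact hψ _ _

def tensorHom {V V' W W' : RMod k A} (f : V ⟶ V') (g : W ⟶ W') :
    tensorObj V W ⟶ tensorObj V' W' :=
  ⟨f.hom ⊗ₘ g.hom, fun a t => tensorEnd_comp V.act W.act V'.act W'.act f.hom g.hom
    f.comm g.comm (Coalgebra.comul a) t⟩

lemma tensorEnd_assoc {A₁ A₂ A₃ V₁ V₂ V₃ : Type u} [AddCommGroup A₁] [Module k A₁]
    [AddCommGroup A₂] [Module k A₂] [AddCommGroup A₃] [Module k A₃]
    [AddCommGroup V₁] [Module k V₁]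
    [AddCommGroup V₂] [Module k V₂] [AddCommGroup V₃] [Module k V₃]
    (f : A₁ →ₗ[k] Module.End k V₁) (g : A₂ →ₗ[k] Module.End k V₂) (h : A₃ →ₗ[k] Module.End k V₃)
    (x : (A₁ ⊗[k] A₂) ⊗[k] A₃) (t : (V₁ ⊗[k] V₂) ⊗[k] V₃) :
    TensorProduct.assoc k V₁ V₂ V₃ (tensorEnd (tensorEnd f g) h x t) =
      tensorEnd f (tensorEnd g h) (TensorProduct.assoc k A₁ A₂ A₃ x)
        (TensorProduct.assoc k V₁ V₂ V₃ t) := by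
  induction x with
  | zero => simp
  | add x y hx hy => simp only [map_add, LinearMap.add_apply, hx, hy]
  | tmul a c =>
  induction a with
  | zero => simp
  | add x y hx hy => simp only [map_add, LinearMap.add_apply, TensorProduct.add_tmul, hx, hy]
  | tmul a b =>
  induction t with
  | zero => simp
  | add x y hx hy => simp only [map_add, LinearMap.add_apply, hx, hy]
  | tmul t w =>
  induction t with
  | zero => simp
  | add x y hx hy => simp only [map_add, LinearMap.add_apply, TensorProduct.add_tmul, hx, hy]
  | tmul u v => simp

lemma tensorEnd_map {A₁ A₂ A₁' A₂' V W : Type u} [AddCommGroup A₁] [Module k A₁]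
    [AddCommGroup A₂] [Module k A₂] [AddCommGroup A₁'] [Module k A₁']
    [AddCommGroup A₂'] [Module k A₂'] [AddCommGroup V] [Module k V]
    [AddCommGroup W] [Module k W]
    (f : A₁ →ₗ[k] Module.End k V) (g : A₂ →ₗ[k] Module.End k W) (p : A₁' →ₗ[k] A₁)
    (q : A₂' →ₗ[k] A₂) (x : A₁' ⊗[k] A₂') :
    tensorEnd (f ∘ₗ p) (g ∘ₗ q) x = tensorEnd f g (TensorProduct.map p q x) := by
  simp only [tensorEnd, TensorProduct.map_comp, LinearMap.comp_apply]

def associator (V W Z : RMod k A) : tensorObj (tensorObj V W) Z ≅ tensorObj V (tensorObj W Z) :=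
  isoMk (α_ V.V W.V Z.V) fun a t => by
    have h1 := tensorEnd_assoc V.act W.act Z.act
      (TensorProduct.map Coalgebra.comul LinearMap.id (Coalgebra.comul a)) t
    have h2 := tensorEnd_map (tensorEnd V.act W.act) Z.act Coalgebra.comul LinearMap.id
      (Coalgebra.comul a)
    have h3 := tensorEnd_map V.act (tensorEnd W.act Z.act) LinearMap.id Coalgebra.comul
      (Coalgebra.comul a)
    have h4 := Coalgebra.coassoc_apply (R := k) a
    change TensorProduct.assoc k V.V W.V Z.V (tensorEnd (tensorEnd V.act W.act ∘ₗ Coalgebra.comul)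
      (Z.act ∘ₗ LinearMap.id) (Coalgebra.comul a) t) =
      tensorEnd (V.act ∘ₗ LinearMap.id) (tensorEnd W.act Z.act ∘ₗ Coalgebra.comul)
      (Coalgebra.comul a) (TensorProduct.assoc k V.V W.V Z.V t)
    rw [h2, h1, h3]
    congr 2

lemma tensorEnd_unit_left {A₁ V : Type u} [AddCommGroup A₁] [Module k A₁] [AddCommGroup V]
    [Module k V] (f : A₁ →ₗ[k] Module.End k V) (x : k ⊗[k] A₁) (t : k ⊗[k] V) :
    TensorProduct.lid k V (tensorEnd (LinearMap.toSpanSingleton k (Module.End k k) 1) f x t) =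
      f (TensorProduct.lid k A₁ x) (TensorProduct.lid k V t) := by
  induction x with
  | zero => simp
  | add x y hx hy => simp only [map_add, LinearMap.add_apply, hx, hy]
  | tmul a b =>
    induction t with
    | zero => simp
    | add x y hx hy => simp only [map_add, hx, hy]
    | tmul v w => simpa [mul_smul] using smul_comm _ _ _

lemma tensorEnd_unit_right {A₁ V : Type u} [AddCommGroup A₁] [Module k A₁] [AddCommGroup V]
    [Module k V] (f : A₁ →ₗ[k] Module.End k V) (x : A₁ ⊗[k] k) (t : V ⊗[k] k) :
    TensorProduct.rid k V (tensorEnd f (LinearMap.toSpanSingleton k (Module.End k k) 1) x t) =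
      f (TensorProduct.rid k A₁ x) (TensorProduct.rid k V t) := by
  induction x with
  | zero => simp
  | add x y hx hy => simp only [map_add, LinearMap.add_apply, hx, hy]
  | tmul a b =>
    induction t with
    | zero => simp
    | add x y hx hy => simp only [map_add, hx, hy]
    | tmul v w => simpa [mul_smul] using smul_comm _ _ _

def leftUnitor (V : RMod k A) : tensorObj (unitObj k A) V ≅ V :=
  isoMk (λ_ V.V) fun a t => by
    have h2 := tensorEnd_map (LinearMap.toSpanSingleton k (Module.End k k) 1) V.act
      Coalgebra.counit LinearMap.id (Coalgebra.comul a)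
    have h1 := tensorEnd_unit_left V.act
      (TensorProduct.map Coalgebra.counit LinearMap.id (Coalgebra.comul a)) t
    have h4 : TensorProduct.map Coalgebra.counit LinearMap.id (Coalgebra.comul a) =
      (1 : k) ⊗ₜ[k] a := Coalgebra.rTensor_counit_comul a
    change TensorProduct.lid k V.V (tensorEnd (_ ∘ₗ Coalgebra.counit)
      (V.act ∘ₗ LinearMap.id) (Coalgebra.comul a) t) = V.act a (TensorProduct.lid k V.V t)
    rw [h2, h1, h4, TensorProduct.lid_tmul, one_smul]

def rightUnitor (V : RMod k A) : tensorObj V (unitObj k A) ≅ V :=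
  isoMk (ρ_ V.V) fun a t => by
    have h2 := tensorEnd_map V.act (LinearMap.toSpanSingleton k (Module.End k k) 1)
      LinearMap.id Coalgebra.counit (Coalgebra.comul a)
    have h1 := tensorEnd_unit_right V.act
      (TensorProduct.map LinearMap.id Coalgebra.counit (Coalgebra.comul a)) t
    have h4 : TensorProduct.map LinearMap.id Coalgebra.counit (Coalgebra.comul a) =
      a ⊗ₜ[k] (1 : k) := Coalgebra.lTensor_counit_comul a
    change TensorProduct.rid k V.V (tensorEnd (V.act ∘ₗ LinearMap.id) (_ ∘ₗ Coalgebra.counit)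
      (Coalgebra.comul a) t) = V.act a (TensorProduct.rid k V.V t)
    rw [h2, h1, h4, TensorProduct.rid_tmul, one_smul]

instance : MonoidalCategoryStruct (RMod k A) where
  tensorObj := tensorObj
  tensorHom := tensorHom
  whiskerLeft V _ _ f := tensorHom (𝟙 V) f
  whiskerRight f W := tensorHom f (𝟙 W)
  tensorUnit := unitObj k A
  associator := associator
  leftUnitor := leftUnitor
  rightUnitor := rightUnitor

variable (k A) in
def inducing : Monoidal.InducingFunctorData (forget k A) where
  μIso V W := Iso.refl _
  εIso := Iso.refl _
  whiskerLeft_eq V _ _ f := by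
    change 𝟙 V.V ⊗ₘ f.hom = 𝟙 _ ≫ V.V ◁ f.hom ≫ 𝟙 _; simp
  whiskerRight_eq f W := by
    change f.hom ⊗ₘ 𝟙 W.V = 𝟙 _ ≫ f.hom ▷ W.V ≫ 𝟙 _; simp
  tensorHom_eq f g := by
    change f.hom ⊗ₘ g.hom = 𝟙 _ ≫ (f.hom ⊗ₘ g.hom) ≫ 𝟙 _; simp
  associator_eq V W Z := by
    change (α_ V.V W.V Z.V).hom =
      (𝟙 _ ≫ (𝟙 _ ⊗ₘ 𝟙 _)) ≫ (α_ V.V W.V Z.V).hom ≫ ((𝟙 _ ⊗ₘ 𝟙 _) ≫ 𝟙 _)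
    simp
  leftUnitor_eq V := by
    change (λ_ V.V).hom = (𝟙 _ ≫ (𝟙 _ ⊗ₘ 𝟙 _)) ≫ (λ_ V.V).hom
    simp
  rightUnitor_eq V := by
    change (ρ_ V.V).hom = (𝟙 _ ≫ (𝟙 _ ⊗ₘ 𝟙 _)) ≫ (ρ_ V.V).hom
    simp

instance : MonoidalCategory (RMod k A) :=
  Monoidal.induced (forget k A) (inducing k A)

instance : (forget k A).Monoidal :=
  Monoidal.fromInducedMonoidal (forget k A) (inducing k A)


end RMod

open Coalgebra in

class Quasitriangular (k : Type u) [CommRing k] (H : Type u) [Ring H] [Bialgebra k H] where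
  R : (H ⊗[k] H)ˣ
  comul_left : TensorProduct.assoc k H H H (TensorProduct.map comul LinearMap.id (R : H ⊗[k] H)) =
    Algebra.TensorProduct.map (AlgHom.id k H) Algebra.TensorProduct.includeRight (R : H ⊗[k] H) *
      Algebra.TensorProduct.includeRight (R : H ⊗[k] H)
  comul_right : TensorProduct.map LinearMap.id comul (R : H ⊗[k] H) =
    Algebra.TensorProduct.map (AlgHom.id k H) Algebra.TensorProduct.includeRight (R : H ⊗[k] H) *
      Algebra.TensorProduct.map (AlgHom.id k H) Algebra.TensorProduct.includeLeft (R : H ⊗[k] H)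
  comm_comul : ∀ h : H, TensorProduct.comm k H H (comul h) * (R : H ⊗[k] H) =
    (R : H ⊗[k] H) * comul h

namespace RMod
variable {k : Type u} [CommRing k] {H : Type u} [Ring H] [Bialgebra k H]

lemma tensorEnd_comm {A A' V W : Type u} [AddCommGroup A] [Module k A]
    [AddCommGroup A'] [Module k A'] [AddCommGroup V] [Module k V] [AddCommGroup W] [Module k W]
    (f : A →ₗ[k] Module.End k V) (g : A' →ₗ[k] Module.End k W) (x : A ⊗[k] A') (t : V ⊗[k] W) :
    TensorProduct.comm k V W (tensorEnd f g x t) =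
      tensorEnd g f (TensorProduct.comm k A A' x) (TensorProduct.comm k V W t) := by
  induction x with
  | zero => simp
  | add x y hx hy => simp only [map_add, LinearMap.add_apply, hx, hy]
  | tmul a b =>
    induction t with
    | zero => simp
    | add x y hx hy => simp only [map_add, hx, hy]
    | tmul v w => simp

section hex
variable {X Y Z : Type u} [AddCommGroup X] [Module k X] [AddCommGroup Y] [Module k Y]
  [AddCommGroup Z] [Module k Z] (f : H →ₗ[k] Module.End k X) (g : H →ₗ[k] Module.End k Y)
  (h : H →ₗ[k] Module.End k Z)

lemma tensorEnd_R23 (hf : f 1 = 1) (r : H ⊗[k] H) :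
    tensorEnd f (tensorEnd g h) (Algebra.TensorProduct.includeRight r) =
      TensorProduct.map LinearMap.id (tensorEnd g h r) := by
  rw [Algebra.TensorProduct.includeRight_apply, tensorEnd_tmul', hf]; rfl

lemma tensorEnd_R13 (hg : g 1 = 1) (r : H ⊗[k] H) (x : X) (y : Y) (z : Z) :
    tensorEnd f (tensorEnd g h)
      (Algebra.TensorProduct.map (AlgHom.id k H) Algebra.TensorProduct.includeRight r)
      (x ⊗ₜ (y ⊗ₜ z)) = TensorProduct.map LinearMap.id (TensorProduct.comm k Z Y).toLinearMap
        (TensorProduct.assoc k X Z Y (tensorEnd f h r (x ⊗ₜ z) ⊗ₜ y)) := by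
  induction r with
  | zero => simp
  | add a b ha hb => simp only [map_add, LinearMap.add_apply, TensorProduct.add_tmul, ha, hb]
  | tmul a b => simp [hg]

lemma tensorEnd_R12 (hh : h 1 = 1) (r : H ⊗[k] H) (t : (X ⊗[k] Y) ⊗[k] Z) :
    tensorEnd f (tensorEnd g h)
      (Algebra.TensorProduct.map (AlgHom.id k H) Algebra.TensorProduct.includeLeft r)
      (TensorProduct.assoc k X Y Z t) = TensorProduct.assoc k X Y Z
        (TensorProduct.map (tensorEnd f g r) LinearMap.id t) := by
  induction t with
  | zero => simp
  | add a b ha hb => simp only [map_add, ha, hb]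
  | tmul t z =>
  induction t with
  | zero => simp
  | add a b ha hb => simp only [map_add, TensorProduct.add_tmul, ha, hb]
  | tmul x y =>
  induction r with
  | zero => simp
  | add a b ha hb => simp only [map_add, LinearMap.add_apply, TensorProduct.map_add_left, ha, hb]
  | tmul a b => simp [hh]

end hex

variable [Quasitriangular k H]

/-- The linear isomorphism `v ⊗ w ↦ w ◁ R⁽¹⁾ ⊗ v ◁ R⁽²⁾`. -/
def braidingLinear (V W : RMod k H) : V.V ⊗[k] W.V ≃ₗ[k] W.V ⊗[k] V.V :=
  LinearEquiv.ofLinearMap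
    (tensorEnd W.act V.act (Quasitriangular.R (k := k) (H := H)) ∘ₗ
      (TensorProduct.comm k V.V W.V).toLinearMap)
    ((TensorProduct.comm k W.V V.V).toLinearMap ∘ₗ
      tensorEnd W.act V.act ((Quasitriangular.R (k := k) (H := H))⁻¹ : (H ⊗[k] H)ˣ))
    (by
      refine LinearMap.ext fun t => ?_
      have h := tensorEnd_mul W.act V.act W.act_mul V.act_mul
        ((Quasitriangular.R (k := k) (H := H))⁻¹ : (H ⊗[k] H)ˣ) (Quasitriangular.R (k := k) (H := H))
      rw [Units.inv_mul, tensorEnd_one _ _ W.act_one V.act_one] at h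
      simpa using (LinearMap.congr_fun h t).symm)
    (by
      refine LinearMap.ext fun t => ?_
      have h := tensorEnd_mul W.act V.act W.act_mul V.act_mul (Quasitriangular.R (k := k) (H := H))
        ((Quasitriangular.R (k := k) (H := H))⁻¹ : (H ⊗[k] H)ˣ)
      rw [Units.mul_inv, tensorEnd_one _ _ W.act_one V.act_one] at h
      have h' := congrArg (TensorProduct.comm k W.V V.V)
        (LinearMap.congr_fun h (TensorProduct.comm k V.V W.V t))
      simpa using h'.symm)

lemma braidingLinear_apply (V W : RMod k H) (t : V.V ⊗[k] W.V) :
    braidingLinear V W t = tensorEnd W.act V.act (Quasitriangular.R (k := k) (H := H))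
      (TensorProduct.comm k V.V W.V t) := rfl

def braiding (V W : RMod k H) : V ⊗ W ≅ W ⊗ V :=
  isoMk (V := V ⊗ W) (W := W ⊗ V) (braidingLinear V W).toModuleIso fun a (t : V.V ⊗[k] W.V) => by
    change braidingLinear V W (tensorEnd V.act W.act (Coalgebra.comul a) t) =
      tensorEnd W.act V.act (Coalgebra.comul a) (braidingLinear V W t)
    rw [braidingLinear_apply, braidingLinear_apply, tensorEnd_comm, ← Module.End.mul_apply,
      ← Module.End.mul_apply,
      ← tensorEnd_mul W.act V.act W.act_mul V.act_mul,
      ← tensorEnd_mul W.act V.act W.act_mul V.act_mul, Quasitriangular.comm_comul]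

lemma braidingLinear_nat {V V' W W' : RMod k H} (f : V ⟶ V') (g : W ⟶ W') (t : V.V ⊗[k] W.V) :
    braidingLinear V' W' (TensorProduct.map f.hom.hom g.hom.hom t) =
      TensorProduct.map g.hom.hom f.hom.hom (braidingLinear V W t) := by
  rw [braidingLinear_apply, braidingLinear_apply,
    tensorEnd_comp W.act V.act W'.act V'.act g.hom f.hom g.comm f.comm]
  congr 1
  induction t with
  | zero => simp
  | add x y hx hy => simp only [map_add, hx, hy]
  | tmul v w => simp


instance : BraidedCategory (RMod k H) where
  braiding := braiding
  braiding_naturality_left f Z := by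
    apply hom_ext
    apply ModuleCat.hom_ext
    exact LinearMap.ext fun t => braidingLinear_nat f (𝟙 Z) t
  braiding_naturality_right Z _ _ f := by
    apply hom_ext
    apply ModuleCat.hom_ext
    exact LinearMap.ext fun t => braidingLinear_nat (𝟙 Z) f t
  hexagon_forward X Y Z := by
    apply hom_ext
    apply ModuleCat.hom_ext
    apply TensorProduct.ext_threefold
    intro x y z
    have h2 := tensorEnd_map (tensorEnd Y.act Z.act) X.act Coalgebra.comul LinearMap.id
      (Quasitriangular.R (k := k) (H := H) : H ⊗[k] H)
    change TensorProduct.assoc k Y.V Z.V X.V (tensorEnd (tensorEnd Y.act Z.act ∘ₗ Coalgebra.comul)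
      (X.act ∘ₗ LinearMap.id) (Quasitriangular.R (k := k) (H := H) : H ⊗[k] H)
      ((y ⊗ₜ z) ⊗ₜ x)) =
      TensorProduct.map LinearMap.id (braidingLinear X Z).toLinearMap
        (TensorProduct.assoc k Y.V X.V Z.V (braidingLinear X Y (x ⊗ₜ y) ⊗ₜ z))
    have h3 : TensorProduct.map LinearMap.id (braidingLinear X Z).toLinearMap =
      TensorProduct.map LinearMap.id
        (tensorEnd Z.act X.act (Quasitriangular.R (k := k) (H := H) : H ⊗[k] H)) ∘ₗ
      TensorProduct.map (LinearMap.id : Y.V →ₗ[k] Y.V)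
        (TensorProduct.comm k X.V Z.V).toLinearMap := by
      rw [← TensorProduct.map_comp]; rfl
    rw [h2, tensorEnd_assoc, Quasitriangular.comul_left, TensorProduct.assoc_tmul,
      tensorEnd_mul _ _ Y.act_mul (tensorEnd_mul _ _ Z.act_mul X.act_mul), Module.End.mul_apply,
      tensorEnd_R13 _ _ _ Z.act_one, tensorEnd_R23 _ _ _ Y.act_one, h3]
    rfl
  hexagon_reverse X Y Z := by
    apply hom_ext
    apply ModuleCat.hom_ext
    refine TensorProduct.ext (LinearMap.ext fun x => TensorProduct.ext
      (LinearMap.ext fun y => LinearMap.ext fun z => ?_))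
    have h2 := tensorEnd_map Z.act (tensorEnd X.act Y.act) LinearMap.id Coalgebra.comul
      (Quasitriangular.R (k := k) (H := H) : H ⊗[k] H)
    change (TensorProduct.assoc k Z.V X.V Y.V).symm
      (tensorEnd (Z.act ∘ₗ LinearMap.id) (tensorEnd X.act Y.act ∘ₗ Coalgebra.comul)
      (Quasitriangular.R (k := k) (H := H) : H ⊗[k] H) (z ⊗ₜ (x ⊗ₜ y))) =
      TensorProduct.map (braidingLinear X Z).toLinearMap LinearMap.id
        ((TensorProduct.assoc k X.V Z.V Y.V).symm (x ⊗ₜ braidingLinear Y Z (y ⊗ₜ z)))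
    rw [LinearEquiv.symm_apply_eq, h2, Quasitriangular.comul_right,
      tensorEnd_mul _ _ Z.act_mul (tensorEnd_mul _ _ X.act_mul Y.act_mul), Module.End.mul_apply,
      tensorEnd_R13 _ _ _ X.act_one, braidingLinear_apply, TensorProduct.comm_tmul]
    generalize (tensorEnd Z.act Y.act (Quasitriangular.R (k := k) (H := H) : H ⊗[k] H))
      (z ⊗ₜ[k] y) = t
    induction t with
    | zero => simp
    | add a b ha hb =>
      simp only [map_add, TensorProduct.add_tmul, TensorProduct.tmul_add] at ha hb ⊢
      rw [ha, hb]
    | tmul z' y' =>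
      have := tensorEnd_R12 Z.act X.act Y.act Y.act_one
        (Quasitriangular.R (k := k) (H := H) : H ⊗[k] H) ((z' ⊗ₜ x) ⊗ₜ y')
      simpa [braidingLinear_apply] using this

end RMod

end Modules

section DoubleBos

/-- A way of writing `x` as a finite sum `∑ i, fst i ⊗ snd i`. -/
structure Rep₂ {k : Type u} [CommRing k] {M N : Type u} [AddCommGroup M] [Module k M]
    [AddCommGroup N] [Module k N] (x : M ⊗[k] N) where
  n : ℕ
  fst : Fin n → M
  snd : Fin n → N
  eq : x = ∑ i, fst i ⊗ₜ snd i

/-- A way of writing `x` as a finite sum `∑ i, fst i ⊗ (snd i ⊗ thd i)`. -/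
structure Rep₃ {k : Type u} [CommRing k] {M N P : Type u} [AddCommGroup M] [Module k M]
    [AddCommGroup N] [Module k N] [AddCommGroup P] [Module k P] (x : M ⊗[k] (N ⊗[k] P)) where
  n : ℕ
  fst : Fin n → M
  snd : Fin n → N
  thd : Fin n → P
  eq : x = ∑ i, fst i ⊗ₜ (snd i ⊗ₜ thd i)

variable {k : Type u} [Field k] {H : Type u} [Ring H] [HopfAlgebra k H] [Quasitriangular k H]

variable (k H) in
/-- The universal R-matrix of `H`. -/
def rMatrix : H ⊗[k] H := (Quasitriangular.R (k := k) (H := H) : (H ⊗[k] H)ˣ)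

variable (k H) in
/-- The inverse of the universal R-matrix of `H`. -/
def rMatrixInv : H ⊗[k] H := ((Quasitriangular.R (k := k) (H := H))⁻¹ : (H ⊗[k] H)ˣ)

section elements

variable (B : RMod k H) [HopfObj B]

/-- The underlying linear map of the coproduct. -/
def comulₗ : B.V →ₗ[k] B.V ⊗[k] B.V := Δ[B].hom.hom

/-- The underlying linear map of the counit. -/
def counitₗ : B.V →ₗ[k] k := ε[B].hom.hom

/-- The underlying linear map of the product. -/
def mulₗ : B.V ⊗[k] B.V →ₗ[k] B.V := μ[B].hom.hom

/-- The underlying linear map of the unit. -/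
def unitₗ : k →ₗ[k] B.V := η[B].hom.hom

/-- The underlying linear map of the antipode. -/
def antipodeₗ : B.V →ₗ[k] B.V := 𝒮[B].hom.hom

/-- The underlying linear map of the inverse of the antipode. -/
def antipodeInvₗ [IsIso 𝒮[B]] : B.V →ₗ[k] B.V := (inv 𝒮[B]).hom.hom

/-- The left action `h ▷ c = c ◁ S h`. -/
def lact (h : H) : B.V →ₗ[k] B.V := B.act (HopfAlgebra.antipode k h)

/-- The coproduct `c ↦ c₁ ◁ R⁻⁽¹⁾ ⊗ c₂ ◁ R⁻⁽²⁾` of the opposite-coopposite braided group. -/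
def comulBar : B.V →ₗ[k] B.V ⊗[k] B.V :=
  tensorEnd B.act B.act (rMatrixInv k H) ∘ₗ comulₗ B

/-- The iterated coproduct `c ↦ c_{(1̄)} ⊗ c_{(2̄)} ⊗ c_{(3̄)}`. -/
def comulBar₃ : B.V →ₗ[k] B.V ⊗[k] (B.V ⊗[k] B.V) :=
  TensorProduct.map LinearMap.id (comulBar B) ∘ₗ comulBar B

/-- The iterated coproduct `b ↦ b₁ ⊗ b₂ ⊗ b₃`. -/
def comul₃ : B.V →ₗ[k] B.V ⊗[k] (B.V ⊗[k] B.V) :=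
  TensorProduct.map LinearMap.id (comulₗ B) ∘ₗ comulₗ B

end elements

variable {C B : RMod k H} [HopfObj C] [HopfObj B]

/-- The underlying bilinear pairing. -/
def DualPairing.evₗ (p : DualPairing C B) (c : C.V) (b : B.V) : k :=
  (p.ev.hom.hom : C.V ⊗[k] B.V →ₗ[k] k) (c ⊗ₜ b)

/-- A realisation of the double bosonisation `U(C̄, H, B)`: a Hopf algebra that is `C̄ ⊗ H ⊗ B` as a
vector space through `c ⊗ h ⊗ b ↦ c h b`, in which `H` is a sub-Hopf algebra, `C̄` (the space `C` with
the opposite product, the left `H`-action `lact`, the coproduct `comulBar` and the antipode `S⁻¹`)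
and `B` generate with `H` the bosonisations of `C̄` and of `B`, and in which the cross relation
`b c = ⟨R₁⁽¹⁾ ▷ c₁, b₁ ◁ R₂⁽¹⁾⟩ (R₁⁽²⁾ ▷ c₂) R₂⁽²⁾ R₁⁻⁽¹⁾ (b₂ ◁ R₂⁻⁽¹⁾) ⟨R₁⁻⁽²⁾ ▷ S̄ c₃, b₃ ◁ R₂⁻⁽²⁾⟩`
holds. -/
structure DoubleBosonisation [IsIso 𝒮[C]] (p : DualPairing C B) where
  carrier : Type u
  [ring : Ring carrier]
  [hopf : HopfAlgebra k carrier]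
  iC : C.V →ₗ[k] carrier
  iH : H →ₐc[k] carrier
  iB : B.V →ₗ[k] carrier
  bijective : Function.Bijective (LinearMap.mul' k carrier ∘ₗ
    TensorProduct.map (LinearMap.mul' k carrier ∘ₗ
      TensorProduct.map iC (iH : H →ₗ[k] carrier)) iB)
  iC_one : iC (unitₗ C 1) = 1
  iC_mul : ∀ c d, iC c * iC d = iC (mulₗ C (d ⊗ₜ c))
  iH_mul_iC : ∀ (h : H) (c : C.V) (x : Rep₂ (Coalgebra.comul (R := k) h)),
    iH h * iC c = ∑ i, iC (lact C (x.fst i) c) * iH (x.snd i)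
  iB_one : iB (unitₗ B 1) = 1
  iB_mul : ∀ a b, iB a * iB b = iB (mulₗ B (a ⊗ₜ b))
  iB_mul_iH : ∀ (b : B.V) (h : H) (x : Rep₂ (Coalgebra.comul (R := k) h)),
    iB b * iH h = ∑ i, iH (x.fst i) * iB (B.act (x.snd i) b)
  counit_iC : ∀ c, Coalgebra.counit (R := k) (iC c) = counitₗ C c
  comul_iC : ∀ (c : C.V) (x : Rep₂ (comulBar C c)) (r : Rep₂ (rMatrixInv k H)),
    Coalgebra.comul (R := k) (iC c) =
      ∑ m, ∑ i, (iC (x.fst m) * iH (r.fst i)) ⊗ₜ[k] iC (lact C (r.snd i) (x.snd m))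
  counit_iB : ∀ b, Coalgebra.counit (R := k) (iB b) = counitₗ B b
  comul_iB : ∀ (b : B.V) (x : Rep₂ (comulₗ B b)) (r : Rep₂ (rMatrix k H)),
    Coalgebra.comul (R := k) (iB b) =
      ∑ m, ∑ i, iB (B.act (r.fst i) (x.fst m)) ⊗ₜ[k] (iH (r.snd i) * iB (x.snd m))
  iB_mul_iC : ∀ (b : B.V) (c : C.V) (y : Rep₃ (comul₃ B b)) (x : Rep₃ (comulBar₃ C c))
    (r : Rep₂ (rMatrix k H)) (s : Rep₂ (rMatrixInv k H)),
    iB b * iC c = ∑ m, ∑ n, ∑ i₁, ∑ i₂, ∑ j₁, ∑ j₂,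
      (p.evₗ (lact C (r.fst i₁) (x.fst m)) (B.act (r.fst i₂) (y.fst n)) *
        p.evₗ (lact C (s.snd j₁) (antipodeInvₗ C (x.thd m))) (B.act (s.snd j₂) (y.thd n))) •
      (iC (lact C (r.snd i₁) (x.snd m)) * iH (r.snd i₂ * s.fst j₁) *
        iB (B.act (s.fst j₂) (y.snd n)))

attribute [instance] DoubleBosonisation.ring DoubleBosonisation.hopf

/-- The element `∑ₐ eₐ ⊗ fᵃ` of `B ⊗ C` given by a coevaluation. -/
def coevElement (coev : 𝟙_ (RMod k H) ⟶ B ⊗ C) : B.V ⊗[k] C.V :=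
  let f : k →ₗ[k] B.V ⊗[k] C.V := coev.hom.hom
  f 1

/-- The element `(∑ₐ fᵃ ⊗ S eₐ) · R` of `U ⊗ U`, for a coevaluation `∑ₐ eₐ ⊗ fᵃ` in `B ⊗ C`. -/
def DoubleBosonisation.rMatrix [IsIso 𝒮[C]] {p : DualPairing C B} (U : DoubleBosonisation p)
    (coev : 𝟙_ (RMod k H) ⟶ B ⊗ C) : U.carrier ⊗[k] U.carrier :=
  TensorProduct.map U.iC (U.iB ∘ₗ antipodeₗ B)
      (TensorProduct.comm k B.V C.V (coevElement coev)) *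
    TensorProduct.map (U.iH : H →ₗ[k] U.carrier) (U.iH : H →ₗ[k] U.carrier)
      (BraidedDouble.rMatrix k H)

end DoubleBos
end BraidedDouble

end

open BraidedDouble CategoryTheory MonoidalCategory
open scoped MonObj ComonObj HopfObj TensorProduct

namespace BraidedDouble

noncomputable section

/-! The double bosonisation is the algebra whose modules are the crossed bimodules, and all parts of
the proposition are read off from this.

Write `evR` for `c ⊗ v ⊗ b ↦ c₁ ⊗ v ⊗ b₁ ⟨c₂, b₂⟩` and `evL` for `c ⊗ v ⊗ b ↦ ⟨c₁, b₁⟩ c₂ ⊗ v ⊗ b₂`,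
braidings understood. The crossing condition says that `evR` followed by `B` and then `C` acting
agrees with `evL` followed by `C` and then `B` acting. As the antipode of `C` is invertible, so is
`evR`, and the condition becomes an exchange rule: acting by `B` and then `C` is `evR⁻¹ ≫ evL`
followed by `C` and then `B`. In elements, after regrouping with the Yang–Baxter equation and the
identities relating `R` to the antipode of `H`, this rule is the cross relation for `b c`
(`sum_ev_smul_act`). The other relations of `U` express that the actions are actions and are
`H`-linear. So a crossed bimodule structure on `V` amounts to maps of `C̄`, `H`, `B` into the
opposite of `End V` that satisfy `DoubleRel` (`doubleRel_opAct`, `DoubleRel.isCrossed`). Since the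
relations reorder every product into the form `c h b`, an algebra with these relations and a
bijective `triple` is universal for them (`DoubleRel.exists_algHom`); its modules are therefore the
crossed bimodules.

Existence. `evR` and `evL` are compatible with the products of `C` and `B`, so the exchange rule is
a distributive law and every left `C`-module `Y` induces a crossed bimodule `Y ⊗ B`. For `Y = C ⊗ H`
the element `c h b` sends `1 ⊗ 1 ⊗ 1` to `c ◁ h₁ ⊗ h₂ ⊗ b`, so the triples act independently
(`injective_free`), and their span is the required algebra. The tensor square of its regular module
is again crossed, which gives the relations for the coproduct (`DoubleRel.doubleRel_comul`);
coassociativity and the counit laws are the linearity of the associator and unitors, evaluated on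
tensors of `1`. The antipode is prescribed on ordered triples and checked by collapsing them one
factor at a time.

The equivalence. The coproduct of `U` on generators is the braided tensor product action written in
elements (`lin_tensorLeftAct_comulBar`), so the functor is monoidal with identity structure maps.

The rigid case. The crossing condition makes the twist by the coevaluation carry the tensor product
action formed with the inverse braiding to the usual one (`twist_left`, `twist_right`). Its inverse
is the twist by `S eₐ ⊗ fᵃ`, and following that with the braiding of `H`-modules gives a morphism of
crossed bimodules. The hexagons come from the formulas for the coproduct on either leg of the
coevaluation. On `U`-modules this braiding is the action of `R_U`, and the quasitriangularity axioms
are the axioms of a braided category at the regular module.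

The action on `B`. By the braided Leibniz rule `C` acts on the factors of `(S b₁) v b₂` separately.
On `b₂` it cancels against the pairing in `evR`, and on `S b₁` it produces the pairing in `evL`
(`leftCoregular_rightAdjoint`). -/

section Strings

variable {𝒞 : Type w} [Category.{v} 𝒞] [MonoidalCategory 𝒞]

/-! ### Right-nested string diagrams

A morphism on a few tensor factors is extended by an arbitrary object `Γ` on the right, so that
composites of such morphisms need no associators. -/

/-- `f : X ⊗ Y ⟶ Z` followed by a context. -/
def bin {X Y Z : 𝒞} (f : X ⊗ Y ⟶ Z) (Γ : 𝒞) : X ⊗ (Y ⊗ Γ) ⟶ Z ⊗ Γ := (α_ X Y Γ).inv ≫ f ▷ Γ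

/-- `f : Z ⟶ X ⊗ Y` followed by a context. -/
def cobin {X Y Z : 𝒞} (f : Z ⟶ X ⊗ Y) (Γ : 𝒞) : Z ⊗ Γ ⟶ X ⊗ (Y ⊗ Γ) := f ▷ Γ ≫ (α_ X Y Γ).hom

/-- `f : X ⟶ Y` followed by a context. -/
def una {X Y : 𝒞} (f : X ⟶ Y) (Γ : 𝒞) : X ⊗ Γ ⟶ Y ⊗ Γ := f ▷ Γ

/-- A pairing followed by a context. -/
def nil₂ {X Y : 𝒞} (f : X ⊗ Y ⟶ 𝟙_ 𝒞) (Γ : 𝒞) : X ⊗ (Y ⊗ Γ) ⟶ Γ := bin f Γ ≫ (λ_ Γ).hom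

/-- A copairing followed by a context. -/
def conil₂ {X Y : 𝒞} (f : 𝟙_ 𝒞 ⟶ X ⊗ Y) (Γ : 𝒞) : Γ ⟶ X ⊗ (Y ⊗ Γ) := (λ_ Γ).inv ≫ cobin f Γ

/-- A covector followed by a context. -/
def nil₁ {X : 𝒞} (f : X ⟶ 𝟙_ 𝒞) (Γ : 𝒞) : X ⊗ Γ ⟶ Γ := f ▷ Γ ≫ (λ_ Γ).hom

/-- A vector followed by a context. -/
def conil₁ {X : 𝒞} (f : 𝟙_ 𝒞 ⟶ X) (Γ : 𝒞) : Γ ⟶ X ⊗ Γ := (λ_ Γ).inv ≫ f ▷ Γ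

/-- A morphism whiskered on the left, followed by a continuation. -/
def wh (A : 𝒞) {X Y Z : 𝒞} (g : X ⟶ Y) (k : A ⊗ Y ⟶ Z) : A ⊗ X ⟶ Z := A ◁ g ≫ k

/-- The rewrite rules below are stated with a continuation. Appending an identity gives the last
step of a diagram a continuation too; for the same reason the sections that simplify diagrams remove
`Category.comp_id` from the simp set. -/
lemma eq_of_comp_id {X Y : 𝒞} {f g : X ⟶ Y} (h : f ≫ 𝟙 _ = g ≫ 𝟙 _) : f = g := by simpa using h

section wh
variable {A X Y Z W : 𝒞}
lemma whisk (g : X ⟶ Y) (k : A ⊗ Y ⟶ Z) : A ◁ g ≫ k = wh A (g ≫ 𝟙 _) k := by simp [wh]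
lemma wh_comp (g : X ⟶ Y) (k : A ⊗ Y ⟶ Z) (h : Z ⟶ W) : wh A g k ≫ h = wh A g (k ≫ h) := by
  simp [wh]
lemma wh_wh (g : X ⟶ Y) (h : Y ⟶ Z) (k : A ⊗ Z ⟶ W) : wh A g (wh A h k) = wh A (g ≫ h) k := by
  simp [wh]
lemma wh_id (k : A ⊗ X ⟶ W) : wh A (𝟙 _) k = k := by simp [wh]
end wh

section planar
variable {X Y Z W Γ Γ' Γ'' Q Q' : 𝒞}

/-- These are instances of the interchange law with a fixed orientation: work on the context is done
before products, pairings and units in front of it, and coproducts are taken before work on the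
context. Two planar diagrams that differ by interchange thus reach a common form. -/
lemma bin_wh (f : X ⊗ Y ⟶ Z) (g : Γ ⟶ Γ') (k : Z ⊗ Γ' ⟶ W) :
    bin f Γ ≫ wh Z g k = wh X (wh Y g (𝟙 _)) (bin f Γ' ≫ k) := by
  simp [bin, wh, ← whisker_exchange_assoc]

lemma cobin_wh (f : Z ⟶ X ⊗ Y) (g : Γ ⟶ Γ') (h : Y ⊗ Γ' ⟶ Q) (k : X ⊗ Q ⟶ W) :
    cobin f Γ ≫ wh X (wh Y g h) k = wh Z g (cobin f Γ' ≫ wh X h k) := by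
  simp [cobin, wh, whisker_exchange_assoc]

lemma wh_cobin (f : Z ⟶ X ⊗ Y) (g : Γ ⟶ Γ') (k : X ⊗ (Y ⊗ Γ') ⟶ W) :
    wh Z g (cobin f Γ' ≫ k) = cobin f Γ ≫ wh X (wh Y g (𝟙 _)) k := by
  simp [cobin, wh, whisker_exchange_assoc]

lemma una_wh (f : X ⟶ Y) (g : Γ ⟶ Γ') (k : Y ⊗ Γ' ⟶ W) :
    una f Γ ≫ wh Y g k = wh X g (una f Γ' ≫ k) := by
  simp [una, wh, whisker_exchange_assoc]

lemma nil₂_comp (f : X ⊗ Y ⟶ 𝟙_ 𝒞) (g : Γ ⟶ Γ') (k : Γ' ⟶ W) :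
    nil₂ f Γ ≫ g ≫ k = wh X (wh Y (g ≫ 𝟙 _) (𝟙 _)) (nil₂ f Γ' ≫ k) := by
  simp only [nil₂, bin, wh, Category.assoc, Category.comp_id, associator_inv_naturality_right_assoc, whisker_exchange_assoc, leftUnitor_naturality_assoc]

lemma nil₂_wh (f : X ⊗ Y ⟶ 𝟙_ 𝒞) (g : Γ ⟶ Γ') (k : Z ⊗ Γ' ⟶ W) :
    nil₂ f (Z ⊗ Γ) ≫ wh Z g k = wh X (wh Y (wh Z g (𝟙 _)) (𝟙 _)) (nil₂ f _ ≫ k) := by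
  simp only [nil₂, bin, wh, Category.assoc, Category.comp_id, associator_inv_naturality_right_assoc, whisker_exchange_assoc, leftUnitor_naturality_assoc]

lemma nil₁_comp (f : X ⟶ 𝟙_ 𝒞) (g : Γ ⟶ Γ') (k : Γ' ⟶ W) :
    nil₁ f Γ ≫ g ≫ k = wh X (g ≫ 𝟙 _) (nil₁ f Γ' ≫ k) := by
  simp only [nil₁, wh, Category.assoc, Category.comp_id, whisker_exchange_assoc, leftUnitor_naturality_assoc]

lemma conil₁_wh (f : 𝟙_ 𝒞 ⟶ X) (g : Γ ⟶ Γ') (k : X ⊗ Γ' ⟶ W) :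
    conil₁ f Γ ≫ wh X g k = g ≫ conil₁ f Γ' ≫ k := by
  simp only [conil₁, wh, Category.assoc, ← whisker_exchange_assoc, leftUnitor_inv_naturality_assoc]

lemma conil₂_wh (f : 𝟙_ 𝒞 ⟶ X ⊗ Y) (g : Γ ⟶ Γ') (h : Y ⊗ Γ' ⟶ Q) (k : X ⊗ Q ⟶ W) :
    conil₂ f Γ ≫ wh X (wh Y g h) k = g ≫ conil₂ f Γ' ≫ wh X h k := by
  simp only [conil₂, Category.assoc, cobin_wh]
  simp only [wh, Category.assoc, leftUnitor_inv_naturality_assoc]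
end planar

section change
variable {X Y Z : 𝒞}
lemma eq_of_bin {f g : X ⊗ Y ⟶ Z} (h : bin f (𝟙_ 𝒞) = bin g (𝟙_ 𝒞)) : f = g := by
  simpa [bin, cancel_epi, MonoidalCategory.whiskerRight_id] using h

variable {X' Y' Z' Γ W : 𝒞}
lemma una_bin (f : X ⊗ Y ⟶ Z) (g : Z ⟶ Z') : bin (f ≫ g) Γ = bin f Γ ≫ una g Γ := by
  simp [bin, una]
end change

end Strings

/-! ### The braiding in a context: sliding morphisms across a strand. -/

section Braid
variable {𝒞 : Type w} [Category.{v} 𝒞] [MonoidalCategory 𝒞] [BraidedCategory 𝒞]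

/-- The braiding followed by a context. -/
def sw (X Y Γ : 𝒞) : X ⊗ (Y ⊗ Γ) ⟶ Y ⊗ (X ⊗ Γ) :=
  (α_ X Y Γ).inv ≫ (β_ X Y).hom ▷ Γ ≫ (α_ Y X Γ).hom

/-- The inverse of `sw`. -/
def swi (X Y Γ : 𝒞) : Y ⊗ (X ⊗ Γ) ⟶ X ⊗ (Y ⊗ Γ) :=
  (α_ Y X Γ).inv ≫ (β_ X Y).inv ▷ Γ ≫ (α_ X Y Γ).hom

section
variable {X Y Z W Γ Γ' Γ'' Q Q' S : 𝒞}

lemma sw_swi (k : X ⊗ (Y ⊗ Γ) ⟶ W) : sw X Y Γ ≫ swi X Y Γ ≫ k = k := by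
  simp [sw, swi]

lemma swi_sw (k : Y ⊗ (X ⊗ Γ) ⟶ W) : swi X Y Γ ≫ sw X Y Γ ≫ k = k := by
  simp [sw, swi]

lemma sw_wh (g : Γ ⟶ Γ') (h : X ⊗ Γ' ⟶ Q) (k : Y ⊗ Q ⟶ W) :
    sw X Y Γ ≫ wh Y (wh X g h) k = wh X (wh Y g (𝟙 _)) (sw X Y Γ' ≫ wh Y h k) := by
  simp only [sw, wh, whiskerLeft_comp, Category.assoc, Category.comp_id,
    ← associator_naturality_right_assoc, ← whisker_exchange_assoc,
    associator_inv_naturality_right_assoc]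

/-- A product slides over a strand to its right. -/
lemma sw_bin_over (S) (f : X ⊗ Y ⟶ Z) (k : Z ⊗ (S ⊗ Γ) ⟶ W) :
    wh S (bin f Γ ≫ 𝟙 _) (sw S Z Γ ≫ k) =
      sw S X (Y ⊗ Γ) ≫ wh X (sw S Y Γ ≫ 𝟙 _) (bin f (S ⊗ Γ) ≫ k) := by
  have h : (S ◁ f) ▷ Γ ≫ (β_ S Z).hom ▷ Γ = (β_ S (X ⊗ Y)).hom ▷ Γ ≫ (f ▷ S) ▷ Γ := by
    rw [← comp_whiskerRight, BraidedCategory.braiding_naturality_right, comp_whiskerRight]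
  have h' : (S ◁ bin f Γ ≫ sw S Z Γ) =
      sw S X (Y ⊗ Γ) ≫ X ◁ sw S Y Γ ≫ bin f (S ⊗ Γ) := by
    trans (S ◁ (α_ X Y Γ).inv ≫ (α_ S (X ⊗ Y) Γ).inv) ≫ ((S ◁ f) ▷ Γ ≫ (β_ S Z).hom ▷ Γ) ≫ (α_ _ _ _).hom
    · simp [bin, sw]
    · rw [h, BraidedCategory.braiding_tensor_right_hom]
      simp [bin, sw]
  simp only [wh, Category.comp_id, reassoc_of% h']

/-- A product slides under a strand to its right. -/
lemma bin_sw (S) (f : X ⊗ Y ⟶ Z) (k : S ⊗ (Z ⊗ Γ) ⟶ W) :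
    bin f (S ⊗ Γ) ≫ sw Z S Γ ≫ k =
      wh X (sw Y S Γ ≫ 𝟙 _) (sw X S (Y ⊗ Γ) ≫ wh S (bin f Γ ≫ 𝟙 _) k) := by
  have h : (f ▷ S) ▷ Γ ≫ (β_ Z S).hom ▷ Γ = (β_ (X ⊗ Y) S).hom ▷ Γ ≫ (S ◁ f) ▷ Γ := by
    rw [← comp_whiskerRight, BraidedCategory.braiding_naturality_left, comp_whiskerRight]
  have h' : bin f (S ⊗ Γ) ≫ sw Z S Γ = X ◁ sw Y S Γ ≫ sw X S (Y ⊗ Γ) ≫ S ◁ bin f Γ := by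
    trans ((α_ X Y (S ⊗ Γ)).inv ≫ (α_ (X ⊗ Y) S Γ).inv) ≫ ((f ▷ S) ▷ Γ ≫ (β_ Z S).hom ▷ Γ) ≫ (α_ _ _ _).hom
    · simp [bin, sw]
    · rw [h, BraidedCategory.braiding_tensor_left_hom]
      simp [bin, sw]
  simp only [wh, Category.comp_id, reassoc_of% h']

/-- A coproduct slides over a strand to its right. -/
lemma sw_cobin (S) (f : Z ⟶ X ⊗ Y) (k : X ⊗ (Y ⊗ (S ⊗ Γ)) ⟶ W) :
    sw S Z Γ ≫ cobin f (S ⊗ Γ) ≫ k =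
      wh S (cobin f Γ ≫ 𝟙 _) (sw S X (Y ⊗ Γ) ≫ wh X (sw S Y Γ ≫ 𝟙 _) k) := by
  have h : (S ◁ f) ▷ Γ ≫ (β_ S (X ⊗ Y)).hom ▷ Γ = (β_ S Z).hom ▷ Γ ≫ (f ▷ S) ▷ Γ := by
    rw [← comp_whiskerRight, BraidedCategory.braiding_naturality_right, comp_whiskerRight]
  rw [BraidedCategory.braiding_tensor_right_hom] at h
  have h' : sw S Z Γ ≫ cobin f (S ⊗ Γ) = S ◁ cobin f Γ ≫ sw S X (Y ⊗ Γ) ≫ X ◁ sw S Y Γ := by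
    trans (α_ S Z Γ).inv ≫ ((β_ S Z).hom ▷ Γ ≫ (f ▷ S) ▷ Γ) ≫ (α_ _ _ _).hom ≫ (α_ _ _ _).hom
    · simp [cobin, sw]
    · rw [← h]
      simp [cobin, sw]
  simp only [wh, Category.comp_id, reassoc_of% h']

/-- A coproduct slides under a strand to its right. -/
lemma cobin_under (S) (f : Z ⟶ X ⊗ Y) :
    cobin f (S ⊗ Γ) ≫ X ◁ sw Y S Γ ≫ sw X S (Y ⊗ Γ) = sw Z S Γ ≫ S ◁ cobin f Γ := by
  have h : (f ▷ S) ▷ Γ ≫ (β_ (X ⊗ Y) S).hom ▷ Γ = (β_ Z S).hom ▷ Γ ≫ (S ◁ f) ▷ Γ := by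
    rw [← comp_whiskerRight, BraidedCategory.braiding_naturality_left, comp_whiskerRight]
  rw [BraidedCategory.braiding_tensor_left_hom] at h
  trans (α_ Z S Γ).inv ≫ ((β_ Z S).hom ▷ Γ ≫ (S ◁ f) ▷ Γ) ≫ (α_ _ _ _).hom ≫ S ◁ (α_ _ _ _).hom
  · rw [← h]
    simp [cobin, sw]
  · simp [cobin, sw]

lemma sw_wh_cobin (S) (f : Z ⟶ X ⊗ Y) (h : X ⊗ (Y ⊗ Γ) ⟶ Q) (k : S ⊗ Q ⟶ W) :
    sw Z S Γ ≫ wh S (cobin f Γ ≫ h) k =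
      cobin f (S ⊗ Γ) ≫ wh X (sw Y S Γ ≫ 𝟙 _) (sw X S (Y ⊗ Γ) ≫ wh S h k) := by
  simp only [wh, Category.comp_id, whiskerLeft_comp, Category.assoc]
  rw [← reassoc_of% cobin_under (Γ := Γ) S f]

lemma sw_una (S) (f : X ⟶ Y) (k : Y ⊗ (S ⊗ Γ) ⟶ W) :
    sw S X Γ ≫ una f (S ⊗ Γ) ≫ k = wh S (una f Γ ≫ 𝟙 _) (sw S Y Γ ≫ k) := by
  have h : (S ◁ f) ▷ Γ ≫ (β_ S Y).hom ▷ Γ = (β_ S X).hom ▷ Γ ≫ (f ▷ S) ▷ Γ := by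
    rw [← comp_whiskerRight, BraidedCategory.braiding_naturality_right, comp_whiskerRight]
  have h' : sw S X Γ ≫ una f (S ⊗ Γ) = S ◁ una f Γ ≫ sw S Y Γ := by
    trans (α_ _ _ _).inv ≫ ((β_ S X).hom ▷ Γ ≫ (f ▷ S) ▷ Γ) ≫ (α_ _ _ _).hom
    · simp [una, sw]
    · rw [← h]
      simp [una, sw]
  simp only [wh, Category.comp_id, reassoc_of% h']

lemma sw_wh_una (S) (f : X ⟶ Y) (h : Y ⊗ Γ ⟶ Q) (k : S ⊗ Q ⟶ W) :
    sw X S Γ ≫ wh S (una f Γ ≫ h) k = una f (S ⊗ Γ) ≫ sw Y S Γ ≫ wh S h k := by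
  have e : (f ▷ S) ▷ Γ ≫ (β_ Y S).hom ▷ Γ = (β_ X S).hom ▷ Γ ≫ (S ◁ f) ▷ Γ := by
    rw [← comp_whiskerRight, BraidedCategory.braiding_naturality_left, comp_whiskerRight]
  have e' : una f (S ⊗ Γ) ≫ sw Y S Γ = sw X S Γ ≫ S ◁ una f Γ := by
    trans (α_ _ _ _).inv ≫ ((f ▷ S) ▷ Γ ≫ (β_ Y S).hom ▷ Γ) ≫ (α_ _ _ _).hom
    · simp [una, sw]
    · rw [e]
      simp [una, sw]
  simp only [wh, whiskerLeft_comp, Category.assoc, reassoc_of% e']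

lemma sw_unit_right (S : 𝒞) : sw S (𝟙_ 𝒞) Γ = S ◁ (λ_ Γ).hom ≫ (λ_ (S ⊗ Γ)).inv := by
  simp only [sw, braiding_tensorUnit_right]
  monoidal

lemma sw_unit_left (S : 𝒞) : sw (𝟙_ 𝒞) S Γ = (λ_ (S ⊗ Γ)).hom ≫ S ◁ (λ_ Γ).inv := by
  simp only [sw, braiding_tensorUnit_left]
  monoidal

/-- A pairing is a product with values in the unit object, and braiding past the unit is trivial, so
this is `sw_bin_over` for that target. The rules for covectors, vectors and copairings below arise
in the same way from those for `una` and `cobin`. -/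
lemma whisker_nil₂ (S) (f : X ⊗ Y ⟶ 𝟙_ 𝒞) :
    S ◁ nil₂ f Γ = sw S X (Y ⊗ Γ) ≫ X ◁ sw S Y Γ ≫ nil₂ f (S ⊗ Γ) := by
  have := sw_bin_over (Γ := Γ) S f ((λ_ _).hom)
  simp only [sw_unit_right, wh, Category.comp_id, Category.assoc, Iso.inv_hom_id] at this
  simpa [nil₂] using this

lemma nil₂_under (S) (f : X ⊗ Y ⟶ 𝟙_ 𝒞) :
    nil₂ f (S ⊗ Γ) = X ◁ sw Y S Γ ≫ sw X S (Y ⊗ Γ) ≫ S ◁ nil₂ f Γ := by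
  have := bin_sw (Γ := Γ) S f (S ◁ (λ_ _).hom)
  simp only [sw_unit_left, wh, Category.comp_id, Category.assoc, Iso.inv_hom_id,
    whiskerLeft_inv_hom] at this
  simpa [nil₂] using this

lemma whisker_nil₁ (S) (f : X ⟶ 𝟙_ 𝒞) : S ◁ nil₁ f Γ = sw S X Γ ≫ nil₁ f (S ⊗ Γ) := by
  have := sw_una (Γ := Γ) S f (λ_ _).hom
  simp only [sw_unit_right, wh, Category.comp_id, Category.assoc, Iso.inv_hom_id] at this
  simpa [nil₁, una] using this.symm

lemma nil₁_under (S) (f : X ⟶ 𝟙_ 𝒞) : nil₁ f (S ⊗ Γ) = sw X S Γ ≫ S ◁ nil₁ f Γ := by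
  have := sw_wh_una (Γ := Γ) S f (λ_ _).hom (𝟙 _)
  simp only [sw_unit_left, wh, Category.comp_id, Category.assoc, whiskerLeft_inv_hom] at this
  simpa [nil₁, una] using this.symm

lemma whisker_conil₁ (S) (f : 𝟙_ 𝒞 ⟶ X) : S ◁ conil₁ f Γ ≫ sw S X Γ = conil₁ f (S ⊗ Γ) := by
  have := sw_una (Γ := Γ) S f (𝟙 _)
  simp only [sw_unit_right, wh, Category.comp_id, Category.assoc] at this
  rw [← cancel_epi (S ◁ (λ_ Γ).hom)]
  simpa [conil₁, una] using this.symm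

lemma conil₁_sw (S) (f : 𝟙_ 𝒞 ⟶ X) : conil₁ f (S ⊗ Γ) ≫ sw X S Γ = S ◁ conil₁ f Γ := by
  have := sw_wh_una (Γ := Γ) S f (𝟙 _) (𝟙 _)
  simp only [sw_unit_left, wh, Category.comp_id, Category.assoc] at this
  rw [← cancel_epi (λ_ (S ⊗ Γ)).hom]
  simpa [conil₁, una] using this.symm

lemma whisker_conil₂ (S) (f : 𝟙_ 𝒞 ⟶ X ⊗ Y) :
    S ◁ conil₂ f Γ ≫ sw S X (Y ⊗ Γ) ≫ X ◁ sw S Y Γ = conil₂ f (S ⊗ Γ) := by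
  have := sw_cobin (Γ := Γ) S f (𝟙 _)
  simp only [sw_unit_right, wh, Category.comp_id, Category.assoc] at this
  rw [← cancel_epi (S ◁ (λ_ Γ).hom)]
  simpa [conil₂] using this.symm

lemma conil₂_under (S) (f : 𝟙_ 𝒞 ⟶ X ⊗ Y) :
    conil₂ f (S ⊗ Γ) ≫ X ◁ sw Y S Γ ≫ sw X S (Y ⊗ Γ) = S ◁ conil₂ f Γ := by
  have := cobin_under (Γ := Γ) S f
  rw [sw_unit_left] at this
  simp only [conil₂, whiskerLeft_comp, Category.assoc, this]
  simp

/-- The braid relation is naturality of the crossing with `Z`, applied to the morphism `β_ X Y`. -/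
lemma sw_sw_sw (k : Z ⊗ (Y ⊗ (X ⊗ Γ)) ⟶ W) :
    sw X Y (Z ⊗ Γ) ≫ wh Y (sw X Z Γ ≫ 𝟙 _) (sw Y Z (X ⊗ Γ) ≫ k) =
      wh X (sw Y Z Γ ≫ 𝟙 _) (sw X Z (Y ⊗ Γ) ≫ wh Z (sw X Y Γ ≫ 𝟙 _) k) := by
  have h := cobin_under (Γ := Γ) Z (β_ X Y).hom
  -- The object `X ⊗ Y` is carried past `Z` as a single strand, assembled by `bin` of the identity
  -- and taken apart by `cobin` of the braiding. Together these two are `sw X Y`.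
  have h := bin_sw (Γ := Γ) Z (𝟙 (X ⊗ Y)) (wh Z (cobin (β_ X Y).hom Γ ≫ 𝟙 _) k)
  rw [sw_wh_cobin] at h
  have e1 (Γ) : bin (𝟙 (X ⊗ Y)) Γ ≫ cobin (β_ X Y).hom Γ = sw X Y Γ := by simp [bin, cobin, sw]
  rw [reassoc_of% e1, wh_wh, wh_id] at h
  simpa [e1] using h
end

section variants
variable {X Y Z W Γ Γ' Γ'' Q Q' : 𝒞}

/-- The normal form may already have merged a later morphism into the middle of a pattern. The
variants ending in `_wh` recognise the pattern in that state. -/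
lemma sw_sw_sw_wh (g : X ⊗ Γ ⟶ Q) (k : Z ⊗ (Y ⊗ Q) ⟶ W) :
    sw X Y (Z ⊗ Γ) ≫ wh Y (sw X Z Γ ≫ wh Z g (𝟙 _)) (sw Y Z Q ≫ k) =
      wh X (sw Y Z Γ ≫ 𝟙 _) (sw X Z (Y ⊗ Γ) ≫ wh Z (sw X Y Γ ≫ wh Y g (𝟙 _)) k) := by
  have := sw_sw_sw (X := X) (Y := Y) (Z := Z) (Γ := Γ) (wh Z (wh Y g (𝟙 _)) k)
  simpa [sw_wh, wh_wh, wh_comp, wh_id] using this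

lemma sw_sw_bin (S : 𝒞) (f : X ⊗ Y ⟶ Z) (k : Z ⊗ (S ⊗ Γ) ⟶ W) :
    sw S X (Y ⊗ Γ) ≫ wh X (sw S Y Γ ≫ 𝟙 _) (bin f (S ⊗ Γ) ≫ k) =
      wh S (bin f Γ ≫ 𝟙 _) (sw S Z Γ ≫ k) := (sw_bin_over S f k).symm

lemma sw_sw_bin_wh (S : 𝒞) (f : X ⊗ Y ⟶ Z) (g : S ⊗ Γ ⟶ Q) (k : Z ⊗ Q ⟶ W) :
    sw S X (Y ⊗ Γ) ≫ wh X (sw S Y Γ ≫ wh Y g (𝟙 _)) (bin f Q ≫ k) =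
      wh S (bin f Γ ≫ 𝟙 _) (sw S Z Γ ≫ wh Z g k) := by
  simpa [bin_wh, wh_wh, wh_comp, wh_id] using sw_sw_bin S f (wh Z g k)

lemma sw_sw_nil₂ (S : 𝒞) (f : X ⊗ Y ⟶ 𝟙_ 𝒞) (k : S ⊗ Γ ⟶ W) :
    sw S X (Y ⊗ Γ) ≫ wh X (sw S Y Γ ≫ 𝟙 _) (nil₂ f (S ⊗ Γ) ≫ k) = wh S (nil₂ f Γ ≫ 𝟙 _) k := by
  simp [wh, whisker_nil₂]

lemma sw_sw_nil₂_wh (S : 𝒞) (f : X ⊗ Y ⟶ 𝟙_ 𝒞) (g : S ⊗ Γ ⟶ Q) (k : Q ⟶ W) :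
    sw S X (Y ⊗ Γ) ≫ wh X (sw S Y Γ ≫ wh Y g (𝟙 _)) (nil₂ f Q ≫ k) =
      wh S (nil₂ f Γ ≫ 𝟙 _) (g ≫ k) := by
  rw [← sw_sw_nil₂, nil₂_comp]
  simp [wh_wh, wh_comp, wh_id]

lemma wh_sw_nil₂ (S : 𝒞) (f : X ⊗ Y ⟶ 𝟙_ 𝒞) (h : Γ ⟶ Q) (k : S ⊗ Q ⟶ W) :
    wh X (sw Y S Γ ≫ 𝟙 _) (sw X S (Y ⊗ Γ) ≫ wh S (nil₂ f Γ ≫ h) k) =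
      nil₂ f (S ⊗ Γ) ≫ wh S h k := by
  simp [wh, nil₂_under S f]

lemma wh_comp_wh_sw_nil₂ (S : 𝒞) (f : X ⊗ Y ⟶ 𝟙_ 𝒞) (b : Γ'' ⟶ Y ⊗ Q') (a : Q' ⟶ S ⊗ Γ) (h : Γ ⟶ Q)
    (k : S ⊗ Q ⟶ W) :
    wh X (b ≫ wh Y a (sw Y S Γ ≫ 𝟙 _)) (sw X S (Y ⊗ Γ) ≫ wh S (nil₂ f Γ ≫ h) k) =
      wh X (b ≫ wh Y a (𝟙 _)) (nil₂ f (S ⊗ Γ) ≫ wh S h k) := by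
  simp [wh, nil₂_under S f]

lemma sw_sw_nil₂_under (S T : 𝒞) {R R' : 𝒞} (f : X ⊗ Y ⟶ 𝟙_ 𝒞) (b : R ⟶ T ⊗ (Y ⊗ Q'))
    (a : Q' ⟶ S ⊗ Γ) (h : Γ ⟶ Q) (m : S ⊗ Q ⟶ R') (k : T ⊗ R' ⟶ W) :
    wh X (b ≫ wh T (wh Y a (sw Y S Γ ≫ 𝟙 _)) (𝟙 _))
        (sw X T (S ⊗ (Y ⊗ Γ)) ≫ wh T (sw X S (Y ⊗ Γ) ≫ wh S (nil₂ f Γ ≫ h) m) k) =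
      wh X (b ≫ wh T (wh Y a (𝟙 _)) (𝟙 _))
        (sw X T (Y ⊗ (S ⊗ Γ)) ≫ wh T (nil₂ f (S ⊗ Γ) ≫ wh S h m) k) := by
  have e (h : X ⊗ (S ⊗ (Y ⊗ Γ)) ⟶ R') :=
    sw_wh (X := X) (Y := T) (sw Y S Γ) h k
  simp only [wh, Category.comp_id, Category.id_comp, whiskerLeft_comp, Category.assoc, nil₂_under S f] at e ⊢
  have e' (h : X ⊗ (S ⊗ (Y ⊗ Γ)) ⟶ R') := (e h).symm
  simp only [← whiskerLeft_comp_assoc T, ← whiskerLeft_comp T, Category.assoc] at e' ⊢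
  rw [e']

lemma sw_nil₁ (S : 𝒞) (f : X ⟶ 𝟙_ 𝒞) (k : S ⊗ Γ ⟶ W) :
    sw S X Γ ≫ nil₁ f (S ⊗ Γ) ≫ k = wh S (nil₁ f Γ ≫ 𝟙 _) k := by
  simp [wh, whisker_nil₁]

lemma sw_wh_nil₁ (S : 𝒞) (f : X ⟶ 𝟙_ 𝒞) (h : Γ ⟶ Q) (k : S ⊗ Q ⟶ W) :
    sw X S Γ ≫ wh S (nil₁ f Γ ≫ h) k = nil₁ f (S ⊗ Γ) ≫ wh S h k := by
  simp [wh, nil₁_under S f]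

lemma wh_conil₁_sw (S : 𝒞) (f : 𝟙_ 𝒞 ⟶ X) (k : X ⊗ (S ⊗ Γ) ⟶ W) :
    wh S (conil₁ f Γ ≫ 𝟙 _) (sw S X Γ ≫ k) = conil₁ f (S ⊗ Γ) ≫ k := by
  simp [wh, ← whisker_conil₁ S f]

lemma conil₁_sw_comp (S : 𝒞) (f : 𝟙_ 𝒞 ⟶ X) (k : S ⊗ (X ⊗ Γ) ⟶ W) :
    conil₁ f (S ⊗ Γ) ≫ sw X S Γ ≫ k = wh S (conil₁ f Γ ≫ 𝟙 _) k := by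
  simp [wh, ← conil₁_sw S f]

end variants
end Braid

/-! ### Algebra, coalgebra and Hopf axioms in a context. -/

section algebra
variable {𝒞 : Type w} [Category.{v} 𝒞] [MonoidalCategory 𝒞] [BraidedCategory 𝒞]
variable {Γ W Q : 𝒞}

lemma bin_mul_mul (A : 𝒞) [MonObj A] (k : A ⊗ Γ ⟶ W) :
    bin μ[A] (A ⊗ Γ) ≫ bin μ[A] Γ ≫ k = wh A (bin μ[A] Γ ≫ 𝟙 _) (bin μ[A] Γ ≫ k) := by
  trans (α_ A A (A ⊗ Γ)).inv ≫ (α_ (A ⊗ A) A Γ).inv ≫ (μ[A] ▷ A ≫ μ[A]) ▷ Γ ≫ k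
  · simp only [bin]; monoidal
  · rw [MonObj.mul_assoc]
    simp only [bin, wh]; monoidal

lemma conil₁_one_mul (A : 𝒞) [MonObj A] (k : A ⊗ Γ ⟶ W) :
    conil₁ η[A] (A ⊗ Γ) ≫ bin μ[A] Γ ≫ k = k := by
  simp [bin, conil₁, ← comp_whiskerRight_assoc]

lemma wh_conil₁_one_mul (A : 𝒞) [MonObj A] (k : A ⊗ Γ ⟶ W) :
    wh A (conil₁ η[A] Γ ≫ 𝟙 _) (bin μ[A] Γ ≫ k) = k := by
  trans (A ◁ (λ_ Γ).inv ≫ (α_ A _ Γ).inv) ≫ (A ◁ η[A] ≫ μ[A]) ▷ Γ ≫ k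
  · simp only [bin, conil₁, wh]; monoidal
  · rw [MonObj.mul_one]; simp

lemma cobin_comul_comul (A : 𝒞) [ComonObj A] (k : A ⊗ (A ⊗ (A ⊗ Γ)) ⟶ W) :
    cobin Δ[A] Γ ≫ cobin Δ[A] (A ⊗ Γ) ≫ k =
      cobin Δ[A] Γ ≫ wh A (cobin Δ[A] Γ ≫ 𝟙 _) k := by
  trans (Δ[A] ≫ Δ[A] ▷ A ≫ (α_ A A A).hom) ▷ Γ ≫ (α_ A (A ⊗ A) Γ).hom ≫ A ◁ (α_ A A Γ).hom ≫ k
  · simp only [cobin]; monoidal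
  · rw [← ComonObj.comul_assoc]
    simp only [cobin, wh]; monoidal

lemma cobin_nil₁ (A : 𝒞) [ComonObj A] (k : A ⊗ Γ ⟶ W) :
    cobin Δ[A] Γ ≫ nil₁ ε[A] (A ⊗ Γ) ≫ k = k := by
  simp [cobin, nil₁, ← comp_whiskerRight_assoc]

lemma cobin_wh_nil₁ (A : 𝒞) [ComonObj A] (h : Γ ⟶ Q) (k : A ⊗ Q ⟶ W) :
    cobin Δ[A] Γ ≫ wh A (nil₁ ε[A] Γ ≫ h) k = wh A h k := by
  trans (Δ[A] ≫ A ◁ ε[A]) ▷ Γ ≫ (α_ A _ Γ).hom ≫ A ◁ (λ_ Γ).hom ≫ A ◁ h ≫ k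
  · simp only [cobin, nil₁, wh]; monoidal
  · rw [ComonObj.comul_counit]; simp [wh]

lemma bin_mul_comul (A : 𝒞) [BimonObj A] (k : A ⊗ (A ⊗ Γ) ⟶ W) :
    bin μ[A] Γ ≫ cobin Δ[A] Γ ≫ k =
      wh A (cobin Δ[A] Γ ≫ 𝟙 _) (cobin Δ[A] (A ⊗ (A ⊗ Γ)) ≫
        wh A (sw A A (A ⊗ Γ) ≫ wh A (bin μ[A] Γ ≫ 𝟙 _) (𝟙 _)) (bin μ[A] (A ⊗ Γ) ≫ k)) := by
  trans (α_ A A Γ).inv ≫ (μ[A] ≫ Δ[A]) ▷ Γ ≫ (α_ A A Γ).hom ≫ k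
  · simp only [bin, cobin]; monoidal
  · have e : (Δ[A] ⊗ₘ Δ[A]) = A ◁ Δ[A] ≫ Δ[A] ▷ (A ⊗ A) := MonoidalCategory.tensorHom_def' _ _
    have e' : (μ[A] ⊗ₘ μ[A]) = (A ⊗ A) ◁ μ[A] ≫ μ[A] ▷ A := MonoidalCategory.tensorHom_def' _ _
    rw [BimonObj.mul_comul, e, e', tensorμ]
    simp only [bin, cobin, wh, sw]; monoidal

lemma conil₁_comul (A : 𝒞) [BimonObj A] (k : A ⊗ (A ⊗ Γ) ⟶ W) :
    conil₁ η[A] Γ ≫ cobin Δ[A] Γ ≫ k = conil₁ η[A] Γ ≫ conil₁ η[A] (A ⊗ Γ) ≫ k := by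
  trans (λ_ Γ).inv ≫ (η[A] ≫ Δ[A]) ▷ Γ ≫ (α_ A A Γ).hom ≫ k
  · simp only [conil₁, cobin]; monoidal
  · have e : (η[A] ⊗ₘ η[A]) = 𝟙_ 𝒞 ◁ η[A] ≫ η[A] ▷ A := MonoidalCategory.tensorHom_def' _ _
    rw [BimonObj.one_comul, MonObj.tensorObj.one_def, e]
    simp only [conil₁]; monoidal

lemma cobin_antipode_left (A : 𝒞) [HopfObj A] (k : A ⊗ Γ ⟶ W) :
    cobin Δ[A] Γ ≫ una 𝒮[A] (A ⊗ Γ) ≫ bin μ[A] Γ ≫ k = nil₁ ε[A] Γ ≫ conil₁ η[A] Γ ≫ k := by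
  have h := congrArg (· ▷ Γ) (HopfObj.antipode_left A)
  simp only [comp_whiskerRight] at h
  simp [cobin, una, bin, nil₁, conil₁, reassoc_of% h]

lemma cobin_antipode_right (A : 𝒞) [HopfObj A] (k : A ⊗ Γ ⟶ W) :
    cobin Δ[A] Γ ≫ wh A (una 𝒮[A] Γ ≫ 𝟙 _) (bin μ[A] Γ ≫ k) =
      nil₁ ε[A] Γ ≫ conil₁ η[A] Γ ≫ k := by
  trans (Δ[A] ≫ A ◁ 𝒮[A] ≫ μ[A]) ▷ Γ ≫ k
  · simp only [bin, una, cobin, wh]; monoidal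
  · rw [HopfObj.antipode_right]
    simp [nil₁, conil₁]

lemma una_antipode_comul (A : 𝒞) [HopfObj A] (k : A ⊗ (A ⊗ Γ) ⟶ W) :
    una 𝒮[A] Γ ≫ cobin Δ[A] Γ ≫ k =
      cobin Δ[A] Γ ≫ sw A A Γ ≫ una 𝒮[A] (A ⊗ Γ) ≫ wh A (una 𝒮[A] Γ ≫ 𝟙 _) k := by
  have h := congrArg (· ▷ Γ) (HopfObj.antipode_comul A)
  simp only [comp_whiskerRight, MonoidalCategory.tensorHom_def] at h
  simp [cobin, una, sw, wh, reassoc_of% h]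

lemma bin_mul_antipode (A : 𝒞) [HopfObj A] (k : A ⊗ Γ ⟶ W) :
    bin μ[A] Γ ≫ una 𝒮[A] Γ ≫ k =
      una 𝒮[A] (A ⊗ Γ) ≫ wh A (una 𝒮[A] Γ ≫ 𝟙 _) (sw A A Γ ≫ bin μ[A] Γ ≫ k) := by
  have h := congrArg (· ▷ Γ) (HopfObj.mul_antipode A)
  simp only [comp_whiskerRight, MonoidalCategory.tensorHom_def] at h
  simp [bin, una, sw, wh, reassoc_of% h]

end algebra

/-! ### The axioms of a dual pairing in a context. -/

section pairing
variable {𝒞 : Type w} [Category.{v} 𝒞] [MonoidalCategory 𝒞] [BraidedCategory 𝒞]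
variable {Γ W Q C B : 𝒞} [HopfObj C] [HopfObj B] (p : DualPairing C B)
include p

lemma DualPairing.bin_mul_nil₂ (k : Γ ⟶ W) :
    bin μ[C] (B ⊗ Γ) ≫ nil₂ p.ev Γ ≫ k =
      wh C (wh C (cobin Δ[B] Γ ≫ 𝟙 _) (nil₂ p.ev (B ⊗ Γ) ≫ 𝟙 _)) (nil₂ p.ev Γ ≫ k) := by
  have h := congrArg (· ▷ Γ) p.mul_ev
  simp only [comp_whiskerRight] at h
  have h' := congrArg (fun z => (α_ C C (B ⊗ Γ)).inv ≫ (α_ (C ⊗ C) B Γ).inv ≫ z ≫ (λ_ Γ).hom ≫ k) h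
  simp only [Category.assoc] at h'
  trans (α_ C C (B ⊗ Γ)).inv ≫ (α_ (C ⊗ C) B Γ).inv ≫ μ[C] ▷ B ▷ Γ ≫ p.ev ▷ Γ ≫ (λ_ Γ).hom ≫ k
  · simp [bin, nil₂]
  · rw [h']
    simp [bin, nil₂, wh, cobin]

lemma DualPairing.wh_mul_nil₂ (k : Γ ⟶ W) :
    wh C (bin μ[B] Γ ≫ 𝟙 _) (nil₂ p.ev Γ ≫ k) =
      cobin Δ[C] (B ⊗ (B ⊗ Γ)) ≫ wh C (nil₂ p.ev (B ⊗ Γ) ≫ 𝟙 _) (nil₂ p.ev Γ ≫ k) := by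
  trans C ◁ (α_ B B Γ).inv ≫ (α_ C (B ⊗ B) Γ).inv ≫ (C ◁ μ[B] ≫ p.ev) ▷ Γ ≫ (λ_ Γ).hom ≫ k
  · simp only [bin, nil₂, wh]; monoidal
  · rw [p.ev_mul]
    have e : Δ[C] ▷ B ▷ B ▷ Γ = (α_ _ _ _).hom ▷ Γ ≫ Δ[C] ▷ (B ⊗ B) ▷ Γ ≫ (α_ _ _ _).inv ▷ Γ := by
      simp
    simp only [bin, nil₂, cobin, wh]; monoidal

lemma DualPairing.wh_comp_mul_nil₂ (a : Q ⟶ B ⊗ (B ⊗ Γ)) (k : Γ ⟶ W) :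
    wh C (a ≫ bin μ[B] Γ ≫ 𝟙 _) (nil₂ p.ev Γ ≫ k) =
      cobin Δ[C] Q ≫ wh C (wh C (a ≫ 𝟙 _) (nil₂ p.ev (B ⊗ Γ) ≫ 𝟙 _)) (nil₂ p.ev Γ ≫ k) := by
  rw [← wh_wh, p.wh_mul_nil₂, wh_cobin, wh_wh, wh_comp, Category.id_comp]; simp

lemma DualPairing.wh_comp_wh_mul_nil₂ {S : 𝒞} (b : S ⟶ B ⊗ Q) (a : Q ⟶ B ⊗ Γ) (k : Γ ⟶ W) :
    wh C (b ≫ wh B a (bin μ[B] Γ ≫ 𝟙 _)) (nil₂ p.ev Γ ≫ k) =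
      cobin Δ[C] S ≫ wh C (wh C (b ≫ wh B a (𝟙 _)) (nil₂ p.ev (B ⊗ Γ) ≫ 𝟙 _)) (nil₂ p.ev Γ ≫ k) := by
  have := p.wh_comp_mul_nil₂ (b ≫ wh B a (𝟙 _)) k
  simpa [wh] using this

lemma DualPairing.conil₁_nil₂ (k : Γ ⟶ W) :
    conil₁ η[C] (B ⊗ Γ) ≫ nil₂ p.ev Γ ≫ k = nil₁ ε[B] Γ ≫ k := by
  have h := congrArg (· ▷ Γ) p.one_ev
  simp only [comp_whiskerRight] at h
  simp [conil₁, nil₂, nil₁, bin, reassoc_of% h]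

lemma DualPairing.wh_conil₁_nil₂ (k : Γ ⟶ W) :
    wh C (conil₁ η[B] Γ ≫ 𝟙 _) (nil₂ p.ev Γ ≫ k) = nil₁ ε[C] Γ ≫ k := by
  trans C ◁ (λ_ Γ).inv ≫ (α_ C _ Γ).inv ≫ (C ◁ η[B] ≫ p.ev) ▷ Γ ≫ (λ_ Γ).hom ≫ k
  · simp only [bin, nil₂, conil₁, wh]; monoidal
  · rw [p.ev_one]; simp [nil₁]

end pairing

/-! ### Coregular maps of a dual pairing and their compatibility with products. -/

section Coregular

attribute [-simp] Category.comp_id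
attribute [local simp] whisk wh_comp wh_wh wh_id bin_wh wh_cobin una_wh nil₂_comp nil₂_wh nil₁_comp
  conil₁_wh conil₂_wh sw_wh bin_sw sw_cobin sw_wh_cobin sw_una sw_wh_una
  sw_sw_sw sw_sw_sw_wh sw_sw_bin sw_sw_bin_wh sw_sw_nil₂ sw_sw_nil₂_wh sw_nil₁ sw_wh_nil₁ wh_sw_nil₂
  wh_comp_wh_sw_nil₂
  wh_conil₁_sw conil₁_sw_comp bin_mul_mul conil₁_one_mul wh_conil₁_one_mul cobin_comul_comul
  cobin_nil₁ cobin_wh_nil₁ conil₁_comul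
  DualPairing.bin_mul_nil₂ DualPairing.wh_mul_nil₂ DualPairing.wh_comp_mul_nil₂
  DualPairing.wh_comp_wh_mul_nil₂ DualPairing.conil₁_nil₂
  DualPairing.wh_conil₁_nil₂

variable {𝒞 : Type w} [Category.{v} 𝒞] [MonoidalCategory 𝒞] [BraidedCategory 𝒞]
variable {Γ W Q C B X Y : 𝒞} [HopfObj C] [HopfObj B] (p : DualPairing C B)

/-- The coregular map `c ⊗ b ↦ b₁ ⟨c, b₂⟩`. -/
def DualPairing.coregB : C ⊗ B ⟶ B :=
  C ◁ Δ[B] ≫ (α_ C B B).inv ≫ (β_ C B).hom ▷ B ≫ (α_ B C B).hom ≫ B ◁ p.ev ≫ (ρ_ B).hom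

/-- The coregular map `c ⊗ b ↦ ⟨c₁, b⟩ c₂`. -/
def DualPairing.coregC : C ⊗ B ⟶ C :=
  Δ[C] ▷ B ≫ (α_ C C B).hom ≫ C ◁ (β_ C B).hom ≫ (α_ C B C).inv ≫ p.ev ▷ C ≫ (λ_ C).hom

lemma DualPairing.bin_coregB (k : B ⊗ Γ ⟶ W) :
    bin p.coregB Γ ≫ k = wh C (cobin Δ[B] Γ ≫ 𝟙 _)
      (sw C B (B ⊗ Γ) ≫ wh B (nil₂ p.ev Γ ≫ 𝟙 _) k) := by
  simp only [bin, coregB, wh, cobin, sw, nil₂]; monoidal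

lemma DualPairing.bin_coregC (k : C ⊗ Γ ⟶ W) :
    bin p.coregC Γ ≫ k = cobin Δ[C] (B ⊗ Γ) ≫ wh C (sw C B Γ ≫ 𝟙 _) (nil₂ p.ev (C ⊗ Γ) ≫ k) := by
  simp only [bin, coregC, wh, cobin, sw, nil₂]; monoidal

/-- From `ev (c d, b) = ev (d, b₁) ev (c, b₂)` and coassociativity, `c` acts before `d`: `coregB` is
an action of the braided opposite of `C`. -/
lemma DualPairing.mul_coregB (k : B ⊗ Γ ⟶ W) :
    bin μ[C] (B ⊗ Γ) ≫ bin p.coregB Γ ≫ k =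
      sw C C (B ⊗ Γ) ≫ wh C (bin p.coregB Γ ≫ 𝟙 _) (bin p.coregB Γ ≫ k) := by
  simp only [bin_coregB]; simp

lemma DualPairing.coregB_comul (k : B ⊗ (B ⊗ Γ) ⟶ W) :
    bin p.coregB Γ ≫ cobin Δ[B] Γ ≫ k =
      wh C (cobin Δ[B] Γ ≫ 𝟙 _) (sw C B (B ⊗ Γ) ≫ wh B (bin p.coregB Γ ≫ 𝟙 _) k) := by
  simp only [bin_coregB]; simp

/-- The braided Leibniz rule. The coproduct of `B` is multiplicative and `ev (c, a b) = ev (c₂, a)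
ev (c₁, b)`, so `c₂` acts on `a` and `c₁` on `b`. -/
lemma DualPairing.coregB_mul (k : B ⊗ Γ ⟶ W) :
    wh C (bin μ[B] Γ ≫ 𝟙 _) (bin p.coregB Γ ≫ k) =
      cobin Δ[C] (B ⊗ (B ⊗ Γ)) ≫ wh C (bin p.coregB (B ⊗ Γ) ≫ 𝟙 _)
        (sw C B (B ⊗ Γ) ≫ wh B (bin p.coregB Γ ≫ 𝟙 _) (bin μ[B] Γ ≫ k)) := by
  -- The common form: both factors are comultiplied, the inner legs are exchanged, and `C` passes
  -- the two front legs to be paired with the product of the other two.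
  trans wh C (wh B (cobin Δ[B] Γ ≫ 𝟙 _) (cobin Δ[B] (B ⊗ (B ⊗ Γ)) ≫
      wh B (sw B B (B ⊗ Γ) ≫ 𝟙 _) (𝟙 _))) (sw C B (B ⊗ (B ⊗ (B ⊗ Γ))) ≫
        wh B (sw C B (B ⊗ (B ⊗ Γ)) ≫ wh B (wh C (bin μ[B] Γ ≫ 𝟙 _) (nil₂ p.ev Γ ≫ 𝟙 _)) (𝟙 _))
          (bin μ[B] Γ ≫ k))
  · simp only [bin_coregB]
    simp [bin_mul_comul, -wh_mul_nil₂]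
  · simp only [bin_coregB]
    simp [-sw_sw_bin, -sw_sw_bin_wh, sw_sw_nil₂_under]

/-- The Leibniz rule for products in `C`, from multiplicativity of the coproduct of `C`: the right
factor consumes `b₁` and the left one `b₂`. -/
lemma DualPairing.mul_coregC (k : C ⊗ Γ ⟶ W) :
    bin μ[C] (B ⊗ Γ) ≫ bin p.coregC Γ ≫ k =
      wh C (wh C (cobin Δ[B] Γ ≫ 𝟙 _) (bin p.coregC (B ⊗ Γ) ≫ sw C B Γ ≫ 𝟙 _))
        (bin p.coregC (C ⊗ Γ) ≫ bin μ[C] Γ ≫ k) := by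
  simp only [bin_coregC]; simp [bin_mul_comul]

lemma DualPairing.coregC_comul (k : C ⊗ (C ⊗ Γ) ⟶ W) :
    bin p.coregC Γ ≫ cobin Δ[C] Γ ≫ k =
      cobin Δ[C] (B ⊗ Γ) ≫ wh C (sw C B Γ ≫ 𝟙 _) (bin p.coregC (C ⊗ Γ) ≫ k) := by
  simp only [bin_coregC]; simp

lemma DualPairing.coregC_mul (k : C ⊗ Γ ⟶ W) :
    wh C (bin μ[B] Γ ≫ 𝟙 _) (bin p.coregC Γ ≫ k) =
      wh C (sw B B Γ ≫ 𝟙 _) (bin p.coregC (B ⊗ Γ) ≫ bin p.coregC Γ ≫ k) := by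
  simp only [bin_coregC]
  simp
  simp only [sw_bin_over]
  -- The braid relation is needed here against its simp orientation, so that rule is switched off in
  -- the closing call.
  rw [← sw_sw_sw]
  simp [-sw_sw_bin, -sw_sw_bin_wh, -sw_sw_sw, -sw_sw_sw_wh]

/-! ### The distributive law -/

/-- `c ⊗ x ⊗ b ↦ c₁ ⊗ x ⊗ b₁ ⟨c₂, b₂⟩`, the second copy of `C` being braided past `x ⊗ b₁`. -/
def DualPairing.evR (X Γ : 𝒞) : C ⊗ (X ⊗ (B ⊗ Γ)) ⟶ C ⊗ (X ⊗ (B ⊗ Γ)) :=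
  cobin Δ[C] (X ⊗ (B ⊗ Γ)) ≫ C ◁ (sw C X (B ⊗ Γ) ≫ X ◁ bin p.coregB Γ)

/-- `c ⊗ x ⊗ b ↦ ⟨c₁, b₁⟩ c₂ ⊗ x ⊗ b₂`, the first copy of `B` being braided past `c₂ ⊗ x`. -/
def DualPairing.evL (X Γ : 𝒞) : C ⊗ (X ⊗ (B ⊗ Γ)) ⟶ C ⊗ (X ⊗ (B ⊗ Γ)) :=
  C ◁ (X ◁ cobin Δ[B] Γ ≫ sw X B (B ⊗ Γ)) ≫ bin p.coregC (X ⊗ (B ⊗ Γ))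

/-- On a product in `C` the map factors into the contribution of the outer factor, which is `evR`
for the strand `C ⊗ X`, and that of the inner factor. Together with `mul_evL` and `evR_evL` this
makes `evR⁻¹ ≫ evL` compatible with multiplication in `C`. -/
lemma DualPairing.mul_evR (X Γ : 𝒞) :
    bin μ[C] (X ⊗ (B ⊗ Γ)) ≫ p.evR X Γ =
      cobin Δ[C] (C ⊗ (X ⊗ (B ⊗ Γ))) ≫
        C ◁ (sw C C (X ⊗ (B ⊗ Γ)) ≫ C ◁ (sw C X (B ⊗ Γ) ≫ X ◁ bin p.coregB Γ)) ≫
        C ◁ p.evR X Γ ≫ bin μ[C] (X ⊗ (B ⊗ Γ)) := by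
  apply eq_of_comp_id
  simp [evR, bin_mul_comul, mul_coregB]

lemma DualPairing.mul_evL (X Γ : 𝒞) :
    bin μ[C] (X ⊗ (B ⊗ Γ)) ≫ p.evL X Γ =
      C ◁ p.evL X Γ ≫ C ◁ C ◁ (X ◁ cobin Δ[B] Γ ≫ sw X B (B ⊗ Γ)) ≫
        C ◁ sw C B (X ⊗ (B ⊗ Γ)) ≫ bin p.coregC (C ⊗ (X ⊗ (B ⊗ Γ))) ≫
        bin μ[C] (X ⊗ (B ⊗ Γ)) := by
  apply eq_of_comp_id
  simp [evL, mul_coregC]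

/-- The outer factor of `C` consumes the last leg of the coproduct of `b` and the inner one the
first leg, so by coassociativity the order does not matter. -/
lemma DualPairing.evR_evL (X Γ : 𝒞) :
    (cobin Δ[C] (C ⊗ (X ⊗ (B ⊗ Γ))) ≫
        C ◁ (sw C C (X ⊗ (B ⊗ Γ)) ≫ C ◁ (sw C X (B ⊗ Γ) ≫ X ◁ bin p.coregB Γ))) ≫
      C ◁ p.evL X Γ =
    C ◁ p.evL X Γ ≫ cobin Δ[C] (C ⊗ (X ⊗ (B ⊗ Γ))) ≫
        C ◁ (sw C C (X ⊗ (B ⊗ Γ)) ≫ C ◁ (sw C X (B ⊗ Γ) ≫ X ◁ bin p.coregB Γ)) := by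
  apply eq_of_comp_id
  simp [evL, coregB_comul]

/-- The counterpart of `mul_evR` for products in `B`. With `evL_mul` and `evL_evR` it gives the
other half of the distributive law. -/
lemma DualPairing.evR_mul (X Γ : 𝒞) :
    C ◁ X ◁ bin μ[B] Γ ≫ p.evR X Γ =
      p.evR X (B ⊗ Γ) ≫ (cobin Δ[C] (X ⊗ (B ⊗ (B ⊗ Γ))) ≫ C ◁ (sw C X (B ⊗ (B ⊗ Γ)) ≫
        X ◁ (sw C B (B ⊗ Γ) ≫ B ◁ bin p.coregB Γ))) ≫ C ◁ X ◁ bin μ[B] Γ := by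
  -- The Leibniz rule `coregB_mul`, used once `C` has crossed `X`; naturality of the crossing moves
  -- the product behind it.
  have key : wh C (wh X (bin μ[B] Γ ≫ 𝟙 _) (𝟙 _))
      (sw C X (B ⊗ Γ) ≫ wh X (bin p.coregB Γ ≫ 𝟙 _) (𝟙 _)) =
      sw C X (B ⊗ (B ⊗ Γ)) ≫ wh X (cobin Δ[C] (B ⊗ (B ⊗ Γ)) ≫ wh C (bin p.coregB (B ⊗ Γ) ≫ 𝟙 _)
        (sw C B (B ⊗ Γ) ≫ wh B (bin p.coregB Γ ≫ 𝟙 _) (bin μ[B] Γ ≫ 𝟙 _))) (𝟙 _) := by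
    rw [← sw_wh, coregB_mul]
  apply eq_of_comp_id
  simp [evR, key]

lemma DualPairing.evL_mul (X Γ : 𝒞) :
    C ◁ X ◁ bin μ[B] Γ ≫ p.evL X Γ =
      (C ◁ (X ◁ (B ◁ cobin Δ[B] Γ ≫ sw B B (B ⊗ Γ)) ≫ sw X B (B ⊗ (B ⊗ Γ))) ≫
        bin p.coregC (X ⊗ (B ⊗ (B ⊗ Γ)))) ≫ p.evL X (B ⊗ Γ) ≫ C ◁ X ◁ bin μ[B] Γ := by
  apply eq_of_comp_id
  trans wh C (wh X (wh B (cobin Δ[B] Γ ≫ 𝟙 _) (cobin Δ[B] (B ⊗ (B ⊗ Γ)) ≫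
      wh B (sw B B (B ⊗ Γ) ≫ 𝟙 _) (𝟙 _))) (sw X B (B ⊗ (B ⊗ (B ⊗ Γ))) ≫
        wh B (sw X B (B ⊗ (B ⊗ Γ)) ≫ wh B (wh X (bin μ[B] Γ ≫ 𝟙 _) (𝟙 _)) (𝟙 _)) (𝟙 _)))
      (wh C (bin μ[B] (X ⊗ (B ⊗ Γ)) ≫ 𝟙 _) (bin p.coregC (X ⊗ (B ⊗ Γ)) ≫ 𝟙 _))
  · simp [evL, bin_mul_comul]
  · rw [coregC_mul]
    simp [evL]

lemma DualPairing.evL_evR (X Γ : 𝒞) :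
    p.evR X (B ⊗ Γ) ≫ (C ◁ (X ◁ (B ◁ cobin Δ[B] Γ ≫ sw B B (B ⊗ Γ)) ≫ sw X B (B ⊗ (B ⊗ Γ))) ≫
        bin p.coregC (X ⊗ (B ⊗ (B ⊗ Γ)))) =
      (C ◁ (X ◁ (B ◁ cobin Δ[B] Γ ≫ sw B B (B ⊗ Γ)) ≫ sw X B (B ⊗ (B ⊗ Γ))) ≫
        bin p.coregC (X ⊗ (B ⊗ (B ⊗ Γ)))) ≫ p.evR X (B ⊗ Γ) := by
  apply eq_of_comp_id
  simp [evR, coregC_comul]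

end Coregular

/-! ### Invertibility of `evR`, and the crossing condition as an exchange rule. -/

section Crossed
attribute [-simp] Category.comp_id
attribute [local simp] whisk wh_comp wh_wh wh_id bin_wh wh_cobin una_wh nil₂_comp nil₂_wh nil₁_comp
  conil₁_wh conil₂_wh sw_wh bin_sw sw_cobin sw_wh_cobin sw_una sw_wh_una
  sw_sw_sw sw_sw_sw_wh sw_sw_bin sw_sw_bin_wh sw_sw_nil₂ sw_sw_nil₂_wh sw_nil₁ sw_wh_nil₁ wh_sw_nil₂
  wh_comp_wh_sw_nil₂
  wh_conil₁_sw conil₁_sw_comp bin_mul_mul conil₁_one_mul wh_conil₁_one_mul cobin_comul_comul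
  cobin_nil₁ cobin_wh_nil₁ conil₁_comul
  DualPairing.bin_mul_nil₂ DualPairing.wh_mul_nil₂ DualPairing.wh_comp_mul_nil₂
  DualPairing.wh_comp_wh_mul_nil₂ DualPairing.conil₁_nil₂
  DualPairing.wh_conil₁_nil₂

variable {𝒞 : Type w} [Category.{v} 𝒞] [MonoidalCategory 𝒞] [BraidedCategory 𝒞]
variable {Γ W Q C B X Y : 𝒞} [HopfObj C] [HopfObj B] (p : DualPairing C B)

section inv
variable [IsIso 𝒮[C]]

/-- The antipode reverses products through the braiding, so its inverse reverses them through the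
inverse braiding. -/
lemma mul_inv_antipode : μ[C] ≫ inv 𝒮[C] = (inv 𝒮[C] ⊗ₘ inv 𝒮[C]) ≫ (β_ C C).inv ≫ μ[C] := by
  have h := HopfObj.mul_antipode C
  rw [← cancel_mono 𝒮[C], ← cancel_epi (𝒮[C] ⊗ₘ 𝒮[C]), ← cancel_epi (β_ C C).hom]
  simp only [Category.assoc, IsIso.inv_hom_id, Category.comp_id, h, tensorHom_comp_tensorHom_assoc,
    IsIso.hom_inv_id, id_tensorHom_id, Category.id_comp, Iso.hom_inv_id_assoc]
  rw [← BraidedCategory.braiding_naturality_assoc]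

lemma inv_antipode_comul : inv 𝒮[C] ≫ Δ[C] = Δ[C] ≫ (β_ C C).inv ≫ (inv 𝒮[C] ⊗ₘ inv 𝒮[C]) := by
  have h := HopfObj.antipode_comul C
  rw [← cancel_epi 𝒮[C], IsIso.hom_inv_id_assoc, reassoc_of% h,
    ← BraidedCategory.braiding_naturality_assoc, Iso.hom_inv_id_assoc, tensorHom_comp_tensorHom]
  simp [Category.comp_id]

/-- Applying the inverse antipode to `c₁ (S c₂) = ε(c) 1` shows that it is an antipode for the
product composed with the inverse braiding. -/
lemma comul_inv_antipode_left : Δ[C] ≫ inv 𝒮[C] ▷ C ≫ (β_ C C).inv ≫ μ[C] = ε[C] ≫ η[C] := by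
  have h := congrArg (· ≫ inv 𝒮[C]) (HopfObj.antipode_right C)
  have h1 : η[C] ≫ inv 𝒮[C] = η[C] := by rw [IsIso.comp_inv_eq, HopfObj.one_antipode]
  simp only [Category.assoc, mul_inv_antipode, h1] at h
  rw [← h, MonoidalCategory.tensorHom_def']
  simp only [Category.assoc]
  rw [← whiskerLeft_comp_assoc]
  simp

lemma comul_inv_antipode_right : Δ[C] ≫ C ◁ inv 𝒮[C] ≫ (β_ C C).inv ≫ μ[C] = ε[C] ≫ η[C] := by
  have h := congrArg (· ≫ inv 𝒮[C]) (HopfObj.antipode_left C)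
  have h1 : η[C] ≫ inv 𝒮[C] = η[C] := by rw [IsIso.comp_inv_eq, HopfObj.one_antipode]
  simp only [Category.assoc, mul_inv_antipode, h1] at h
  rw [← h, MonoidalCategory.tensorHom_def]
  simp only [Category.assoc]
  rw [← comp_whiskerRight_assoc]
  simp

lemma DualPairing.coregB_coregB (k : B ⊗ Γ ⟶ W) :
    wh C (bin p.coregB Γ ≫ 𝟙 _) (bin p.coregB Γ ≫ k) =
      swi C C (B ⊗ Γ) ≫ bin μ[C] (B ⊗ Γ) ≫ bin p.coregB Γ ≫ k := by
  rw [p.mul_coregB, swi_sw]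

/-- Since `coregB` is an action of the braided opposite product, for which the inverse antipode is
the convolution inverse of the identity, acting by the two legs of `c` cancels. -/
lemma DualPairing.coregB_skew_left (k : B ⊗ Γ ⟶ W) :
    cobin Δ[C] (B ⊗ Γ) ≫ una (inv 𝒮[C]) _ ≫ wh C (bin p.coregB Γ ≫ 𝟙 _) (bin p.coregB Γ ≫ k) =
      nil₁ ε[C] _ ≫ k := by
  have e (k : C ⊗ (B ⊗ Γ) ⟶ W) : cobin Δ[C] (B ⊗ Γ) ≫ una (inv 𝒮[C]) _ ≫ swi C C (B ⊗ Γ) ≫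
      bin μ[C] (B ⊗ Γ) ≫ k = nil₁ ε[C] (B ⊗ Γ) ≫ conil₁ η[C] (B ⊗ Γ) ≫ k := by
    trans (Δ[C] ≫ inv 𝒮[C] ▷ C ≫ (β_ C C).inv ≫ μ[C]) ▷ (B ⊗ Γ) ≫ k
    · simp only [cobin, una, swi, bin]; monoidal
    · rw [comul_inv_antipode_left]; simp [nil₁, conil₁, -nil₁_comp]
  rw [coregB_coregB, e]
  have e' : conil₁ η[C] (B ⊗ Γ) ≫ bin p.coregB Γ ≫ k = k := by
    simp only [bin_coregB]; simp
  rw [e']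

lemma DualPairing.coregB_skew_right (k : B ⊗ Γ ⟶ W) :
    cobin Δ[C] (B ⊗ Γ) ≫ wh C (una (inv 𝒮[C]) _ ≫ bin p.coregB Γ ≫ 𝟙 _) (bin p.coregB Γ ≫ k) =
      nil₁ ε[C] _ ≫ k := by
  have e (k : C ⊗ (B ⊗ Γ) ⟶ W) : cobin Δ[C] (B ⊗ Γ) ≫ wh C (una (inv 𝒮[C]) _ ≫ 𝟙 _) (swi C C (B ⊗ Γ) ≫
      bin μ[C] (B ⊗ Γ) ≫ k) = nil₁ ε[C] (B ⊗ Γ) ≫ conil₁ η[C] (B ⊗ Γ) ≫ k := by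
    trans (Δ[C] ≫ C ◁ inv 𝒮[C] ≫ (β_ C C).inv ≫ μ[C]) ▷ (B ⊗ Γ) ≫ k
    · simp only [cobin, una, swi, bin, wh]; monoidal
    · rw [comul_inv_antipode_right]; simp [nil₁, conil₁, -nil₁_comp]
  have := p.coregB_coregB (Γ := Γ) k
  trans cobin Δ[C] (B ⊗ Γ) ≫ wh C (una (inv 𝒮[C]) _ ≫ 𝟙 _) (wh C (bin p.coregB Γ ≫ 𝟙 _) (bin p.coregB Γ ≫ k))
  · simp
  rw [coregB_coregB, e]
  have e' : conil₁ η[C] (B ⊗ Γ) ≫ bin p.coregB Γ ≫ k = k := by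
    simp only [bin_coregB]; simp
  rw [e']

/-- The inverse of `evR`. -/
def DualPairing.evRInv (X Γ : 𝒞) : C ⊗ (X ⊗ (B ⊗ Γ)) ⟶ C ⊗ (X ⊗ (B ⊗ Γ)) :=
  cobin Δ[C] (X ⊗ (B ⊗ Γ)) ≫
    C ◁ (una (inv 𝒮[C]) _ ≫ sw C X (B ⊗ Γ) ≫ X ◁ bin p.coregB Γ)

/-- By coassociativity the leg carrying the inverse antipode and the leg acting by `coregB` are the
two halves of one coproduct, and they cancel by the skew antipode identity. -/
lemma DualPairing.evR_evRInv (X Γ : 𝒞) : p.evR X Γ ≫ p.evRInv X Γ = 𝟙 _ := by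
  -- The cancellation takes place behind `X`. It is simplified by the same rules as the goal, so
  -- that its left side matches what arises there.
  have key : sw C X (B ⊗ Γ) ≫ wh X (cobin Δ[C] (B ⊗ Γ) ≫ una (inv 𝒮[C]) _ ≫
    wh C (bin p.coregB Γ ≫ 𝟙 _) (bin p.coregB Γ ≫ 𝟙 _)) (𝟙 _) = nil₁ ε[C] _ ≫ 𝟙 _ := by
    rw [coregB_skew_left]; simp
  simp at key
  apply eq_of_comp_id
  simp [evR, evRInv, key]

lemma DualPairing.evRInv_evR (X Γ : 𝒞) : p.evRInv X Γ ≫ p.evR X Γ = 𝟙 _ := by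
  have key : sw C X (B ⊗ Γ) ≫ wh X (cobin Δ[C] (B ⊗ Γ) ≫ wh C (una (inv 𝒮[C]) _ ≫ bin p.coregB Γ ≫ 𝟙 _) (bin p.coregB Γ ≫ 𝟙 _)) (𝟙 _) = nil₁ ε[C] _ ≫ 𝟙 _ := by
    rw [coregB_skew_right]; simp
  simp at key
  apply eq_of_comp_id
  simp [evR, evRInv, key]

end inv

/-- By naturality of the braiding, `c₂` may cross `v` and `b₁` before `b₁` acts on `v`. Hence all
pairing can be done before either action. `crossRight_eq_evL` is the mirror image. -/
lemma crossLeft_eq_evR (l : C ⊗ X ⟶ X) (r : X ⊗ B ⟶ X) :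
    crossLeft p.ev l r = (α_ C X B).hom ≫ C ◁ X ◁ (ρ_ B).inv ≫ p.evR X (𝟙_ 𝒞) ≫
      C ◁ bin r (𝟙_ 𝒞) ≫ bin l (𝟙_ 𝒞) ≫ (ρ_ X).hom := by
  trans (α_ C X B).hom ≫ C ◁ X ◁ (ρ_ B).inv ≫ (C ◁ X ◁ cobin Δ[B] (𝟙_ 𝒞) ≫
    cobin Δ[C] (X ⊗ (B ⊗ (B ⊗ (𝟙_ 𝒞)))) ≫ C ◁ C ◁ bin r (B ⊗ 𝟙_ 𝒞) ≫ C ◁ sw C X (B ⊗ 𝟙_ 𝒞) ≫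
    C ◁ X ◁ nil₂ p.ev (𝟙_ 𝒞) ≫ bin l (𝟙_ 𝒞)) ≫ (ρ_ X).hom
  · simp only [crossLeft, tensorμ, cobin, bin, sw, nil₂, MonoidalCategory.tensorHom_def']; monoidal
  · congr 1; congr 1; simp only [← Category.assoc]; congr 1; simp only [Category.assoc]
    apply eq_of_comp_id
    simp [DualPairing.evR, DualPairing.bin_coregB]

lemma crossRight_eq_evL (l : C ⊗ X ⟶ X) (r : X ⊗ B ⟶ X) :
    crossRight p.ev l r = (α_ C X B).hom ≫ C ◁ X ◁ (ρ_ B).inv ≫ p.evL X (𝟙_ 𝒞) ≫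
      bin l (B ⊗ 𝟙_ 𝒞) ≫ bin r (𝟙_ 𝒞) ≫ (ρ_ X).hom := by
  trans (α_ C X B).hom ≫ C ◁ X ◁ (ρ_ B).inv ≫ (C ◁ X ◁ cobin Δ[B] (𝟙_ 𝒞) ≫
    cobin Δ[C] (X ⊗ (B ⊗ (B ⊗ (𝟙_ 𝒞)))) ≫ C ◁ bin l (B ⊗ B ⊗ 𝟙_ 𝒞) ≫ C ◁ sw X B (B ⊗ 𝟙_ 𝒞) ≫
    C ◁ B ◁ bin r (𝟙_ 𝒞) ≫ nil₂ p.ev (X ⊗ 𝟙_ 𝒞)) ≫ (ρ_ X).hom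
  · simp only [crossRight, tensorμ, cobin, bin, sw, nil₂, MonoidalCategory.tensorHom_def']; monoidal
  · congr 1; congr 1; simp only [← Category.assoc]; congr 1; simp only [Category.assoc]
    apply eq_of_comp_id
    simp [DualPairing.evL, DualPairing.bin_coregC]

end Crossed

/-! ### Crossed bimodules induced from left modules over `C`. -/

section Induced
attribute [-simp] Category.comp_id
attribute [local simp] whisk wh_comp wh_wh wh_id bin_wh wh_cobin una_wh nil₂_comp nil₂_wh nil₁_comp
  conil₁_wh conil₂_wh sw_wh bin_sw sw_cobin sw_wh_cobin sw_una sw_wh_una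
  sw_sw_sw sw_sw_sw_wh sw_sw_bin sw_sw_bin_wh sw_sw_nil₂ sw_sw_nil₂_wh sw_nil₁ sw_wh_nil₁ wh_sw_nil₂
  wh_comp_wh_sw_nil₂
  wh_conil₁_sw conil₁_sw_comp bin_mul_mul conil₁_one_mul wh_conil₁_one_mul cobin_comul_comul
  cobin_nil₁ cobin_wh_nil₁ conil₁_comul
  DualPairing.bin_mul_nil₂ DualPairing.wh_mul_nil₂ DualPairing.wh_comp_mul_nil₂
  DualPairing.wh_comp_wh_mul_nil₂ DualPairing.conil₁_nil₂
  DualPairing.wh_conil₁_nil₂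

variable {𝒞 : Type w} [Category.{v} 𝒞] [MonoidalCategory 𝒞] [BraidedCategory 𝒞]
variable {Γ W Q C B X Y Z : 𝒞}

lemma sw_tensor_right (X Y Z Γ : 𝒞) : sw X (Y ⊗ Z) Γ =
    X ◁ (α_ Y Z Γ).hom ≫ sw X Y (Z ⊗ Γ) ≫ Y ◁ sw X Z Γ ≫ (α_ Y Z (X ⊗ Γ)).inv := by
  simp only [sw, BraidedCategory.braiding_tensor_right_hom]; monoidal

lemma sw_tensor_left (X Y Z Γ : 𝒞) : sw (X ⊗ Y) Z Γ =
    (α_ X Y (Z ⊗ Γ)).hom ≫ X ◁ sw Y Z Γ ≫ sw X Z (Y ⊗ Γ) ≫ Z ◁ (α_ X Y Γ).inv := by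
  simp only [sw, BraidedCategory.braiding_tensor_left_hom]; monoidal

variable [HopfObj C] [HopfObj B] (p : DualPairing C B)

lemma DualPairing.evR_tensor (X Y Γ : 𝒞) : p.evR (X ⊗ Y) Γ =
    C ◁ (α_ X Y (B ⊗ Γ)).hom ≫ (cobin Δ[C] (X ⊗ (Y ⊗ (B ⊗ Γ))) ≫ C ◁ (sw C X (Y ⊗ (B ⊗ Γ)) ≫
      X ◁ (sw C Y (B ⊗ Γ) ≫ Y ◁ bin p.coregB Γ))) ≫ C ◁ (α_ X Y (B ⊗ Γ)).inv := by
  simp only [evR, cobin, sw_tensor_right]; monoidal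

lemma DualPairing.evL_tensor (X Y Γ : 𝒞) : p.evL (X ⊗ Y) Γ =
    C ◁ (α_ X Y (B ⊗ Γ)).hom ≫ (C ◁ (X ◁ (Y ◁ cobin Δ[B] Γ ≫ sw Y B (B ⊗ Γ)) ≫ sw X B (Y ⊗ (B ⊗ Γ))) ≫
        bin p.coregC (X ⊗ (Y ⊗ (B ⊗ Γ)))) ≫ C ◁ (α_ X Y (B ⊗ Γ)).inv := by
  simp only [evL, cobin, sw_tensor_left, bin]; monoidal

lemma DualPairing.evR_natural (f : X ⟶ Y) (Γ : 𝒞) :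
    C ◁ una f (B ⊗ Γ) ≫ p.evR Y Γ = p.evR X Γ ≫ C ◁ una f (B ⊗ Γ) := by
  apply eq_of_comp_id
  simp [evR, -sw_una]
  rw [← sw_una]
  simp [-sw_una]

lemma DualPairing.evL_natural (f : X ⟶ Y) (Γ : 𝒞) :
    C ◁ una f (B ⊗ Γ) ≫ p.evL Y Γ = p.evL X Γ ≫ C ◁ una f (B ⊗ Γ) := by
  apply eq_of_comp_id
  simp [evL]

variable [IsIso 𝒮[C]]

instance (X Γ : 𝒞) : IsIso (p.evR X Γ) := ⟨p.evRInv X Γ, p.evR_evRInv X Γ, p.evRInv_evR X Γ⟩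

/-- The left action of `C` on the right `B`-module `Y ⊗ B` induced from a left `C`-module `Y`, in the
context `Γ`. -/
def DualPairing.induced (l : C ⊗ Y ⟶ Y) (Γ : 𝒞) : C ⊗ (Y ⊗ (B ⊗ Γ)) ⟶ Y ⊗ (B ⊗ Γ) :=
  inv (p.evR Y Γ) ≫ p.evL Y Γ ≫ bin l (B ⊗ Γ)

lemma DualPairing.evR_one (X Γ : 𝒞) :
    conil₁ η[C] (X ⊗ (B ⊗ Γ)) ≫ p.evR X Γ = conil₁ η[C] (X ⊗ (B ⊗ Γ)) := by
  apply eq_of_comp_id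
  simp [evR, bin_coregB]

lemma DualPairing.evL_one (X Γ : 𝒞) :
    conil₁ η[C] (X ⊗ (B ⊗ Γ)) ≫ p.evL X Γ = conil₁ η[C] (X ⊗ (B ⊗ Γ)) := by
  apply eq_of_comp_id
  simp [evL, bin_coregC]
  rw [← nil₁_comp]
  simp [-nil₁_comp]

end Induced
section Induced
variable {𝒞 : Type w} [Category.{v} 𝒞] [MonoidalCategory 𝒞] [BraidedCategory 𝒞]
variable {Γ W Q C B X Y Z : 𝒞} [HopfObj C] [HopfObj B] (p : DualPairing C B) [IsIso 𝒮[C]]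

lemma DualPairing.induced_one (l : C ⊗ Y ⟶ Y) (hl : η[C] ▷ Y ≫ l = (λ_ Y).hom) (Γ : 𝒞) :
    conil₁ η[C] (Y ⊗ (B ⊗ Γ)) ≫ p.induced l Γ = 𝟙 _ := by
  have : conil₁ η[C] (Y ⊗ (B ⊗ Γ)) ≫ inv (p.evR Y Γ) = conil₁ η[C] (Y ⊗ (B ⊗ Γ)) := by
    rw [IsIso.comp_inv_eq, evR_one]
  rw [induced, reassoc_of% this, reassoc_of% evL_one]
  have := congrArg (fun z => z ▷ B ▷ Γ) hl
  simp only [comp_whiskerRight] at this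
  simp [conil₁, bin, reassoc_of% this]

/-- The exchange rule for a product in `C` is the exchange rule for each factor in turn. All
rearrangements are commutations of `evR`, `evL` and `l`, some of them inverted. -/
lemma DualPairing.induced_mul (l : C ⊗ Y ⟶ Y) (hl : μ[C] ▷ Y ≫ l = (α_ C C Y).hom ≫ C ◁ l ≫ l)
    (Γ : 𝒞) :
    bin μ[C] (Y ⊗ (B ⊗ Γ)) ≫ p.induced l Γ = C ◁ p.induced l Γ ≫ p.induced l Γ := by
  have e1 := p.mul_evR Y Γ
  have e2 := p.mul_evL Y Γ
  have e3 := p.evR_evL Y Γ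
  have e4 := p.evR_tensor C Y Γ
  have e5 := p.evL_tensor C Y Γ
  -- `T` is `evR` for the strand `C ⊗ Y` up to associators, hence invertible; likewise `M` below is
  -- `evL` for that strand.
  generalize hT : (cobin Δ[C] (C ⊗ (Y ⊗ (B ⊗ Γ))) ≫
        C ◁ (sw C C (Y ⊗ (B ⊗ Γ)) ≫ C ◁ (sw C Y (B ⊗ Γ) ≫ Y ◁ bin p.coregB Γ))) = T at e1 e3 e4
  have hT' : T = C ◁ (α_ C Y (B ⊗ Γ)).inv ≫ p.evR (C ⊗ Y) Γ ≫ C ◁ (α_ C Y (B ⊗ Γ)).hom := by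
    rw [e4]; simp
  have iT : IsIso T := by rw [hT']; infer_instance
  rw [reassoc_of% hT] at e1
  have n1 : T ≫ C ◁ bin l (B ⊗ Γ) = C ◁ bin l (B ⊗ Γ) ≫ p.evR Y Γ := by
    rw [hT']
    simpa [bin, una] using (C ◁ (α_ C Y (B ⊗ Γ)).inv ≫= p.evR_natural l Γ).symm
  generalize hM : (C ◁ C ◁ (Y ◁ cobin Δ[B] Γ ≫ sw Y B (B ⊗ Γ)) ≫
        C ◁ sw C B (Y ⊗ (B ⊗ Γ)) ≫ bin p.coregC (C ⊗ (Y ⊗ (B ⊗ Γ)))) = M at e2 e5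
  have n2 : C ◁ C ◁ (Y ◁ cobin Δ[B] Γ ≫ sw Y B (B ⊗ Γ)) ≫
        C ◁ sw C B (Y ⊗ (B ⊗ Γ)) ≫ bin p.coregC (C ⊗ (Y ⊗ (B ⊗ Γ))) ≫ C ◁ bin l (B ⊗ Γ) =
      C ◁ bin l (B ⊗ Γ) ≫ p.evL Y Γ := by
    have := C ◁ (α_ C Y (B ⊗ Γ)).inv ≫= p.evL_natural l Γ
    rw [e5] at this
    simpa only [una, bin, whiskerLeft_comp, Category.assoc, Iso.inv_hom_id_assoc, Iso.hom_inv_id_assoc, whiskerLeft_inv_hom_assoc, ← cancel_mono (C ◁ (α_ Y B Γ).inv)] using this.symm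
  have hl' : bin μ[C] (Y ⊗ (B ⊗ Γ)) ≫ bin l (B ⊗ Γ) = C ◁ bin l (B ⊗ Γ) ≫ bin l (B ⊗ Γ) := by
    trans (α_ C C (Y ⊗ (B ⊗ Γ))).inv ≫ (α_ (C ⊗ C) Y (B ⊗ Γ)).inv ≫ (μ[C] ▷ Y ≫ l) ▷ (B ⊗ Γ)
    · simp only [bin]; monoidal
    · rw [hl]; simp only [bin]; monoidal
  have i1 : bin μ[C] (Y ⊗ (B ⊗ Γ)) ≫ inv (p.evR Y Γ) =
      C ◁ inv (p.evR Y Γ) ≫ inv T ≫ bin μ[C] (Y ⊗ (B ⊗ Γ)) := by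
    rw [IsIso.comp_inv_eq]
    simp only [Category.assoc]
    rw [e1, IsIso.inv_hom_id_assoc, ← whiskerLeft_comp_assoc]
    simp
  have i2 : inv T ≫ C ◁ p.evL Y Γ = C ◁ p.evL Y Γ ≫ inv T := by
    rw [IsIso.inv_comp_eq, ← Category.assoc, IsIso.eq_comp_inv, e3]
  have i3 : C ◁ bin l (B ⊗ Γ) ≫ inv (p.evR Y Γ) = inv T ≫ C ◁ bin l (B ⊗ Γ) := by
    rw [IsIso.comp_inv_eq, Category.assoc, IsIso.eq_inv_comp, n1]
  simp only [induced, whiskerLeft_comp, Category.assoc]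
  rw [reassoc_of% i1, reassoc_of% e2, reassoc_of% i2, hl', reassoc_of% i3, reassoc_of% n2]

/-- This is the crossing condition for the free right action, up to associators. The product of `B`
passes through `evR⁻¹` and `evL` by `evR_mul` and `evL_mul`, and the extra factors commute by
`evL_evR`. -/
lemma DualPairing.induced_crossed (l : C ⊗ Y ⟶ Y) (Γ : 𝒞) :
    (cobin Δ[C] (Y ⊗ (B ⊗ (B ⊗ Γ))) ≫ C ◁ (sw C Y (B ⊗ (B ⊗ Γ)) ≫
        Y ◁ (sw C B (B ⊗ Γ) ≫ B ◁ bin p.coregB Γ))) ≫ C ◁ Y ◁ bin μ[B] Γ ≫ p.induced l Γ =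
      (C ◁ (Y ◁ (B ◁ cobin Δ[B] Γ ≫ sw B B (B ⊗ Γ)) ≫ sw Y B (B ⊗ (B ⊗ Γ))) ≫
        bin p.coregC (Y ⊗ (B ⊗ (B ⊗ Γ)))) ≫ p.induced l (B ⊗ Γ) ≫ Y ◁ bin μ[B] Γ := by
  have e1 := p.evR_mul Y Γ
  have e2 := p.evL_mul Y Γ
  have e3 := p.evL_evR Y Γ
  set T := (cobin Δ[C] (Y ⊗ (B ⊗ (B ⊗ Γ))) ≫ C ◁ (sw C Y (B ⊗ (B ⊗ Γ)) ≫
        Y ◁ (sw C B (B ⊗ Γ) ≫ B ◁ bin p.coregB Γ)))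
  set M := (C ◁ (Y ◁ (B ◁ cobin Δ[B] Γ ≫ sw B B (B ⊗ Γ)) ≫ sw Y B (B ⊗ (B ⊗ Γ))) ≫
        bin p.coregC (Y ⊗ (B ⊗ (B ⊗ Γ))))
  have i1 : T ≫ C ◁ Y ◁ bin μ[B] Γ ≫ inv (p.evR Y Γ) =
      inv (p.evR Y (B ⊗ Γ)) ≫ C ◁ Y ◁ bin μ[B] Γ := by
    rw [IsIso.eq_inv_comp, ← Category.assoc, ← Category.assoc, IsIso.comp_inv_eq, e1, Category.assoc]
  have i2 : inv (p.evR Y (B ⊗ Γ)) ≫ M = M ≫ inv (p.evR Y (B ⊗ Γ)) := by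
    rw [IsIso.inv_comp_eq, ← Category.assoc, IsIso.eq_comp_inv, e3]
  have hb : bin l (B ⊗ (B ⊗ Γ)) ≫ Y ◁ bin μ[B] Γ = C ◁ Y ◁ bin μ[B] Γ ≫ bin l (B ⊗ Γ) := by
    simp only [bin, Category.assoc, ← whisker_exchange, associator_inv_naturality_right_assoc]
  simp only [induced, Category.assoc]
  rw [reassoc_of% i1, reassoc_of% e2, reassoc_of% i2, hb]

/-- The left action of `C` on `Y ⊗ B`. -/
def DualPairing.inducedLeft (l : C ⊗ Y ⟶ Y) : C ⊗ (Y ⊗ B) ⟶ Y ⊗ B :=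
  C ◁ Y ◁ (ρ_ B).inv ≫ p.induced l (𝟙_ 𝒞) ≫ Y ◁ (ρ_ B).hom

/-- The right action of `B` on `Y ⊗ B`. -/
def inducedRight (Y B : 𝒞) [HopfObj B] : (Y ⊗ B) ⊗ B ⟶ Y ⊗ B := (α_ Y B B).hom ≫ Y ◁ μ[B]

lemma DualPairing.bin_inducedLeft (l : C ⊗ Y ⟶ Y) (Γ : 𝒞) :
    bin (p.inducedLeft l) Γ = C ◁ (α_ Y B Γ).hom ≫ p.induced l Γ ≫ (α_ Y B Γ).inv := by
  -- An abstract inverse hides its dependence on `Γ`. The explicit one is visibly its value at the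
  -- unit context, whiskered by `Γ`, up to coherence.
  have e : inv (p.evR Y Γ) = p.evRInv Y Γ := by
    rw [IsIso.inv_eq_of_hom_inv_id (p.evR_evRInv Y Γ)]
  have e' : inv (p.evR Y (𝟙_ 𝒞)) = p.evRInv Y (𝟙_ 𝒞) := by
    rw [IsIso.inv_eq_of_hom_inv_id (p.evR_evRInv Y _)]
  simp only [inducedLeft, induced, e, e', evRInv, evL, bin, cobin, una, sw]
  monoidal

lemma bin_inducedRight (Y B Γ : 𝒞) [HopfObj B] :
    bin (inducedRight Y B) Γ = (α_ Y B (B ⊗ Γ)).hom ≫ Y ◁ bin μ[B] Γ ≫ (α_ Y B Γ).inv := by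
  simp only [inducedRight, bin]
  monoidal

/-- The analogue of a Verma module: `B` acts freely, and `C` is moved past `B` by the exchange rule
until it reaches `Y`. These modules are plentiful enough to realise the double bosonisation. -/
theorem DualPairing.isCrossedBimodule_induced (l : C ⊗ Y ⟶ Y) (h₁ : η[C] ▷ Y ≫ l = (λ_ Y).hom)
    (h₂ : μ[C] ▷ Y ≫ l = (α_ C C Y).hom ≫ C ◁ l ≫ l) :
    IsCrossedBimodule p (p.inducedLeft l) (inducedRight Y B) where
  one_left := by
    have := p.induced_one l h₁ (𝟙_ 𝒞)
    rw [inducedLeft, ← whisker_exchange_assoc]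
    have e : η[C] ▷ (Y ⊗ (B ⊗ 𝟙_ 𝒞)) = (λ_ _).hom ≫ conil₁ η[C] (Y ⊗ (B ⊗ 𝟙_ 𝒞)) := by
      simp [conil₁]
    rw [e, Category.assoc, reassoc_of% this]
    monoidal
  mul_left := by
    have := p.induced_mul l h₂ (𝟙_ 𝒞)
    have e : μ[C] ▷ (Y ⊗ (B ⊗ 𝟙_ 𝒞)) = (α_ C C _).hom ≫ bin μ[C] (Y ⊗ (B ⊗ 𝟙_ 𝒞)) := by
      simp [bin]
    simp only [inducedLeft]
    rw [← whisker_exchange_assoc, e, Category.assoc, reassoc_of% this]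
    monoidal
  right_one := by simp [inducedRight, ← whiskerLeft_comp]
  right_mul := by
    have := MonObj.mul_assoc B
    simp only [inducedRight]
    trans (α_ Y B (B ⊗ B)).hom ≫ Y ◁ ((α_ B B B).inv ≫ μ[B] ▷ B ≫ μ[B])
    · rw [this]; simp
    · monoidal
  crossed := by
    rw [crossLeft_eq_evR, crossRight_eq_evL, bin_inducedLeft, bin_inducedRight, evR_tensor,
      evL_tensor, bin_inducedLeft]
    have := p.induced_crossed l (𝟙_ 𝒞)
    simp only [whiskerLeft_comp, Category.assoc] at this
    simp [reassoc_of% this]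

end Induced

/-! ### The coregular and adjoint actions on `B`. -/

section Adjoint
attribute [-simp] Category.comp_id
attribute [local simp] whisk wh_comp wh_wh wh_id bin_wh wh_cobin una_wh nil₂_comp nil₂_wh nil₁_comp
  conil₁_wh conil₂_wh sw_wh bin_sw sw_cobin sw_wh_cobin sw_una sw_wh_una
  sw_sw_sw sw_sw_sw_wh sw_sw_bin sw_sw_bin_wh sw_sw_nil₂ sw_sw_nil₂_wh sw_nil₁ sw_wh_nil₁ wh_sw_nil₂
  wh_comp_wh_sw_nil₂
  wh_conil₁_sw conil₁_sw_comp bin_mul_mul conil₁_one_mul wh_conil₁_one_mul cobin_comul_comul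
  cobin_nil₁ cobin_wh_nil₁ conil₁_comul
  DualPairing.bin_mul_nil₂ DualPairing.wh_mul_nil₂ DualPairing.wh_comp_mul_nil₂
  DualPairing.wh_comp_wh_mul_nil₂ DualPairing.conil₁_nil₂
  DualPairing.wh_conil₁_nil₂

variable {𝒞 : Type w} [Category.{v} 𝒞] [MonoidalCategory 𝒞] [BraidedCategory 𝒞]
variable {Γ W Q C B X Y Z V V' W' : 𝒞} 

lemma wh_comp_conil₁_sw (S : 𝒞) (f : 𝟙_ 𝒞 ⟶ X) (a : Q ⟶ Γ) (k : X ⊗ (S ⊗ Γ) ⟶ W) :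
    wh S (a ≫ conil₁ f Γ ≫ 𝟙 _) (sw S X Γ ≫ k) = wh S (a ≫ 𝟙 _) (conil₁ f (S ⊗ Γ) ≫ k) := by
  rw [← wh_conil₁_sw]; simp [wh, -whisk]

lemma sw_comp_una (S) (f : X ⟶ Y) (g : S ⊗ Γ ⟶ Q) (k : Y ⊗ Q ⟶ W) :
    sw S X Γ ≫ wh X g (una f Q ≫ k) = wh S (una f Γ ≫ 𝟙 _) (sw S Y Γ ≫ wh Y g k) := by
  rw [← una_wh, sw_una]

lemma sw_bin_over_comp_wh {Q'} (S) (f : X ⊗ Y ⟶ Z) (b : Q' ⟶ X ⊗ Q) (a : Q ⟶ Y ⊗ Γ) (k : Z ⊗ (S ⊗ Γ) ⟶ W) :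
    wh S (b ≫ wh X a (bin f Γ ≫ 𝟙 _)) (sw S Z Γ ≫ k) =
      wh S (b ≫ wh X a (𝟙 _)) (sw S X (Y ⊗ Γ) ≫ wh X (sw S Y Γ ≫ 𝟙 _) (bin f (S ⊗ Γ) ≫ k)) := by
  rw [← sw_bin_over]; simp [wh, -whisk]

lemma bin_tensorLeftAct [ComonObj C] (l : C ⊗ V ⟶ V') (l' : C ⊗ W ⟶ W') (Γ : 𝒞) :
    C ◁ (α_ V W Γ).inv ≫ bin (tensorLeftAct l l') Γ = cobin Δ[C] (V ⊗ (W ⊗ Γ)) ≫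
      C ◁ sw C V (W ⊗ Γ) ≫ C ◁ V ◁ bin l' Γ ≫ bin l (W' ⊗ Γ) ≫ (α_ V' W' Γ).inv := by
  simp only [tensorLeftAct, tensorμ, MonoidalCategory.tensorHom_def', bin, cobin, sw]; monoidal

lemma bin_tensorRightAct [ComonObj B] (r : V ⊗ B ⟶ V') (r' : W ⊗ B ⟶ W') (Γ : 𝒞) :
    (α_ V W (B ⊗ Γ)).inv ≫ bin (tensorRightAct r r') Γ = V ◁ W ◁ cobin Δ[B] Γ ≫
      V ◁ sw W B (B ⊗ Γ) ≫ V ◁ B ◁ bin r' Γ ≫ bin r (W' ⊗ Γ) ≫ (α_ V' W' Γ).inv := by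
  simp only [tensorRightAct, tensorμ, MonoidalCategory.tensorHom_def', bin, cobin, sw]; monoidal

variable [HopfObj C] [HopfObj B] (p : DualPairing C B)

/-- In the convolution algebra of forms on `C ⊗ B`, with product `f(c₂, b₁) g(c₁, b₂)` up to
braiding, `ev ∘ S_C` is a left inverse of `ev` and `ev ∘ S_B` is a right inverse, so the two agree.
-/
lemma DualPairing.antipode_ev : 𝒮[C] ▷ B ≫ p.ev = C ◁ 𝒮[B] ≫ p.ev := by
  apply eq_of_bin
  have h1 (Γ) : cobin Δ[C] (B ⊗ Γ) ≫ wh C (una 𝒮[C] (B ⊗ Γ) ≫ wh C (cobin Δ[B] Γ ≫ 𝟙 _) (nil₂ p.ev (B ⊗ Γ) ≫ 𝟙 _)) (nil₂ p.ev Γ ≫ 𝟙 _) =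
      nil₁ ε[C] (B ⊗ Γ) ≫ nil₁ ε[B] Γ ≫ 𝟙 _ := by
    trans cobin Δ[C] (B ⊗ Γ) ≫ wh C (una 𝒮[C] _ ≫ 𝟙 _) (bin μ[C] (B ⊗ Γ) ≫ nil₂ p.ev Γ ≫ 𝟙 _)
    · simp
    · rw [cobin_antipode_right, p.conil₁_nil₂]
  have h2 (Γ) : wh C (cobin Δ[B] Γ ≫ wh B (una 𝒮[B] Γ ≫ 𝟙 _) (𝟙 _)) (cobin Δ[C] (B ⊗ (B ⊗ Γ)) ≫ wh C (nil₂ p.ev (B ⊗ Γ) ≫ 𝟙 _) (nil₂ p.ev Γ ≫ 𝟙 _)) =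
      nil₁ ε[C] (B ⊗ Γ) ≫ nil₁ ε[B] Γ ≫ 𝟙 _ := by
    trans wh C (cobin Δ[B] Γ ≫ wh B (una 𝒮[B] Γ ≫ 𝟙 _) (bin μ[B] Γ ≫ 𝟙 _)) (nil₂ p.ev Γ ≫ 𝟙 _)
    · simp
    · rw [cobin_antipode_right]
      trans wh C (nil₁ ε[B] Γ ≫ 𝟙 _) (wh C (conil₁ η[B] Γ ≫ 𝟙 _) (nil₂ p.ev Γ ≫ 𝟙 _))
      · simp [-wh_conil₁_nil₂]
      · rw [p.wh_conil₁_nil₂, nil₁_comp]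
  have e := h1 (B ⊗ 𝟙_ 𝒞)
  have e' := h2 (𝟙_ 𝒞)
  apply eq_of_comp_id
  suffices una 𝒮[C] _ ≫ nil₂ p.ev (𝟙_ 𝒞) ≫ 𝟙 _ = wh C (una 𝒮[B] _ ≫ 𝟙 _) (nil₂ p.ev (𝟙_ 𝒞) ≫ 𝟙 _) by
    rw [← cancel_mono (λ_ (𝟙_ 𝒞)).hom]
    simpa [una, nil₂, bin, wh, -whisk, Category.comp_id] using this
  trans cobin Δ[C] (B ⊗ 𝟙_ 𝒞) ≫ wh C (una 𝒮[C] _ ≫ wh C (cobin Δ[B] (𝟙_ 𝒞) ≫ 𝟙 _)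
    (nil₂ p.ev (B ⊗ 𝟙_ 𝒞) ≫ 𝟙 _)) (nil₁ ε[C] (B ⊗ 𝟙_ 𝒞) ≫ nil₁ ε[B] (𝟙_ 𝒞) ≫ 𝟙 _)
  · have (g : C ⊗ (B ⊗ 𝟙_ 𝒞) ⟶ B ⊗ 𝟙_ 𝒞) : cobin Δ[C] (B ⊗ 𝟙_ 𝒞) ≫ wh C g
        (nil₁ ε[C] (B ⊗ 𝟙_ 𝒞) ≫ nil₁ ε[B] (𝟙_ 𝒞) ≫ 𝟙 _) = g ≫ nil₁ ε[B] (𝟙_ 𝒞) ≫ 𝟙 _ := by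
      have := nil₁_comp ε[C] g (nil₁ ε[B] (𝟙_ 𝒞) ≫ 𝟙 _)
      rw [show g ≫ 𝟙 _ = g from Category.comp_id g] at this
      rw [← this, cobin_nil₁]
    rw [this]
    simp
  trans cobin Δ[C] (B ⊗ 𝟙_ 𝒞) ≫ wh C (wh C (cobin Δ[B] (𝟙_ 𝒞) ≫ wh B (una 𝒮[B] _ ≫ 𝟙 _) (𝟙 _))
    (nil₁ ε[C] (B ⊗ B ⊗ 𝟙_ 𝒞) ≫ nil₁ ε[B] (B ⊗ 𝟙_ 𝒞) ≫ 𝟙 _)) (nil₂ p.ev (𝟙_ 𝒞) ≫ 𝟙 _)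
  -- Expanding the counits turns both sides into the triple convolution product of `ev ∘ S_C`, `ev`
  -- and `ev ∘ S_B`.
  · rw [← e, ← e']
    simp
  · have (g : B ⊗ 𝟙_ 𝒞 ⟶ B ⊗ (B ⊗ 𝟙_ 𝒞)) : wh C g
        (nil₁ ε[C] (B ⊗ B ⊗ 𝟙_ 𝒞) ≫ nil₁ ε[B] (B ⊗ 𝟙_ 𝒞) ≫ 𝟙 _) =
          nil₁ ε[C] (B ⊗ 𝟙_ 𝒞) ≫ g ≫ nil₁ ε[B] (B ⊗ 𝟙_ 𝒞) ≫ 𝟙 _ := by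
      have := nil₁_comp ε[C] g (nil₁ ε[B] (B ⊗ 𝟙_ 𝒞) ≫ 𝟙 _)
      rw [show g ≫ 𝟙 _ = g from Category.comp_id g] at this
      rw [← this]
    rw [this, cobin_wh_nil₁]
    have h (g : B ⊗ 𝟙_ 𝒞 ⟶ B ⊗ 𝟙_ 𝒞) : cobin Δ[B] (𝟙_ 𝒞) ≫ wh B g
        (nil₁ ε[B] (B ⊗ 𝟙_ 𝒞) ≫ 𝟙 _) = g := by
      have := nil₁_comp ε[B] g (𝟙 _)
      rw [show g ≫ 𝟙 _ = g from Category.comp_id g] at this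
      rw [← this, cobin_nil₁]
    simp only [Category.assoc, wh_comp, Category.id_comp, h]

variable [IsIso 𝒮[C]]

lemma bin_leftCoregular (k : B ⊗ Γ ⟶ W) : bin (leftCoregular p) Γ ≫ k =
    una (inv 𝒮[C]) (B ⊗ Γ) ≫ bin p.coregB Γ ≫ k := by
  simp only [bin, leftCoregular, una, DualPairing.coregB, MonoidalCategory.tensorHom_def]; monoidal

lemma bin_rightAdjoint (k : B ⊗ Γ ⟶ W) : bin (rightAdjoint B) Γ ≫ k =
    wh B (cobin Δ[B] Γ ≫ una 𝒮[B] (B ⊗ Γ) ≫ 𝟙 _) (sw B B (B ⊗ Γ) ≫ bin μ[B] (B ⊗ Γ) ≫ bin μ[B] Γ ≫ k) := by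
  simp only [bin, rightAdjoint, una, cobin, sw, wh]; monoidal

lemma cobin_inv_antipode (k : C ⊗ (C ⊗ Γ) ⟶ W) : una (inv 𝒮[C]) Γ ≫ cobin Δ[C] Γ ≫ k =
    cobin Δ[C] Γ ≫ swi C C Γ ≫ una (inv 𝒮[C]) (C ⊗ Γ) ≫ wh C (una (inv 𝒮[C]) Γ ≫ 𝟙 _) k := by
  trans (inv 𝒮[C] ≫ Δ[C]) ▷ Γ ≫ (α_ C C Γ).hom ≫ k
  · simp only [una, cobin]; monoidal
  · rw [inv_antipode_comul, MonoidalCategory.tensorHom_def]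
    simp only [una, cobin, swi, wh]; monoidal

lemma bin_mul_inv_antipode (k : C ⊗ Γ ⟶ W) : bin μ[C] Γ ≫ una (inv 𝒮[C]) Γ ≫ k =
    una (inv 𝒮[C]) (C ⊗ Γ) ≫ wh C (una (inv 𝒮[C]) Γ ≫ 𝟙 _) (swi C C Γ ≫ bin μ[C] Γ ≫ k) := by
  trans (α_ C C Γ).inv ≫ (μ[C] ≫ inv 𝒮[C]) ▷ Γ ≫ k
  · simp only [una, bin]; monoidal
  · rw [mul_inv_antipode, MonoidalCategory.tensorHom_def]
    simp only [una, bin, swi, wh]; monoidal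

/-- The inverse antipode reverses products, which turns the action `coregB` of the opposite algebra
into a left action of `C`. -/
lemma leftCoregular_mul_left (k : B ⊗ Γ ⟶ W) : bin μ[C] (B ⊗ Γ) ≫ bin (leftCoregular p) Γ ≫ k =
    wh C (bin (leftCoregular p) Γ ≫ 𝟙 _) (bin (leftCoregular p) Γ ≫ k) := by
  simp only [bin_leftCoregular]
  rw [bin_mul_inv_antipode, ← p.coregB_coregB]
  simp

lemma leftCoregular_one_left (k : B ⊗ Γ ⟶ W) : conil₁ η[C] (B ⊗ Γ) ≫ bin (leftCoregular p) Γ ≫ k = k := by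
  have h : η[C] ≫ inv 𝒮[C] = η[C] := by rw [IsIso.comp_inv_eq, HopfObj.one_antipode]
  have e (k : C ⊗ (B ⊗ Γ) ⟶ W) : conil₁ η[C] (B ⊗ Γ) ≫ una (inv 𝒮[C]) (B ⊗ Γ) ≫ k = conil₁ η[C] (B ⊗ Γ) ≫ k := by
    simp only [conil₁, una, Category.assoc, ← comp_whiskerRight_assoc, h]
  simp only [bin_leftCoregular, e]
  simp only [DualPairing.bin_coregB]; simp

/-- The inverse antipode also reverses the coproduct through the inverse braiding, so the Leibniz
rule of `coregB` becomes that of the braided tensor product action. -/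
lemma leftCoregular_mul (k : B ⊗ Γ ⟶ W) : wh C (bin μ[B] Γ ≫ 𝟙 _) (bin (leftCoregular p) Γ ≫ k) =
    cobin Δ[C] (B ⊗ (B ⊗ Γ)) ≫ wh C (sw C B (B ⊗ Γ) ≫ wh B (bin (leftCoregular p) Γ ≫ 𝟙 _) (𝟙 _))
      (bin (leftCoregular p) (B ⊗ Γ) ≫ bin μ[B] Γ ≫ k) := by
  have e : wh C (bin μ[B] Γ ≫ 𝟙 _) (una (inv 𝒮[C]) (B ⊗ Γ) ≫ bin p.coregB Γ ≫ k) =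
      una (inv 𝒮[C]) (B ⊗ (B ⊗ Γ)) ≫ wh C (bin μ[B] Γ ≫ 𝟙 _) (bin p.coregB Γ ≫ k) := by
    simp
  simp only [bin_leftCoregular, e]
  rw [p.coregB_mul, cobin_inv_antipode]
  trans cobin Δ[C] (B ⊗ (B ⊗ Γ)) ≫ swi C C (B ⊗ (B ⊗ Γ)) ≫
    wh C (bin (leftCoregular p) (B ⊗ Γ) ≫ 𝟙 _) (sw C B (B ⊗ Γ) ≫
      wh B (bin (leftCoregular p) Γ ≫ 𝟙 _) (bin μ[B] Γ ≫ k))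
  · simp [bin_leftCoregular]
  · rw [sw_bin_over, swi_sw]
    simp [bin_leftCoregular, -sw_sw_bin, -sw_sw_bin_wh]

lemma rightAdjoint_one (k : B ⊗ Γ ⟶ W) : wh B (conil₁ η[B] Γ ≫ 𝟙 _) (bin (rightAdjoint B) Γ ≫ k) = k := by
  have h : η[B] ≫ 𝒮[B] = η[B] := HopfObj.one_antipode B
  have e {Γ W} (k : B ⊗ Γ ⟶ W) : conil₁ η[B] (Γ) ≫ una 𝒮[B] (Γ) ≫ k = conil₁ η[B] (Γ) ≫ k := by
    simp only [conil₁, una, Category.assoc, ← comp_whiskerRight_assoc, h]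
  simp only [bin_rightAdjoint]
  simp [e, wh_comp_conil₁_sw]

lemma rightAdjoint_mul_right (k : B ⊗ Γ ⟶ W) : wh B (bin μ[B] Γ ≫ 𝟙 _) (bin (rightAdjoint B) Γ ≫ k) =
    bin (rightAdjoint B) (B ⊗ Γ) ≫ bin (rightAdjoint B) Γ ≫ k := by
  trans wh B (wh B (cobin Δ[B] Γ ≫ 𝟙 _) (cobin Δ[B] _ ≫ wh B (sw B B _ ≫ wh B (bin μ[B] Γ ≫ 𝟙 _) (𝟙 _))
      (una 𝒮[B] _ ≫ wh B (una 𝒮[B] _ ≫ 𝟙 _) (sw B B _ ≫ 𝟙 _))))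
    (wh B (bin μ[B] (B ⊗ Γ) ≫ 𝟙 _) (sw B B (B ⊗ Γ) ≫ bin μ[B] _ ≫ bin μ[B] _ ≫ k))
  · simp only [bin_rightAdjoint]
    simp [bin_mul_comul, bin_mul_antipode]
  · rw [sw_bin_over]
    simp only [bin_rightAdjoint]
    simp [-sw_sw_bin, -sw_sw_bin_wh, sw_bin_over, sw_bin_over_comp_wh, sw_comp_una]

/-- Multiplying `v ◁ b₂ = (S b₂) v b₃` by `b₁` on the left and cancelling `b₁ (S b₂)` leaves `v b`.
This is the commutation rule between `v` and `b` that the adjoint action encodes. -/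
lemma mul_rightAdjoint (k : B ⊗ Γ ⟶ W) :
    wh B (cobin Δ[B] Γ ≫ 𝟙 _) (sw B B (B ⊗ Γ) ≫ wh B (bin (rightAdjoint B) Γ ≫ 𝟙 _) (bin μ[B] Γ ≫ k)) =
      bin μ[B] Γ ≫ k := by
  trans wh B (cobin Δ[B] Γ ≫ cobin Δ[B] (B ⊗ Γ) ≫ wh B (una 𝒮[B] _ ≫ 𝟙 _) (bin μ[B] (B ⊗ Γ) ≫ 𝟙 _))
    (sw B B (B ⊗ Γ) ≫ wh B (bin μ[B] Γ ≫ 𝟙 _) (bin μ[B] Γ ≫ k))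
  · simp only [bin_rightAdjoint]
    simp [-sw_sw_bin, -sw_sw_bin_wh, sw_bin_over, sw_bin_over_comp_wh]
  · rw [cobin_antipode_right, cobin_nil₁, wh_conil₁_sw, conil₁_wh, conil₁_one_mul]
    simp

/-- Up to braidings, `(v w) ◁ b = (S b₁) v w b₂`, and `w b₂ = b₂ (w ◁ b₃)` by `mul_rightAdjoint`. -/
lemma rightAdjoint_mul (k : B ⊗ Γ ⟶ W) : bin μ[B] (B ⊗ Γ) ≫ bin (rightAdjoint B) Γ ≫ k =
    wh B (wh B (cobin Δ[B] Γ ≫ 𝟙 _) (sw B B (B ⊗ Γ) ≫ wh B (bin (rightAdjoint B) Γ ≫ 𝟙 _) (𝟙 _)))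
      (bin (rightAdjoint B) (B ⊗ Γ) ≫ bin μ[B] Γ ≫ k) := by
  trans wh B (wh B (cobin Δ[B] Γ ≫ una 𝒮[B] _ ≫ 𝟙 _) (sw B B (B ⊗ Γ) ≫ 𝟙 _)) (sw B B _ ≫
    bin μ[B] _ ≫ wh B (wh B (cobin Δ[B] Γ ≫ 𝟙 _) (sw B B (B ⊗ Γ) ≫
      wh B (bin (rightAdjoint B) Γ ≫ 𝟙 _) (bin μ[B] Γ ≫ 𝟙 _))) (bin μ[B] Γ ≫ k))
  · rw [mul_rightAdjoint]
    simp only [bin_rightAdjoint]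
    simp
  · simp only [bin_rightAdjoint (W := W)]
    simp [sw_comp_una]

/-- The antipode reverses the coproduct of `b`, and the inverse antipode on `c` cancels against the
antipode on the paired leg by `antipode_ev`. Thus `c` is simply paired with `b₁`. -/
lemma leftCoregular_antipode (k : B ⊗ Γ ⟶ W) :
    wh C (una 𝒮[B] Γ ≫ 𝟙 _) (bin (leftCoregular p) Γ ≫ k) =
      wh C (cobin Δ[B] Γ ≫ 𝟙 _) (nil₂ p.ev (B ⊗ Γ) ≫ una 𝒮[B] Γ ≫ k) := by
  have h {Γ W} (k : Γ ⟶ W) : una (inv 𝒮[C]) (B ⊗ Γ) ≫ wh C (una 𝒮[B] Γ ≫ 𝟙 _) (nil₂ p.ev Γ ≫ k) =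
      nil₂ p.ev Γ ≫ k := by
    trans (α_ C B Γ).inv ≫ (inv 𝒮[C] ▷ B ≫ C ◁ 𝒮[B] ≫ p.ev) ▷ Γ ≫ (λ_ _).hom ≫ k
    · simp only [una, wh, nil₂, bin]; monoidal
    · rw [← p.antipode_ev, ← comp_whiskerRight_assoc]
      simp [nil₂, bin]
  trans wh C (cobin Δ[B] Γ ≫ sw B B Γ ≫ una 𝒮[B] _ ≫ 𝟙 _) (sw C B (B ⊗ Γ) ≫
    wh B (una (inv 𝒮[C]) (B ⊗ Γ) ≫ wh C (una 𝒮[B] Γ ≫ 𝟙 _) (nil₂ p.ev Γ ≫ 𝟙 _)) k)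
  · simp only [bin_leftCoregular, p.bin_coregB]
    simp [una_antipode_comul]
  · rw [h]
    simp

lemma leftCoregular_skew (k : B ⊗ Γ ⟶ W) :
    cobin Δ[C] (B ⊗ Γ) ≫ wh C (bin p.coregB Γ ≫ 𝟙 _) (bin (leftCoregular p) Γ ≫ k) =
      nil₁ ε[C] _ ≫ k := by
  rw [← p.coregB_skew_left, bin_leftCoregular]; simp

/-- The crossing condition, from the Leibniz rule applied to `(S b₁) v b₂`. On `b₂` the action of
`C` undoes the coregular action that `evR` put there, and on `S b₁` it becomes the pairing with the
first leg of `b` that `evL` requires. -/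
lemma leftCoregular_rightAdjoint (k : B ⊗ Γ ⟶ W) :
    p.evR B Γ ≫ wh C (bin (rightAdjoint B) Γ ≫ 𝟙 _) (bin (leftCoregular p) Γ ≫ k) =
      p.evL B Γ ≫ bin (leftCoregular p) (B ⊗ Γ) ≫ bin (rightAdjoint B) Γ ≫ k := by
  -- The Leibniz rule is used once, splitting `(S b₁) v` from `b₂`. The two actions of `C` on `b₂`
  -- are then adjacent.
  trans wh C (wh B (cobin Δ[B] Γ ≫ una 𝒮[B] _ ≫ 𝟙 _) (sw B B (B ⊗ Γ) ≫ 𝟙 _))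
    (cobin Δ[C] _ ≫ wh C (sw C B _ ≫ wh B (sw C B _ ≫ wh B (cobin Δ[C] (B ⊗ Γ) ≫
      wh C (bin p.coregB Γ ≫ 𝟙 _) (bin (leftCoregular p) Γ ≫ 𝟙 _)) (𝟙 _)) (bin μ[B] _ ≫ 𝟙 _))
        (bin (leftCoregular p) _ ≫ bin μ[B] _ ≫ k))
  · trans cobin Δ[C] (B ⊗ (B ⊗ Γ)) ≫ wh C (sw C B (B ⊗ Γ) ≫ wh B (wh C (cobin Δ[B] Γ ≫ 𝟙 _)
        (sw C B (B ⊗ Γ) ≫ wh B (bin p.coregB Γ ≫ 𝟙 _) (una 𝒮[B] _ ≫ 𝟙 _))) (sw B B (B ⊗ Γ) ≫ bin μ[B] _ ≫ 𝟙 _))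
        (wh C (bin μ[B] Γ ≫ 𝟙 _) (bin (leftCoregular p) Γ ≫ k))
    · simp only [bin_rightAdjoint]
      simp [DualPairing.evR, p.coregB_comul, sw_comp_una, -sw_sw_bin, -sw_sw_bin_wh]
    · rw [leftCoregular_mul]
      simp [sw_comp_una]
  -- The two actions on `b₂` cancel, leaving `C` to act on `(S b₁) v` alone.
  · rw [leftCoregular_skew]
    trans wh C (wh B (cobin Δ[B] Γ ≫ una 𝒮[B] _ ≫ 𝟙 _) (sw B B (B ⊗ Γ) ≫ 𝟙 _))
      (wh C (bin μ[B] _ ≫ 𝟙 _) (bin (leftCoregular p) (B ⊗ Γ) ≫ bin μ[B] _ ≫ k))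
    · rw [sw_wh_nil₁, wh_id, sw_wh_nil₁, wh_id, cobin_wh_nil₁]
    · rw [leftCoregular_mul]
      trans wh C (wh B (cobin Δ[B] Γ ≫ 𝟙 _) (sw B B (B ⊗ Γ) ≫ 𝟙 _))
        (cobin Δ[C] _ ≫ wh C (sw C B _ ≫ wh B (bin (leftCoregular p) _ ≫ 𝟙 _) (𝟙 _)) (wh C (una 𝒮[B] _ ≫ 𝟙 _)
          (bin (leftCoregular p) _ ≫ bin μ[B] _ ≫ bin μ[B] _ ≫ k)))
      · simp [-sw_sw_bin, -sw_sw_bin_wh, sw_comp_una]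
      -- After the second use of the Leibniz rule `C` acts on `S b₁`, which gives the pairing in
      -- `evL`.
      · rw [leftCoregular_antipode]
        simp only [bin_rightAdjoint]
        simp [DualPairing.evL, p.bin_coregC, sw_comp_una]

lemma leftCoregular_one (k : B ⊗ Γ ⟶ W) :
    wh C (conil₁ η[B] Γ ≫ 𝟙 _) (bin (leftCoregular p) Γ ≫ k) = nil₁ ε[C] Γ ≫ conil₁ η[B] Γ ≫ k := by
  have h : inv 𝒮[C] ≫ ε[C] = ε[C] := by rw [IsIso.inv_comp_eq, HopfObj.antipode_counit]
  have e {Γ W} (k : Γ ⟶ W) : una (inv 𝒮[C]) Γ ≫ nil₁ ε[C] Γ ≫ k = nil₁ ε[C] Γ ≫ k := by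
    simp only [nil₁, una, Category.assoc, ← comp_whiskerRight_assoc, h]
  trans una (inv 𝒮[C]) _ ≫ wh C (conil₁ η[B] Γ ≫ conil₁ η[B] _ ≫ 𝟙 _) (sw C B (B ⊗ Γ) ≫
    wh B (nil₂ p.ev Γ ≫ 𝟙 _) k)
  · simp only [bin_leftCoregular, p.bin_coregB]
    simp
  · rw [wh_comp_conil₁_sw]
    trans una (inv 𝒮[C]) _ ≫ wh C (conil₁ η[B] Γ ≫ 𝟙 _) (wh C (conil₁ η[B] _ ≫ 𝟙 _) (nil₂ p.ev _ ≫ k))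
    · simp [-DualPairing.wh_conil₁_nil₂]
    · rw [p.wh_conil₁_nil₂]
      simp [e]

lemma one_rightAdjoint (k : B ⊗ Γ ⟶ W) :
    conil₁ η[B] (B ⊗ Γ) ≫ bin (rightAdjoint B) Γ ≫ k = nil₁ ε[B] Γ ≫ conil₁ η[B] Γ ≫ k := by
  trans conil₁ η[B] (B ⊗ Γ) ≫ wh B (cobin Δ[B] Γ ≫ una 𝒮[B] (B ⊗ Γ) ≫ 𝟙 _) (sw B B (B ⊗ Γ) ≫
    wh B (bin μ[B] Γ ≫ 𝟙 _) (bin μ[B] Γ ≫ k))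
  · simp only [bin_rightAdjoint, bin_mul_mul]
  · trans cobin Δ[B] Γ ≫ una 𝒮[B] (B ⊗ Γ) ≫ bin μ[B] Γ ≫ k
    · simp
    · rw [cobin_antipode_left]

end Adjoint

/-! ### `B` as an algebra in the category of crossed bimodules. -/

section Part
variable {𝒞 : Type w} [Category.{v} 𝒞] [MonoidalCategory 𝒞] [BraidedCategory 𝒞]
variable {C B : 𝒞} [HopfObj C] [HopfObj B] (p : DualPairing C B) [IsIso 𝒮[C]]

theorem isCrossedBimodule_coregular_adjoint :
    IsCrossedBimodule p (leftCoregular p) (rightAdjoint B) where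
  one_left := by
    trans (λ_ B).hom ≫ (ρ_ B).inv ≫
      (conil₁ η[C] (B ⊗ 𝟙_ 𝒞) ≫ bin (leftCoregular p) (𝟙_ 𝒞) ≫ 𝟙 _) ≫ (ρ_ B).hom
    · simp only [conil₁, bin]; monoidal
    · rw [leftCoregular_one_left]; simp
  mul_left := by
    trans (α_ C C B).hom ≫ C ◁ C ◁ (ρ_ B).inv ≫
      (bin μ[C] (B ⊗ 𝟙_ 𝒞) ≫ bin (leftCoregular p) (𝟙_ 𝒞) ≫ 𝟙 _) ≫ (ρ_ B).hom
    · simp only [bin]; monoidal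
    · rw [leftCoregular_mul_left]; simp only [bin, wh]; monoidal
  right_one := by
    trans wh B (conil₁ η[B] (𝟙_ 𝒞) ≫ 𝟙 _) (bin (rightAdjoint B) (𝟙_ 𝒞) ≫ 𝟙 _) ≫ (ρ_ B).hom
    · simp only [conil₁, bin, wh]; monoidal
    · rw [rightAdjoint_one]; simp
  right_mul := by
    trans B ◁ B ◁ (ρ_ B).inv ≫
      wh B (bin μ[B] (𝟙_ 𝒞) ≫ 𝟙 _) (bin (rightAdjoint B) (𝟙_ 𝒞) ≫ 𝟙 _) ≫ (ρ_ B).hom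
    · simp only [bin, wh]; monoidal
    · rw [rightAdjoint_mul_right]; simp only [bin]; monoidal
  crossed := by
    have := leftCoregular_rightAdjoint p (𝟙 (B ⊗ 𝟙_ 𝒞))
    simp only [wh, Category.comp_id] at this
    rw [crossLeft_eq_evR, crossRight_eq_evL, reassoc_of% this]

lemma leftCoregular_mul_hom : tensorLeftAct (leftCoregular p) (leftCoregular p) ≫ μ[B] =
    C ◁ μ[B] ≫ leftCoregular p := by
  have h1 := bin_tensorLeftAct (leftCoregular p) (leftCoregular p) (𝟙_ 𝒞)
  have h2 := leftCoregular_mul p (𝟙 (B ⊗ 𝟙_ 𝒞))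
  simp only [wh, Category.comp_id, whiskerLeft_comp, Category.assoc] at h2
  have h3 := h1 =≫ una μ[B] (𝟙_ 𝒞)
  have e : (α_ B B (𝟙_ 𝒞)).inv ≫ una μ[B] (𝟙_ 𝒞) = bin μ[B] (𝟙_ 𝒞) := rfl
  simp only [Category.assoc, e] at h3
  rw [← h2, ← una_bin] at h3
  apply eq_of_bin
  rw [← cancel_epi (C ◁ (α_ B B (𝟙_ 𝒞)).inv), h3]
  simp only [bin]; monoidal

lemma rightAdjoint_mul_hom : tensorRightAct (rightAdjoint B) (rightAdjoint B) ≫ μ[B] =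
    μ[B] ▷ B ≫ rightAdjoint B := by
  have h1 := bin_tensorRightAct (rightAdjoint B) (rightAdjoint B) (𝟙_ 𝒞)
  have h2 := rightAdjoint_mul (𝟙 (B ⊗ 𝟙_ 𝒞))
  simp only [wh, Category.comp_id, whiskerLeft_comp, Category.assoc] at h2
  have h3 := h1 =≫ una μ[B] (𝟙_ 𝒞)
  have e : (α_ B B (𝟙_ 𝒞)).inv ≫ una μ[B] (𝟙_ 𝒞) = bin μ[B] (𝟙_ 𝒞) := rfl
  simp only [Category.assoc, e] at h3
  rw [← h2, ← una_bin] at h3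
  apply eq_of_bin
  rw [← cancel_epi (α_ B B (B ⊗ 𝟙_ 𝒞)).inv, h3]
  simp only [bin]; monoidal

lemma leftCoregular_one_hom : ((ρ_ C).hom ≫ ε[C]) ≫ η[B] = C ◁ η[B] ≫ leftCoregular p := by
  symm
  trans wh C (conil₁ η[B] (𝟙_ 𝒞) ≫ 𝟙 _) (bin (leftCoregular p) (𝟙_ 𝒞) ≫ 𝟙 _) ≫ (ρ_ B).hom
  · simp only [conil₁, bin, wh]; monoidal
  · rw [leftCoregular_one]; simp only [conil₁, nil₁]; monoidal

lemma rightAdjoint_one_hom : ((λ_ B).hom ≫ ε[B]) ≫ η[B] = η[B] ▷ B ≫ rightAdjoint B := by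
  symm
  trans (λ_ B).hom ≫ (ρ_ B).inv ≫
    (conil₁ η[B] (B ⊗ 𝟙_ 𝒞) ≫ bin (rightAdjoint B) (𝟙_ 𝒞) ≫ 𝟙 _) ≫ (ρ_ B).hom
  · simp only [conil₁, bin]; monoidal
  · rw [one_rightAdjoint]; simp only [conil₁, nil₁]; monoidal

/-- `B` as an algebra in the category of crossed bimodules. -/
def coregularMon : MonObj (CrossedBimodule.mk B (leftCoregular p) (rightAdjoint B)
    (isCrossedBimodule_coregular_adjoint p)) where
  one := ⟨η[B], leftCoregular_one_hom p, rightAdjoint_one_hom⟩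
  mul := ⟨μ[B], leftCoregular_mul_hom p, rightAdjoint_mul_hom⟩
  one_mul := by
    apply CrossedBimodule.hom_ext
    change (η[B] ⊗ₘ 𝟙 B) ≫ μ[B] = (λ_ B).hom
    simp
  mul_one := by
    apply CrossedBimodule.hom_ext
    change (𝟙 B ⊗ₘ η[B]) ≫ μ[B] = (ρ_ B).hom
    simp
  mul_assoc := by
    apply CrossedBimodule.hom_ext
    change (μ[B] ⊗ₘ 𝟙 B) ≫ μ[B] = (α_ B B B).hom ≫ (𝟙 B ⊗ₘ μ[B]) ≫ μ[B]
    simp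

end Part

/-! ### The coevaluation, and the twist that it defines. -/

section Rigid
attribute [-simp] Category.comp_id
attribute [local simp] whisk wh_comp wh_wh wh_id bin_wh wh_cobin una_wh nil₂_comp nil₂_wh nil₁_comp
  conil₁_wh conil₂_wh sw_wh bin_sw sw_cobin sw_wh_cobin sw_una sw_wh_una
  sw_sw_sw sw_sw_sw_wh sw_sw_bin sw_sw_bin_wh sw_sw_nil₂ sw_sw_nil₂_wh sw_nil₁ sw_wh_nil₁ wh_sw_nil₂
  wh_comp_wh_sw_nil₂
  wh_conil₁_sw conil₁_sw_comp bin_mul_mul conil₁_one_mul wh_conil₁_one_mul cobin_comul_comul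
  cobin_nil₁ cobin_wh_nil₁ conil₁_comul
  DualPairing.bin_mul_nil₂ DualPairing.wh_mul_nil₂ DualPairing.wh_comp_mul_nil₂
  DualPairing.wh_comp_wh_mul_nil₂ DualPairing.conil₁_nil₂
  DualPairing.wh_conil₁_nil₂

variable {𝒞 : Type w} [Category.{v} 𝒞] [MonoidalCategory 𝒞] [BraidedCategory 𝒞]
variable {Γ W W' Q C B X Y Z V V' : 𝒞} 

lemma wh_conil₂_sw (S : 𝒞) (f : 𝟙_ 𝒞 ⟶ X ⊗ Y) (h : Y ⊗ (S ⊗ Γ) ⟶ Q) (k : X ⊗ Q ⟶ W) :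
    wh S (conil₂ f Γ ≫ 𝟙 _) (sw S X (Y ⊗ Γ) ≫ wh X (sw S Y Γ ≫ h) k) = conil₂ f (S ⊗ Γ) ≫ wh X h k := by
  rw [← whisker_conil₂]; simp [wh, -whisk]

lemma conil₂_sw_sw (S : 𝒞) (f : 𝟙_ 𝒞 ⟶ X ⊗ Y) (k : S ⊗ (X ⊗ (Y ⊗ Γ)) ⟶ W) :
    conil₂ f (S ⊗ Γ) ≫ wh X (sw Y S Γ ≫ 𝟙 _) (sw X S (Y ⊗ Γ) ≫ k) = wh S (conil₂ f Γ ≫ 𝟙 _) k := by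
  simp only [wh, Category.comp_id, ← conil₂_under, Category.assoc]

section pairing
variable [HopfObj C] [HopfObj B] (p : DualPairing C B) (E : ExactPairing B C) 

section
variable (hE : E.evaluation' = p.ev)
include hE

lemma zig_left {h : Γ ⟶ Q} (k : B ⊗ Q ⟶ W) :
    conil₂ E.coevaluation' (B ⊗ Γ) ≫ wh B (nil₂ p.ev Γ ≫ h) k = wh B h k := by
  have := E.evaluation_coevaluation'
  rw [hE] at this
  trans (λ_ _).inv ≫ (α_ _ _ _).inv ≫ (E.coevaluation' ▷ B ≫ (α_ B C B).hom ≫ B ◁ p.ev) ▷ Γ ≫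
    (α_ B _ Γ).hom ≫ B ◁ (λ_ _).hom ≫ wh B h k
  · simp only [conil₂, cobin, nil₂, bin, wh]; monoidal
  · rw [this]; simp [wh, -whisk]

lemma zig_right (k : C ⊗ Γ ⟶ W) :
    wh C (conil₂ E.coevaluation' Γ ≫ 𝟙 _) (nil₂ p.ev (C ⊗ Γ) ≫ k) = k := by
  have := E.coevaluation_evaluation'
  rw [hE] at this
  trans C ◁ (λ_ _).inv ≫ (α_ C _ Γ).inv ≫ (C ◁ E.coevaluation' ≫ (α_ C B C).inv ≫ p.ev ▷ C) ▷ Γ ≫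
    (α_ _ C Γ).hom ≫ (λ_ _).hom ≫ k
  · simp only [conil₂, cobin, nil₂, bin, wh]; monoidal
  · rw [this]; simp

/-- Under the duality the coproduct of `B` is the transpose of the product of `C`. Inserting a
straightened bend makes the product of `C` meet the pairing, where `mul_ev` applies. -/
lemma coev_comul (k : B ⊗ (B ⊗ (C ⊗ Γ)) ⟶ W) :
    conil₂ E.coevaluation' Γ ≫ cobin Δ[B] (C ⊗ Γ) ≫ k =
      conil₂ E.coevaluation' Γ ≫ wh B (conil₂ E.coevaluation' (C ⊗ Γ) ≫
        wh B (bin μ[C] Γ ≫ 𝟙 _) (𝟙 _)) k := by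
  have z := zig_right p E hE (Γ := Γ) (𝟙 _)
  symm
  trans conil₂ E.coevaluation' Γ ≫ wh B (conil₂ E.coevaluation' (C ⊗ Γ) ≫
        wh B (wh C (wh C (conil₂ E.coevaluation' Γ ≫ 𝟙 _) (𝟙 _)) (bin μ[C] _ ≫ nil₂ p.ev (C ⊗ Γ) ≫ 𝟙 _)) (𝟙 _)) k
  · conv_lhs => rw [← z]
    simp
  · rw [p.bin_mul_nil₂]
    simp only [wh_wh, wh_comp, conil₂_wh, Category.assoc, Category.id_comp]
    simp [zig_left p E hE, wh_conil₂_sw, -nil₂_comp, -nil₂_wh]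

/-- The transpose of `ev_mul`, by the same bending, now on the strand of `B`. -/
lemma coev_wh_comul (k : B ⊗ (C ⊗ (C ⊗ Γ)) ⟶ W) :
    conil₂ E.coevaluation' Γ ≫ wh B (cobin Δ[C] Γ ≫ 𝟙 _) k =
      conil₂ E.coevaluation' Γ ≫ wh B (conil₂ E.coevaluation' (C ⊗ Γ) ≫ 𝟙 _)
        (bin μ[B] (C ⊗ (C ⊗ Γ)) ≫ k) := by
  have z {Γ Q W : 𝒞} (h : Γ ⟶ Q) (k : B ⊗ Q ⟶ W) := zig_left p E hE (h := h) k
  have z' {Γ W : 𝒞} (k : C ⊗ Γ ⟶ W) := zig_right p E hE k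
  symm
  trans conil₂ E.coevaluation' Γ ≫ wh B (conil₂ E.coevaluation' (C ⊗ Γ) ≫ 𝟙 _)
        (conil₂ E.coevaluation' (B ⊗ (B ⊗ (C ⊗ (C ⊗ Γ)))) ≫ wh B (wh C (bin μ[B] (C ⊗ (C ⊗ Γ)) ≫ 𝟙 _) (nil₂ p.ev _ ≫ 𝟙 _)) k)
  · trans conil₂ E.coevaluation' Γ ≫ wh B (conil₂ E.coevaluation' (C ⊗ Γ) ≫ 𝟙 _)
        (bin μ[B] (C ⊗ (C ⊗ Γ)) ≫ conil₂ E.coevaluation' (B ⊗ ((C ⊗ (C ⊗ Γ)))) ≫ wh B ((nil₂ p.ev _ ≫ 𝟙 _)) k)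
    · rw [z, wh_id]
    · simp only [wh_wh, wh_comp, conil₂_wh, Category.assoc, Category.id_comp]
  · trans conil₂ E.coevaluation' Γ ≫ wh B (cobin Δ[C] Γ ≫ wh C (wh C (conil₂ E.coevaluation' Γ ≫ 𝟙 _)
        (nil₂ p.ev (C ⊗ Γ) ≫ 𝟙 _)) (wh C (conil₂ E.coevaluation' (C ⊗ Γ) ≫ 𝟙 _) (nil₂ p.ev (C ⊗ (C ⊗ Γ)) ≫ 𝟙 _))) k
    · trans conil₂ E.coevaluation' Γ ≫ wh B (wh C (conil₂ E.coevaluation' Γ ≫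
        wh B (conil₂ E.coevaluation' (C ⊗ Γ) ≫ 𝟙 _) (𝟙 _)) (cobin Δ[C] _ ≫
          wh C (nil₂ p.ev _ ≫ 𝟙 _) (nil₂ p.ev _ ≫ 𝟙 _))) k
      · conv_rhs => rw [conil₂_wh]
        simp
      · simp
    · rw [z', z']
      simp

lemma coev_counit (k : C ⊗ Γ ⟶ W) :
    conil₂ E.coevaluation' Γ ≫ nil₁ ε[B] (C ⊗ Γ) ≫ k = conil₁ η[C] Γ ≫ k := by
  have z {Γ W : 𝒞} (k : C ⊗ Γ ⟶ W) := zig_right p E hE k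
  symm
  trans conil₁ η[C] Γ ≫ wh C (conil₂ E.coevaluation' Γ ≫ 𝟙 _) (nil₂ p.ev (C ⊗ Γ) ≫ k)
  · rw [z]
  · simp

/-- A morphism slid under the second leg of the coevaluation, acted on by `coregB`. -/
lemma coev_coregB (k : B ⊗ (C ⊗ Γ) ⟶ W) :
    wh C (conil₂ E.coevaluation' Γ ≫ 𝟙 _) (bin p.coregB (C ⊗ Γ) ≫ k) =
      wh C (conil₂ E.coevaluation' Γ ≫ 𝟙 _) (sw C B (C ⊗ Γ) ≫ wh B (bin μ[C] Γ ≫ 𝟙 _) k) := by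
  have z {Γ W : 𝒞} (k : C ⊗ Γ ⟶ W) := zig_right p E hE k
  trans wh C (conil₂ E.coevaluation' Γ ≫ 𝟙 _) (sw C B (C ⊗ Γ) ≫ wh B
    (wh C (conil₂ E.coevaluation' (C ⊗ Γ) ≫ 𝟙 _) (nil₂ p.ev (C ⊗ (C ⊗ Γ)) ≫ bin μ[C] Γ ≫ 𝟙 _)) k)
  · simp only [p.bin_coregB]
    trans wh C (conil₂ E.coevaluation' Γ ≫ cobin Δ[B] (C ⊗ Γ) ≫ 𝟙 _) (sw C B _ ≫ wh B (nil₂ p.ev _ ≫ 𝟙 _) k)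
    · simp
    · rw [coev_comul p E hE]
      simp [-DualPairing.bin_mul_nil₂]
  · rw [z]

/-- Bending the leg in `C` turns the coregular map on `C` into multiplication in `B`, because the
coproduct of `C` is the transpose of that multiplication. -/
lemma coev_coregC (k : B ⊗ (C ⊗ Γ) ⟶ W) :
    conil₂ E.coevaluation' (B ⊗ Γ) ≫ wh B (bin p.coregC Γ ≫ 𝟙 _) k =
      conil₂ E.coevaluation' (B ⊗ Γ) ≫ wh B (sw C B Γ ≫ 𝟙 _) (bin μ[B] (C ⊗ Γ) ≫ k) := by
  have z {Γ Q W : 𝒞} (h : Γ ⟶ Q) (k : B ⊗ Q ⟶ W) := zig_left p E hE (h := h) k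
  simp only [p.bin_coregC]
  trans conil₂ E.coevaluation' (B ⊗ Γ) ≫ wh B (cobin Δ[C] (B ⊗ Γ) ≫ 𝟙 _) (wh B (wh C (sw C B Γ ≫ 𝟙 _) (nil₂ p.ev (C ⊗ Γ) ≫ 𝟙 _)) k)
  · simp
  · rw [coev_wh_comul p E hE]
    trans conil₂ E.coevaluation' (B ⊗ Γ) ≫ wh B (sw C B Γ ≫ 𝟙 _) (wh B (conil₂ E.coevaluation' (B ⊗ (C ⊗ Γ)) ≫ 
      wh B (nil₂ p.ev _ ≫ 𝟙 _) (𝟙 _)) (bin μ[B] (C ⊗ Γ) ≫ k))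
    · simp [-nil₂_comp, conil₂_wh]
    · rw [z, wh_id, wh_id]

/-- An inverse crossing of `C` is a positive crossing of its dual `B`, bent by the coevaluation and
the pairing. The rewrite rules handle positive crossings, so inverse ones are removed in this way.
-/
lemma swi_swi_eq_coev (S T X : 𝒞) (k : S ⊗ (T ⊗ (C ⊗ X)) ⟶ W) : swi S C (T ⊗ X) ≫ wh S (swi T C X ≫ 𝟙 _) k =
    wh C (wh S (wh T (conil₂ E.coevaluation' X ≫ 𝟙 _) (sw T B (C ⊗ X) ≫ 𝟙 _)) (sw S B (T ⊗ (C ⊗ X)) ≫ 𝟙 _)) (nil₂ p.ev (S ⊗ (T ⊗ (C ⊗ X))) ≫ k) := by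
  have z {Γ W : 𝒞} (k : C ⊗ Γ ⟶ W) := zig_right p E hE k
  have h : wh S (sw T C X ≫ 𝟙 _) (sw S C (T ⊗ X) ≫ wh C (wh S (wh T (conil₂ E.coevaluation' X ≫ 𝟙 _) (sw T B (C ⊗ X) ≫ 𝟙 _)) (sw S B (T ⊗ (C ⊗ X)) ≫ 𝟙 _)) (nil₂ p.ev (S ⊗ (T ⊗ (C ⊗ X))) ≫ k)) = k := by
    trans wh S (wh T (wh C (conil₂ E.coevaluation' X ≫ 𝟙 _) (nil₂ p.ev (C ⊗ X) ≫ 𝟙 _)) (𝟙 _)) k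
    · simp
    · rw [z]; simp
  rw [← h]
  rw [wh_wh, Category.assoc, Category.id_comp, swi_sw, wh_id, swi_sw, h]

lemma swi_swi_eq_coev' (S T X : 𝒞) (k : B ⊗ (S ⊗ (T ⊗ X)) ⟶ W) : wh S (swi B T X ≫ 𝟙 _) (swi B S (T ⊗ X) ≫ k) =
    conil₂ E.coevaluation' (S ⊗ (T ⊗ (B ⊗ X))) ≫ wh B (sw C S _ ≫ wh S (sw C T _ ≫
      wh T (nil₂ p.ev X ≫ 𝟙 _) (𝟙 _)) (𝟙 _)) k := by
  have z {Γ Q W : 𝒞} (h : Γ ⟶ Q) (k : B ⊗ Q ⟶ W) := zig_left p E hE (h := h) k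
  have h : sw B S (T ⊗ X) ≫ wh S (sw B T X ≫ 𝟙 _) (conil₂ E.coevaluation' (S ⊗ (T ⊗ (B ⊗ X))) ≫
      wh B (sw C S _ ≫ wh S (sw C T _ ≫ wh T (nil₂ p.ev X ≫ 𝟙 _) (𝟙 _)) (𝟙 _)) k) = k := by
    trans conil₂ E.coevaluation' (B ⊗ (S ⊗ (T ⊗ X))) ≫ wh B (nil₂ p.ev _ ≫ 𝟙 _) k
    · have e := conil₂_wh (X := B) E.coevaluation' (sw B S (T ⊗ X) ≫ S ◁ sw B T X)
        (sw C S _ ≫ wh S (sw C T _ ≫ wh T (nil₂ p.ev X ≫ 𝟙 _) (𝟙 _)) (𝟙 _)) k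
      trans (sw B S (T ⊗ X) ≫ S ◁ sw B T X) ≫ conil₂ E.coevaluation' (S ⊗ (T ⊗ (B ⊗ X))) ≫
        wh B (sw C S _ ≫ wh S (sw C T _ ≫ wh T (nil₂ p.ev X ≫ 𝟙 _) (𝟙 _)) (𝟙 _)) k
      · simp [wh, -whisk]
      · rw [← e]
        congr 2
        trans wh C (sw B S (T ⊗ X) ≫ 𝟙 _)
          (sw C S _ ≫ wh S (wh C (sw B T X ≫ 𝟙 _) (sw C T _ ≫ wh T (nil₂ p.ev X ≫ 𝟙 _) (𝟙 _))) (𝟙 _))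
        · rw [sw_wh]
          simp only [wh, Category.comp_id, whiskerLeft_comp, Category.assoc]
        · rw [wh_sw_nil₂, wh_sw_nil₂]; simp
    · rw [z, wh_id]
  conv_lhs => rw [← h]
  rw [swi_sw, wh_wh, Category.assoc, Category.id_comp, swi_sw, wh_id]

end

/-- The twist `v ⊗ w ↦ (v ◁ q⁽¹⁾) ⊗ (q⁽²⁾ ▷ w)` by a copairing `q`. -/
def twist (r : V ⊗ B ⟶ V') (l : C ⊗ X ⟶ Y) (q : 𝟙_ 𝒞 ⟶ B ⊗ C) (Γ : 𝒞) :
    V ⊗ (X ⊗ Γ) ⟶ V' ⊗ (Y ⊗ Γ) :=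
  wh V (conil₂ q (X ⊗ Γ) ≫ 𝟙 _) (bin r (C ⊗ (X ⊗ Γ)) ≫ wh V' (bin l Γ ≫ 𝟙 _) (𝟙 _))

section module
variable {p}
variable {l : C ⊗ V ⟶ V} {r : V ⊗ B ⟶ V} (h : IsCrossedBimodule p l r)
include h

lemma IsCrossedBimodule.bin_mul_left (k : V ⊗ Γ ⟶ W) :
    bin μ[C] (V ⊗ Γ) ≫ bin l Γ ≫ k = wh C (bin l Γ ≫ 𝟙 _) (bin l Γ ≫ k) := by
  trans (α_ C C (V ⊗ Γ)).inv ≫ (α_ (C ⊗ C) V Γ).inv ≫ (μ[C] ▷ V ≫ l) ▷ Γ ≫ k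
  · simp only [bin]; monoidal
  · rw [h.mul_left]; simp only [bin, wh]; monoidal

lemma IsCrossedBimodule.bin_one_left (k : V ⊗ Γ ⟶ W) :
    conil₁ η[C] (V ⊗ Γ) ≫ bin l Γ ≫ k = k := by
  trans (λ_ (V ⊗ Γ)).inv ≫ (α_ _ V Γ).inv ≫ (η[C] ▷ V ≫ l) ▷ Γ ≫ k
  · simp only [conil₁, bin]; monoidal
  · rw [h.one_left]; monoidal

lemma IsCrossedBimodule.bin_right_mul (k : V ⊗ Γ ⟶ W) :
    wh V (bin μ[B] Γ ≫ 𝟙 _) (bin r Γ ≫ k) = bin r (B ⊗ Γ) ≫ bin r Γ ≫ k := by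
  trans V ◁ (α_ B B Γ).inv ≫ (α_ V (B ⊗ B) Γ).inv ≫ (V ◁ μ[B] ≫ r) ▷ Γ ≫ k
  · simp only [bin, wh]; monoidal
  · rw [h.right_mul]; simp only [bin]; monoidal

lemma IsCrossedBimodule.bin_right_one (k : V ⊗ Γ ⟶ W) :
    wh V (conil₁ η[B] Γ ≫ 𝟙 _) (bin r Γ ≫ k) = k := by
  trans V ◁ (λ_ Γ).inv ≫ (α_ V _ Γ).inv ≫ (V ◁ η[B] ≫ r) ▷ Γ ≫ k
  · simp only [conil₁, bin, wh]; monoidal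
  · rw [h.right_one]; monoidal

lemma IsCrossedBimodule.bin_crossed (k : V ⊗ Γ ⟶ W) :
    p.evR V Γ ≫ wh C (bin r Γ ≫ 𝟙 _) (bin l Γ ≫ k) = p.evL V Γ ≫ bin l (B ⊗ Γ) ≫ bin r Γ ≫ k := by
  trans C ◁ (α_ V B Γ).inv ≫ (α_ C (V ⊗ B) Γ).inv ≫ (α_ C V B).inv ▷ Γ ≫ crossLeft p.ev l r ▷ Γ ≫ k
  · rw [crossLeft_eq_evR]
    simp only [DualPairing.evR, cobin, bin, sw, wh]; monoidal
  · rw [h.crossed, crossRight_eq_evL]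
    simp only [DualPairing.evL, cobin, bin, sw, wh]; monoidal
end module

section twist
variable (hE : E.evaluation' = p.ev)
variable {p}
variable {l : C ⊗ V ⟶ V} {r : V ⊗ B ⟶ V} (h : IsCrossedBimodule p l r)
variable {l' : C ⊗ X ⟶ X} {r' : X ⊗ B ⟶ X} (h' : IsCrossedBimodule p l' r')

lemma twist_comp {Z} (ρ : V ⊗ B ⟶ V') (l : C ⊗ X ⟶ Y) (q : 𝟙_ 𝒞 ⟶ B ⊗ C) (k : V' ⊗ (Y ⊗ Γ) ⟶ Z) :
    twist ρ l q Γ ≫ k = wh V (conil₂ q (X ⊗ Γ) ≫ 𝟙 _) (bin ρ (C ⊗ (X ⊗ Γ)) ≫ wh V' (bin l Γ ≫ 𝟙 _) k) := by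
  simp [twist]

lemma conil₂_antipode (q : 𝟙_ 𝒞 ⟶ B ⊗ C) (k : B ⊗ (C ⊗ Γ) ⟶ W) :
    conil₂ (q ≫ 𝒮[B] ▷ C) Γ ≫ k = conil₂ q Γ ≫ una 𝒮[B] (C ⊗ Γ) ≫ k := by
  simp [conil₂, cobin, una]

include hE h h'

/-- By the module axioms two successive twists are one twist by `(S e) e' ⊗ f' f`. By `coev_comul`
this is `(S e₁) e₂ ⊗ f = 1 ⊗ 1`. -/
lemma twist_antipode_twist : twist r l' (E.coevaluation' ≫ 𝒮[B] ▷ C) Γ ≫ twist r l' E.coevaluation' Γ = 𝟙 _ := by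
  apply eq_of_comp_id
  rw [Category.assoc, twist_comp, twist_comp]
  simp only [conil₂_antipode]
  trans wh V (conil₂ E.coevaluation' (X ⊗ Γ) ≫ wh B (conil₂ E.coevaluation' (C ⊗ (X ⊗ Γ)) ≫ wh B (bin μ[C] (X ⊗ Γ) ≫ 𝟙 _) (𝟙 _))
    (una 𝒮[B] _ ≫ bin μ[B] _ ≫ 𝟙 _)) (bin r _ ≫ wh V (bin l' Γ ≫ 𝟙 _) (𝟙 _))
  · trans wh V (conil₂ E.coevaluation' (X ⊗ Γ) ≫ wh B (conil₂ E.coevaluation' (C ⊗ (X ⊗ Γ)) ≫ 𝟙 _) 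
      (una 𝒮[B] _ ≫ 𝟙 _)) (wh V (bin μ[B] _ ≫ 𝟙 _) (bin r _ ≫ wh V (bin μ[C] (X ⊗ Γ) ≫ bin l' Γ ≫ 𝟙 _) (𝟙 _)))
    · rw [h.bin_right_mul, h'.bin_mul_left]
      simp
    · simp
  · rw [← coev_comul p E hE, cobin_antipode_left, coev_counit p E hE]
    trans wh V (conil₁ η[B] _ ≫ 𝟙 _) (bin r _ ≫ wh V (conil₁ η[C] _ ≫ bin l' Γ ≫ 𝟙 _) (𝟙 _))
    · simp
    · rw [h.bin_right_one, h'.bin_one_left, wh_id, Category.comp_id]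

lemma twist_twist_antipode : twist r l' E.coevaluation' Γ ≫ twist r l' (E.coevaluation' ≫ 𝒮[B] ▷ C) Γ = 𝟙 _ := by
  apply eq_of_comp_id
  rw [Category.assoc, twist_comp, twist_comp]
  simp only [conil₂_antipode]
  trans wh V (conil₂ E.coevaluation' (X ⊗ Γ) ≫ wh B (conil₂ E.coevaluation' (C ⊗ (X ⊗ Γ)) ≫ wh B (bin μ[C] (X ⊗ Γ) ≫ 𝟙 _) (𝟙 _))
    (wh B (una 𝒮[B] _ ≫ 𝟙 _) (bin μ[B] _ ≫ 𝟙 _))) (bin r _ ≫ wh V (bin l' Γ ≫ 𝟙 _) (𝟙 _))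
  · trans wh V (conil₂ E.coevaluation' (X ⊗ Γ) ≫ wh B (conil₂ E.coevaluation' (C ⊗ (X ⊗ Γ)) ≫ una 𝒮[B] _ ≫ 𝟙 _) 
      (𝟙 _)) (wh V (bin μ[B] _ ≫ 𝟙 _) (bin r _ ≫ wh V (bin μ[C] (X ⊗ Γ) ≫ bin l' Γ ≫ 𝟙 _) (𝟙 _)))
    · rw [h.bin_right_mul, h'.bin_mul_left]
      simp
    · simp
  · rw [← coev_comul p E hE, cobin_antipode_right, coev_counit p E hE]
    trans wh V (conil₁ η[B] _ ≫ 𝟙 _) (bin r _ ≫ wh V (conil₁ η[C] _ ≫ bin l' Γ ≫ 𝟙 _) (𝟙 _))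
    · simp
    · rw [h.bin_right_one, h'.bin_one_left, wh_id, Category.comp_id]

/-- The twist by the coevaluation intertwines the two tensor product actions of `C`. -/
lemma twist_left (k : V ⊗ (X ⊗ Γ) ⟶ W) :
    wh C (twist r l' E.coevaluation' Γ ≫ 𝟙 _) (cobin Δ[C] (V ⊗ (X ⊗ Γ)) ≫
      wh C (sw C V (X ⊗ Γ) ≫ wh V (bin l' Γ ≫ 𝟙 _) (𝟙 _)) (bin l _ ≫ k)) =
    cobin Δ[C] (V ⊗ (X ⊗ Γ)) ≫ swi C C _ ≫ wh C (swi V C _ ≫ 𝟙 _) (bin l _ ≫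
      wh V (bin l' Γ ≫ 𝟙 _) (twist r l' E.coevaluation' Γ ≫ k)) := by
  simp only [twist_comp]
  -- The middle term is the `evR` side of the crossing condition of `V`, with the first leg of the
  -- coevaluation as the element of `B`. On the left the acting copy of `C` multiplies the second
  -- leg, and `coev_coregB` exchanges this for a coregular action on the first leg.
  trans wh C (wh V (conil₂ E.coevaluation' (X ⊗ Γ) ≫ 𝟙 _) (𝟙 _)) (p.evR V _ ≫ wh C (bin r _ ≫ 𝟙 _) 
      (bin l _ ≫ wh V (bin l' Γ ≫ 𝟙 _) k))
  · trans cobin Δ[C] (V ⊗ (X ⊗ Γ)) ≫ wh C (sw C V _ ≫ wh V (wh C (conil₂ E.coevaluation' (X ⊗ Γ) ≫ 𝟙 _)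
      (sw C B _ ≫ wh B (bin μ[C] (X ⊗ Γ) ≫ bin l' Γ ≫ 𝟙 _) (𝟙 _))) (bin r _ ≫ 𝟙 _)) (bin l _ ≫ k)
    · rw [h'.bin_mul_left]
      simp
    · trans cobin Δ[C] (V ⊗ (X ⊗ Γ)) ≫ wh C (sw C V _ ≫ wh V (wh C (conil₂ E.coevaluation' (X ⊗ Γ) ≫ 𝟙 _)
        (bin p.coregB _ ≫ wh B (bin l' Γ ≫ 𝟙 _) (𝟙 _))) (bin r _ ≫ 𝟙 _)) (bin l _ ≫ k)
      · rw [coev_coregB p E hE]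
        simp
      · simp [DualPairing.evR]
  -- On the `evL` side `coev_comul` splits the coevaluation in two. The copy paired with `C` is the
  -- bent form of the inverse crossings on the right.
  · rw [h.bin_crossed, swi_swi_eq_coev p E hE]
    trans wh C (wh V (conil₂ E.coevaluation' (X ⊗ Γ) ≫ cobin Δ[B] _ ≫ 𝟙 _) (sw V B _ ≫ 𝟙 _)) 
      (bin p.coregC _ ≫ bin l _ ≫ bin r _ ≫ wh V (bin l' Γ ≫ 𝟙 _) k)
    · simp [DualPairing.evL]
    · rw [coev_comul p E hE, p.bin_coregC]
      trans wh C (wh V (conil₂ E.coevaluation' (X ⊗ Γ) ≫ wh B (conil₂ E.coevaluation' (C ⊗ (X ⊗ Γ)) ≫ 𝟙 _)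
          (𝟙 _)) (sw V B _ ≫ 𝟙 _)) (cobin Δ[C] _ ≫ wh C (sw C B _ ≫ 𝟙 _) (nil₂ p.ev _ ≫ 
            bin l _ ≫ bin r _ ≫ wh V (bin μ[C] _ ≫ bin l' Γ ≫ 𝟙 _) k))
      · simp
      · rw [h'.bin_mul_left]
        simp

/-- The twist by the coevaluation intertwines the two tensor product actions of `B`. -/
lemma twist_right (k : V ⊗ (X ⊗ Γ) ⟶ W) :
    twist r l' E.coevaluation' (B ⊗ Γ) ≫ wh V (wh X (cobin Δ[B] Γ ≫ 𝟙 _) (sw X B (B ⊗ Γ) ≫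
      wh B (bin r' Γ ≫ 𝟙 _) (𝟙 _))) (bin r _ ≫ k) =
    wh V (wh X (cobin Δ[B] Γ ≫ swi B B Γ ≫ 𝟙 _) (swi B X _ ≫ 𝟙 _)) (bin r _ ≫ wh V (bin r' Γ ≫ 𝟙 _)
      (twist r l' E.coevaluation' Γ ≫ k)) := by
  simp only [twist_comp]
  have c := h'.bin_crossed (Γ := Γ) (𝟙 _)
  -- The middle term is the `evL` side of the crossing condition of `X`, with the second leg of the
  -- coevaluation as the element of `C`.
  trans wh V (conil₂ E.coevaluation' (X ⊗ (B ⊗ Γ)) ≫ 𝟙 _) (bin r _ ≫ 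
    wh V (p.evL X Γ ≫ bin l' (B ⊗ Γ) ≫ bin r' Γ ≫ 𝟙 _) k)
  · trans wh V (wh X (cobin Δ[B] Γ ≫ 𝟙 _) (sw X B (B ⊗ Γ) ≫ 𝟙 _)) (wh V (conil₂ E.coevaluation' (B ⊗ (X ⊗ (B ⊗ Γ))) ≫ 
      wh B (sw C B _ ≫ 𝟙 _) (bin μ[B] _ ≫ 𝟙 _)) (bin r _ ≫ wh V (bin l' _ ≫ bin r' Γ ≫ 𝟙 _) k))
    · trans wh V (wh X (cobin Δ[B] Γ ≫ 𝟙 _) (sw X B (B ⊗ Γ) ≫ 𝟙 _)) (wh V (conil₂ E.coevaluation' (B ⊗ (X ⊗ (B ⊗ Γ))) ≫ 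
        wh B (sw C B _ ≫ 𝟙 _) (𝟙 _)) (bin r _ ≫ bin r _ ≫ wh V (bin l' _ ≫ bin r' Γ ≫ 𝟙 _) k))
      · simp
      · rw [← h.bin_right_mul]
        simp
    · rw [← coev_coregC p E hE]
      simp [DualPairing.evL]
  · rw [← c]
    trans wh V (wh X (cobin Δ[B] Γ ≫ 𝟙 _) (𝟙 _)) (wh V (conil₂ E.coevaluation' (X ⊗ (B ⊗ (B ⊗ Γ))) ≫
      wh B (cobin Δ[C] _ ≫ 𝟙 _) (𝟙 _)) (bin r _ ≫ wh V (wh C (sw C X _ ≫ wh X (sw C B _ ≫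
        wh B (nil₂ p.ev Γ ≫ 𝟙 _) (𝟙 _)) (𝟙 _)) (wh C (bin r' Γ ≫ 𝟙 _) (bin l' Γ ≫ 𝟙 _))) k))
    · trans wh V (conil₂ E.coevaluation' (X ⊗ (B ⊗ Γ)) ≫
        wh B (wh C (wh X (cobin Δ[B] Γ ≫ 𝟙 _) (𝟙 _)) (cobin Δ[C] _ ≫ 𝟙 _)) (𝟙 _)) (bin r _ ≫
          wh V (wh C (sw C X _ ≫ wh X (sw C B _ ≫
            wh B (nil₂ p.ev Γ ≫ 𝟙 _) (𝟙 _)) (𝟙 _)) (wh C (bin r' Γ ≫ 𝟙 _) (bin l' Γ ≫ 𝟙 _))) k)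
      · simp [DualPairing.evR, p.bin_coregB]
      · rw [conil₂_wh]; simp
    · rw [coev_wh_comul p E hE]
      trans wh V (wh X (cobin Δ[B] Γ ≫ 𝟙 _) (𝟙 _)) (wh V (conil₂ E.coevaluation' (X ⊗ (B ⊗ (B ⊗ Γ))) ≫
        wh B (conil₂ E.coevaluation' _ ≫ 𝟙 _) (𝟙 _)) (wh V (bin μ[B] _ ≫ 𝟙 _) (bin r _ ≫ wh V (wh C (sw C X _ ≫ wh X (sw C B _ ≫
          wh B (nil₂ p.ev Γ ≫ 𝟙 _) (𝟙 _)) (𝟙 _)) (wh C (bin r' Γ ≫ 𝟙 _) (bin l' Γ ≫ 𝟙 _))) k)))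
      · simp
      · rw [h.bin_right_mul]
        have e := swi_swi_eq_coev' p E hE X B Γ (𝟙 _)
        trans wh V (wh X (cobin Δ[B] Γ ≫ 𝟙 _) (wh X (swi B B Γ ≫ 𝟙 _) (swi B X (B ⊗ Γ) ≫ 𝟙 _)))
          (bin r _ ≫ wh V (bin r' Γ ≫ 𝟙 _) (wh V (conil₂ E.coevaluation' (X ⊗ Γ) ≫ 𝟙 _) (bin r _ ≫ wh V (bin l' Γ ≫ 𝟙 _) k)))
        · rw [e]
          simp [conil₂_wh]
        · simp
end twist


end pairing
end Rigid

/-! ### The hexagon identities for the twisted braiding. -/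

section Rigid
attribute [-simp] Category.comp_id
attribute [local simp] whisk wh_comp wh_wh wh_id bin_wh wh_cobin una_wh nil₂_comp nil₂_wh nil₁_comp
  conil₁_wh conil₂_wh sw_wh bin_sw sw_cobin sw_wh_cobin sw_una sw_wh_una
  sw_sw_sw sw_sw_sw_wh sw_sw_bin sw_sw_bin_wh sw_sw_nil₂ sw_sw_nil₂_wh sw_nil₁ sw_wh_nil₁ wh_sw_nil₂
  wh_comp_wh_sw_nil₂
  wh_conil₁_sw conil₁_sw_comp bin_mul_mul conil₁_one_mul wh_conil₁_one_mul cobin_comul_comul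
  cobin_nil₁ cobin_wh_nil₁ conil₁_comul
  DualPairing.bin_mul_nil₂ DualPairing.wh_mul_nil₂ DualPairing.wh_comp_mul_nil₂
  DualPairing.wh_comp_wh_mul_nil₂ DualPairing.conil₁_nil₂
  DualPairing.wh_conil₁_nil₂

variable {𝒞 : Type w} [Category.{v} 𝒞] [MonoidalCategory 𝒞] [BraidedCategory 𝒞]
variable {Γ W W' Q C B X Y Z V V' : 𝒞} 

/-- Two nested copairings: crossing the left legs is crossing the right legs. -/
lemma conil₂_conil₂_sw (f : 𝟙_ 𝒞 ⟶ X ⊗ Y) (k : X ⊗ (X ⊗ (Y ⊗ (Y ⊗ Γ))) ⟶ W) :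
    conil₂ f Γ ≫ wh X (conil₂ f (Y ⊗ Γ) ≫ 𝟙 _) (sw X X (Y ⊗ (Y ⊗ Γ)) ≫ k) =
      conil₂ f Γ ≫ wh X (conil₂ f (Y ⊗ Γ) ≫ wh X (sw Y Y Γ ≫ 𝟙 _) (𝟙 _)) k := by
  have h1 := wh_conil₂_sw (Γ := Y ⊗ Γ) X f (swi X Y (Y ⊗ Γ) ≫ 𝟙 _) k
  have h2 := conil₂_sw_sw (Γ := Γ) Y f (swi X Y (Y ⊗ Γ) ≫ 𝟙 _)
  rw [sw_swi] at h1 h2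
  rw [wh_id] at h1
  rw [h1, ← conil₂_wh, h2]
  simp

lemma sw_wh_twist (r : V ⊗ B ⟶ V) (q : 𝟙_ 𝒞 ⟶ B ⊗ C) (H : V ⊗ (C ⊗ Γ) ⟶ Q) (k : X ⊗ Q ⟶ W) :
    sw V X Γ ≫ wh X (wh V (conil₂ q Γ ≫ 𝟙 _) (bin r _ ≫ H)) k =
      wh V (conil₂ q (X ⊗ Γ) ≫ wh B (sw C X _ ≫ 𝟙 _) (𝟙 _)) (bin r _ ≫ sw V X _ ≫ wh X H k) := by
  rw [sw_wh, ← conil₂_sw_sw]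
  simp

section pairing
variable [HopfObj C] [HopfObj B] {p : DualPairing C B} (E : ExactPairing B C) 
variable (hE : E.evaluation' = p.ev)
include hE

section hexagon
variable {lV : C ⊗ V ⟶ V} {rV : V ⊗ B ⟶ V} (hV : IsCrossedBimodule p lV rV)
variable {lX : C ⊗ X ⟶ X} {rX : X ⊗ B ⟶ X} (hX : IsCrossedBimodule p lX rX)
variable {lZ : C ⊗ Z ⟶ Z} {rZ : Z ⊗ B ⟶ Z} (hZ : IsCrossedBimodule p lZ rZ)

include hV in
-- The coproduct of the second leg becomes, by `coev_wh_comul`, a product `e e'` in the first. The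
-- antipode reverses it, and after `conil₂_conil₂_sw` has uncrossed the nested copairings the
-- factors act as the twists with `X` and then `Z`.
lemma twist_hexagon_forward (k : X ⊗ (Z ⊗ (V ⊗ Γ)) ⟶ W) :
    wh V (conil₂ (E.coevaluation' ≫ 𝒮[B] ▷ C) (X ⊗ (Z ⊗ Γ)) ≫ 𝟙 _) (bin rV _ ≫
      wh V (cobin Δ[C] _ ≫ wh C (sw C X _ ≫ wh X (bin lZ Γ ≫ 𝟙 _) (𝟙 _)) (bin lX _ ≫ 𝟙 _))
        (sw V X _ ≫ wh X (sw V Z Γ ≫ 𝟙 _) k)) =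
    twist rV lX (E.coevaluation' ≫ 𝒮[B] ▷ C) (Z ⊗ Γ) ≫ sw V X (Z ⊗ Γ) ≫
      wh X (twist rV lZ (E.coevaluation' ≫ 𝒮[B] ▷ C) Γ ≫ sw V Z Γ ≫ 𝟙 _) k := by
  have anti {Γ W : 𝒞} (k : V ⊗ Γ ⟶ W) : wh V (bin μ[B] Γ ≫ una 𝒮[B] Γ ≫ 𝟙 _) (bin rV Γ ≫ k) =
      wh V (sw B B _ ≫ una 𝒮[B] _ ≫ wh B (una 𝒮[B] _ ≫ 𝟙 _) (𝟙 _)) (bin rV _ ≫ bin rV _ ≫ k) := by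
    rw [← hV.bin_right_mul, bin_mul_antipode]
    simp [-sw_sw_bin, -sw_sw_bin_wh, sw_bin_over]
  trans wh V (conil₂ E.coevaluation' (X ⊗ (Z ⊗ Γ)) ≫ wh B (conil₂ E.coevaluation' _ ≫ 𝟙 _) (𝟙 _))
    (wh V (bin μ[B] _ ≫ una 𝒮[B] _ ≫ 𝟙 _) (bin rV _ ≫
      wh V (wh C (sw C X _ ≫ wh X (bin lZ Γ ≫ 𝟙 _) (𝟙 _)) (bin lX _ ≫ 𝟙 _))
        (sw V X _ ≫ wh X (sw V Z Γ ≫ 𝟙 _) k)))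
  · trans wh V (conil₂ E.coevaluation' (X ⊗ (Z ⊗ Γ)) ≫ wh B (cobin Δ[C] _ ≫ 𝟙 _) (una 𝒮[B] _ ≫ 𝟙 _)) (bin rV _ ≫
      wh V (wh C (sw C X _ ≫ wh X (bin lZ Γ ≫ 𝟙 _) (𝟙 _)) (bin lX _ ≫ 𝟙 _))
        (sw V X _ ≫ wh X (sw V Z Γ ≫ 𝟙 _) k))
    · simp only [conil₂_antipode]; simp
    · rw [coev_wh_comul p E hE]
      simp only [wh_wh, wh_comp, Category.assoc, Category.id_comp]
  · rw [anti, wh_wh]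
    simp only [twist_comp, wh_comp, Category.assoc, Category.id_comp]
    rw [conil₂_conil₂_sw, sw_wh_twist]
    simp only [conil₂_antipode]
    have e : bin lX (Z ⊗ Γ) ≫ conil₂ E.coevaluation' (X ⊗ (Z ⊗ Γ)) ≫ una 𝒮[B] _ ≫ wh B (sw C X _ ≫ 𝟙 _) (𝟙 _) =
        conil₂ E.coevaluation' _ ≫ una 𝒮[B] _ ≫ wh B (sw C C _ ≫ wh C (sw C X _ ≫ 𝟙 _) (bin lX _ ≫ 𝟙 _)) (𝟙 _) := by
      rw [sw_sw_bin, una_wh, una_wh, conil₂_wh, Category.assoc, Category.id_comp]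
    trans wh V (conil₂ E.coevaluation' (X ⊗ (Z ⊗ Γ)) ≫ una 𝒮[B] _ ≫ 𝟙 _) (bin rV _ ≫ 
      wh V (bin lX (Z ⊗ Γ) ≫ conil₂ E.coevaluation' (X ⊗ (Z ⊗ Γ)) ≫ una 𝒮[B] _ ≫ wh B (sw C X _ ≫ 𝟙 _) (𝟙 _))
        (bin rV _ ≫ sw V X _ ≫ wh X (wh V (bin lZ _ ≫ 𝟙 _) (sw V Z _ ≫ 𝟙 _)) k))
    · rw [e]
      -- As an opaque morphism this copairing is not moved by `conil₂_wh`.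
      generalize hK : conil₂ E.coevaluation' (C ⊗ (X ⊗ (Z ⊗ Γ))) = K
      simp
    · simp

include hZ in
-- Dually, the antipode reverses the coproduct of the first leg, and `coev_comul` turns it into two
-- coevaluations whose second legs are multiplied in `C` and act successively on `Z`.
lemma twist_hexagon_reverse_aux :
    wh X (conil₂ (E.coevaluation' ≫ 𝒮[B] ▷ C) (Z ⊗ Γ) ≫ cobin Δ[B] _ ≫ 𝟙 _) (sw X B _ ≫ 
      wh B (bin rX _ ≫ wh X (bin lZ Γ ≫ 𝟙 _) (sw X Z Γ ≫ 𝟙 _)) (𝟙 _)) =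
    twist rX lZ (E.coevaluation' ≫ 𝒮[B] ▷ C) Γ ≫ sw X Z Γ ≫
      conil₂ (E.coevaluation' ≫ 𝒮[B] ▷ C) (Z ⊗ (X ⊗ Γ)) ≫ wh B (bin lZ (X ⊗ Γ) ≫ 𝟙 _) (𝟙 _) := by
  simp only [twist_comp, conil₂_antipode, una_antipode_comul]
  rw [coev_comul p E hE]
  have e : sw X Z Γ ≫ conil₂ E.coevaluation' (Z ⊗ (X ⊗ Γ)) ≫ una 𝒮[B] _ ≫ wh B (bin lZ (X ⊗ Γ) ≫ 𝟙 _) (𝟙 _) =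
    wh X (conil₂ E.coevaluation' _ ≫ una 𝒮[B] _ ≫ wh B (bin lZ _ ≫ 𝟙 _) (𝟙 _)) (sw X B _ ≫ wh B (sw X Z Γ ≫ 𝟙 _) (𝟙 _)) := by
    trans conil₂ E.coevaluation' (X ⊗ (Z ⊗ Γ)) ≫ wh B (wh C (sw X Z Γ ≫ 𝟙 _) (bin lZ (X ⊗ Γ) ≫ 𝟙 _))
      (una 𝒮[B] _ ≫ 𝟙 _)
    · rw [conil₂_wh, una_wh, Category.assoc, Category.id_comp]
    · rw [← wh_conil₂_sw]
      simp [sw_comp_una]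
  rw [e]
  trans wh X (conil₂ E.coevaluation' (Z ⊗ Γ) ≫ wh B (conil₂ E.coevaluation' (C ⊗ (Z ⊗ Γ)) ≫ 𝟙 _) (𝟙 _))
      (wh X (sw B B _ ≫ una 𝒮[B] _ ≫ wh B (una 𝒮[B] _ ≫ 𝟙 _) (𝟙 _)) (sw X B _ ≫ wh B (bin rX _ ≫ 𝟙 _)
        (wh B (wh X (bin μ[C] _ ≫ bin lZ Γ ≫ 𝟙 _) (sw X Z Γ ≫ 𝟙 _)) (𝟙 _))))
  · simp
  · rw [hZ.bin_mul_left]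
    generalize hK : conil₂ E.coevaluation' (C ⊗ (Z ⊗ Γ)) = K
    simp [sw_comp_una]
    rw [← hK, conil₂_wh, Category.assoc, Category.id_comp]

include hV hZ in
lemma twist_hexagon_reverse (k : Z ⊗ (V ⊗ (X ⊗ Γ)) ⟶ W) :
    wh V (wh X (conil₂ (E.coevaluation' ≫ 𝒮[B] ▷ C) (Z ⊗ Γ) ≫ cobin Δ[B] _ ≫ 𝟙 _) (sw X B _ ≫ 
      wh B (bin rX _ ≫ 𝟙 _) (𝟙 _))) (bin rV _ ≫ wh V (wh X (bin lZ Γ ≫ 𝟙 _) (𝟙 _)) 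
        (wh V (sw X Z Γ ≫ 𝟙 _) (sw V Z _ ≫ k))) =
    wh V (twist rX lZ (E.coevaluation' ≫ 𝒮[B] ▷ C) Γ ≫ sw X Z Γ ≫ 𝟙 _)
      (twist rV lZ (E.coevaluation' ≫ 𝒮[B] ▷ C) (X ⊗ Γ) ≫ sw V Z _ ≫ k) := by
  have e := twist_hexagon_reverse_aux (Γ := Γ) (X := X) E hE hZ (rX := rX)
  trans wh V (twist rX lZ (E.coevaluation' ≫ 𝒮[B] ▷ C) Γ ≫ sw X Z Γ ≫
      conil₂ (E.coevaluation' ≫ 𝒮[B] ▷ C) (Z ⊗ (X ⊗ Γ)) ≫ wh B (bin lZ (X ⊗ Γ) ≫ 𝟙 _) (𝟙 _)) (bin rV _ ≫ sw V Z _ ≫ k)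
  · rw [← e]
    generalize conil₂ (E.coevaluation' ≫ 𝒮[B] ▷ C) (Z ⊗ Γ) = K
    simp
  · rw [twist_comp rV lZ]
    generalize twist rX lZ (E.coevaluation' ≫ 𝒮[B] ▷ C) Γ = T
    generalize conil₂ (E.coevaluation' ≫ 𝒮[B] ▷ C) (Z ⊗ (X ⊗ Γ)) = K
    simp
end hexagon
end pairing
end Rigid

/-! ### The twisted braiding intertwines the actions. -/

section Rigid
attribute [-simp] Category.comp_id
attribute [local simp] whisk wh_comp wh_wh wh_id bin_wh wh_cobin una_wh nil₂_comp nil₂_wh nil₁_comp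
  conil₁_wh conil₂_wh sw_wh bin_sw sw_cobin sw_wh_cobin sw_una sw_wh_una
  sw_sw_sw sw_sw_sw_wh sw_sw_bin sw_sw_bin_wh sw_sw_nil₂ sw_sw_nil₂_wh sw_nil₁ sw_wh_nil₁ wh_sw_nil₂
  wh_comp_wh_sw_nil₂
  wh_conil₁_sw conil₁_sw_comp bin_mul_mul conil₁_one_mul wh_conil₁_one_mul cobin_comul_comul
  cobin_nil₁ cobin_wh_nil₁ conil₁_comul
  DualPairing.bin_mul_nil₂ DualPairing.wh_mul_nil₂ DualPairing.wh_comp_mul_nil₂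
  DualPairing.wh_comp_wh_mul_nil₂ DualPairing.conil₁_nil₂
  DualPairing.wh_conil₁_nil₂

variable {𝒞 : Type w} [Category.{v} 𝒞] [MonoidalCategory 𝒞] [BraidedCategory 𝒞]
variable {Γ W W' Q C B X Y Z V V' : 𝒞} [HopfObj C] [HopfObj B] {p : DualPairing C B} 

variable (E : ExactPairing B C) 
variable (hE : E.evaluation' = p.ev)

section
include hE
variable {lV : C ⊗ V ⟶ V} {rV : V ⊗ B ⟶ V} (hV : IsCrossedBimodule p lV rV)
variable {lX : C ⊗ X ⟶ X} {rX : X ⊗ B ⟶ X} (hX : IsCrossedBimodule p lX rX)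
include hV hX

/-- The twist by `S e ⊗ f` inverts the twist by the coevaluation, so by `twist_left` it carries the
tensor product action to the one formed with the inverse braiding. The crossing of `V` and `X` turns
that into the tensor product action on `X ⊗ V`. -/
lemma twist_sw_left : 
    (cobin Δ[C] (V ⊗ (X ⊗ Γ)) ≫ wh C (sw C V (X ⊗ Γ) ≫ wh V (bin lX Γ ≫ 𝟙 _) (𝟙 _)) (bin lV _ ≫ 𝟙 _)) ≫
      twist rV lX (E.coevaluation' ≫ 𝒮[B] ▷ C) Γ ≫ sw V X Γ =
    C ◁ (twist rV lX (E.coevaluation' ≫ 𝒮[B] ▷ C) Γ ≫ sw V X Γ) ≫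
      cobin Δ[C] (X ⊗ (V ⊗ Γ)) ≫ wh C (sw C X (V ⊗ Γ) ≫ wh X (bin lV Γ ≫ 𝟙 _) (𝟙 _)) (bin lX _ ≫ 𝟙 _) := by
  have h1 := twist_left E hE hV hX (Γ := Γ) (𝟙 _)
  have h2 := twist_twist_antipode E hE hV hX (Γ := Γ)
  have h3 := twist_antipode_twist E hE hV hX (Γ := Γ)
  generalize twist rV lX (E.coevaluation' ≫ 𝒮[B] ▷ C) Γ = T at *
  generalize twist rV lX E.coevaluation' Γ = T' at *
  have h4 : cobin Δ[C] (V ⊗ (X ⊗ Γ)) ≫ wh C (sw C V (X ⊗ Γ) ≫ wh V (bin lX Γ ≫ 𝟙 _) (𝟙 _)) (bin lV _ ≫ 𝟙 _) =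
      C ◁ T ≫ cobin Δ[C] (V ⊗ (X ⊗ Γ)) ≫ swi C C _ ≫ wh C (swi V C _ ≫ 𝟙 _) (bin lV _ ≫
        wh V (bin lX Γ ≫ 𝟙 _) T') := by
    simp only [Category.comp_id] at h1
    rw [Category.comp_id, Category.comp_id, Category.comp_id, ← h1]
    simp only [wh, ← Category.assoc, ← whiskerLeft_comp, h3]
    simp
  rw [h4, whiskerLeft_comp]
  simp only [Category.assoc]
  refine congrArg (fun z => C ◁ T ≫ z) ?_
  have h5 : wh V (bin lX Γ ≫ 𝟙 _) T' ≫ T ≫ sw V X Γ = wh V (bin lX Γ ≫ 𝟙 _) (sw V X Γ ≫ 𝟙 _) := by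
    rw [wh_comp, reassoc_of% h2, Category.comp_id (sw V X Γ)]
  simp only [Category.assoc, wh_comp] at h5 ⊢
  simp only [h5]
  apply eq_of_comp_id
  simp [-sw_sw_bin, -sw_sw_bin_wh, sw_bin_over, swi_sw]
  rw [← sw_wh, swi_sw]

lemma twist_sw_right : 
    (wh V (wh X (cobin Δ[B] Γ ≫ 𝟙 _) (sw X B (B ⊗ Γ) ≫ wh B (bin rX Γ ≫ 𝟙 _) (𝟙 _))) (bin rV _ ≫ 𝟙 _)) ≫
      twist rV lX (E.coevaluation' ≫ 𝒮[B] ▷ C) Γ ≫ sw V X Γ =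
    (twist rV lX (E.coevaluation' ≫ 𝒮[B] ▷ C) (B ⊗ Γ) ≫ sw V X (B ⊗ Γ)) ≫
      (wh X (wh V (cobin Δ[B] Γ ≫ 𝟙 _) (sw V B (B ⊗ Γ) ≫ wh B (bin rV Γ ≫ 𝟙 _) (𝟙 _))) (bin rX _ ≫ 𝟙 _)) := by
  have h1 := twist_right E hE hV hX (Γ := Γ) (𝟙 _)
  have h2 := twist_twist_antipode E hE hV hX (Γ := Γ)
  have h3 := twist_antipode_twist E hE hV hX (Γ := B ⊗ Γ)
  generalize twist rV lX (E.coevaluation' ≫ 𝒮[B] ▷ C) Γ = T at *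
  generalize twist rV lX E.coevaluation' Γ = T' at *
  generalize twist rV lX (E.coevaluation' ≫ 𝒮[B] ▷ C) (B ⊗ Γ) = S at *
  generalize twist rV lX E.coevaluation' (B ⊗ Γ) = S' at *
  have h4 := congrArg (fun z => S ≫ z ≫ T ≫ sw V X Γ) h1
  simp only [Category.assoc, reassoc_of% h3] at h4
  have h5 : wh V (bin rX Γ ≫ 𝟙 _) (T' ≫ 𝟙 _) ≫ T ≫ sw V X Γ = wh V (bin rX Γ ≫ 𝟙 _) (sw V X Γ ≫ 𝟙 _) := by
    rw [wh_comp, Category.assoc, Category.id_comp, reassoc_of% h2, Category.comp_id (sw V X Γ)]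
  rw [h4, Category.assoc]
  congr 1
  simp only [Category.assoc, wh_comp] at h5 ⊢
  simp only [h5]
  apply eq_of_comp_id
  simp [-sw_sw_bin, -sw_sw_bin_wh, sw_bin_over, sw_bin_over_comp_wh, swi_sw]

end

end Rigid

/-! ### The braided category of crossed bimodules in the rigid case. -/

section RigidBraided
variable {𝒞 : Type w} [Category.{v} 𝒞] [MonoidalCategory 𝒞] [BraidedCategory 𝒞]
variable {Γ W W' Q C B X Y Z V V' : 𝒞} [HopfObj C] [HopfObj B] {p : DualPairing C B} 
variable (E : ExactPairing B C) (hE : E.evaluation' = p.ev)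

/-- The braiding `V ⊗ X ⟶ X ⊗ V` twisted by a copairing. -/
def twistBraid (r : V ⊗ B ⟶ V) (l : C ⊗ X ⟶ X) (q : 𝟙_ 𝒞 ⟶ B ⊗ C) : V ⊗ X ⟶ X ⊗ V :=
  V ◁ ((λ_ X).inv ≫ q ▷ X ≫ (α_ B C X).hom ≫ 𝒮[B] ▷ (C ⊗ X)) ≫
    (α_ V B (C ⊗ X)).inv ≫ (r ⊗ₘ l) ≫ (β_ V X).hom

lemma twistBraid_context (r : V ⊗ B ⟶ V) (l : C ⊗ X ⟶ X) (q : 𝟙_ 𝒞 ⟶ B ⊗ C) (Γ : 𝒞) :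
    twistBraid r l q ▷ Γ = (α_ V X Γ).hom ≫
      (twist r l (q ≫ 𝒮[B] ▷ C) Γ ≫ sw V X Γ) ≫ (α_ X V Γ).inv := by
  simp only [twistBraid, twist, wh, conil₂, cobin, bin, sw, MonoidalCategory.tensorHom_def]
  monoidal

lemma tensorLeftAct_context [ComonObj C] (l : C ⊗ V ⟶ V') (l' : C ⊗ W ⟶ W') (Γ : 𝒞) :
    tensorLeftAct l l' ▷ Γ = (α_ C _ Γ).hom ≫ C ◁ (α_ V W Γ).hom ≫
      (cobin Δ[C] (V ⊗ (W ⊗ Γ)) ≫ wh C (sw C V (W ⊗ Γ) ≫ wh V (bin l' Γ ≫ 𝟙 _) (𝟙 _)) (bin l _ ≫ 𝟙 _)) ≫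
        (α_ V' W' Γ).inv := by
  simp only [tensorLeftAct, tensorμ, MonoidalCategory.tensorHom_def', bin, cobin, sw, wh]; monoidal

lemma tensorRightAct_context [ComonObj B] (r : V ⊗ B ⟶ V') (r' : W ⊗ B ⟶ W') (Γ : 𝒞) :
    tensorRightAct r r' ▷ Γ = (α_ _ B Γ).hom ≫ (α_ V W (B ⊗ Γ)).hom ≫
      (wh V (wh W (cobin Δ[B] Γ ≫ 𝟙 _) (sw W B (B ⊗ Γ) ≫ wh B (bin r' Γ ≫ 𝟙 _) (𝟙 _))) (bin r _ ≫ 𝟙 _)) ≫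
        (α_ V' W' Γ).inv := by
  simp only [tensorRightAct, tensorμ, MonoidalCategory.tensorHom_def', bin, cobin, sw, wh]; monoidal

lemma rigidBraiding_context (q : 𝟙_ 𝒞 ⟶ B ⊗ C) (V X : CrossedBimodule p) (Γ : 𝒞) :
    rigidBraiding q V X ▷ Γ = (α_ V.V X.V Γ).hom ≫
      (twist V.right X.left (q ≫ 𝒮[B] ▷ C) Γ ≫ sw V.V X.V Γ) ≫ (α_ X.V V.V Γ).inv :=
  twistBraid_context _ _ _ _

lemma eq_of_whiskerRight_unit {f g : X ⟶ Y} (h : f ▷ 𝟙_ 𝒞 = g ▷ 𝟙_ 𝒞) : f = g := by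
  simpa [MonoidalCategory.whiskerRight_id] using h

lemma rigidBraiding_eq (q : 𝟙_ 𝒞 ⟶ B ⊗ C) (V X : CrossedBimodule p) :
    rigidBraiding q V X = V.V ◁ (ρ_ X.V).inv ≫ (twist V.right X.left (q ≫ 𝒮[B] ▷ C) (𝟙_ 𝒞) ≫
      sw V.V X.V (𝟙_ 𝒞)) ≫ X.V ◁ (ρ_ V.V).hom := by
  apply eq_of_whiskerRight_unit
  rw [rigidBraiding_context]
  simp only [comp_whiskerRight]
  generalize twist V.right X.left (q ≫ 𝒮[B] ▷ C) (𝟙_ 𝒞) = T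
  generalize sw V.V X.V (𝟙_ 𝒞) = T'
  monoidal

lemma rigidBraiding_naturality_right (q : 𝟙_ 𝒞 ⟶ B ⊗ C) (X : CrossedBimodule p) {Y Z : CrossedBimodule p} (f : Y ⟶ Z) :
    X.V ◁ f.hom ≫ rigidBraiding q X Z = rigidBraiding q X Y ≫ f.hom ▷ X.V := by
  have e : f.hom ≫ (λ_ Z.V).inv ≫ q ▷ Z.V ≫ (α_ B C Z.V).hom ≫ 𝒮[B] ▷ (C ⊗ Z.V) =
      ((λ_ Y.V).inv ≫ q ▷ Y.V ≫ (α_ B C Y.V).hom ≫ 𝒮[B] ▷ (C ⊗ Y.V)) ≫ B ◁ C ◁ f.hom := by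
    rw [leftUnitor_inv_naturality_assoc, whisker_exchange_assoc, associator_naturality_right_assoc,
      whisker_exchange]
    simp only [Category.assoc]
  simp only [rigidBraiding]
  rw [← whiskerLeft_comp_assoc, e, whiskerLeft_comp_assoc, Category.assoc, Category.assoc, Category.assoc,
    ← BraidedCategory.braiding_naturality_right, MonoidalCategory.tensorHom_def, MonoidalCategory.tensorHom_def]
  simp only [Category.assoc]
  rw [associator_inv_naturality_right_assoc, whisker_exchange_assoc,
    ← whiskerLeft_comp_assoc X.V Y.left, f.left_comm]
  simp only [whiskerLeft_comp, Category.assoc]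

lemma rigidBraiding_naturality_left (q : 𝟙_ 𝒞 ⟶ B ⊗ C) {X Y : CrossedBimodule p} (f : X ⟶ Y) (Z : CrossedBimodule p) :
    f.hom ▷ Z.V ≫ rigidBraiding q Y Z = rigidBraiding q X Z ≫ Z.V ◁ f.hom := by
  simp only [rigidBraiding]
  rw [Category.assoc, Category.assoc, Category.assoc,
    ← BraidedCategory.braiding_naturality_left, MonoidalCategory.tensorHom_def', MonoidalCategory.tensorHom_def']
  rw [Category.assoc, Category.assoc, ← whisker_exchange_assoc, associator_inv_naturality_left_assoc,
    ← whisker_exchange_assoc, ← comp_whiskerRight_assoc (f.hom ▷ B), ← f.right_comm, comp_whiskerRight_assoc]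

lemma twist_tensor_right (r : V ⊗ B ⟶ V') (l : C ⊗ X ⟶ Y) (l' : C ⊗ W ⟶ Z) (q : 𝟙_ 𝒞 ⟶ B ⊗ C) (Γ : 𝒞) :
    V ◁ (α_ X W Γ).inv ≫ twist r (tensorLeftAct l l') q Γ ≫ sw V' (Y ⊗ Z) Γ ≫ (α_ Y Z _).hom =
    wh V (conil₂ q (X ⊗ (W ⊗ Γ)) ≫ 𝟙 _) (bin r _ ≫
      wh V' (cobin Δ[C] _ ≫ wh C (sw C X _ ≫ wh X (bin l' Γ ≫ 𝟙 _) (𝟙 _)) (bin l _ ≫ 𝟙 _))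
        (sw V' Y _ ≫ wh Y (sw V' Z Γ ≫ 𝟙 _) (𝟙 _))) := by
  simp only [twist, sw, wh, bin, conil₂, cobin, BraidedCategory.braiding_tensor_right_hom, tensorLeftAct, tensorμ, MonoidalCategory.tensorHom_def']
  monoidal

lemma twist_tensor_left (r : V ⊗ B ⟶ V') (r' : X ⊗ B ⟶ Y) (l : C ⊗ W ⟶ Z) (q : 𝟙_ 𝒞 ⟶ B ⊗ C) (Γ : 𝒞) :
    (α_ V X _).inv ≫ twist (tensorRightAct r r') l q Γ ≫ sw (V' ⊗ Y) Z Γ ≫ Z ◁ (α_ V' Y Γ).hom =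
    wh V (wh X (conil₂ q (W ⊗ Γ) ≫ cobin Δ[B] _ ≫ 𝟙 _) (sw X B _ ≫ 
      wh B (bin r' _ ≫ 𝟙 _) (𝟙 _))) (bin r _ ≫ wh V' (wh Y (bin l Γ ≫ 𝟙 _) (𝟙 _)) 
        (wh V' (sw Y Z Γ ≫ 𝟙 _) (sw V' Z _ ≫ 𝟙 _))) := by
  simp only [twist, sw, wh, bin, conil₂, cobin, BraidedCategory.braiding_tensor_left_hom, tensorRightAct, tensorμ, MonoidalCategory.tensorHom_def']
  monoidal

section
include hE

lemma twistBraid_hexagon_forward {lX : C ⊗ X ⟶ X} {r : X ⊗ B ⟶ X} (hX : IsCrossedBimodule p lX r)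
    (l : C ⊗ Y ⟶ Y) (l' : C ⊗ Z ⟶ Z) :
    (α_ X Y Z).hom ≫ twistBraid r (tensorLeftAct l l') E.coevaluation' ≫ (α_ Y Z X).hom =
      twistBraid r l E.coevaluation' ▷ Z ≫ (α_ Y X Z).hom ≫ Y ◁ twistBraid r l' E.coevaluation' := by
  apply eq_of_whiskerRight_unit
  have h := twist_hexagon_forward E hE hX (lX := l) (lZ := l') (Γ := 𝟙_ 𝒞) (𝟙 _)
  rw [← twist_tensor_right] at h
  have e {P Q : 𝒞} (f : P ⟶ Q) : f ▷ Z ▷ 𝟙_ 𝒞 = (α_ _ _ _).hom ≫ f ▷ (Z ⊗ 𝟙_ 𝒞) ≫ (α_ _ _ _).inv := by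
    simp [MonoidalCategory.whiskerRight_tensor]
  simp only [comp_whiskerRight, whisker_assoc]
  rw [e, twistBraid_context, twistBraid_context, twistBraid_context]
  simp only [wh, Category.comp_id] at h
  have h2 := congrArg (fun z => (α_ (X ⊗ Y) Z (𝟙_ 𝒞)).hom ≫ (α_ X Y (Z ⊗ 𝟙_ 𝒞)).hom ≫ z ≫
    (α_ Y Z (X ⊗ 𝟙_ 𝒞)).inv ≫ (α_ (Y ⊗ Z) X (𝟙_ 𝒞)).inv ≫ (α_ Y Z X).hom ▷ 𝟙_ 𝒞) h
  -- With twists and crossings opaque, both sides differ by coherence isomorphisms only.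
  generalize twist r (tensorLeftAct l l') (E.coevaluation' ≫ 𝒮[B] ▷ C) (𝟙_ 𝒞) = T1 at *
  generalize twist r l (E.coevaluation' ≫ 𝒮[B] ▷ C) (Z ⊗ 𝟙_ 𝒞) = T2 at *
  generalize twist r l' (E.coevaluation' ≫ 𝒮[B] ▷ C) (𝟙_ 𝒞) = T3 at *
  generalize sw X Y (Z ⊗ 𝟙_ 𝒞) = T5 at *
  generalize sw X Z (𝟙_ 𝒞) = T6 at *
  generalize sw X (Y ⊗ Z) (𝟙_ 𝒞) = T4 at *
  refine Eq.trans ?_ (h2.trans ?_) <;> monoidal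

lemma twistBraid_hexagon_reverse {lX : C ⊗ X ⟶ X} {r : X ⊗ B ⟶ X} (hX : IsCrossedBimodule p lX r)
    (r' : Y ⊗ B ⟶ Y) {l' : C ⊗ Z ⟶ Z} {rZ : Z ⊗ B ⟶ Z} (hZ : IsCrossedBimodule p l' rZ) :
    (α_ X Y Z).inv ≫ twistBraid (tensorRightAct r r') l' E.coevaluation' ≫ (α_ Z X Y).inv =
      X ◁ twistBraid r' l' E.coevaluation' ≫ (α_ X Z Y).inv ≫ twistBraid r l' E.coevaluation' ▷ Y := by
  apply eq_of_whiskerRight_unit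
  have h := twist_hexagon_reverse E hE hX (rX := r') hZ (Γ := 𝟙_ 𝒞) (𝟙 _)
  rw [← twist_tensor_left] at h
  have e {P Q : 𝒞} (f : P ⟶ Q) : f ▷ Y ▷ 𝟙_ 𝒞 = (α_ _ _ _).hom ≫ f ▷ (Y ⊗ 𝟙_ 𝒞) ≫ (α_ _ _ _).inv := by
    simp [MonoidalCategory.whiskerRight_tensor]
  simp only [comp_whiskerRight, whisker_assoc]
  rw [e, twistBraid_context, twistBraid_context, twistBraid_context]
  simp only [wh, Category.comp_id] at h
  have h2 := congrArg (fun z => (α_ X Y Z).inv ▷ 𝟙_ 𝒞 ≫ (α_ (X ⊗ Y) Z (𝟙_ 𝒞)).hom ≫ 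
    (α_ X Y (Z ⊗ 𝟙_ 𝒞)).hom ≫ z ≫ Z ◁ (α_ X Y (𝟙_ 𝒞)).inv ≫ (α_ Z (X ⊗ Y) (𝟙_ 𝒞)).inv ≫
      (α_ Z X Y).inv ▷ 𝟙_ 𝒞) h
  generalize twist (tensorRightAct r r') l' (E.coevaluation' ≫ 𝒮[B] ▷ C) (𝟙_ 𝒞) = T1 at *
  generalize twist r' l' (E.coevaluation' ≫ 𝒮[B] ▷ C) (𝟙_ 𝒞) = T2 at *
  generalize twist r l' (E.coevaluation' ≫ 𝒮[B] ▷ C) (Y ⊗ 𝟙_ 𝒞) = T3 at *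
  generalize sw (X ⊗ Y) Z (𝟙_ 𝒞) = T4 at *
  generalize sw Y Z (𝟙_ 𝒞) = T5 at *
  generalize sw X Z (Y ⊗ 𝟙_ 𝒞) = T6 at *
  refine Eq.trans ?_ (h2.trans ?_) <;> monoidal

lemma rigidBraiding_left (V X : CrossedBimodule p) :
    tensorLeftAct V.left X.left ≫ rigidBraiding E.coevaluation' V X =
      C ◁ rigidBraiding E.coevaluation' V X ≫ tensorLeftAct X.left V.left := by
  apply eq_of_whiskerRight_unit
  have h := twist_sw_left E hE V.isCrossed X.isCrossed (Γ := 𝟙_ 𝒞)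
  rw [comp_whiskerRight, comp_whiskerRight, whisker_assoc, tensorLeftAct_context, tensorLeftAct_context,
    rigidBraiding_context]
  have h' := congrArg (fun z => (α_ C _ _).hom ≫ C ◁ (α_ V.V X.V _).hom ≫ z ≫ (α_ X.V V.V _).inv) h
  simp only [Category.assoc, whiskerLeft_comp, Iso.inv_hom_id_assoc, whiskerLeft_inv_hom_assoc] at h' ⊢
  exact h'

lemma rigidBraiding_right (V X : CrossedBimodule p) :
    tensorRightAct V.right X.right ≫ rigidBraiding E.coevaluation' V X =
      rigidBraiding E.coevaluation' V X ▷ B ≫ tensorRightAct X.right V.right := by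
  apply eq_of_whiskerRight_unit
  have e {P Q : 𝒞} (f : P ⟶ Q) : f ▷ B ▷ 𝟙_ 𝒞 = (α_ _ _ _).hom ≫ f ▷ (B ⊗ 𝟙_ 𝒞) ≫ (α_ _ _ _).inv := by
    simp [MonoidalCategory.whiskerRight_tensor, Category.comp_id]
  have h := twist_sw_right E hE V.isCrossed X.isCrossed (Γ := 𝟙_ 𝒞)
  rw [comp_whiskerRight, comp_whiskerRight, e, tensorRightAct_context, tensorRightAct_context,
    rigidBraiding_context, rigidBraiding_context]
  have h' := congrArg (fun z => (α_ _ B _).hom ≫ (α_ V.V X.V _).hom ≫ z ≫ (α_ X.V V.V _).inv) h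
  simp only [Category.assoc, Iso.inv_hom_id_assoc] at h' ⊢
  exact h'

/-- The braiding is invertible. -/
def rigidBraidingIso (V X : CrossedBimodule p) : V.V ⊗ X.V ≅ X.V ⊗ V.V where
  hom := rigidBraiding E.coevaluation' V X
  inv := X.V ◁ (ρ_ V.V).inv ≫ swi V.V X.V (𝟙_ 𝒞) ≫ twist V.right X.left E.coevaluation' (𝟙_ 𝒞) ≫ V.V ◁ (ρ_ X.V).hom
  hom_inv_id := by
    rw [rigidBraiding_eq]
    have h := twist_antipode_twist E hE V.isCrossed X.isCrossed (Γ := 𝟙_ 𝒞)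
    simp only [Category.assoc, whiskerLeft_hom_inv_assoc, sw_swi, reassoc_of% h, whiskerLeft_inv_hom]
  inv_hom_id := by
    rw [rigidBraiding_eq]
    have h := twist_twist_antipode E hE V.isCrossed X.isCrossed (Γ := 𝟙_ 𝒞)
    simp only [Category.assoc, whiskerLeft_hom_inv_assoc, swi_sw, reassoc_of% h, whiskerLeft_inv_hom]

/-- Crossed bimodules are braided when `B` is rigid. -/
abbrev rigidBraided : BraidedCategory (CrossedBimodule p) where
  braiding V X := CrossedBimodule.isoMk (rigidBraidingIso E hE V X) (rigidBraiding_left E hE V X)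
    (rigidBraiding_right E hE V X)
  braiding_naturality_right X Y Z f := by
    ext
    change (𝟙 X.V ⊗ₘ f.hom) ≫ rigidBraiding E.coevaluation' X Z = rigidBraiding E.coevaluation' X Y ≫ (f.hom ⊗ₘ 𝟙 X.V)
    rw [MonoidalCategory.id_tensorHom, MonoidalCategory.tensorHom_id, rigidBraiding_naturality_right]
  braiding_naturality_left {X Y} f Z := by
    ext
    change (f.hom ⊗ₘ 𝟙 Z.V) ≫ rigidBraiding E.coevaluation' Y Z = rigidBraiding E.coevaluation' X Z ≫ (𝟙 Z.V ⊗ₘ f.hom)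
    rw [MonoidalCategory.id_tensorHom, MonoidalCategory.tensorHom_id, rigidBraiding_naturality_left]
  hexagon_forward X Y Z := by
    ext
    change (α_ X.V Y.V Z.V).hom ≫ rigidBraiding E.coevaluation' X (CrossedBimodule.tensorObj Y Z) ≫ (α_ Y.V Z.V X.V).hom = 
      (rigidBraiding E.coevaluation' X Y ⊗ₘ 𝟙 Z.V) ≫ (α_ Y.V X.V Z.V).hom ≫ (𝟙 Y.V ⊗ₘ rigidBraiding E.coevaluation' X Z)
    rw [MonoidalCategory.id_tensorHom, MonoidalCategory.tensorHom_id]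
    exact twistBraid_hexagon_forward E hE X.isCrossed Y.left Z.left
  hexagon_reverse X Y Z := by
    ext
    change (α_ X.V Y.V Z.V).inv ≫ rigidBraiding E.coevaluation' (CrossedBimodule.tensorObj X Y) Z ≫ (α_ Z.V X.V Y.V).inv = 
      (𝟙 X.V ⊗ₘ rigidBraiding E.coevaluation' Y Z) ≫ (α_ X.V Z.V Y.V).inv ≫ (rigidBraiding E.coevaluation' X Z ⊗ₘ 𝟙 Y.V)
    rw [MonoidalCategory.id_tensorHom, MonoidalCategory.tensorHom_id]
    exact twistBraid_hexagon_reverse E hE X.isCrossed Y.right Z.isCrossed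
end
end RigidBraided

/-! ### Choosing finite sums that represent tensors, and multilinear maps on them. -/

lemma exists_sum_tmul {k : Type u} [CommRing k] {M N : Type u} [AddCommGroup M] [Module k M]
    [AddCommGroup N] [Module k N] (x : M ⊗[k] N) :
    ∃ (n : ℕ) (f : Fin n → M) (g : Fin n → N), x = ∑ i, f i ⊗ₜ g i := by
  induction x with
  | zero => exact ⟨0, Fin.elim0, Fin.elim0, by simp⟩
  | tmul a b => exact ⟨1, fun _ => a, fun _ => b, by simp⟩
  | add x y hx hy =>
    obtain ⟨n, f, g, rfl⟩ := hx
    obtain ⟨m, f', g', rfl⟩ := hy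
    exact ⟨n + m, Fin.append f f', Fin.append g g', by simp [Fin.sum_univ_add]⟩

def Rep₂.some {k : Type u} [CommRing k] {M N : Type u} [AddCommGroup M] [Module k M]
    [AddCommGroup N] [Module k N] (x : M ⊗[k] N) : Rep₂ x :=
  ⟨_, _, _, (exists_sum_tmul x).choose_spec.choose_spec.choose_spec⟩

lemma exists_sum_tmul₃ {k : Type u} [CommRing k] {M N P : Type u} [AddCommGroup M] [Module k M]
    [AddCommGroup N] [Module k N] [AddCommGroup P] [Module k P] (x : M ⊗[k] (N ⊗[k] P)) :
    ∃ (n : ℕ) (f : Fin n → M) (g : Fin n → N) (h : Fin n → P), x = ∑ i, f i ⊗ₜ (g i ⊗ₜ h i) := by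
  induction x with
  | zero => exact ⟨0, Fin.elim0, Fin.elim0, Fin.elim0, by simp⟩
  | tmul a b =>
    obtain ⟨n, f, g, rfl⟩ := exists_sum_tmul b
    exact ⟨n, fun _ => a, f, g, by simp [TensorProduct.tmul_sum]⟩
  | add x y hx hy =>
    obtain ⟨n, f, g, h, rfl⟩ := hx
    obtain ⟨m, f', g', h', rfl⟩ := hy
    exact ⟨n + m, Fin.append f f', Fin.append g g', Fin.append h h', by simp [Fin.sum_univ_add]⟩

def Rep₃.some {k : Type u} [CommRing k] {M N P : Type u} [AddCommGroup M] [Module k M]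
    [AddCommGroup N] [Module k N] [AddCommGroup P] [Module k P] (x : M ⊗[k] (N ⊗[k] P)) : Rep₃ x :=
  ⟨_, _, _, _, (exists_sum_tmul₃ x).choose_spec.choose_spec.choose_spec.choose_spec⟩

/-- A bilinear map from a function that is bilinear. -/
def mk₂ {k : Type u} [CommRing k] {M N P : Type*} [AddCommGroup M] [Module k M]
    [AddCommGroup N] [Module k N] [AddCommGroup P] [Module k P] (f : M → N → P)
    (h₁ : ∀ x x' y, f (x + x') y = f x y + f x' y := by
      intros; simp only [map_add, LinearMap.add_apply, mul_add, add_mul, add_smul, smul_add,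
        TensorProduct.tmul_add, TensorProduct.add_tmul, Finset.sum_add_distrib])
    (h₂ : ∀ (c : k) x y, f (c • x) y = c • f x y := by
      intros; simp only [map_smul, LinearMap.smul_apply, smul_eq_mul, smul_mul_assoc, mul_smul_comm, smul_smul,
        Finset.smul_sum, mul_comm, mul_left_comm, mul_assoc, TensorProduct.tmul_smul, ← TensorProduct.smul_tmul'])
    (h₃ : ∀ x y y', f x (y + y') = f x y + f x y' := by
      intros; simp only [map_add, LinearMap.add_apply, mul_add, add_mul, add_smul, smul_add,
        TensorProduct.tmul_add, TensorProduct.add_tmul, Finset.sum_add_distrib])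
    (h₄ : ∀ (c : k) x y, f x (c • y) = c • f x y := by
      intros; simp only [map_smul, LinearMap.smul_apply, smul_eq_mul, smul_mul_assoc, mul_smul_comm, smul_smul,
        Finset.smul_sum, mul_comm, mul_left_comm, mul_assoc, TensorProduct.tmul_smul, ← TensorProduct.smul_tmul']) :
    M →ₗ[k] N →ₗ[k] P := LinearMap.mk₂ k f h₁ h₂ h₃ h₄

/-- A trilinear map from a function that is trilinear. -/
def mk₃ {k : Type u} [CommRing k] {M N P Q : Type*} [AddCommGroup M] [Module k M]
    [AddCommGroup N] [Module k N] [AddCommGroup P] [Module k P] [AddCommGroup Q] [Module k Q]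
    (f : M → N → P → Q)
    (h₁ : ∀ x x' y z, f (x + x') y z = f x y z + f x' y z := by
      intros; simp only [map_add, LinearMap.add_apply, mul_add, add_mul, add_smul, smul_add,
        TensorProduct.tmul_add, TensorProduct.add_tmul, Finset.sum_add_distrib])
    (h₂ : ∀ (c : k) x y z, f (c • x) y z = c • f x y z := by
      intros; simp only [map_smul, LinearMap.smul_apply, smul_eq_mul, smul_mul_assoc, mul_smul_comm, smul_smul,
        Finset.smul_sum, mul_comm, mul_left_comm, mul_assoc, TensorProduct.tmul_smul, ← TensorProduct.smul_tmul'])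
    (h₃ : ∀ x y y' z, f x (y + y') z = f x y z + f x y' z := by
      intros; simp only [map_add, LinearMap.add_apply, mul_add, add_mul, add_smul, smul_add,
        TensorProduct.tmul_add, TensorProduct.add_tmul, Finset.sum_add_distrib])
    (h₄ : ∀ (c : k) x y z, f x (c • y) z = c • f x y z := by
      intros; simp only [map_smul, LinearMap.smul_apply, smul_eq_mul, smul_mul_assoc, mul_smul_comm, smul_smul,
        Finset.smul_sum, mul_comm, mul_left_comm, mul_assoc, TensorProduct.tmul_smul, ← TensorProduct.smul_tmul'])
    (h₅ : ∀ x y z z', f x y (z + z') = f x y z + f x y z' := by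
      intros; simp only [map_add, LinearMap.add_apply, mul_add, add_mul, add_smul, smul_add,
        TensorProduct.tmul_add, TensorProduct.add_tmul, Finset.sum_add_distrib])
    (h₆ : ∀ (c : k) x y z, f x y (c • z) = c • f x y z := by
      intros; simp only [map_smul, LinearMap.smul_apply, smul_eq_mul, smul_mul_assoc, mul_smul_comm, smul_smul,
        Finset.smul_sum, mul_comm, mul_left_comm, mul_assoc, TensorProduct.tmul_smul, ← TensorProduct.smul_tmul']) :
    M →ₗ[k] N →ₗ[k] P →ₗ[k] Q :=
  LinearMap.mk₂ k (fun x y => { toFun := f x y, map_add' := h₅ x y, map_smul' := fun c => h₆ c x y })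
    (fun x x' y => LinearMap.ext (h₁ x x' y)) (fun c x y => LinearMap.ext (h₂ c x y))
    (fun x y y' => LinearMap.ext (h₃ x y y')) (fun c x y => LinearMap.ext (h₄ c x y))

section
variable {k : Type u} [CommRing k] {M N P Q : Type*} [AddCommGroup M] [Module k M]
    [AddCommGroup N] [Module k N] [AddCommGroup P] [Module k P] [AddCommGroup Q] [Module k Q]

@[simp] lemma mk₂_apply (f : M → N → P) (h₁ h₂ h₃ h₄) (x : M) (y : N) :
    mk₂ (k := k) f h₁ h₂ h₃ h₄ x y = f x y := rfl

@[simp] lemma mk₃_apply (f : M → N → P → Q) (h₁ h₂ h₃ h₄ h₅ h₆) (x : M) (y : N) (z : P) :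
    mk₃ (k := k) f h₁ h₂ h₃ h₄ h₅ h₆ x y z = f x y z := rfl

end

/-! ### Identities for the R-matrix as finite sums. -/

section
variable {k : Type u} [Field k] {H : Type u} [Ring H] [HopfAlgebra k H] [Quasitriangular k H]
variable {M : Type u} [AddCommGroup M] [Module k M]


omit [HopfAlgebra k H] [Quasitriangular k H] in
lemma Rep₂.sum_eq {M N P : Type u} [AddCommGroup M] [Module k M]
    [AddCommGroup N] [Module k N] [AddCommGroup P] [Module k P] {x : M ⊗[k] N} (r : Rep₂ x)
    (g : M →ₗ[k] N →ₗ[k] P) : ∑ i, g (r.fst i) (r.snd i) = TensorProduct.lift g x := by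
  conv_rhs => rw [r.eq]
  simp

lemma Rep₂.sum_congr {M N P : Type u} [AddCommGroup M] [Module k M]
    [AddCommGroup N] [Module k N] [AddCommGroup P] [Module k P] {x : M ⊗[k] N} (r r' : Rep₂ x)
    (g : M →ₗ[k] N →ₗ[k] P) :
    ∑ i, g (r.fst i) (r.snd i) = ∑ i, g (r'.fst i) (r'.snd i) := by
  rw [r.sum_eq, r'.sum_eq]

variable (r : Rep₂ (rMatrix k H))
variable (s : Rep₂ (rMatrixInv k H)) 
variable (k H) in
lemma rMatrix_mul_inv : rMatrix k H * rMatrixInv k H = 1 := Units.mul_inv _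

variable (k H) in
lemma rMatrixInv_mul : rMatrixInv k H * rMatrix k H = 1 := Units.inv_mul _

open Algebra.TensorProduct in
variable (k H) in
-- `R₁₃ R₂₃` is `(Δ ⊗ id) R`; exchanging the first two factors, `R₂₃ R₁₃` is `(τΔ ⊗ id) R`. The
-- relation between `τΔ` and `Δ`, applied in the first two factors, links them through `R₁₂`.
lemma yang_baxter :
    map (.id k H) includeLeft (rMatrix k H) * (map (.id k H) includeRight (rMatrix k H) *
      includeRight (rMatrix k H) : H ⊗[k] (H ⊗[k] H)) =
    (includeRight (rMatrix k H) * map (.id k H) includeRight (rMatrix k H)) *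
      map (.id k H) includeLeft (rMatrix k H) := by
  have h (x : H ⊗[k] H) : map (.id k H) includeLeft x = Algebra.TensorProduct.assoc k k k H H H (x ⊗ₜ[k] (1 : H)) := by
    induction x with
    | zero => simp
    | add x y hx hy => simp [TensorProduct.add_tmul, hx, hy]
    | tmul x y => simp
  have h1 := Quasitriangular.comul_left (k := k) (H := H)
  have h2 : (includeRight (rMatrix k H) * map (.id k H) includeRight (rMatrix k H) : H ⊗[k] (H ⊗[k] H)) =
    Algebra.TensorProduct.leftComm k H H H (map (.id k H) includeRight (rMatrix k H) * includeRight (rMatrix k H)) := by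
    rw [map_mul]
    congr 1
    · generalize rMatrix k H = x
      induction x with
      | zero => simp
      | add x y hx hy => simp only [map_add, hx, hy]
      | tmul x y => simp
    · generalize rMatrix k H = x
      induction x with
      | zero => simp
      | add x y hx hy => simp only [map_add, hx, hy]
      | tmul x y => simp
  rw [h2]
  rw [show map (.id k H) includeRight (rMatrix k H) * includeRight (rMatrix k H) = _ from h1.symm]
  rw [h]
  generalize (Quasitriangular.R (k := k) (H := H) : H ⊗[k] H) = t
  induction t with
  | zero => simp
  | add x y hx hy => simp only [map_add, mul_add, add_mul, hx, hy]
  | tmul x y =>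
    have e (z : H ⊗[k] H) : Algebra.TensorProduct.leftComm k H H H (TensorProduct.assoc k H H H (z ⊗ₜ y)) =
      Algebra.TensorProduct.assoc k k k H H H (TensorProduct.comm k H H z ⊗ₜ y) := by
      induction z with
      | zero => simp
      | add x y hx hy => simp only [map_add, TensorProduct.add_tmul, hx, hy]
      | tmul x y => simp
    have e' (z : H ⊗[k] (H ⊗[k] H)) : TensorProduct.assoc k H H H ((TensorProduct.assoc k H H H).symm z) = z := by simp
    rw [TensorProduct.map_tmul, LinearMap.id_apply, e, ← map_mul, Algebra.TensorProduct.tmul_mul_tmul, mul_one]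
    rw [show TensorProduct.comm k H H (Coalgebra.comul x) * rMatrix k H = _ from Quasitriangular.comm_comul x |>.trans rfl] 
    rw [show TensorProduct.assoc k H H H (Coalgebra.comul x ⊗ₜ[k] y) = Algebra.TensorProduct.assoc k k k H H H (Coalgebra.comul x ⊗ₜ[k] y) from rfl, ← map_mul,  Algebra.TensorProduct.tmul_mul_tmul, one_mul]
    rfl

section sums
variable (g : H →ₗ[k] H →ₗ[k] H →ₗ[k] M)


def lift₃ : H ⊗[k] (H ⊗[k] H) →ₗ[k] M :=
  TensorProduct.lift (TensorProduct.uncurry (.id k) H H M ∘ₗ g)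

@[simp] lemma lift₃_tmul (a b c : H) : lift₃ g (a ⊗ₜ (b ⊗ₜ c)) = g a b c := by simp [lift₃]

lemma Rep₂.tensor_map {M N M' N' : Type u} [AddCommGroup M] [Module k M]
    [AddCommGroup N] [Module k N] [AddCommGroup M'] [Module k M']
    [AddCommGroup N'] [Module k N'] {x : M ⊗[k] N} (r : Rep₂ x) (f : M →ₗ[k] M') (f' : N →ₗ[k] N') :
    TensorProduct.map f f' x = ∑ i, f (r.fst i) ⊗ₜ f' (r.snd i) := by
  conv_lhs => rw [r.eq]
  simp

variable (d : ∀ h : H, Rep₂ (Coalgebra.comul (R := k) h))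

open Algebra.TensorProduct 
lemma sum_R12 {x} (r : Rep₂ x) : map (.id k H) (includeLeft : H →ₐ[k] H ⊗[k] H) x = ∑ i, r.fst i ⊗ₜ (r.snd i ⊗ₜ 1) :=
  r.tensor_map _ _
lemma sum_R13 {x} (r : Rep₂ x) : map (.id k H) (includeRight : H →ₐ[k] H ⊗[k] H) x = ∑ i, r.fst i ⊗ₜ (1 ⊗ₜ r.snd i) :=
  r.tensor_map _ _
lemma sum_R23 {x} (r : Rep₂ x) : (includeRight : (H ⊗[k] H) →ₐ[k] H ⊗[k] (H ⊗[k] H)) x = ∑ i, 1 ⊗ₜ (r.fst i ⊗ₜ r.snd i) := by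
  conv_lhs => rw [r.eq]
  simp

lemma comul_fst_rMatrix :
    ∑ i, ∑ m, g ((d (r.fst i)).fst m) ((d (r.fst i)).snd m) (r.snd i) =
      ∑ i, ∑ j, g (r.fst i) (r.fst j) (r.snd i * r.snd j) := by
  have h := congrArg (lift₃ g) (Quasitriangular.comul_left (k := k) (H := H))
  rw [show (Quasitriangular.R (k := k) (H := H) : H ⊗[k] H) = rMatrix k H from rfl, r.tensor_map, sum_R13 r, sum_R23 r] at h
  simp only [Finset.sum_mul_sum, tmul_mul_tmul, one_mul, mul_one, map_sum, lift₃_tmul] at h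
  rw [← h]
  refine Finset.sum_congr rfl fun i _ => ?_
  conv_rhs => rw [(d (r.fst i)).eq]
  simp [TensorProduct.sum_tmul]

lemma comul_snd_rMatrix :
    ∑ i, ∑ m, g (r.fst i) ((d (r.snd i)).fst m) ((d (r.snd i)).snd m)  =
      ∑ i, ∑ j, g (r.fst i * r.fst j) (r.snd j) (r.snd i) := by
  have h := congrArg (lift₃ g) (Quasitriangular.comul_right (k := k) (H := H))
  rw [show (Quasitriangular.R (k := k) (H := H) : H ⊗[k] H) = rMatrix k H from rfl, r.tensor_map, sum_R13 r, sum_R12 r] at h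
  simp only [Finset.sum_mul_sum, tmul_mul_tmul, one_mul, mul_one, map_sum, lift₃_tmul] at h
  rw [← h]
  refine Finset.sum_congr rfl fun i _ => ?_
  conv_rhs => rw [(d (r.snd i)).eq]
  simp [TensorProduct.tmul_sum]

lemma yang_baxter_sum :
    ∑ i, ∑ j, ∑ l, g (r.fst i * r.fst j) (r.snd i * r.fst l) (r.snd j * r.snd l) =
      ∑ l, ∑ i, ∑ j, g (r.fst j * r.fst i) (r.fst l * r.snd i) (r.snd l * r.snd j) := by
  have h := congrArg (lift₃ g) (yang_baxter k H)
  rw [sum_R13 r, sum_R23 r, sum_R12 r, Finset.sum_mul_sum, Finset.sum_mul_sum, Finset.sum_mul_sum,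
    Finset.sum_mul_sum] at h
  simpa only [Finset.mul_sum, Finset.sum_mul, tmul_mul_tmul, one_mul, mul_one, map_sum, lift₃_tmul] using h

variable (k H) in
lemma yang_baxter_inv :
    map (.id k H) includeLeft (rMatrixInv k H) * (map (.id k H) includeRight (rMatrixInv k H) *
      includeRight (rMatrixInv k H) : H ⊗[k] (H ⊗[k] H)) =
    (includeRight (rMatrixInv k H) * map (.id k H) includeRight (rMatrixInv k H)) *
      map (.id k H) includeLeft (rMatrixInv k H) := by
  have h₁ (f : H ⊗[k] H →ₐ[k] H ⊗[k] (H ⊗[k] H)) (x) : f (rMatrix k H) * (f (rMatrixInv k H) * x) = x := by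
    rw [← mul_assoc, ← map_mul, rMatrix_mul_inv, map_one, one_mul]
  have h₂ (f : H ⊗[k] H →ₐ[k] H ⊗[k] (H ⊗[k] H)) (x) : f (rMatrixInv k H) * (f (rMatrix k H) * x) = x := by
    rw [← mul_assoc, ← map_mul, rMatrixInv_mul, map_one, one_mul]
  have h₃ (f : H ⊗[k] H →ₐ[k] H ⊗[k] (H ⊗[k] H)) : f (rMatrix k H) * (f (rMatrixInv k H)) = 1 := by
    rw [← map_mul, rMatrix_mul_inv, map_one]
  have h₄ (f : H ⊗[k] H →ₐ[k] H ⊗[k] (H ⊗[k] H)) : f (rMatrixInv k H) * (f (rMatrix k H)) = 1 := by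
    rw [← map_mul, rMatrixInv_mul, map_one]
  refine left_inv_eq_right_inv (a := map (.id k H) includeLeft (rMatrix k H) * (map (.id k H) includeRight (rMatrix k H) *
      includeRight (rMatrix k H) : H ⊗[k] (H ⊗[k] H))) ?_ ?_
  · rw [yang_baxter]; simp only [mul_assoc, h₂, h₄]
  · simp only [mul_assoc, h₁, h₃]

lemma yang_baxter_inv_sum :
    ∑ i, ∑ j, ∑ l, g (s.fst i * s.fst j) (s.snd i * s.fst l) (s.snd j * s.snd l) =
      ∑ l, ∑ i, ∑ j, g (s.fst j * s.fst i) (s.fst l * s.snd i) (s.snd l * s.snd j) := by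
  have h := congrArg (lift₃ g) (yang_baxter_inv k H)
  rw [sum_R13 s, sum_R23 s, sum_R12 s, Finset.sum_mul_sum, Finset.sum_mul_sum, Finset.sum_mul_sum,
    Finset.sum_mul_sum] at h
  simpa only [Finset.mul_sum, Finset.sum_mul, tmul_mul_tmul, one_mul, mul_one, map_sum, lift₃_tmul] using h

lemma comul_snd_rMatrixInv' : map (.id k H) (Bialgebra.comulAlgHom k H) (rMatrixInv k H) =
    map (.id k H) includeLeft (rMatrixInv k H) * map (.id k H) includeRight (rMatrixInv k H) := by
  refine left_inv_eq_right_inv (a := map (.id k H) (Bialgebra.comulAlgHom k H) (rMatrix k H)) ?_ ?_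
  · rw [← map_mul, rMatrixInv_mul, map_one]
  · rw [show map (.id k H) (Bialgebra.comulAlgHom k H) (rMatrix k H) = _ from Quasitriangular.comul_right (k := k) (H := H)]
    change map (.id k H) includeRight (rMatrix k H) * map (.id k H) includeLeft (rMatrix k H) * _ = 1
    rw [mul_assoc, ← mul_assoc (map _ includeLeft _), ← map_mul, rMatrix_mul_inv, map_one, one_mul, ← map_mul, rMatrix_mul_inv, map_one]

lemma comul_snd_rMatrixInv :
    ∑ i, ∑ m, g (s.fst i) ((d (s.snd i)).fst m) ((d (s.snd i)).snd m)  =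
      ∑ i, ∑ j, g (s.fst i * s.fst j) (s.snd i) (s.snd j) := by
  have h := congrArg (lift₃ g) (comul_snd_rMatrixInv' (k := k) (H := H))
  rw [sum_R13 s, sum_R12 s] at h
  rw [show (map (.id k H) (Bialgebra.comulAlgHom k H) (rMatrixInv k H)) = _ from s.tensor_map LinearMap.id Coalgebra.comul] at h
  simp only [Finset.sum_mul_sum, tmul_mul_tmul, one_mul, mul_one, map_sum, lift₃_tmul] at h
  rw [← h]
  refine Finset.sum_congr rfl fun i _ => ?_
  conv_rhs => rw [(d (s.snd i)).eq]
  simp [TensorProduct.tmul_sum]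

lemma comul_fst_rMatrixInv' : map (Bialgebra.comulAlgHom k H) (.id k H) (rMatrixInv k H) =
    (Algebra.TensorProduct.assoc k k k H H H).symm (includeRight (rMatrixInv k H) *
      map (.id k H) includeRight (rMatrixInv k H)) := by
  refine left_inv_eq_right_inv (a := map (Bialgebra.comulAlgHom k H) (.id k H) (rMatrix k H)) ?_ ?_
  · rw [← map_mul, rMatrixInv_mul, map_one]
  · have h := congrArg (Algebra.TensorProduct.assoc k k k H H H).symm (Quasitriangular.comul_left (k := k) (H := H))
    have h' : map (Bialgebra.comulAlgHom k H) (.id k H) (rMatrix k H) =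
      (Algebra.TensorProduct.assoc k k k H H H).symm (map (.id k H) includeRight (rMatrix k H) *
        includeRight (rMatrix k H)) := h ▸ ((TensorProduct.assoc k H H H).symm_apply_apply _).symm
    rw [h', ← map_mul, mul_assoc, ← mul_assoc (includeRight _) , ← map_mul includeRight, rMatrix_mul_inv, map_one, one_mul, ← map_mul, rMatrix_mul_inv, map_one, map_one]

lemma comul_fst_rMatrixInv :
    ∑ i, ∑ m, g ((d (s.fst i)).fst m) ((d (s.fst i)).snd m) (s.snd i) =
      ∑ i, ∑ j, g (s.fst j) (s.fst i) (s.snd i * s.snd j) := by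
  have h := congrArg (fun z => lift₃ g (Algebra.TensorProduct.assoc k k k H H H z)) (comul_fst_rMatrixInv' (k := k) (H := H))
  simp only [AlgEquiv.apply_symm_apply] at h
  rw [sum_R13 s, sum_R23 s] at h
  rw [show (map (Bialgebra.comulAlgHom k H) (.id k H) (rMatrixInv k H)) = _ from s.tensor_map Coalgebra.comul LinearMap.id] at h
  simp only [Finset.sum_mul_sum, tmul_mul_tmul, one_mul, mul_one, map_sum, lift₃_tmul] at h
  rw [← h]
  refine Finset.sum_congr rfl fun i _ => ?_
  conv_rhs => rw [(d (s.fst i)).eq]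
  simp [TensorProduct.sum_tmul]

end sums


omit [HopfAlgebra k H] [Quasitriangular k H] in
lemma Rep₂.mul_eq [Algebra k H] {x : H ⊗[k] H} (r : Rep₂ x) (y : H ⊗[k] H) :
    y * x = y * ∑ i, r.fst i ⊗ₜ r.snd i := congrArg _ r.eq

section
variable {I J K N M : Type*} [Fintype I] [Fintype J] [Fintype K] [Fintype N] [AddCommMonoid M]

lemma sum_rev₃ (f : I → J → K → M) : ∑ i, ∑ j, ∑ l, f i j l = ∑ l, ∑ j, ∑ i, f i j l := by
  rw [Finset.sum_congr rfl fun i _ => Finset.sum_comm, Finset.sum_comm]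
  exact Finset.sum_congr rfl fun i _ => Finset.sum_comm

lemma sum_comm₂₂ (f : I → J → K → N → M) :
    ∑ i, ∑ j, ∑ l, ∑ m, f i j l m = ∑ l, ∑ m, ∑ i, ∑ j, f i j l m := by
  calc _ = ∑ l, ∑ j, ∑ i, ∑ m, f i j l m := sum_rev₃ fun i j l => ∑ m, f i j l m
    _ = ∑ l, ∑ m, ∑ i, ∑ j, f i j l m := Finset.sum_congr rfl fun l _ => by
      rw [sum_rev₃]

end

section counit
open Coalgebra HopfAlgebra

omit [Quasitriangular k H] in
lemma sum_counit_smul {h : H} (d : Rep₂ (comul (R := k) h)) : ∑ m, counit (R := k) (d.fst m) • d.snd m = h := by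
  have h' := congrArg (TensorProduct.lid k H) (rTensor_counit_comul (R := k) h)
  rw [d.eq] at h'
  simpa using h'

omit [Quasitriangular k H] in
lemma sum_counit_smul' {h : H} (d : Rep₂ (comul (R := k) h)) : ∑ m, counit (R := k) (d.snd m) • d.fst m = h := by
  have h' := congrArg (TensorProduct.rid k H) (lTensor_counit_comul (R := k) h)
  rw [d.eq] at h'
  simpa using h'

omit [Quasitriangular k H] in
lemma sum_antipode_mul {h : H} (d : Rep₂ (comul (R := k) h)) :
    ∑ m, antipode k (d.fst m) * d.snd m = algebraMap k H (counit (R := k) h) := by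
  have h' := mul_antipode_rTensor_comul_apply (R := k) h
  rw [d.eq] at h'
  simpa using h'

omit [Quasitriangular k H] in
lemma sum_mul_antipode {h : H} (d : Rep₂ (comul (R := k) h)) :
    ∑ m, d.fst m * antipode k (d.snd m) = algebraMap k H (counit (R := k) h) := by
  have h' := mul_antipode_lTensor_comul_apply (R := k) h
  rw [d.eq] at h'
  simpa using h'

/-- Applying the counit to the first factor of `(Δ ⊗ id) R = R₁₃ R₂₃` gives `R = (1 ⊗ (ε ⊗ id) R)
R`, and `R` cancels. -/
lemma sum_counit_fst_rMatrix : ∑ i, counit (R := k) (r.fst i) • r.snd i = 1 := by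
  have h := comul_fst_rMatrix r (mk₃ fun x y z => counit (R := k) x • (y ⊗ₜ[k] z)) (fun h => Rep₂.some _)
  simp only [mk₃_apply] at h
  have h₁ : (1 ⊗ₜ ∑ i, counit (R := k) (r.fst i) • r.snd i) * rMatrix k H = rMatrix k H := by
    rw [r.mul_eq]
    simp only [TensorProduct.smul_tmul', ← TensorProduct.sum_tmul, sum_counit_smul] at h
    refine Eq.trans ?_ (h.symm.trans r.eq.symm)
    simp only [TensorProduct.tmul_sum, Finset.sum_mul_sum, Algebra.TensorProduct.tmul_mul_tmul, one_mul,
      TensorProduct.smul_tmul, smul_mul_assoc]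
  have h₂ := congrArg (fun z => LinearMap.mul' k H (z * rMatrixInv k H)) h₁
  simpa [mul_assoc, rMatrix_mul_inv, Algebra.TensorProduct.one_def] using h₂

lemma sum_counit_snd_rMatrix : ∑ i, counit (R := k) (r.snd i) • r.fst i = 1 := by
  have h := comul_snd_rMatrix r (mk₃ fun x y z => counit (R := k) z • (x ⊗ₜ[k] y)) (fun h => Rep₂.some _)
  simp only [mk₃_apply] at h
  have h₁ : ((∑ i, counit (R := k) (r.snd i) • r.fst i) ⊗ₜ 1) * rMatrix k H = rMatrix k H := by
    rw [r.mul_eq]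
    simp only [← TensorProduct.tmul_smul, ← TensorProduct.tmul_sum, sum_counit_smul'] at h
    refine Eq.trans ?_ (h.symm.trans r.eq.symm)
    simp only [TensorProduct.sum_tmul, Finset.sum_mul_sum, Algebra.TensorProduct.tmul_mul_tmul, one_mul,
      TensorProduct.tmul_smul, smul_mul_assoc, ← TensorProduct.smul_tmul']
  have h₂ := congrArg (fun z => LinearMap.mul' k H (z * rMatrixInv k H)) h₁
  simpa [mul_assoc, rMatrix_mul_inv, Algebra.TensorProduct.one_def] using h₂

lemma sum_counit_snd_rMatrixInv : ∑ i, counit (R := k) (s.snd i) • s.fst i = 1 := by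
  let f := (Algebra.TensorProduct.rid k k H).toAlgHom.comp
    (Algebra.TensorProduct.map (.id k H) (Bialgebra.counitAlgHom k H))
  have h := congrArg f (rMatrix_mul_inv k H)
  have h' : f (rMatrix k H) = 1 := by
    have r := Rep₂.some (rMatrix k H)
    rw [← sum_counit_snd_rMatrix r]
    conv_lhs => rw [r.eq]
    simp [f]
  rw [map_mul, h', one_mul, map_one] at h
  rw [← h]
  conv_rhs => rw [s.eq]
  simp [f]

variable (k H) in
-- By the formula for `(Δ ⊗ id) R` and `(S h₁) h₂ = ε(h)`, the left side is a left inverse of `R`.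
lemma map_antipode_id_rMatrix :
    TensorProduct.map (antipode k) LinearMap.id (rMatrix k H) = rMatrixInv k H := by
  have r := Rep₂.some (rMatrix k H)
  refine left_inv_eq_right_inv (a := rMatrix k H) ?_ (rMatrix_mul_inv k H)
  have h := comul_fst_rMatrix r (mk₃ fun x y z => (antipode k x * y) ⊗ₜ[k] z) (fun h => Rep₂.some _)
  simp only [mk₃_apply, ← TensorProduct.sum_tmul, sum_antipode_mul] at h
  rw [r.tensor_map, r.mul_eq]
  simp only [Finset.sum_mul_sum, Algebra.TensorProduct.tmul_mul_tmul, LinearMap.id_apply]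
  rw [← h]
  simp only [Algebra.algebraMap_eq_smul_one, TensorProduct.smul_tmul, ← TensorProduct.tmul_sum]
  rw [sum_counit_fst_rMatrix]
  rfl

variable (k H) in
lemma map_id_antipode_rMatrixInv :
    TensorProduct.map LinearMap.id (antipode k) (rMatrixInv k H) = rMatrix k H := by
  have s := Rep₂.some (rMatrixInv k H)
  refine (left_inv_eq_right_inv (rMatrix_mul_inv k H) ?_).symm
  have h := comul_snd_rMatrixInv s (mk₃ fun x y z => x ⊗ₜ[k] (y * antipode k z)) (fun h => Rep₂.some _)
  simp only [mk₃, LinearMap.mk₂_apply, LinearMap.coe_mk, AddHom.coe_mk, ← TensorProduct.tmul_sum,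
    sum_mul_antipode] at h
  rw [s.tensor_map]
  conv_lhs => enter [1]; rw [s.eq]
  simp only [Finset.sum_mul_sum, Algebra.TensorProduct.tmul_mul_tmul, LinearMap.id_apply]
  rw [← h]
  simp only [Algebra.algebraMap_eq_smul_one, TensorProduct.tmul_smul, TensorProduct.smul_tmul', ← TensorProduct.sum_tmul]
  rw [sum_counit_snd_rMatrixInv]
  rfl

variable (g : H →ₗ[k] H →ₗ[k] M)

lemma sum_antipode_rMatrix : ∑ i, g (antipode k (r.fst i)) (r.snd i) = ∑ i, g (s.fst i) (s.snd i) := by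
  rw [s.sum_eq, ← map_antipode_id_rMatrix, r.tensor_map]
  simp

lemma sum_rMatrixInv_antipode : ∑ i, g (s.fst i) (antipode k (s.snd i)) = ∑ i, g (r.fst i) (r.snd i) := by
  rw [r.sum_eq, ← map_id_antipode_rMatrixInv, s.tensor_map]
  simp

lemma sum_antipode_antipode_rMatrix :
    ∑ i, g (antipode k (r.fst i)) (antipode k (r.snd i)) = ∑ i, g (r.fst i) (r.snd i) := by
  have s := Rep₂.some (rMatrixInv k H)
  rw [← sum_rMatrixInv_antipode r s]
  exact sum_antipode_rMatrix r s (g.compl₂ (antipode k))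

end counit

end

/-! ### Moving the action of `H` through an `H`-linear action. -/

section CrossRelation
section
variable {k : Type u} [Field k] {H : Type u} [Ring H] [HopfAlgebra k H]
  {M : Type u} [AddCommGroup M] [Module k M]

lemma sum_coassoc (g : H →ₗ[k] H →ₗ[k] H →ₗ[k] M)
    (d : ∀ h : H, Rep₂ (Coalgebra.comul (R := k) h)) (h : H) :
    ∑ m, ∑ n, g ((d h).fst m) ((d ((d h).snd m)).fst n) ((d ((d h).snd m)).snd n) =
      ∑ m, ∑ n, g ((d ((d h).fst m)).fst n) ((d ((d h).fst m)).snd n) ((d h).snd m) := by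
  have e := congrArg (TensorProduct.lift (TensorProduct.uncurry (.id k) H H M ∘ₗ g))
    (Coalgebra.coassoc_apply (R := k) h)
  rw [LinearMap.rTensor, (d h).tensor_map, LinearMap.lTensor, (d h).tensor_map] at e
  have e₁ (x : H) : Coalgebra.comul (R := k) x = ∑ n, (d x).fst n ⊗ₜ (d x).snd n := (d x).eq
  simp only [e₁] at e
  simpa [TensorProduct.sum_tmul] using e.symm

end

variable {k : Type u} [Field k] {H : Type u} [Ring H] [HopfAlgebra k H] [Quasitriangular k H]

/-- `L` is a morphism `C ⊗ V ⟶ W` of `H`-modules. -/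
def IsHLinear (C V W : RMod k H) (L : C.V →ₗ[k] V.V →ₗ[k] W.V) : Prop :=
  ∀ (h : H) (d : Rep₂ (Coalgebra.comul (R := k) h)) (c : C.V) (v : V.V),
    ∑ m, L (C.act (d.fst m) c) (V.act (d.snd m) v) = W.act h (L c v)

lemma act_comp (C : RMod k H) (a b : H) (c : C.V) : C.act b (C.act a c) = C.act (a * b) c := by
  rw [C.act_mul]; rfl

lemma act_one_apply (C : RMod k H) (c : C.V) : C.act 1 c = c := by
  rw [C.act_one]; rfl

variable {C V W : RMod k H} {L : C.V →ₗ[k] V.V →ₗ[k] W.V}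

/-- Insert `(S h₁) h₂` in front of the action on `c` and let `h₂`, `h₃` act diagonally. In the
opposite endomorphism algebra this is the relation `h c = (h₁ ▷ c) h₂`. -/
lemma IsHLinear.act_right (hL : IsHLinear C V W L) (h : H) (d : Rep₂ (Coalgebra.comul (R := k) h)) (c : C.V) (v : V.V) :
    L c (V.act h v) = ∑ m, W.act (d.snd m) (L (C.act (HopfAlgebra.antipode k (d.fst m)) c) v) := by
  have d' : ∀ h : H, Rep₂ (Coalgebra.comul (R := k) h) := fun _ => Rep₂.some _
  have e' := d.sum_congr (d' h) (mk₂ fun a b => W.act b (L (C.act (HopfAlgebra.antipode k a) c) v))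
  simp only [mk₂_apply] at e'
  rw [e']
  have e := sum_coassoc (mk₃ fun x y z => L (C.act (HopfAlgebra.antipode k x * y) c) (V.act z v)) d' h
  simp only [mk₃_apply, ← act_comp C] at e ⊢
  simp only [hL _ (d' _)] at e
  rw [e]
  simp only [act_comp C]
  have e₂ (m) : ∑ n, L (C.act (HopfAlgebra.antipode k ((d' ((d' h).fst m)).fst n) * (d' ((d' h).fst m)).snd n) c) (V.act ((d' h).snd m) v) = L c (V.act (Coalgebra.counit (R := k) ((d' h).fst m) • ((d' h).snd m)) v) := by
    simp only [← LinearMap.sum_apply, ← map_sum, sum_antipode_mul]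
    simp [Algebra.algebraMap_eq_smul_one, C.act_one]
  simp only [e₂]
  conv_lhs => rw [← sum_counit_smul (d' h)]
  simp only [← LinearMap.sum_apply, ← map_sum]

variable {M : Type u} [AddCommGroup M] [Module k M] (r : Rep₂ (rMatrix k H))

/-- String diagrams let `H` act on `v` before `C` does, while the cross relation has `H` acting
after `C`. The formula for `(id ⊗ Δ) R` with `H`-linearity moves one part of the action to the
output, that for `(Δ ⊗ id) R` with `act_right` moves the other, and the Yang–Baxter equation
restores the order of the factors. -/
lemma cross_sum (hL : IsHLinear C V W L) (g : H →ₗ[k] H →ₗ[k] W.V →ₗ[k] M) (c : C.V) (v : V.V) :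
    ∑ i, ∑ j, ∑ l, ∑ m, g (r.fst j * (r.fst l * r.fst m)) (r.snd i * r.snd j) (L (C.act (r.snd m) c) (V.act (r.fst i * r.snd l) v)) =
      ∑ i, ∑ l, ∑ n, ∑ j, g (r.fst l * r.fst n) (r.snd i * (r.snd n * r.snd j)) (W.act (r.snd l * r.fst j) (L (C.act (HopfAlgebra.antipode k (r.fst i)) c) v)) := by
  have d : ∀ h : H, Rep₂ (Coalgebra.comul (R := k) h) := fun _ => Rep₂.some _
  have e₁ (x : H) (y : H) (w : V.V) :
    ∑ l, ∑ m, g (x * (r.fst l * r.fst m)) y (L (C.act (r.snd m) c) (V.act (r.snd l) w)) = 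
      ∑ l, g (x * r.fst l) y (W.act (r.snd l) (L c w)) := by
    have h := comul_snd_rMatrix r (mk₃ fun a b b' => g (x * a) y (L (C.act b c) (V.act b' w))) d
    simp only [mk₃_apply] at h
    rw [← h]
    refine Finset.sum_congr rfl fun i _ => ?_
    rw [← hL (r.snd i) (d _), map_sum]
  simp only [← act_comp V, e₁]
  have e₂ (x : H) (z y : H) :
    ∑ i, g z (r.snd i * x) (W.act y (L c (V.act (r.fst i) v))) = 
      ∑ i, ∑ n, g z (r.snd i * (r.snd n * x)) (W.act (r.fst n * y) (L (C.act (HopfAlgebra.antipode k (r.fst i)) c) v)) := by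
    have h := comul_fst_rMatrix r (mk₃ fun a b b' => g z (b' * x) (W.act (b * y) (L (C.act (HopfAlgebra.antipode k a) c) v))) d
    simp only [mk₃_apply, mul_assoc] at h
    rw [← h]
    refine Finset.sum_congr rfl fun i _ => ?_
    simp only [← act_comp W, ← map_sum, ← hL.act_right]
  trans ∑ i, ∑ n, ∑ l, ∑ j, g (r.fst j * r.fst l) (r.snd i * (r.snd n * r.snd j)) (W.act (r.fst n * r.snd l) (L (C.act (HopfAlgebra.antipode k (r.fst i)) c) v))
  · rw [sum_rev₃]
    simp only [e₂]
    exact sum_comm₂₂ _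
  · refine Finset.sum_congr rfl fun i _ => ?_
    have h := yang_baxter_sum r (mk₃ fun a b b' => g a (r.snd i * b') (W.act b (L (C.act (HopfAlgebra.antipode k (r.fst i)) c) v)))
    simp only [mk₃_apply, mul_assoc] at h
    exact h.symm

end CrossRelation

/-! ### The exchange rule as one diagram. -/

section CrossNormalForm
attribute [-simp] Category.comp_id
attribute [local simp] whisk wh_comp wh_wh wh_id bin_wh wh_cobin una_wh nil₂_comp nil₂_wh nil₁_comp
  conil₁_wh conil₂_wh sw_wh bin_sw sw_cobin sw_wh_cobin sw_una sw_wh_una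
  sw_sw_sw sw_sw_sw_wh sw_sw_bin sw_sw_bin_wh sw_sw_nil₂ sw_sw_nil₂_wh sw_nil₁ sw_wh_nil₁ wh_sw_nil₂
  wh_comp_wh_sw_nil₂
  wh_conil₁_sw conil₁_sw_comp bin_mul_mul conil₁_one_mul wh_conil₁_one_mul cobin_comul_comul
  cobin_nil₁ cobin_wh_nil₁ conil₁_comul
  DualPairing.bin_mul_nil₂ DualPairing.wh_mul_nil₂ DualPairing.wh_comp_mul_nil₂
  DualPairing.wh_comp_wh_mul_nil₂ DualPairing.conil₁_nil₂
  DualPairing.wh_conil₁_nil₂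

variable {𝒞 : Type w} [Category.{v} 𝒞] [MonoidalCategory 𝒞] [BraidedCategory 𝒞]
variable {W C B : 𝒞} [HopfObj C] [HopfObj B] (p : DualPairing C B) [IsIso 𝒮[C]]

/-- `evRInv ≫ evL` with all coproducts taken first. -/
lemma DualPairing.evRInv_evL (V Γ : 𝒞) : p.evRInv V Γ ≫ p.evL V Γ =
    cobin Δ[C] (V ⊗ (B ⊗ Γ)) ≫ C ◁ cobin Δ[C] (V ⊗ (B ⊗ Γ)) ≫
      C ◁ C ◁ C ◁ V ◁ (cobin Δ[B] Γ ≫ B ◁ cobin Δ[B] Γ) ≫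
      C ◁ C ◁ (una (inv 𝒮[C]) (V ⊗ (B ⊗ (B ⊗ (B ⊗ Γ)))) ≫ sw C V (B ⊗ (B ⊗ (B ⊗ Γ))) ≫
        V ◁ (sw C B (B ⊗ (B ⊗ Γ)) ≫ B ◁ (sw C B (B ⊗ Γ) ≫ B ◁ nil₂ p.ev Γ))) ≫
      C ◁ C ◁ sw V B (B ⊗ Γ) ≫ C ◁ sw C B (V ⊗ (B ⊗ Γ)) ≫ nil₂ p.ev (C ⊗ (V ⊗ (B ⊗ Γ))) := by
  apply eq_of_comp_id
  simp [evRInv, evL, bin_coregB, bin_coregC]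
  done

end CrossNormalForm

/-! ### Evaluating diagrams of modules on elements. -/

section Elements
variable {k : Type u} [Field k] {H : Type u} [Ring H] [HopfAlgebra k H] [Quasitriangular k H]

/-- The linear map underlying a morphism of modules. -/
def lin {X Y : RMod k H} (f : X ⟶ Y) : X.V →ₗ[k] Y.V := f.hom.hom

/-- Pure tensors in a tensor product of modules. -/
def tm (X Y : RMod k H) : X.V →ₗ[k] Y.V →ₗ[k] (X ⊗ Y).V := TensorProduct.mk k X.V Y.V

variable {X Y Z Γ W : RMod k H}

@[simp] lemma lin_comp (f : X ⟶ Y) (g : Y ⟶ Z) (x : X.V) : lin (f ≫ g) x = lin g (lin f x) := rfl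
@[simp] lemma lin_whiskerLeft (f : Y ⟶ Z) (x : X.V) (y : Y.V) :
    lin (X ◁ f) (tm X Y x y) = tm X Z x (lin f y) := rfl
@[simp] lemma lin_whiskerRight (f : X ⟶ Y) (x : X.V) (z : Z.V) :
    lin (f ▷ Z) (tm X Z x z) = tm Y Z (lin f x) z := rfl
@[simp] lemma lin_associator_hom (x : X.V) (y : Y.V) (z : Z.V) :
    lin (α_ X Y Z).hom (tm (X ⊗ Y) Z (tm X Y x y) z) = tm X (Y ⊗ Z) x (tm Y Z y z) := rfl
@[simp] lemma lin_associator_inv (x : X.V) (y : Y.V) (z : Z.V) :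
    lin (α_ X Y Z).inv (tm X (Y ⊗ Z) x (tm Y Z y z)) = tm (X ⊗ Y) Z (tm X Y x y) z := rfl
@[simp] lemma lin_leftUnitor_inv (x : X.V) :
    lin (λ_ X).inv x = tm (𝟙_ (RMod k H)) X (1 : k) x := rfl
@[simp] lemma lin_rightUnitor_hom (t : k) (x : X.V) :
    lin (ρ_ X).hom (tm X (𝟙_ (RMod k H)) x t) = t • x := rfl
lemma lin_ext {f g : X ⟶ Y} (h : ∀ x, lin f x = lin g x) : f = g := by
  apply RMod.hom_ext
  apply ModuleCat.hom_ext
  exact LinearMap.ext h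

lemma linearMap_ext_tm {M : Type u} [AddCommGroup M] [Module k M] {f g : (X ⊗ Y).V →ₗ[k] M}
    (h : ∀ x y, f (tm X Y x y) = g (tm X Y x y)) : f = g :=
  TensorProduct.ext' h

lemma lin_ext₂ {f g : X ⊗ Y ⟶ Z} (h : ∀ x y, lin f (tm X Y x y) = lin g (tm X Y x y)) : f = g :=
  lin_ext fun x => LinearMap.congr_fun (linearMap_ext_tm h) x

lemma lin_act (f : X ⟶ Y) (h : H) (x : X.V) : lin f (X.act h x) = Y.act h (lin f x) := f.comm h x

lemma act_tm (h : H) (d : Rep₂ (Coalgebra.comul (R := k) h)) (x : X.V) (y : Y.V) :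
    (X ⊗ Y).act h (tm X Y x y) = ∑ m, tm X Y (X.act (d.fst m) x) (Y.act (d.snd m) y) := by
  change tensorEnd X.act Y.act (Coalgebra.comul h) (x ⊗ₜ y) = _
  conv_lhs => rw [d.eq]
  simp only [map_sum, LinearMap.sum_apply, tensorEnd_tmul]
  rfl

lemma lin_braiding (r : Rep₂ (rMatrix k H)) (x : X.V) (y : Y.V) :
    lin (β_ X Y).hom (tm X Y x y) = ∑ i, tm Y X (Y.act (r.fst i) y) (X.act (r.snd i) x) := by
  change tensorEnd Y.act X.act (rMatrix k H) (y ⊗ₜ x) = _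
  conv_lhs => rw [r.eq]
  simp only [map_sum, LinearMap.sum_apply, tensorEnd_tmul]
  rfl

@[simp] lemma lin_bin (f : X ⊗ Y ⟶ Z) (x : X.V) (y : Y.V) (t : Γ.V) :
    lin (bin f Γ) (tm X (Y ⊗ Γ) x (tm Y Γ y t)) = tm Z Γ (lin f (tm X Y x y)) t := rfl

@[simp] lemma lin_una (f : X ⟶ Y) (x : X.V) (t : Γ.V) :
    lin (una f Γ) (tm X Γ x t) = tm Y Γ (lin f x) t := rfl

lemma lin_sw (r : Rep₂ (rMatrix k H)) (x : X.V) (y : Y.V) (t : Γ.V) :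
    lin (sw X Y Γ) (tm X (Y ⊗ Γ) x (tm Y Γ y t)) =
      ∑ i, tm Y (X ⊗ Γ) (Y.act (r.fst i) y) (tm X Γ (X.act (r.snd i) x) t) := by
  simp [sw, lin_braiding r]

variable {C B : RMod k H} [HopfObj C] [HopfObj B] (p : DualPairing C B)

lemma exists_lift₃ {M : Type u} [AddCommGroup M] [Module k M] (g : X.V →ₗ[k] Y.V →ₗ[k] Z.V →ₗ[k] M) :
    ∃ G : (X ⊗ (Y ⊗ Z)).V →ₗ[k] M, ∀ x y z, G (tm X _ x (tm Y Z y z)) = g x y z :=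
  ⟨TensorProduct.lift (TensorProduct.uncurry (.id k) Y.V Z.V M ∘ₗ g), fun _ _ _ => rfl⟩

lemma lin_comul {b : B.V} (d : Rep₂ (comulₗ B b)) : lin Δ[B] b = ∑ m, tm B B (d.fst m) (d.snd m) := d.eq

lemma lin_comul₃ {b : B.V} (y : Rep₃ (comul₃ B b)) :
    lin (B ◁ Δ[B]) (lin Δ[B] b) = ∑ m, tm B _ (y.fst m) (tm B B (y.snd m) (y.thd m)) := y.eq

section
variable {M : Type u} [AddCommGroup M] [Module k M]

lemma sum_comul_right (g : B.V →ₗ[k] B.V →ₗ[k] B.V →ₗ[k] M) (d : ∀ b, Rep₂ (comulₗ B b)) {b : B.V}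
    (y : Rep₃ (comul₃ B b)) :
    ∑ m, ∑ n, g ((d b).fst m) ((d ((d b).snd m)).fst n) ((d ((d b).snd m)).snd n) =
      ∑ n, g (y.fst n) (y.snd n) (y.thd n) := by
  obtain ⟨G, hG⟩ := exists_lift₃ g
  have h := congrArg G (lin_comul₃ y)
  simpa [lin_comul (d _), hG] using h

lemma sum_comul_act (g : B.V →ₗ[k] B.V →ₗ[k] M) {b : B.V} {h : H}
    (d : Rep₂ (comulₗ B b)) (d' : Rep₂ (comulₗ B (B.act h b))) (e : Rep₂ (Coalgebra.comul (R := k) h)) :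
    ∑ m, g (d'.fst m) (d'.snd m) = ∑ n, ∑ m, g (B.act (e.fst n) (d.fst m)) (B.act (e.snd n) (d.snd m)) := by
  have e₀ : lin Δ[B] b = ∑ m, tm B B (d.fst m) (d.snd m) := d.eq
  rw [d'.sum_eq]
  change TensorProduct.lift g (lin Δ[B] (B.act h b)) = _
  rw [lin_act, e₀, map_sum, Finset.sum_comm]
  refine (map_sum (TensorProduct.lift g) _ _).trans (Finset.sum_congr rfl fun m _ => ?_)
  rw [act_tm h e]
  exact map_sum (TensorProduct.lift g) _ _

end

/-- The bilinear map underlying a morphism from a tensor product. -/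
def curr (f : X ⊗ Y ⟶ Z) : X.V →ₗ[k] Y.V →ₗ[k] Z.V := (tm X Y).compr₂ (lin f)

lemma curr_apply (f : X ⊗ Y ⟶ Z) (x : X.V) (y : Y.V) : curr f x y = lin f (tm X Y x y) := rfl

lemma isHLinear_curr (f : X ⊗ Y ⟶ Z) : IsHLinear X Y Z (curr f) := fun h d x y => by
  simp only [curr_apply]
  rw [← lin_act, act_tm h d, map_sum]

/-- The pairing as a bilinear form. -/
def DualPairing.evB : C.V →ₗ[k] B.V →ₗ[k] k := TensorProduct.curry (p.ev.hom.hom : C.V ⊗[k] B.V →ₗ[k] k)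

lemma DualPairing.evₗ_eq (c : C.V) (b : B.V) : p.evₗ c b = p.evB c b := rfl

@[simp] lemma lin_nil₂ (c : C.V) (b : B.V) (t : Γ.V) :
    lin (nil₂ p.ev Γ) (tm C (B ⊗ Γ) c (tm B Γ b t)) = p.evB c b • t := rfl

/-- The pairing is a morphism to the trivial module, so acting by `S h` on `C` is adjoint to acting
by `h` on `B`. -/
lemma DualPairing.evB_act (h : H) (c : C.V) (b : B.V) :
    p.evB (C.act (HopfAlgebra.antipode k h) c) b = p.evB c (B.act h b) := by
  have e := (isHLinear_curr p.ev).act_right h (Rep₂.some _) c b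
  change p.evB c (B.act h b) = ∑ m, Coalgebra.counit (R := k) ((Rep₂.some (Coalgebra.comul (R := k) h)).snd m) •
    p.evB (C.act (HopfAlgebra.antipode k ((Rep₂.some (Coalgebra.comul (R := k) h)).fst m)) c) b at e
  rw [e]
  conv_lhs => rw [← sum_counit_smul' (Rep₂.some (Coalgebra.comul (R := k) h))]
  simp only [map_sum, map_smul, LinearMap.sum_apply, LinearMap.smul_apply]


lemma lin_cobin_cobin {c : C.V} (t : Γ.V) (x : Rep₃ (comul₃ C c)) :
    lin (C ◁ cobin Δ[C] Γ) (lin (cobin Δ[C] Γ) (tm C Γ c t)) =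
      ∑ m, tm C _ (x.fst m) (tm C _ (x.snd m) (tm C Γ (x.thd m) t)) := by
  have e : cobin Δ[C] Γ ≫ C ◁ cobin Δ[C] Γ = cobin (Δ[C] ≫ C ◁ Δ[C]) Γ ≫ C ◁ (α_ C C Γ).hom := by
    simp only [cobin]; monoidal
  have e' : lin (Δ[C] ≫ C ◁ Δ[C]) c = ∑ m, tm C _ (x.fst m) (tm C C (x.snd m) (x.thd m)) := x.eq
  rw [← lin_comp, e]
  simp only [cobin, lin_comp, lin_whiskerRight, e', map_sum, LinearMap.sum_apply, lin_associator_hom, lin_whiskerLeft]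

variable [IsIso 𝒮[C]]

set_option maxHeartbeats 2000000 in
lemma lin_evRInv_evL (r : Rep₂ (rMatrix k H))
    (c : C.V) (v : W.V) (b : B.V) (t : Γ.V) (x : Rep₃ (comul₃ C c)) (y : Rep₃ (comul₃ B b)) :
    lin (p.evRInv W Γ ≫ p.evL W Γ)
      (tm C (W ⊗ (B ⊗ Γ)) c (tm W (B ⊗ Γ) v (tm B Γ b t))) = ∑ m, ∑ n, ∑ i, ∑ j, ∑ j', ∑ u, ∑ z, 
        (p.evB (C.act (r.snd j') (C.act (r.snd j) (C.act (r.snd i) (lin (inv 𝒮[C]) (x.thd m))))) (y.thd n) *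
          p.evB (x.fst m) (B.act (r.fst z) (B.act (r.fst u) (B.act (r.fst j) (y.fst n))))) •
          tm C (W ⊗ (B ⊗ Γ)) (C.act (r.snd z) (x.snd m)) (tm W (B ⊗ Γ) (W.act (r.snd u) (W.act (r.fst i) v))
            (tm B Γ (B.act (r.fst j') (y.snd n)) t)) := by
  rw [DualPairing.evRInv_evL]
  simp only [lin_comp]
  rw [lin_cobin_cobin _ x]
  simp only [map_sum, lin_whiskerLeft, lin_comp]
  refine Finset.sum_congr rfl fun m _ => ?_
  rw [lin_cobin_cobin _ y, lin_una]
  simp only [map_sum, lin_sw r, lin_whiskerLeft, lin_comp]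
  simp only [lin_nil₂, map_smul, smul_smul]

set_option maxHeartbeats 2000000 in
lemma lin_cross (l : C ⊗ W ⟶ W) (q : W ⊗ B ⟶ W) (r : Rep₂ (rMatrix k H))
    (c : C.V) (v : W.V) (b : B.V) (t : Γ.V) (x : Rep₃ (comul₃ C c)) (y : Rep₃ (comul₃ B b)) :
    lin (p.evRInv W Γ ≫ p.evL W Γ ≫ bin l (B ⊗ Γ) ≫ bin q Γ)
      (tm C (W ⊗ (B ⊗ Γ)) c (tm W (B ⊗ Γ) v (tm B Γ b t))) = tm W Γ (∑ m, ∑ n, ∑ i, ∑ j, ∑ j', ∑ u, ∑ z, 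
        (p.evB (x.fst m) (B.act (r.fst j * (r.fst u * r.fst z)) (y.fst n)) *
        p.evB (C.act (r.snd i * (r.snd j * r.snd j')) (lin (inv 𝒮[C]) (x.thd m))) (y.thd n)) •
          lin q (tm W B (lin l (tm C W (C.act (r.snd z) (x.snd m)) (W.act (r.fst i * r.snd u) v)))
            (B.act (r.fst j') (y.snd n)))) t := by
  rw [← Category.assoc, lin_comp, lin_evRInv_evL p r c v b t x y, map_sum, map_sum, LinearMap.sum_apply]
  refine Finset.sum_congr rfl fun m _ => ?_
  rw [map_sum, map_sum, LinearMap.sum_apply]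
  refine Finset.sum_congr rfl fun n _ => ?_
  simp only [map_sum, map_smul, LinearMap.sum_apply, LinearMap.smul_apply, lin_comp, lin_bin, act_comp, mul_assoc]
  simp only [mul_comm]

end Elements

/-! ### Comparison of the exchange rule with the cross relation. -/

section Frozen
variable {k : Type u} [Field k] {H : Type u} [Ring H] [HopfAlgebra k H] [Quasitriangular k H]
variable {C B W : RMod k H} [HopfObj C] [HopfObj B] (p : DualPairing C B)
variable {M : Type u} [AddCommGroup M] [Module k M]
variable (r : Rep₂ (rMatrix k H)) (s : Rep₂ (rMatrixInv k H))

lemma sum_inv_mul (g : H →ₗ[k] H →ₗ[k] M) :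
    ∑ i, ∑ j, g (s.fst i * r.fst j) (s.snd i * r.snd j) = g 1 1 := by
  have h := congrArg (TensorProduct.lift g) (rMatrixInv_mul k H)
  have e : rMatrixInv k H * rMatrix k H = (∑ i, s.fst i ⊗ₜ s.snd i) * (∑ j, r.fst j ⊗ₜ r.snd j) :=
    congrArg₂ _ s.eq r.eq
  rw [e, Finset.sum_mul_sum] at h
  simpa [Algebra.TensorProduct.one_def] using h

lemma comulBar_eq {c : C.V} (d : Rep₂ (comulₗ C c)) :
    comulBar C c = ∑ m, ∑ i, tm C C (C.act (s.fst i) (d.fst m)) (C.act (s.snd i) (d.snd m)) := by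
  let T : (C ⊗ C).V →ₗ[k] (C ⊗ C).V := tensorEnd C.act C.act (rMatrixInv k H)
  have hT (a b) : T (tm C C a b) = ∑ i, tm C C (C.act (s.fst i) a) (C.act (s.snd i) b) := by
    change tensorEnd C.act C.act (rMatrixInv k H) (a ⊗ₜ b) = _
    conv_lhs => enter [1]; rw [s.eq]
    simp only [map_sum, LinearMap.sum_apply]
    rfl
  change T (lin Δ[C] c) = _
  rw [lin_comul d, map_sum]
  simp only [hT]

/-- The iterated coproduct of `C̄` is that of `C` acted on by `R₁₂⁻¹ R₁₃⁻¹ R₂₃⁻¹`: the coproduct is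
equivariant, and `(id ⊗ Δ) R⁻¹ = R₁₂⁻¹ R₁₃⁻¹`. -/
lemma sum_comulBar₃_aux (F : C.V →ₗ[k] C.V →ₗ[k] C.V →ₗ[k] M) {c : C.V}
    (x : Rep₃ (comulBar₃ C c)) (z : Rep₃ (comul₃ C c)) :
    ∑ m, F (x.fst m) (x.snd m) (x.thd m) = ∑ m, ∑ i, ∑ j, ∑ l,
      F (C.act (s.fst i * s.fst j) (z.fst m)) (C.act (s.snd i * s.fst l) (z.snd m))
        (C.act (s.snd j * s.snd l) (z.thd m)) := by
  have dC : ∀ c, Rep₂ (comulₗ C c) := fun _ => Rep₂.some _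
  have dH : ∀ h : H, Rep₂ (Coalgebra.comul (R := k) h) := fun _ => Rep₂.some _
  obtain ⟨G, hG⟩ := exists_lift₃ F
  let T : (C ⊗ C).V →ₗ[k] (C ⊗ (C ⊗ C)).V := TensorProduct.map LinearMap.id (comulBar C)
  have hT (a b) : T (tm C C a b) = tm C (C ⊗ C) a (comulBar C b) := rfl
  have e : ∑ m, F (x.fst m) (x.snd m) (x.thd m) = G (T (comulBar C c)) := by
    have e' : T (comulBar C c) = ∑ m, tm C _ (x.fst m) (tm C C (x.snd m) (x.thd m)) := x.eq
    rw [e', map_sum]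
    simp only [hG]
  rw [e, comulBar_eq s (dC c)]
  simp only [map_sum, hT, comulBar_eq s (dC _), hG]
  trans ∑ m, ∑ m', ∑ i, ∑ j, ∑ l, F (C.act (s.fst i * s.fst j) ((dC c).fst m))
    (C.act (s.snd i * s.fst l) ((dC ((dC c).snd m)).fst m'))
        (C.act (s.snd j * s.snd l) ((dC ((dC c).snd m)).snd m'))
  · refine Finset.sum_congr rfl fun m _ => ?_
    have h (i) := sum_comul_act (mk₂ fun a b => ∑ l, F (C.act (s.fst i) ((dC c).fst m)) (C.act (s.fst l) a)
        (C.act (s.snd l) b)) (dC ((dC c).snd m)) (dC (C.act (s.snd i) ((dC c).snd m))) (dH (s.snd i))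
    simp only [mk₂_apply] at h
    simp only [h]
    have h₂ := comul_snd_rMatrixInv s (mk₃ fun a b b' => ∑ m', ∑ l, F (C.act a ((dC c).fst m))
      (C.act (b * s.fst l) ((dC ((dC c).snd m)).fst m'))
        (C.act (b' * s.snd l) ((dC ((dC c).snd m)).snd m'))) dH
    simp only [mk₃_apply] at h₂
    simp only [act_comp]
    rw [h₂]
    rw [sum_rev₃]
    exact Finset.sum_congr rfl fun m' _ => Finset.sum_comm
  · exact sum_comul_right (mk₃ fun a b b' => ∑ i, ∑ j, ∑ l, F (C.act (s.fst i * s.fst j) a)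
      (C.act (s.snd i * s.fst l) b) (C.act (s.snd j * s.snd l) b')) dC z

/-- The Yang–Baxter equation for the inverse puts `R₁₂⁻¹` last, where the action of `R` on the first
two legs cancels it. The two remaining copies of `R⁻¹` are rewritten as `(S ⊗ id) R`. -/
lemma sum_comulBar₃ (G : C.V →ₗ[k] C.V →ₗ[k] C.V →ₗ[k] M) {c : C.V}
    (x : Rep₃ (comulBar₃ C c)) (z : Rep₃ (comul₃ C c)) :
    ∑ m, ∑ i, G (C.act (r.fst i) (x.fst m)) (C.act (r.snd i) (x.snd m)) (x.thd m) =
      ∑ m, ∑ i, ∑ n, G (C.act (HopfAlgebra.antipode k (r.fst n)) (z.fst m))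
        (C.act (HopfAlgebra.antipode k (r.fst i)) (z.snd m)) (C.act (r.snd i * r.snd n) (z.thd m)) := by
  have s := Rep₂.some (rMatrixInv k H)
  have h := sum_comulBar₃_aux s (mk₃ fun a b c => ∑ i, G (C.act (r.fst i) a) (C.act (r.snd i) b) c) x z
  simp only [mk₃_apply] at h
  rw [h]
  refine Finset.sum_congr rfl fun m _ => ?_
  have h₂ := yang_baxter_inv_sum s (mk₃ fun a b b' => ∑ i, G (C.act (a * r.fst i) (z.fst m)) (C.act (b * r.snd i) (z.snd m)) (C.act b' (z.thd m)))
  simp only [mk₃_apply] at h₂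
  simp only [act_comp]
  rw [h₂]
  trans ∑ l, ∑ j, G (C.act (s.fst j) (z.fst m)) (C.act (s.fst l) (z.snd m)) (C.act (s.snd l * s.snd j) (z.thd m))
  · refine Finset.sum_congr rfl fun l _ => ?_
    rw [Finset.sum_comm]
    refine Finset.sum_congr rfl fun j _ => ?_
    have h₃ := sum_inv_mul r s (mk₂ fun a b => G (C.act (s.fst j * a) (z.fst m)) (C.act (s.fst l * b) (z.snd m)) (C.act (s.snd l * s.snd j) (z.thd m)))
    simpa only [mk₂_apply, mul_one, mul_assoc] using h₃
  · have h₄ := sum_antipode_rMatrix r s (mk₂ fun a b => ∑ j, G (C.act (s.fst j) (z.fst m)) (C.act a (z.snd m)) (C.act (b * s.snd j) (z.thd m)))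
    simp only [mk₂_apply] at h₄
    rw [← h₄]
    refine Finset.sum_congr rfl fun i _ => ?_
    have h₅ := sum_antipode_rMatrix r s (mk₂ fun a b => G (C.act a (z.fst m)) (C.act (HopfAlgebra.antipode k (r.fst i)) (z.snd m)) (C.act (r.snd i * b) (z.thd m)))
    simpa only [mk₂_apply] using h₅.symm

variable [IsIso 𝒮[C]] 

lemma lin_inv_antipode_act (h : H) (c : C.V) : lin (inv 𝒮[C]) (C.act h c) = C.act h (lin (inv 𝒮[C]) c) := lin_act _ _ _

set_option maxHeartbeats 2000000 in
-- The left side is the right-hand side of the cross relation for `b c` acting on `v`; the right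
-- side is `evRInv ≫ evL` followed by both actions, in elements. The identities `(S ⊗ S) R = R` and
-- `(id ⊗ S) R⁻¹ = R` remove the antipodes in `lact`, `sum_comulBar₃` passes from the coproduct of
-- `C̄` to that of `C`, and `cross_sum` moves the factors of `H`.
lemma sum_ev_smul_act (l : C ⊗ W ⟶ W) (q : W ⊗ B ⟶ W) (c : C.V) (v : W.V) (b : B.V)
    (x : Rep₃ (comulBar₃ C c)) (z : Rep₃ (comul₃ C c)) (y : Rep₃ (comul₃ B b)) :
    ∑ m, ∑ n, ∑ i₁, ∑ i₂, ∑ j₁, ∑ j₂,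
      (p.evₗ (lact C (r.fst i₁) (x.fst m)) (B.act (r.fst i₂) (y.fst n)) *
        p.evₗ (lact C (s.snd j₁) (antipodeInvₗ C (x.thd m))) (B.act (s.snd j₂) (y.thd n))) •
      lin q (tm W B (W.act (r.snd i₂ * s.fst j₁) (lin l (tm C W (lact C (r.snd i₁) (x.snd m)) v)))
        (B.act (s.fst j₂) (y.snd n))) =
    ∑ m, ∑ n, ∑ i, ∑ j, ∑ j', ∑ u, ∑ t, 
        (p.evB (z.fst m) (B.act (r.fst j * (r.fst u * r.fst t)) (y.fst n)) *
        p.evB (C.act (r.snd i * (r.snd j * r.snd j')) (lin (inv 𝒮[C]) (z.thd m))) (y.thd n)) •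
          lin q (tm W B (lin l (tm C W (C.act (r.snd t) (z.snd m)) (W.act (r.fst i * r.snd u) v)))
            (B.act (r.fst j') (y.snd n))) := by
  rw [Finset.sum_comm, Finset.sum_comm (s := Finset.univ (α := Fin z.n))]
  refine Finset.sum_congr rfl fun n _ => ?_
  trans ∑ m, ∑ i, ∑ u, ∑ j, ∑ j', (p.evB (C.act (r.fst i) (x.fst m)) (B.act (r.fst u) (y.fst n)) *
        p.evB (C.act (r.snd j * r.snd j') (lin (inv 𝒮[C]) (x.thd m))) (y.thd n)) •
      lin q (tm W B (W.act (r.snd u * r.fst j) (lin l (tm C W (C.act (r.snd i) (x.snd m)) v)))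
        (B.act (r.fst j') (y.snd n)))
  · refine Finset.sum_congr rfl fun m _ => ?_
    -- Both legs of this copy of `R` act on `C` through `lact`, hence through the antipode, and `(S
    -- ⊗ S) R = R` absorbs it.
    have h₁ := sum_antipode_antipode_rMatrix r (mk₂ fun a b => ∑ u, ∑ j, ∑ j', (p.evB (C.act a (x.fst m)) (B.act (r.fst u) (y.fst n)) *
        p.evB (C.act (r.snd j * r.snd j') (lin (inv 𝒮[C]) (x.thd m))) (y.thd n)) •
      lin q (tm W B (W.act (r.snd u * r.fst j) (lin l (tm C W (C.act b (x.snd m)) v)))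
        (B.act (r.fst j') (y.snd n))))
    simp only [mk₂_apply] at h₁
    rw [← h₁]
    refine Finset.sum_congr rfl fun i _ => ?_
    refine Finset.sum_congr rfl fun u _ => ?_
    simp only [p.evₗ_eq, lact, ← p.evB_act, act_comp]
    have h₂ := sum_rMatrixInv_antipode r s (mk₂ fun a b => ∑ j', (p.evB (C.act (HopfAlgebra.antipode k (r.fst i)) (x.fst m)) (B.act (r.fst u) (y.fst n)) *
        p.evB (C.act (b * r.snd j') (lin (inv 𝒮[C]) (x.thd m))) (y.thd n)) •
      lin q (tm W B (W.act (r.snd u * a) (lin l (tm C W (C.act (HopfAlgebra.antipode k (r.snd i)) (x.snd m)) v)))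
        (B.act (r.fst j') (y.snd n))))
    simp only [mk₂_apply, ← p.evB_act, act_comp] at h₂ ⊢
    rw [← h₂]
    refine Finset.sum_congr rfl fun j _ => ?_
    have h₃ := sum_rMatrixInv_antipode r s (mk₂ fun a b => (p.evB (C.act (HopfAlgebra.antipode k (r.fst i)) (x.fst m)) (B.act (r.fst u) (y.fst n)) *
        p.evB (C.act (HopfAlgebra.antipode k (s.snd j) * b) (lin (inv 𝒮[C]) (x.thd m))) (y.thd n)) •
      lin q (tm W B (W.act (r.snd u * s.fst j) (lin l (tm C W (C.act (HopfAlgebra.antipode k (r.snd i)) (x.snd m)) v)))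
        (B.act a (y.snd n))))
    simp only [mk₂_apply, ← p.evB_act, act_comp] at h₃ ⊢
    exact h₃
  have h₁ := sum_comulBar₃ r (mk₃ fun c₁ c₂ c₃ => ∑ u, ∑ j, ∑ j', (p.evB c₁ (B.act (r.fst u) (y.fst n)) *
        p.evB (C.act (r.snd j * r.snd j') (lin (inv 𝒮[C]) c₃)) (y.thd n)) •
      lin q (tm W B (W.act (r.snd u * r.fst j) (lin l (tm C W c₂ v)))
        (B.act (r.fst j') (y.snd n)))) x z
  simp only [mk₃_apply] at h₁
  rw [h₁]
  refine Finset.sum_congr rfl fun m _ => ?_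
  have h₂ := cross_sum r (isHLinear_curr l) (mk₃ fun a b w => ∑ j', (p.evB (z.fst m) (B.act a (y.fst n)) *
        p.evB (C.act (b * r.snd j') (lin (inv 𝒮[C]) (z.thd m))) (y.thd n)) •
      lin q (tm W B w (B.act (r.fst j') (y.snd n)))) (z.snd m) v
  simp only [mk₃_apply, curr_apply] at h₂
  trans ∑ i, ∑ j, ∑ u, ∑ t, ∑ j', (p.evB (z.fst m) (B.act (r.fst j * (r.fst u * r.fst t)) (y.fst n)) *
        p.evB (C.act ((r.snd i * r.snd j) * r.snd j') (lin (inv 𝒮[C]) (z.thd m))) (y.thd n)) •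
          lin q (tm W B (lin l (tm C W (C.act (r.snd t) (z.snd m)) (W.act (r.fst i * r.snd u) v)))
            (B.act (r.fst j') (y.snd n)))
  · rw [h₂]
    refine Finset.sum_congr rfl fun i _ => ?_
    rw [Finset.sum_comm]
    simp only [p.evB_act, act_comp, lin_inv_antipode_act, mul_assoc]
  · refine Finset.sum_congr rfl fun i _ => ?_
    refine Finset.sum_congr rfl fun j _ => ?_
    rw [sum_rev₃]
    simp only [mul_assoc]
    exact Finset.sum_congr rfl fun j' _ => Finset.sum_comm

end Frozen

/-! ### The crossing condition solved for one order of the two actions. -/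

section CrossedIff
variable {𝒞 : Type w} [Category.{v} 𝒞] [MonoidalCategory 𝒞] [BraidedCategory 𝒞]
variable {C B V : 𝒞} [HopfObj C] [HopfObj B] (p : DualPairing C B) [IsIso 𝒮[C]]

lemma crossLeft_eq_crossRight_iff (l : C ⊗ V ⟶ V) (q : V ⊗ B ⟶ V) :
    crossLeft p.ev l q = crossRight p.ev l q ↔
      C ◁ bin q (𝟙_ 𝒞) ≫ bin l (𝟙_ 𝒞) =
        p.evRInv V (𝟙_ 𝒞) ≫ p.evL V (𝟙_ 𝒞) ≫ bin l (B ⊗ 𝟙_ 𝒞) ≫ bin q (𝟙_ 𝒞) := by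
  rw [crossLeft_eq_evR, crossRight_eq_evL, cancel_epi, cancel_epi]
  simp only [← Category.assoc]
  rw [cancel_mono]
  simp only [Category.assoc]
  constructor
  · intro h
    rw [← h, ← Category.assoc (p.evRInv V _), p.evRInv_evR, Category.id_comp]
  · intro h
    rw [h, ← Category.assoc (p.evR V _), p.evR_evRInv, Category.id_comp]

end CrossedIff

/-! ### Crossed bimodules as representations of the relations. -/

section Relations
variable {k : Type u} [Field k] {H : Type u} [Ring H] [HopfAlgebra k H] [Quasitriangular k H]
variable {C B : RMod k H} [HopfObj C] [HopfObj B] [IsIso 𝒮[C]] (p : DualPairing C B)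

/-- The algebra relations of the double bosonisation for maps of `C`, `H` and `B` into an algebra. -/
structure DoubleRel (A : Type u) [Ring A] [Algebra k A] (iC : C.V →ₗ[k] A) (iH : H →ₐ[k] A)
    (iB : B.V →ₗ[k] A) : Prop where
  iC_one : iC (unitₗ C 1) = 1
  iC_mul : ∀ c d, iC c * iC d = iC (mulₗ C (d ⊗ₜ c))
  iH_mul_iC : ∀ (h : H) (c : C.V) (x : Rep₂ (Coalgebra.comul (R := k) h)),
    iH h * iC c = ∑ i, iC (lact C (x.fst i) c) * iH (x.snd i)
  iB_one : iB (unitₗ B 1) = 1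
  iB_mul : ∀ a b, iB a * iB b = iB (mulₗ B (a ⊗ₜ b))
  iB_mul_iH : ∀ (b : B.V) (h : H) (x : Rep₂ (Coalgebra.comul (R := k) h)),
    iB b * iH h = ∑ i, iH (x.fst i) * iB (B.act (x.snd i) b)
  iB_mul_iC : ∀ (b : B.V) (c : C.V) (y : Rep₃ (comul₃ B b)) (x : Rep₃ (comulBar₃ C c))
    (r : Rep₂ (rMatrix k H)) (s : Rep₂ (rMatrixInv k H)),
    iB b * iC c = ∑ m, ∑ n, ∑ i₁, ∑ i₂, ∑ j₁, ∑ j₂,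
      (p.evₗ (lact C (r.fst i₁) (x.fst m)) (B.act (r.fst i₂) (y.fst n)) *
        p.evₗ (lact C (s.snd j₁) (antipodeInvₗ C (x.thd m))) (B.act (s.snd j₂) (y.thd n))) •
      (iC (lact C (r.snd i₁) (x.snd m)) * iH (r.snd i₂ * s.fst j₁) *
        iB (B.act (s.fst j₂) (y.snd n)))

lemma DoubleBosonisation.rel {p : DualPairing C B} (U : DoubleBosonisation p) :
    DoubleRel p U.carrier U.iC (U.iH : H →ₐ[k] U.carrier) U.iB where
  iC_one := U.iC_one
  iC_mul := U.iC_mul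
  iH_mul_iC := U.iH_mul_iC
  iB_one := U.iB_one
  iB_mul := U.iB_mul
  iB_mul_iH := U.iB_mul_iH
  iB_mul_iC := U.iB_mul_iC

section lift
variable {A A' : Type u} [Ring A] [Algebra k A] [Ring A'] [Algebra k A']

/-- The map `c ⊗ h ⊗ b ↦ c h b`. -/
def triple (iC : C.V →ₗ[k] A) (iH : H →ₐ[k] A) (iB : B.V →ₗ[k] A) : (C.V ⊗[k] H) ⊗[k] B.V →ₗ[k] A :=
  LinearMap.mul' k A ∘ₗ TensorProduct.map (LinearMap.mul' k A ∘ₗ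
      TensorProduct.map iC (iH : H →ₗ[k] A)) iB

omit [HopfObj C] [HopfObj B] [Quasitriangular k H] [IsIso 𝒮[C]] in
@[simp] lemma triple_tmul (iC : C.V →ₗ[k] A) (iH : H →ₐ[k] A) (iB : B.V →ₗ[k] A) (c : C.V) (h : H) (b : B.V) :
    triple iC iH iB ((c ⊗ₜ h) ⊗ₜ b) = iC c * iH h * iB b := rfl

variable {iC : C.V →ₗ[k] A} {iH : H →ₐ[k] A} {iB : B.V →ₗ[k] A}
variable {iC' : C.V →ₗ[k] A'} {iH' : H →ₐ[k] A'} {iB' : B.V →ₗ[k] A'}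

omit [HopfObj C] [HopfObj B] [Quasitriangular k H] [IsIso 𝒮[C]] in
lemma triple_induction (hs : Function.Surjective (triple iC iH iB)) {P : A → Prop} (h0 : P 0)
    (ha : ∀ x y, P x → P y → P (x + y)) (hm : ∀ c h b, P (iC c * iH h * iB b)) (x : A) : P x := by
  obtain ⟨t, rfl⟩ := hs x
  induction t with
  | zero => simpa using h0
  | add x y hx hy => rw [map_add]; exact ha _ _ hx hy
  | tmul t b =>
    induction t with
    | zero => simpa using h0
    | add x y hx hy => rw [TensorProduct.add_tmul, map_add]; exact ha _ _ hx hy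
    | tmul c h => exact hm c h b

variable {p}

/-- The relations reorder any product into triples `c h b`. A linear map given on triples is
therefore multiplicative once the target satisfies the same relations. -/
theorem DoubleRel.exists_algHom (hA : DoubleRel p A iC iH iB) (hA' : DoubleRel p A' iC' iH' iB')
    (hb : Function.Bijective (triple iC iH iB)) :
    ∃ f : A →ₐ[k] A', (∀ c, f (iC c) = iC' c) ∧ (∀ h, f (iH h) = iH' h) ∧ ∀ b, f (iB b) = iB' b := by
  let e := LinearEquiv.ofBijective _ hb
  let f : A →ₗ[k] A' := triple iC' iH' iB' ∘ₗ e.symm.toLinearMap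
  have hf (c h b) : f (iC c * iH h * iB b) = iC' c * iH' h * iB' b := by
    have : e.symm (iC c * iH h * iB b) = (c ⊗ₜ h) ⊗ₜ b := by
      rw [LinearEquiv.symm_apply_eq]; rfl
    simp only [f, LinearMap.comp_apply, LinearEquiv.coe_coe, this, triple_tmul]
  -- Right multiplication is treated for `B`, then `H`, then `C`. Reordering in each case produces
  -- right factors that have already been treated.
  have hfB (x b) : f (x * iB b) = f x * iB' b := by
    induction x using triple_induction hb.2 with
    | h0 => simp
    | ha x y hx hy => rw [add_mul, map_add, hx, hy, map_add, add_mul]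
    | hm c h b' => rw [mul_assoc, hA.iB_mul, hf, hf, mul_assoc _ (iB' b'), hA'.iB_mul]
  have hfH (x h) : f (x * iH h) = f x * iH' h := by
    induction x using triple_induction hb.2 with
    | h0 => simp
    | ha x y hx hy => rw [add_mul, map_add, hx, hy, map_add, add_mul]
    | hm c h' b =>
      have d := Rep₂.some (Coalgebra.comul (R := k) h)
      rw [mul_assoc, hA.iB_mul_iH b h d, hf, mul_assoc _ (iB' b), hA'.iB_mul_iH b h d]
      simp only [Finset.mul_sum, map_sum, ← mul_assoc]
      simp only [mul_assoc _ (iH h'), mul_assoc _ (iH' h'), ← map_mul, hf]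
  have hfC' (c h d) : f (iC c * iH h * iC d) = iC' c * iH' h * iC' d := by
    have e := Rep₂.some (Coalgebra.comul (R := k) h)
    rw [mul_assoc, hA.iH_mul_iC h d e, mul_assoc (iC' c), hA'.iH_mul_iC h d e]
    simp only [Finset.mul_sum, map_sum, ← mul_assoc]
    refine Finset.sum_congr rfl fun i _ => ?_
    rw [hA.iC_mul, hA'.iC_mul, ← mul_one (_ * iH _), ← hA.iB_one, hf, hA'.iB_one, mul_one]
  have hfC (x d) : f (x * iC d) = f x * iC' d := by
    induction x using triple_induction hb.2 with
    | h0 => simp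
    | ha x y hx hy => rw [add_mul, map_add, hx, hy, map_add, add_mul]
    | hm c h b =>
      have x := Rep₃.some (comulBar₃ C d)
      have y := Rep₃.some (comul₃ B b)
      have r := Rep₂.some (rMatrix k H)
      have s := Rep₂.some (rMatrixInv k H)
      rw [mul_assoc, hA.iB_mul_iC b d y x r s, hf, mul_assoc _ (iB' b), hA'.iB_mul_iC b d y x r s]
      simp only [Finset.mul_sum, map_sum, mul_smul_comm, map_smul, ← mul_assoc, hfB, hfH, hfC']
  have hf1 : f 1 = 1 := by
    have := hf (unitₗ C 1) 1 (unitₗ B 1)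
    simpa [hA.iC_one, hA.iB_one, hA'.iC_one, hA'.iB_one] using this
  refine ⟨AlgHom.ofLinearMap f hf1 fun x y => ?_, fun c => ?_, fun h => ?_, fun b => ?_⟩
  · induction y using triple_induction hb.2 with
    | h0 => simp
    | ha y z hy hz => rw [mul_add, map_add, hy, hz, map_add, mul_add]
    | hm c h b => rw [← mul_assoc, ← mul_assoc, hfB, hfH, hfC, hf, mul_assoc, mul_assoc, mul_assoc]
  · have := hfC 1 c
    rwa [one_mul, hf1, one_mul] at this
  · have := hfH 1 h
    rwa [one_mul, hf1, one_mul] at this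
  · have := hfB 1 b
    rwa [one_mul, hf1, one_mul] at this

end lift

section EndAlgebra
section
variable {M : Type u} [AddCommGroup M] [Module k M] {X Y Z T : RMod k H}

lemma linearMap_ext_tm₃ {f g : (X ⊗ (Y ⊗ Z)).V →ₗ[k] M}
    (h : ∀ x y z, f (tm X _ x (tm Y Z y z)) = g (tm X _ x (tm Y Z y z))) : f = g :=
  linearMap_ext_tm fun x w => LinearMap.congr_fun (f := f ∘ₗ tm X _ x) (g := g ∘ₗ tm X _ x)
    (linearMap_ext_tm (h x)) w

lemma linearMap_ext_tm₄ {f g : (X ⊗ (Y ⊗ (Z ⊗ T))).V →ₗ[k] M}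
    (h : ∀ x y z t, f (tm X _ x (tm Y _ y (tm Z T z t))) = g (tm X _ x (tm Y _ y (tm Z T z t)))) :
    f = g :=
  linearMap_ext_tm fun x w => LinearMap.congr_fun (f := f ∘ₗ tm X _ x) (g := g ∘ₗ tm X _ x)
    (linearMap_ext_tm₃ (h x)) w

end

variable {W : RMod k H}

/-- The action of `H` as a homomorphism to the opposite of the endomorphism algebra. -/
def opAct {A : Type u} [Ring A] [Algebra k A] (W : RMod k A) : A →ₐ[k] (Module.End k W.V)ᵐᵒᵖ :=
  AlgHom.ofLinearMap ((MulOpposite.opLinearEquiv k).toLinearMap ∘ₗ W.act)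
    (congrArg MulOpposite.op W.act_one) fun a b => congrArg MulOpposite.op (W.act_mul a b)

/-- The left action of `C` as a map to the opposite of the endomorphism algebra. -/
def opLeft (l : C ⊗ W ⟶ W) : C.V →ₗ[k] (Module.End k W.V)ᵐᵒᵖ :=
  (MulOpposite.opLinearEquiv k).toLinearMap ∘ₗ curr l

/-- The right action of `B` as a map to the opposite of the endomorphism algebra. -/
def opRight (q : W ⊗ B ⟶ W) : B.V →ₗ[k] (Module.End k W.V)ᵐᵒᵖ :=
  (MulOpposite.opLinearEquiv k).toLinearMap ∘ₗ (curr q).flip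

lemma lin_crossed_apply {l : C ⊗ W ⟶ W} {q : W ⊗ B ⟶ W} (h : crossLeft p.ev l q = crossRight p.ev l q)
    (r : Rep₂ (rMatrix k H)) (s : Rep₂ (rMatrixInv k H)) (c : C.V) (v : W.V) (b : B.V)
    (x : Rep₃ (comulBar₃ C c)) (y : Rep₃ (comul₃ B b)) :
    lin l (tm C W c (lin q (tm W B v b))) =
      ∑ m, ∑ n, ∑ i₁, ∑ i₂, ∑ j₁, ∑ j₂,
      (p.evₗ (lact C (r.fst i₁) (x.fst m)) (B.act (r.fst i₂) (y.fst n)) *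
        p.evₗ (lact C (s.snd j₁) (antipodeInvₗ C (x.thd m))) (B.act (s.snd j₂) (y.thd n))) •
      lin q (tm W B (W.act (r.snd i₂ * s.fst j₁) (lin l (tm C W (lact C (r.snd i₁) (x.snd m)) v)))
        (B.act (s.fst j₂) (y.snd n))) := by
  have z : Rep₃ (comul₃ C c) := Rep₃.some _
  rw [crossLeft_eq_crossRight_iff] at h
  rw [sum_ev_smul_act p r s l q c v b x z y]
  have e := congrArg (fun f => lin f (tm C _ c (tm W _ v (tm B (𝟙_ (RMod k H)) b (1 : k))))) h
  simp only [lin_comp] at e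
  have e₂ := lin_cross p l q r c v b (1 : k) z y (Γ := 𝟙_ (RMod k H))
  simp only [lin_comp] at e₂
  rw [e₂] at e
  have e₃ := congrArg (lin (ρ_ W).hom) e
  rw [lin_rightUnitor_hom, one_smul] at e₃
  rw [← e₃]
  exact (one_smul k _).symm

lemma crossed_of_lin_apply {l : C ⊗ W ⟶ W} {q : W ⊗ B ⟶ W}
    (r : Rep₂ (rMatrix k H)) (s : Rep₂ (rMatrixInv k H))
    (x : ∀ c, Rep₃ (comulBar₃ C c)) (y : ∀ b, Rep₃ (comul₃ B b))
    (h : ∀ c v b, lin l (tm C W c (lin q (tm W B v b))) =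
      ∑ m, ∑ n, ∑ i₁, ∑ i₂, ∑ j₁, ∑ j₂,
      (p.evₗ (lact C (r.fst i₁) ((x c).fst m)) (B.act (r.fst i₂) ((y b).fst n)) *
        p.evₗ (lact C (s.snd j₁) (antipodeInvₗ C ((x c).thd m))) (B.act (s.snd j₂) ((y b).thd n))) •
      lin q (tm W B (W.act (r.snd i₂ * s.fst j₁) (lin l (tm C W (lact C (r.snd i₁) ((x c).snd m)) v)))
        (B.act (s.fst j₂) ((y b).snd n)))) :
    crossLeft p.ev l q = crossRight p.ev l q := by
  have z : ∀ c, Rep₃ (comul₃ C c) := fun _ => Rep₃.some _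
  rw [crossLeft_eq_crossRight_iff]
  refine lin_ext fun w => LinearMap.congr_fun (f := lin _) (g := lin _) (linearMap_ext_tm₄ fun c v b t => ?_) w
  have e₂ := lin_cross p l q r c v b t (z c) (y b) (Γ := 𝟙_ (RMod k H))
  refine Eq.trans ?_ e₂.symm
  rw [← sum_ev_smul_act p r s l q c v b (x c) (z c) (y b), ← h]
  rfl

/-- In the opposite endomorphism algebra the left factor of a product acts first. The opposite
product of `C̄` then expresses the left action of `C`, the relations with `H` are the `H`-linearity
of the two actions, and the cross relation is the crossing condition. -/
lemma doubleRel_opAct {l : C ⊗ W ⟶ W} {q : W ⊗ B ⟶ W} (h : IsCrossedBimodule p l q) :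
    DoubleRel p (Module.End k W.V)ᵐᵒᵖ (opLeft l) (opAct W) (opRight q) where
  iC_one := by
    refine MulOpposite.unop_injective (LinearMap.ext fun v => ?_)
    exact congrArg (fun f => lin f (tm _ W (1 : k) v)) h.one_left |>.trans (one_smul k v)
  iC_mul c d := by
    refine MulOpposite.unop_injective (LinearMap.ext fun v => ?_)
    exact congrArg (fun f => lin f (tm _ W (tm C C d c) v)) h.mul_left.symm
  iH_mul_iC a c d := by
    refine MulOpposite.unop_injective (LinearMap.ext fun v => ?_)
    rw [Finset.unop_sum, LinearMap.sum_apply]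
    exact (isHLinear_curr l).act_right a d c v
  iB_one := by
    refine MulOpposite.unop_injective (LinearMap.ext fun v => ?_)
    exact congrArg (fun f => lin f (tm W _ v (1 : k))) h.right_one |>.trans (one_smul k v)
  iB_mul a b := by
    refine MulOpposite.unop_injective (LinearMap.ext fun v => ?_)
    exact congrArg (fun f => lin f (tm W _ v (tm B B a b))) h.right_mul.symm
  iB_mul_iH b a d := by
    refine MulOpposite.unop_injective (LinearMap.ext fun v => ?_)
    rw [Finset.unop_sum, LinearMap.sum_apply]
    exact ((isHLinear_curr q) a d v b).symm
  iB_mul_iC b c y x r s := by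
    refine MulOpposite.unop_injective (LinearMap.ext fun v => ?_)
    have e := lin_crossed_apply p h.crossed r s c v b x y
    simp only [Finset.unop_sum, MulOpposite.unop_smul, LinearMap.sum_apply, LinearMap.smul_apply]
    exact e

section restrict
variable {A : Type u} [Ring A] [Algebra k A] {iC : C.V →ₗ[k] A} {iH : H →ₐ[k] A} {iB : B.V →ₗ[k] A}

lemma act_sum_apply {J : Type*} (M : RMod k A) (t : Finset J) (f : J → A) (v : M.V) :
    M.act (∑ i ∈ t, f i) v = ∑ i ∈ t, M.act (f i) v := by
  rw [map_sum]
  exact LinearMap.sum_apply t _ v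

lemma act_smul_apply (M : RMod k A) (t : k) (a : A) (v : M.V) : M.act (t • a) v = t • M.act a v := by
  rw [map_smul]
  rfl

lemma act_mul_apply (M : RMod k A) (a b : A) (v : M.V) : M.act (a * b) v = M.act b (M.act a v) := by
  rw [M.act_mul]
  rfl

/-- Restriction of scalars. -/
def RMod.restrict (iH : H →ₐ[k] A) (M : RMod k A) : RMod k H where
  V := M.V
  act := M.act ∘ₗ (iH : H →ₗ[k] A)
  act_one := by simp [M.act_one]
  act_mul a b := by simp [M.act_mul]

/-- The converse of `IsHLinear.act_right`, now cancelling `h₁ (S h₂)`. It recovers the `H`-linearity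
of the action of `C` from the relation between `H` and `C`. -/
lemma IsHLinear.of_act_right {C V W : RMod k H} {L : C.V →ₗ[k] V.V →ₗ[k] W.V}
    (hL : ∀ (h : H) (d : Rep₂ (Coalgebra.comul (R := k) h)) (c : C.V) (v : V.V),
      L c (V.act h v) = ∑ m, W.act (d.snd m) (L (C.act (HopfAlgebra.antipode k (d.fst m)) c) v)) :
    IsHLinear C V W L := fun h d c v => by
  have d' : ∀ h : H, Rep₂ (Coalgebra.comul (R := k) h) := fun _ => Rep₂.some _
  have e' := d.sum_congr (d' h) (mk₂ fun a b => L (C.act a c) (V.act b v))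
  simp only [mk₂_apply] at e'
  rw [e']
  simp only [hL _ (d' _), act_comp C]
  have e := sum_coassoc (mk₃ fun x y z => W.act z (L (C.act (x * HopfAlgebra.antipode k y) c) v)) d' h
  simp only [mk₃_apply] at e
  rw [e]
  have e₂ (m) : ∑ n, W.act ((d' h).snd m) (L (C.act ((d' ((d' h).fst m)).fst n * HopfAlgebra.antipode k ((d' ((d' h).fst m)).snd n)) c) v) =
      W.act (Coalgebra.counit (R := k) ((d' h).fst m) • ((d' h).snd m)) (L c v) := by
    simp only [← LinearMap.sum_apply, ← map_sum, sum_mul_antipode]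
    simp [Algebra.algebraMap_eq_smul_one, C.act_one]
  simp only [e₂]
  conv_rhs => rw [← sum_counit_smul (d' h)]
  simp only [← LinearMap.sum_apply, ← map_sum]

/-- A morphism from a tensor product built from a bilinear map. -/
def homMk {X Y Z : RMod k H} (L : X.V →ₗ[k] Y.V →ₗ[k] Z.V) (hL : IsHLinear X Y Z L) : X ⊗ Y ⟶ Z where
  hom := ModuleCat.ofHom (TensorProduct.lift L)
  comm h w := by
    have d := Rep₂.some (Coalgebra.comul (R := k) h)
    let L' : (X ⊗ Y).V →ₗ[k] Z.V := TensorProduct.lift L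
    change (L' ∘ₗ (X ⊗ Y).act h) w = (Z.act h ∘ₗ L') w
    refine LinearMap.congr_fun (linearMap_ext_tm fun x y => ?_) w
    rw [LinearMap.comp_apply, act_tm h d, map_sum]
    exact hL h d x y

variable {p} (hA : DoubleRel p A iC iH iB) (M : RMod k A)

lemma DoubleRel.act_iC_act_iH (hA : DoubleRel p A iC iH iB) (M : RMod k A) (h : H) (d : Rep₂ (Coalgebra.comul (R := k) h)) (c : C.V) (v : M.V) :
    M.act (iC c) (M.act (iH h) v) = ∑ m, M.act (iH (d.snd m)) (M.act (iC (lact C (d.fst m) c)) v) := by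
  simp only [← act_mul_apply, ← act_sum_apply]
  rw [← hA.iH_mul_iC]

lemma DoubleRel.act_iH_act_iB (hA : DoubleRel p A iC iH iB) (M : RMod k A) (h : H) (d : Rep₂ (Coalgebra.comul (R := k) h)) (v : M.V) (b : B.V) :
    ∑ m, M.act (iB (B.act (d.snd m) b)) (M.act (iH (d.fst m)) v) = M.act (iH h) (M.act (iB b) v) := by
  simp only [← act_mul_apply, ← act_sum_apply]
  rw [← hA.iB_mul_iH]

lemma DoubleRel.act_iC_act_iB (hA : DoubleRel p A iC iH iB) (M : RMod k A) (c : C.V) (v : M.V) (b : B.V) (r : Rep₂ (rMatrix k H)) (s : Rep₂ (rMatrixInv k H))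
    (x : Rep₃ (comulBar₃ C c)) (y : Rep₃ (comul₃ B b)) :
    M.act (iC c) (M.act (iB b) v) = 
      ∑ m, ∑ n, ∑ i₁, ∑ i₂, ∑ j₁, ∑ j₂,
      (p.evₗ (lact C (r.fst i₁) (x.fst m)) (B.act (r.fst i₂) (y.fst n)) *
        p.evₗ (lact C (s.snd j₁) (antipodeInvₗ C (x.thd m))) (B.act (s.snd j₂) (y.thd n))) •
      M.act (iB (B.act (s.fst j₂) (y.snd n))) (M.act (iH (r.snd i₂ * s.fst j₁)) 
        (M.act (iC (lact C (r.snd i₁) (x.snd m))) v)) := by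
  simp only [← act_mul_apply, ← act_sum_apply, ← act_smul_apply]
  rw [hA.iB_mul_iC b c y x r s]


/-- The left action of `C` on a module over an algebra that satisfies the relations. -/
def DoubleRel.left : C ⊗ M.restrict iH ⟶ M.restrict iH :=
  homMk (M.act ∘ₗ iC) (.of_act_right fun h d c v => hA.act_iC_act_iH M h d c v)

/-- The right action of `B` on a module over an algebra that satisfies the relations. -/
def DoubleRel.right : M.restrict iH ⊗ B ⟶ M.restrict iH :=
  homMk (Z := M.restrict iH) (M.act ∘ₗ iB).flip fun h d v b => hA.act_iH_act_iB M h d v b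

lemma DoubleRel.isCrossed : IsCrossedBimodule p (hA.left M) (hA.right M) where
  one_left := lin_ext₂ fun (t : k) v => by
    change M.act (iC (unitₗ C t)) v = t • v
    rw [← mul_one t, ← smul_eq_mul, map_smul, map_smul, hA.iC_one, map_smul, M.act_one, smul_eq_mul, mul_one]
    rfl
  mul_left := lin_ext fun x => by
    refine LinearMap.congr_fun (f := lin _) (g := lin _) (linearMap_ext_tm fun w v => ?_) x
    refine LinearMap.congr_fun (f := lin (μ[C] ▷ M.restrict iH ≫ hA.left M) ∘ₗ (tm (C ⊗ C) (M.restrict iH)).flip v)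
      (g := lin ((α_ C C (M.restrict iH)).hom ≫ C ◁ hA.left M ≫ hA.left M) ∘ₗ (tm (C ⊗ C) (M.restrict iH)).flip v)
      (linearMap_ext_tm fun c d => ?_) w
    change M.act (iC (mulₗ C (c ⊗ₜ d))) v = M.act (iC c) (M.act (iC d) v)
    rw [← hA.iC_mul, M.act_mul]; rfl
  right_one := lin_ext₂ fun v (t : k) => by
    change M.act (iB (unitₗ B t)) v = t • v
    rw [← mul_one t, ← smul_eq_mul, map_smul, map_smul, hA.iB_one, map_smul, M.act_one, smul_eq_mul, mul_one]
    rfl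
  right_mul := lin_ext fun x => LinearMap.congr_fun (linearMap_ext_tm₃ fun v a b => by
    change M.act (iB (mulₗ B (a ⊗ₜ b))) v = M.act (iB b) (M.act (iB a) v)
    rw [← hA.iB_mul, M.act_mul]; rfl) x
  crossed := by
    have x : ∀ c, Rep₃ (comulBar₃ C c) := fun _ => Rep₃.some _
    have y : ∀ b, Rep₃ (comul₃ B b) := fun _ => Rep₃.some _
    have r := Rep₂.some (rMatrix k H)
    have s := Rep₂.some (rMatrixInv k H)
    refine crossed_of_lin_apply p r s x y ?_
    intro c v b
    exact hA.act_iC_act_iB M c v b r s (x c) (y b)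

/-- The crossed bimodule of a module over an algebra that satisfies the relations. -/
def DoubleRel.toCrossed : CrossedBimodule p :=
  ⟨M.restrict iH, hA.left M, hA.right M, hA.isCrossed M⟩

end restrict

end EndAlgebra

end Relations

/-! ### Braided tensor product actions in elements. -/

section TensorActions
variable {k : Type u} [Field k] {H : Type u} [Ring H] [HopfAlgebra k H] [Quasitriangular k H]
variable {C B V W V' W' : RMod k H} [HopfObj C] [HopfObj B]

@[simp] lemma lin_tensorHom (f : V ⟶ V') (g : W ⟶ W') (v : V.V) (w : W.V) :
    lin (f ⊗ₘ g) (tm V W v w) = tm V' W' (lin f v) (lin g w) := rfl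

lemma lin_tensorμ (X Y Z T : RMod k H) (r : Rep₂ (rMatrix k H)) (x : X.V) (y : Y.V) (z : Z.V) (t : T.V) :
    lin (tensorμ X Y Z T) (tm (X ⊗ Y) (Z ⊗ T) (tm X Y x y) (tm Z T z t)) =
      ∑ i, tm (X ⊗ Z) (Y ⊗ T) (tm X Z x (Z.act (r.fst i) z)) (tm Y T (Y.act (r.snd i) y) t) := by
  simp [tensorμ, lin_braiding r]

lemma lin_tensorLeftAct (l : C ⊗ V ⟶ V') (l' : C ⊗ W ⟶ W') (r : Rep₂ (rMatrix k H)) (c : C.V)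
    (d : Rep₂ (comulₗ C c)) (v : V.V) (w : W.V) :
    lin (tensorLeftAct l l') (tm C (V ⊗ W) c (tm V W v w)) =
      ∑ m, ∑ i, tm V' W' (lin l (tm C V (d.fst m) (V.act (r.fst i) v)))
        (lin l' (tm C W (C.act (r.snd i) (d.snd m)) w)) := by
  simp [tensorLeftAct, lin_tensorμ _ _ _ _ r, lin_comul d]

lemma lin_tensorRightAct (q : V ⊗ B ⟶ V') (q' : W ⊗ B ⟶ W') (r : Rep₂ (rMatrix k H)) (b : B.V)
    (d : Rep₂ (comulₗ B b)) (v : V.V) (w : W.V) :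
    lin (tensorRightAct q q') (tm (V ⊗ W) B (tm V W v w) b) =
      ∑ m, ∑ i, tm V' W' (lin q (tm V B v (B.act (r.fst i) (d.fst m))))
        (lin q' (tm W B (W.act (r.snd i) w) (d.snd m))) := by
  simp [tensorRightAct, lin_tensorμ _ _ _ _ r, lin_comul d]

lemma sum_comulBar {M : Type u} [AddCommGroup M] [Module k M] (s : Rep₂ (rMatrixInv k H)) {c : C.V}
    (d : Rep₂ (comulₗ C c)) (x : Rep₂ (comulBar C c)) (g : C.V →ₗ[k] C.V →ₗ[k] M) :
    ∑ m, g (x.fst m) (x.snd m) = ∑ m, ∑ i, g (C.act (s.fst i) (d.fst m)) (C.act (s.snd i) (d.snd m)) := by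
  rw [x.sum_eq, comulBar_eq s d]
  let G : (C ⊗ C).V →ₗ[k] M := TensorProduct.lift g
  change G (∑ m, ∑ i, tm C C (C.act (s.fst i) (d.fst m)) (C.act (s.snd i) (d.snd m))) = _
  simp only [map_sum]
  rfl

set_option maxHeartbeats 1000000 in
-- The coproduct of `U` on `C` acts as the braided tensor product. By `H`-linearity of `l` and the
-- formula for `(Δ ⊗ id) R⁻¹` the outer `R⁻¹` splits in two. With the antipode in `lact`, one part
-- becomes a copy of `R` cancelling the `R⁻¹` inside `comulBar`, and the other becomes the `R` of
-- the braiding.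
lemma lin_tensorLeftAct_comulBar (l : C ⊗ V ⟶ V') (l' : C ⊗ W ⟶ W') (s : Rep₂ (rMatrixInv k H)) (c : C.V)
    (x : Rep₂ (comulBar C c)) (v : V.V) (w : W.V) :
    lin (tensorLeftAct l l') (tm C (V ⊗ W) c (tm V W v w)) =
      ∑ m, ∑ i, tm V' W' (V'.act (s.fst i) (lin l (tm C V (x.fst m) v)))
        (lin l' (tm C W (lact C (s.snd i) (x.snd m)) w)) := by
  have r := Rep₂.some (rMatrix k H)
  have d := Rep₂.some (comulₗ C c)
  have D : ∀ h : H, Rep₂ (Coalgebra.comul (R := k) h) := fun _ => Rep₂.some _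
  have e := sum_comulBar s d x (mk₂ fun a b => ∑ i, tm V' W' (V'.act (s.fst i) (curr l a v))
    (curr l' (C.act (HopfAlgebra.antipode k (s.snd i)) b) w))
  simp only [mk₂_apply] at e
  refine Eq.trans ?_ e.symm
  rw [lin_tensorLeftAct l l' r c d]
  refine Finset.sum_congr rfl fun m _ => ?_
  have e₁ (j) := comul_fst_rMatrixInv s (mk₃ fun a b b' => tm V' W' (curr l (C.act (s.fst j * a) (d.fst m)) (V.act b v))
    (curr l' (C.act (s.snd j * HopfAlgebra.antipode k b') (d.snd m)) w)) D
  simp only [mk₃_apply] at e₁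
  have e₂ (i j) : tm V' W' (V'.act (s.fst i) (curr l (C.act (s.fst j) (d.fst m)) v))
      (curr l' (C.act (HopfAlgebra.antipode k (s.snd i)) (C.act (s.snd j) (d.snd m))) w) =
      ∑ n, tm V' W' (curr l (C.act (s.fst j * (D (s.fst i)).fst n) (d.fst m)) (V.act ((D (s.fst i)).snd n) v))
        (curr l' (C.act (s.snd j * HopfAlgebra.antipode k (s.snd i)) (d.snd m)) w) := by
    rw [← isHLinear_curr l _ (D _)]
    simp only [act_comp, map_sum, LinearMap.sum_apply]
  simp only [e₂, e₁, HopfAlgebra.antipode_mul_antidistrib, ← mul_assoc]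
  have e₃ (i j) := sum_rMatrixInv_antipode r s (mk₂ fun a b => tm V' W' (curr l (C.act (s.fst j * a) (d.fst m)) (V.act (s.fst i) v))
    (curr l' (C.act (s.snd j * b * HopfAlgebra.antipode k (s.snd i)) (d.snd m)) w))
  simp only [mk₂_apply] at e₃
  simp only [e₃]
  rw [Finset.sum_comm]
  have e₄ (i) := sum_inv_mul r s (mk₂ fun a b => tm V' W' (curr l (C.act a (d.fst m)) (V.act (s.fst i) v))
    (curr l' (C.act (b * HopfAlgebra.antipode k (s.snd i)) (d.snd m)) w))
  simp only [mk₂_apply] at e₄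
  simp only [e₄, one_mul, act_one_apply]
  have e₅ := sum_rMatrixInv_antipode r s (mk₂ fun a b => tm V' W' (curr l (d.fst m) (V.act a v))
    (curr l' (C.act b (d.snd m)) w))
  simp only [mk₂_apply] at e₅
  rw [e₅]
  rfl

end TensorActions

/-! ### The equivalence with modules, and the action of the coproduct. -/

section Modules
variable {k : Type u} [Field k] {H : Type u} [Ring H] [HopfAlgebra k H] [Quasitriangular k H]
variable {C B : RMod k H} [HopfObj C] [HopfObj B] [IsIso 𝒮[C]] {p : DualPairing C B}
variable {A : Type u} [Ring A] [Algebra k A] {iC : C.V →ₗ[k] A} {iH : H →ₐ[k] A} {iB : B.V →ₗ[k] A}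

omit [HopfObj C] [HopfObj B] [Quasitriangular k H] [IsIso 𝒮[C]] in
lemma commute_of_triple (hs : Function.Surjective (triple iC iH iB)) {M N : RMod k A} (f : M.V →ₗ[k] N.V)
    (hC : ∀ c v, f (M.act (iC c) v) = N.act (iC c) (f v)) (hH : ∀ h v, f (M.act (iH h) v) = N.act (iH h) (f v))
    (hB : ∀ b v, f (M.act (iB b) v) = N.act (iB b) (f v)) (a : A) (v : M.V) :
    f (M.act a v) = N.act a (f v) := by
  induction a using triple_induction hs generalizing v with
  | h0 => simp
  | ha x y hx hy => rw [map_add, map_add, LinearMap.add_apply, LinearMap.add_apply, map_add, hx, hy]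
  | hm c h b => simp only [act_mul_apply, hC, hH, hB]

variable (hA : DoubleRel p A iC iH iB) (hb : Function.Bijective (triple iC iH iB)) (X Y : CrossedBimodule p)

/-- The module over the algebra of the double bosonisation defined by a crossed bimodule. -/
def DoubleRel.toModule : RMod k A where
  V := X.V.V
  act := (MulOpposite.opLinearEquiv k).symm.toLinearMap ∘ₗ
    (hA.exists_algHom (doubleRel_opAct p X.isCrossed) hb).choose.toLinearMap
  act_one := by
    refine MulOpposite.op_injective ?_
    exact map_one (hA.exists_algHom (doubleRel_opAct p X.isCrossed) hb).choose
  act_mul a b := by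
    refine MulOpposite.op_injective ?_
    exact map_mul (hA.exists_algHom (doubleRel_opAct p X.isCrossed) hb).choose a b

lemma DoubleRel.toModule_act_iC (c : C.V) (v : X.V.V) :
    (hA.toModule hb X).act (iC c) v = lin X.left (tm C X.V c v) :=
  LinearMap.congr_fun (congrArg MulOpposite.unop
    ((hA.exists_algHom (doubleRel_opAct p X.isCrossed) hb).choose_spec.1 c)) v

lemma DoubleRel.toModule_act_iH (h : H) (v : X.V.V) : (hA.toModule hb X).act (iH h) v = X.V.act h v :=
  LinearMap.congr_fun (congrArg MulOpposite.unop
    ((hA.exists_algHom (doubleRel_opAct p X.isCrossed) hb).choose_spec.2.1 h)) v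

lemma DoubleRel.toModule_act_iB (b : B.V) (v : X.V.V) :
    (hA.toModule hb X).act (iB b) v = lin X.right (tm X.V B v b) :=
  LinearMap.congr_fun (congrArg MulOpposite.unop
    ((hA.exists_algHom (doubleRel_opAct p X.isCrossed) hb).choose_spec.2.2 b)) v

/-- The functor from crossed bimodules to modules over the algebra of the double bosonisation. -/
def DoubleRel.toModuleFunctor : CrossedBimodule p ⥤ RMod k A where
  obj X := hA.toModule hb X
  map {X Y} f := ⟨f.hom.hom, fun a v => by
    refine commute_of_triple hb.2 (M := hA.toModule hb X) (N := hA.toModule hb Y) f.hom.hom.hom ?_ ?_ ?_ a v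
    · intro c v
      exact (congrArg (lin f.hom) (hA.toModule_act_iC hb X c v)).trans (Eq.trans (
        congrArg (fun f => lin f (tm C X.V c v)) f.left_comm) (hA.toModule_act_iC hb Y c _).symm)
    · intro h v
      exact (congrArg (lin f.hom) (hA.toModule_act_iH hb X h v)).trans (Eq.trans (
        f.hom.comm h v) (hA.toModule_act_iH hb Y h _).symm)
    · intro b v
      exact (congrArg (lin f.hom) (hA.toModule_act_iB hb X b v)).trans (Eq.trans (
        congrArg (fun f => lin f (tm X.V B v b)) f.right_comm) (hA.toModule_act_iB hb Y b _).symm)⟩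
  map_id _ := rfl
  map_comp _ _ := rfl

instance : (hA.toModuleFunctor hb).Faithful where
  map_injective {X Y f g} h := by
    apply CrossedBimodule.hom_ext
    apply RMod.hom_ext
    exact congrArg (fun φ : hA.toModule hb X ⟶ hA.toModule hb Y => φ.hom) h

lemma hom_commute_act {M N : RMod k A} (f : M ⟶ N) (a : A) (v : M.V) :
    f.hom.hom (M.act a v) = N.act a (f.hom.hom v) := f.comm a v

instance : (hA.toModuleFunctor hb).Full where
  map_surjective {X Y} g := by
    refine ⟨⟨⟨g.hom, fun h v => ?_⟩, ?_, ?_⟩, rfl⟩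
    · exact (congrArg g.hom.hom (hA.toModule_act_iH hb X h v)).symm.trans
        ((hom_commute_act g (iH h) v).trans (hA.toModule_act_iH hb Y h _))
    · refine lin_ext₂ fun c v => ?_
      exact (congrArg g.hom.hom (hA.toModule_act_iC hb X c v)).symm.trans
        ((hom_commute_act g (iC c) v).trans (hA.toModule_act_iC hb Y c _))
    · refine lin_ext₂ fun v b => ?_
      exact (congrArg g.hom.hom (hA.toModule_act_iB hb X b v)).symm.trans
        ((hom_commute_act g (iB b) v).trans (hA.toModule_act_iB hb Y b _))

lemma DoubleRel.toModule_toCrossed_act (M : RMod k A) (a : A) (v : M.V) :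
    (hA.toModule hb (hA.toCrossed M)).act a v = M.act a v :=
  commute_of_triple hb.2 (M := hA.toModule hb (hA.toCrossed M)) (N := M) LinearMap.id
    (hA.toModule_act_iC hb (hA.toCrossed M)) (hA.toModule_act_iH hb (hA.toCrossed M))
    (fun b v => hA.toModule_act_iB hb (hA.toCrossed M) b v) a v

instance : (hA.toModuleFunctor hb).EssSurj where
  mem_essImage M := ⟨hA.toCrossed M, ⟨RMod.isoMk (V := hA.toModule hb (hA.toCrossed M)) (W := M) (Iso.refl _)
    (hA.toModule_toCrossed_act hb M)⟩⟩

instance : (hA.toModuleFunctor hb).IsEquivalence where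

variable (iC iH iB) in
/-- The coproduct of `U` on `C`. -/
def comulC : C.V →ₗ[k] A ⊗[k] A :=
  TensorProduct.lift (mk₂ fun c d => ∑ i, (iC c * iH ((Rep₂.some (rMatrixInv k H)).fst i)) ⊗ₜ[k]
    iC (lact C ((Rep₂.some (rMatrixInv k H)).snd i) d)) ∘ₗ comulBar C

variable (iC iH iB) in
/-- The coproduct of `U` on `B`. -/
def comulB : B.V →ₗ[k] A ⊗[k] A :=
  TensorProduct.lift (mk₂ fun b d => ∑ i, iB (B.act ((Rep₂.some (rMatrix k H)).fst i) b) ⊗ₜ[k]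
    (iH ((Rep₂.some (rMatrix k H)).snd i) * iB d)) ∘ₗ comulₗ B

lemma comulC_eq (c : C.V) (x : Rep₂ (comulBar C c)) (s : Rep₂ (rMatrixInv k H)) :
    comulC iC iH c = ∑ m, ∑ i, (iC (x.fst m) * iH (s.fst i)) ⊗ₜ[k] iC (lact C (s.snd i) (x.snd m)) := by
  rw [comulC, LinearMap.comp_apply, ← x.sum_eq]
  refine Finset.sum_congr rfl fun m _ => ?_
  rw [mk₂_apply]
  exact Rep₂.sum_congr (Rep₂.some _) s (mk₂ (fun a b => (iC (x.fst m) * iH a) ⊗ₜ[k]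
    iC (C.act (HopfAlgebra.antipode k b) (x.snd m))))

lemma comulB_eq (b : B.V) (x : Rep₂ (comulₗ B b)) (r : Rep₂ (rMatrix k H)) :
    comulB iH iB b = ∑ m, ∑ i, iB (B.act (r.fst i) (x.fst m)) ⊗ₜ[k] (iH (r.snd i) * iB (x.snd m)) := by
  rw [comulB, LinearMap.comp_apply, ← x.sum_eq]
  refine Finset.sum_congr rfl fun m _ => ?_
  rw [mk₂_apply]
  exact Rep₂.sum_congr (Rep₂.some _) r (mk₂ (fun a h => iB (B.act a (x.fst m)) ⊗ₜ[k] (iH h * iB (x.snd m))))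

omit [IsIso 𝒮[C]] [HopfObj C] [HopfObj B] [Quasitriangular k H] in
lemma tensorEnd_sum_tmul {V W : Type u} [AddCommGroup V] [Module k V] [AddCommGroup W] [Module k W] {m n : ℕ}
    (f g) (a b : Fin m → Fin n → A) (v : V) (w : W) :
    tensorEnd (k := k) f g (∑ i, ∑ j, a i j ⊗ₜ b i j) (v ⊗ₜ w) = ∑ i, ∑ j, f (a i j) v ⊗ₜ g (b i j) w := by
  simp only [map_sum, LinearMap.sum_apply, tensorEnd_tmul]

lemma DoubleRel.tensorEnd_comulC (c : C.V) (t : (X.V ⊗ Y.V).V) :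
    tensorEnd (hA.toModule hb X).act (hA.toModule hb Y).act (comulC iC iH c) t =
      lin (tensorLeftAct X.left Y.left) (tm C (X.V ⊗ Y.V) c t) := by
  refine LinearMap.congr_fun (f := (tensorEnd (hA.toModule hb X).act (hA.toModule hb Y).act (comulC iC iH c) : (X.V ⊗ Y.V).V →ₗ[k] (X.V ⊗ Y.V).V))
    (g := lin (tensorLeftAct X.left Y.left) ∘ₗ tm C (X.V ⊗ Y.V) c) (linearMap_ext_tm fun v w => ?_) t
  have x := Rep₂.some (comulBar C c)
  have s := Rep₂.some (rMatrixInv k H)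
  refine (congrArg (fun z => tensorEnd (hA.toModule hb X).act (hA.toModule hb Y).act z (v ⊗ₜ w)) (comulC_eq c x s)).trans
    ((tensorEnd_sum_tmul (hA.toModule hb X).act (hA.toModule hb Y).act _ _ _ _).trans
      (Eq.trans ?_ (lin_tensorLeftAct_comulBar X.left Y.left s c x v w).symm))
  refine Finset.sum_congr rfl fun m _ => Finset.sum_congr rfl fun i _ => ?_
  refine congrArg₂ (fun a b => tm X.V Y.V a b) ?_ (hA.toModule_act_iC hb Y _ w)
  exact (act_mul_apply (hA.toModule hb X) _ _ v).trans ((hA.toModule_act_iH hb X _ _).trans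
    (congrArg (X.V.act _) (hA.toModule_act_iC hb X _ v)))

lemma DoubleRel.tensorEnd_comulB (b : B.V) (t : (X.V ⊗ Y.V).V) :
    tensorEnd (hA.toModule hb X).act (hA.toModule hb Y).act (comulB iH iB b) t =
      lin (tensorRightAct X.right Y.right) (tm (X.V ⊗ Y.V) B t b) := by
  refine LinearMap.congr_fun (f := (tensorEnd (hA.toModule hb X).act (hA.toModule hb Y).act (comulB iH iB b) : (X.V ⊗ Y.V).V →ₗ[k] (X.V ⊗ Y.V).V))
    (g := lin (tensorRightAct X.right Y.right) ∘ₗ (tm (X.V ⊗ Y.V) B).flip b) (linearMap_ext_tm fun v w => ?_) t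
  have x := Rep₂.some (comulₗ B b)
  have r := Rep₂.some (rMatrix k H)
  refine (congrArg (fun z => tensorEnd (hA.toModule hb X).act (hA.toModule hb Y).act z (v ⊗ₜ w)) (comulB_eq b x r)).trans
    ((tensorEnd_sum_tmul (hA.toModule hb X).act (hA.toModule hb Y).act _ _ _ _).trans
      (Eq.trans ?_ (lin_tensorRightAct X.right Y.right r b x v w).symm))
  refine Finset.sum_congr rfl fun m _ => Finset.sum_congr rfl fun i _ => ?_
  refine congrArg₂ (fun a b => tm X.V Y.V a b) (hA.toModule_act_iB hb X _ v) ?_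
  exact (act_mul_apply (hA.toModule hb Y) _ _ w).trans ((hA.toModule_act_iB hb Y _ _).trans
    (congrArg (fun z => lin Y.right (tm Y.V B z (x.snd m))) (hA.toModule_act_iH hb Y _ w)))

variable (iH) in
/-- The coproduct of `U` on `H`. -/
def comulH : H →ₐ[k] A ⊗[k] A := (Algebra.TensorProduct.map iH iH).comp (Bialgebra.comulAlgHom k H)

lemma DoubleRel.tensorEnd_comulH (h : H) (t : (X.V ⊗ Y.V).V) :
    tensorEnd (hA.toModule hb X).act (hA.toModule hb Y).act (comulH iH h) t = (X.V ⊗ Y.V).act h t := by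
  have eX : (hA.toModule hb X).act ∘ₗ iH.toLinearMap = X.V.act :=
    LinearMap.ext fun h => LinearMap.ext fun v => hA.toModule_act_iH hb X h v
  have eY : (hA.toModule hb Y).act ∘ₗ iH.toLinearMap = Y.V.act :=
    LinearMap.ext fun h => LinearMap.ext fun v => hA.toModule_act_iH hb Y h v
  have e := RMod.tensorEnd_map (hA.toModule hb X).act (hA.toModule hb Y).act iH.toLinearMap iH.toLinearMap
    (Coalgebra.comul (R := k) h)
  rw [eX, eY] at e
  exact (LinearMap.congr_fun e t).symm

/-- The tensor product of two modules along an algebra homomorphism `A →ₐ A ⊗ A`. -/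
def RMod.tensorAlong (δ : A →ₐ[k] A ⊗[k] A) (M N : RMod k A) : RMod k A where
  V := M.V ⊗ N.V
  act := tensorEnd M.act N.act ∘ₗ δ.toLinearMap
  act_one := by
    rw [LinearMap.comp_apply, AlgHom.toLinearMap_apply, map_one]
    exact tensorEnd_one _ _ M.act_one N.act_one
  act_mul a b := by
    rw [LinearMap.comp_apply, AlgHom.toLinearMap_apply, map_mul]
    exact tensorEnd_mul _ _ M.act_mul N.act_mul _ _

/-- Formulated for any algebra map with the prescribed values on generators: it then serves for a
given double bosonisation and also, before any Hopf structure is available, for the construction of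
one. -/
theorem DoubleRel.toModule_tensor_act (δ : A →ₐ[k] A ⊗[k] A) (hC : ∀ c, δ (iC c) = comulC iC iH c)
    (hH : ∀ h, δ (iH h) = comulH iH h) (hB : ∀ b, δ (iB b) = comulB iH iB b) (a : A) (t : (X.V ⊗ Y.V).V) :
    (hA.toModule hb (X ⊗ Y)).act a t = tensorEnd (hA.toModule hb X).act (hA.toModule hb Y).act (δ a) t := by
  refine commute_of_triple hb.2 (M := hA.toModule hb (X ⊗ Y))
    (N := RMod.tensorAlong δ (hA.toModule hb X) (hA.toModule hb Y)) LinearMap.id ?_ ?_ ?_ a t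
  · intro c t
    refine (hA.toModule_act_iC hb (X ⊗ Y) c t).trans ((hA.tensorEnd_comulC hb X Y c t).symm.trans ?_)
    rw [← hC]; rfl
  · intro h t
    refine (hA.toModule_act_iH hb (X ⊗ Y) h t).trans ((hA.tensorEnd_comulH hb X Y h t).symm.trans ?_)
    rw [← hH]; rfl
  · intro b t
    refine (hA.toModule_act_iB hb (X ⊗ Y) b t).trans ((hA.tensorEnd_comulB hb X Y b t).symm.trans ?_)
    rw [← hB]; rfl

/-- The trivial module along an augmentation. -/
def RMod.unitAlong (e : A →ₐ[k] k) : RMod k A where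
  V := 𝟙_ (ModuleCat.{u} k)
  act := LinearMap.toSpanSingleton k (Module.End k k) 1 ∘ₗ e.toLinearMap
  act_one := by simp
  act_mul a b := by simp [mul_comm, mul_smul]

theorem DoubleRel.toModule_unit_act (e : A →ₐ[k] k) (hC : ∀ c, e (iC c) = counitₗ C c)
    (hH : ∀ h, e (iH h) = Coalgebra.counit (R := k) h) (hB : ∀ b, e (iB b) = counitₗ B b) (a : A) (t : k) :
    (hA.toModule hb (𝟙_ (CrossedBimodule p))).act a t = e a * t := by
  refine commute_of_triple hb.2 (M := hA.toModule hb (𝟙_ (CrossedBimodule p)))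
    (N := RMod.unitAlong e) LinearMap.id ?_ ?_ ?_ a t
  · intro c (t : k)
    refine (hA.toModule_act_iC hb (𝟙_ (CrossedBimodule p)) c t).trans ?_
    change counitₗ C (t • c) = e (iC c) * t
    rw [map_smul, hC, smul_eq_mul, mul_comm]
  · intro h (t : k)
    refine (hA.toModule_act_iH hb (𝟙_ (CrossedBimodule p)) h t).trans ?_
    change Coalgebra.counit (R := k) h * t = e (iH h) * t
    rw [hH]
  · intro b (t : k)
    refine (hA.toModule_act_iB hb (𝟙_ (CrossedBimodule p)) b t).trans ?_
    change counitₗ B (t • b) = e (iB b) * t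
    rw [map_smul, hB, smul_eq_mul, mul_comm]

end Modules

/-! ### The monoidal structure on the equivalence. -/

section Functor
variable {k : Type u} [Field k] {H : Type u} [Ring H] [HopfAlgebra k H] [Quasitriangular k H]
variable {C B : RMod k H} [HopfObj C] [HopfObj B] [IsIso 𝒮[C]] {p : DualPairing C B}
variable (U : DoubleBosonisation p)

namespace DoubleBosonisation

lemma bijective_triple : Function.Bijective (triple U.iC (U.iH : H →ₐ[k] U.carrier) U.iB) := U.bijective

/-- The functor from crossed bimodules to modules over a double bosonisation. -/
def functor : CrossedBimodule p ⥤ RMod k U.carrier := U.rel.toModuleFunctor U.bijective_triple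

instance : U.functor.IsEquivalence := inferInstanceAs (U.rel.toModuleFunctor U.bijective_triple).IsEquivalence

lemma comul_iH (h : H) : Coalgebra.comul (R := k) (U.iH h) = comulH (U.iH : H →ₐ[k] U.carrier) h :=
  (CoalgHomClass.map_comp_comul_apply U.iH h).symm

lemma comul_iC_eq (c : C.V) : Coalgebra.comul (R := k) (U.iC c) = comulC U.iC (U.iH : H →ₐ[k] U.carrier) c := by
  have x := Rep₂.some (comulBar C c)
  have s := Rep₂.some (rMatrixInv k H)
  rw [comulC_eq c x s, U.comul_iC c x s]
  rfl

lemma comul_iB_eq (b : B.V) : Coalgebra.comul (R := k) (U.iB b) = comulB (U.iH : H →ₐ[k] U.carrier) U.iB b := by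
  have x := Rep₂.some (comulₗ B b)
  have r := Rep₂.some (BraidedDouble.rMatrix k H)
  rw [comulB_eq b x r, U.comul_iB b x r]
  rfl

lemma functor_tensor_act (X Y : CrossedBimodule p) (a : U.carrier) (t : (X.V ⊗ Y.V).V) :
    (U.functor.obj (X ⊗ Y)).act a t = (U.functor.obj X ⊗ U.functor.obj Y).act a t := by
  have h := U.rel.toModule_tensor_act U.bijective_triple X Y (Bialgebra.comulAlgHom k U.carrier)
    U.comul_iC_eq U.comul_iH U.comul_iB_eq a t
  exact h

lemma functor_unit_act (a : U.carrier) (t : k) :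
    (U.functor.obj (𝟙_ _)).act a t = (𝟙_ (RMod k U.carrier)).act a t :=
  U.rel.toModule_unit_act U.bijective_triple (Bialgebra.counitAlgHom k U.carrier) U.counit_iC
    (fun h => CoalgHomClass.counit_comp_apply U.iH h) U.counit_iB a t

/-- Underlying spaces of tensor products agree, so the structure maps are identities. The content is
that these are linear over `U`, by `functor_unit_act` and `functor_tensor_act`. -/
def functorCoreMonoidal : U.functor.CoreMonoidal where
  εIso := RMod.isoMk (V := 𝟙_ (RMod k U.carrier)) (W := U.functor.obj (𝟙_ _)) (Iso.refl (𝟙_ (ModuleCat.{u} k)))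
    fun a t => (U.functor_unit_act a t).symm
  μIso X Y := RMod.isoMk (V := U.functor.obj X ⊗ U.functor.obj Y) (W := U.functor.obj (X ⊗ Y)) (Iso.refl (X.V.V ⊗ Y.V.V))
    fun a t => (U.functor_tensor_act X Y a t).symm
  μIso_hom_natural_left f Z := by
    apply RMod.hom_ext; apply ModuleCat.hom_ext; apply TensorProduct.ext'; intro x y; rfl
  μIso_hom_natural_right Z f := by
    apply RMod.hom_ext; apply ModuleCat.hom_ext; apply TensorProduct.ext'; intro x y; rfl
  associativity X Y Z := by
    apply RMod.hom_ext; apply ModuleCat.hom_ext; apply TensorProduct.ext_threefold; intro x y z; rfl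
  left_unitality X := by
    apply RMod.hom_ext; apply ModuleCat.hom_ext; apply TensorProduct.ext'; intro x y; rfl
  right_unitality X := by
    apply RMod.hom_ext; apply ModuleCat.hom_ext; apply TensorProduct.ext'; intro x y; rfl

instance : U.functor.Monoidal := U.functorCoreMonoidal.toMonoidal

/-- The functor to modules of a double bosonisation preserves underlying vector spaces. -/
def functorForget : U.functor ⋙ RMod.forget k U.carrier ≅ CrossedBimodule.forget p ⋙ RMod.forget k H :=
  NatIso.ofComponents (fun X => Iso.refl X.V.V) fun f => rfl

instance : NatTrans.IsMonoidal U.functorForget.hom where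
  unit := rfl
  tensor X Y := by
    apply ModuleCat.hom_ext; apply TensorProduct.ext'; intro x y; rfl

end DoubleBosonisation
end Functor

/-! ### Quasitriangularity of `U` from the braiding. -/

section RMatrix
variable {k : Type u} [Field k] {H : Type u} [Ring H] [HopfAlgebra k H] [Quasitriangular k H]
variable {C B : RMod k H} [HopfObj C] [HopfObj B]

lemma lin_rigidBraiding {p : DualPairing C B} (coev : 𝟙_ (RMod k H) ⟶ B ⊗ C) (X Y : CrossedBimodule p)
    (r : Rep₂ (rMatrix k H)) (e : Rep₂ (coevElement coev)) (v : X.V.V) (w : Y.V.V) :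
    lin (rigidBraiding coev X Y) (tm X.V Y.V v w) =
      ∑ a, ∑ i, tm Y.V X.V (Y.V.act (r.fst i) (lin Y.left (tm C Y.V (e.snd a) w)))
        (X.V.act (r.snd i) (lin X.right (tm X.V B v (antipodeₗ B (e.fst a))))) := by
  have h : lin coev (1 : k) = ∑ a, tm B C (e.fst a) (e.snd a) := e.eq
  have h' : lin (coev ▷ Y.V) (tm (𝟙_ (RMod k H)) Y.V (1 : k) w) = ∑ a, tm (B ⊗ C) Y.V (tm B C (e.fst a) (e.snd a)) w := by
    refine (congrArg (fun z => tm (B ⊗ C) Y.V z w) h).trans ?_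
    simp only [map_sum, LinearMap.sum_apply]
  simp only [rigidBraiding, lin_comp, lin_whiskerLeft, lin_leftUnitor_inv, lin_whiskerRight]
  erw [h']
  simp only [map_sum, LinearMap.sum_apply, lin_associator_hom, lin_whiskerRight, lin_associator_inv, lin_tensorHom,
    lin_braiding r]
  rfl

variable [IsIso 𝒮[C]] {p : DualPairing C B} (U : DoubleBosonisation p)

namespace DoubleBosonisation

lemma rMatrix_eq (coev : 𝟙_ (RMod k H) ⟶ B ⊗ C) (r : Rep₂ (BraidedDouble.rMatrix k H))
    (e : Rep₂ (coevElement coev)) :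
    U.rMatrix coev = ∑ a, ∑ i, (U.iC (e.snd a) * U.iH (r.fst i)) ⊗ₜ (U.iB (antipodeₗ B (e.fst a)) * U.iH (r.snd i)) := by
  rw [rMatrix, r.tensor_map]
  conv_lhs => enter [1, 2]; rw [e.eq]
  simp only [map_sum, TensorProduct.comm_tmul, TensorProduct.map_tmul, Finset.sum_mul_sum,
    Algebra.TensorProduct.tmul_mul_tmul]
  rfl

/-- The twist contributes `fᵃ ⊗ S eₐ` and the braiding of `H`-modules contributes `R`. On right
modules the left factor of the product acts first, which matches the order in the braiding. -/
lemma rigidBraiding_eq (coev : 𝟙_ (RMod k H) ⟶ B ⊗ C) (X Y : CrossedBimodule p) (t : (X.V ⊗ Y.V).V) :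
    lin (rigidBraiding coev X Y) t = tensorEnd (U.functor.obj Y).act (U.functor.obj X).act (U.rMatrix coev)
      (TensorProduct.comm k X.V.V Y.V.V t) := by
  refine LinearMap.congr_fun (f := lin (rigidBraiding coev X Y))
    (g := (tensorEnd (U.functor.obj Y).act (U.functor.obj X).act (U.rMatrix coev) ∘ₗ
      (TensorProduct.comm k X.V.V Y.V.V).toLinearMap : (X.V ⊗ Y.V).V →ₗ[k] (Y.V ⊗ X.V).V)) (linearMap_ext_tm fun v w => ?_) t
  have r := Rep₂.some (BraidedDouble.rMatrix k H)
  have e := Rep₂.some (coevElement coev)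
  refine (lin_rigidBraiding coev X Y r e v w).trans (Eq.symm ?_)
  refine (congrArg (fun z => tensorEnd (U.functor.obj Y).act (U.functor.obj X).act z (w ⊗ₜ v)) (U.rMatrix_eq coev r e)).trans
    ((tensorEnd_sum_tmul (U.functor.obj Y).act (U.functor.obj X).act _ _ _ _).trans ?_)
  refine Finset.sum_congr rfl fun a _ => Finset.sum_congr rfl fun i _ => ?_
  refine congrArg₂ (fun a b => tm Y.V X.V a b) ?_ ?_
  · exact (act_mul_apply (U.functor.obj Y) _ _ w).trans ((U.rel.toModule_act_iH U.bijective_triple Y _ _).trans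
      (congrArg (Y.V.act _) (U.rel.toModule_act_iC U.bijective_triple Y _ w)))
  · exact (act_mul_apply (U.functor.obj X) _ _ v).trans ((U.rel.toModule_act_iH U.bijective_triple X _ _).trans
      (congrArg (X.V.act _) (U.rel.toModule_act_iB U.bijective_triple X _ v)))

end DoubleBosonisation

/-- The right regular module of an algebra. -/
def RMod.regular (k A : Type u) [Field k] [Ring A] [Algebra k A] : RMod k A where
  V := ModuleCat.of k A
  act := (LinearMap.mul k A).flip
  act_one := by ext; simp
  act_mul a b := by ext; simp [mul_assoc]

lemma tensorEnd_mul_flip {A : Type u} [Ring A] [Algebra k A] (x t : A ⊗[k] A) :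
    tensorEnd (V := A) (W := A) (LinearMap.mul k A).flip (LinearMap.mul k A).flip x t = t * x := by
  induction x with
  | zero => simp
  | add x y hx hy => rw [map_add, LinearMap.add_apply, hx, hy, mul_add]
  | tmul a b =>
    induction t with
    | zero => simp
    | add x y hx hy => rw [map_add, hx, hy, add_mul]
    | tmul c d => simp

namespace DoubleBosonisation

/-- The crossed bimodule of the regular module. -/
def regular : CrossedBimodule p := U.rel.toCrossed (RMod.regular k U.carrier)

lemma functor_regular_act (a v : U.carrier) : (U.functor.obj U.regular).act a v = v * a :=
  U.rel.toModule_toCrossed_act U.bijective_triple (RMod.regular k U.carrier) a v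

lemma tensorEnd_functor_regular (x t : U.carrier ⊗[k] U.carrier) :
    tensorEnd (U.functor.obj U.regular).act (U.functor.obj U.regular).act x t = t * x := by
  have h : (U.functor.obj U.regular).act = (LinearMap.mul k U.carrier).flip :=
    LinearMap.ext fun a => LinearMap.ext fun v => U.functor_regular_act a v
  exact (congrArg (fun f : U.carrier →ₗ[k] Module.End k U.carrier => tensorEnd f f x t) h).trans (tensorEnd_mul_flip x t)

lemma functor_tensor_regular_act (a : U.carrier) (t : U.carrier ⊗[k] U.carrier) :
    (U.functor.obj (U.regular ⊗ U.regular)).act a t = t * Coalgebra.comul (R := k) a := by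
  refine (U.functor_tensor_act U.regular U.regular a t).trans ?_
  exact U.tensorEnd_functor_regular _ _

variable (E : ExactPairing B C) (hE : E.evaluation' = p.ev)

lemma rigidBraided_apply (X Y : CrossedBimodule p) (t : (X.V ⊗ Y.V).V) :
    lin ((rigidBraided E hE).braiding X Y).hom.hom t =
      tensorEnd (U.functor.obj Y).act (U.functor.obj X).act (U.rMatrix E.coevaluation')
      (TensorProduct.comm k X.V.V Y.V.V t) := U.rigidBraiding_eq E.coevaluation' X Y t

lemma rigidBraided_regular (t : U.carrier ⊗[k] U.carrier) :
    lin ((rigidBraided E hE).braiding U.regular U.regular).hom.hom t =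
      TensorProduct.comm k _ _ t * U.rMatrix E.coevaluation' := by
  refine (U.rigidBraided_apply E hE U.regular U.regular t).trans ?_
  exact U.tensorEnd_functor_regular _ _

include hE in
-- On the regular module the braiding is the flip followed by right multiplication by `R_U`;
-- bijectivity of the braiding makes `R_U` invertible.
lemma exists_inverse_rMatrix : ∃ t, U.rMatrix E.coevaluation' * t = 1 ∧ t * U.rMatrix E.coevaluation' = 1 := by
  let b := (rigidBraided E hE).braiding U.regular U.regular
  have h₁ (t) : lin b.inv.hom (lin b.hom.hom t) = t :=
    congrArg (fun f => lin f.hom t) b.hom_inv_id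
  have h₂ (t) : lin b.hom.hom (lin b.inv.hom t) = t :=
    congrArg (fun f => lin f.hom t) b.inv_hom_id
  -- The preimage of `1` gives a left inverse of `R_U`; injectivity of right multiplication by `R_U`
  -- makes it two-sided.
  let s : U.carrier ⊗[k] U.carrier := lin b.inv.hom (1 : U.carrier ⊗[k] U.carrier)
  have e : TensorProduct.comm k _ _ s * U.rMatrix E.coevaluation' = 1 :=
    (U.rigidBraided_regular E hE s).symm.trans (h₂ _)
  have inj (x y : U.carrier ⊗[k] U.carrier) (h : x * U.rMatrix E.coevaluation' = y * U.rMatrix E.coevaluation') : x = y := by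
    obtain ⟨x, rfl⟩ := (TensorProduct.comm k U.carrier U.carrier).surjective x
    obtain ⟨y, rfl⟩ := (TensorProduct.comm k U.carrier U.carrier).surjective y
    have h' := (U.rigidBraided_regular E hE x).trans (h.trans (U.rigidBraided_regular E hE y).symm)
    exact congrArg _ ((h₁ x).symm.trans ((congrArg (lin b.inv.hom) h').trans (h₁ y)))
  refine ⟨_, inj _ _ ?_, e⟩
  rw [mul_assoc, e, mul_one, one_mul]

include hE in
-- Linearity of the braiding over `U` on the regular module, evaluated at `1 ⊗ 1`.
lemma comm_comul_rMatrix (a : U.carrier) :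
    TensorProduct.comm k _ _ (Coalgebra.comul (R := k) a) * U.rMatrix E.coevaluation' =
      U.rMatrix E.coevaluation' * Coalgebra.comul (R := k) a := by
  let b := (rigidBraided E hE).braiding U.regular U.regular
  have h := (U.functor.map b.hom).comm a (1 : U.carrier ⊗[k] U.carrier)
  have h' : lin b.hom.hom ((U.functor.obj (U.regular ⊗ U.regular)).act a (1 : U.carrier ⊗[k] U.carrier)) = 
    (U.functor.obj (U.regular ⊗ U.regular)).act a (lin b.hom.hom (1 : U.carrier ⊗[k] U.carrier)) := h
  erw [functor_tensor_regular_act, functor_tensor_regular_act] at h'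
  rw [one_mul] at h'
  refine (U.rigidBraided_regular E hE _).symm.trans (h'.trans ?_)
  refine (congrArg (fun z => z * Coalgebra.comul (R := k) a) (U.rigidBraided_regular E hE _)).trans ?_
  rw [show TensorProduct.comm k U.carrier U.carrier 1 = 1 from rfl, one_mul]

variable {E}

lemma rigidBraided_tm (ρ : Rep₂ (U.rMatrix E.coevaluation')) (X Y : CrossedBimodule p) (v : X.V.V) (w : Y.V.V) :
    lin ((rigidBraided E hE).braiding X Y).hom.hom (tm X.V Y.V v w) =
      ∑ i, tm Y.V X.V ((U.functor.obj Y).act (ρ.fst i) w) ((U.functor.obj X).act (ρ.snd i) v) := by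
  refine (U.rigidBraided_apply E hE X Y _).trans ?_
  refine (congrArg (fun z => tensorEnd (U.functor.obj Y).act (U.functor.obj X).act z (w ⊗ₜ v)) ρ.eq).trans ?_
  rw [map_sum]
  exact LinearMap.sum_apply _ _ _

lemma rigidBraided_regular_tmul (ρ : Rep₂ (U.rMatrix E.coevaluation')) (v w : U.carrier) :
    lin ((rigidBraided E hE).braiding U.regular U.regular).hom.hom (v ⊗ₜ[k] w : U.carrier ⊗[k] U.carrier) =
      ∑ i, (w * ρ.fst i) ⊗ₜ[k] (v * ρ.snd i) := by
  refine (U.rigidBraided_tm hE ρ U.regular U.regular v w).trans (Finset.sum_congr rfl fun i _ => ?_)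
  exact congrArg₂ (fun a b => a ⊗ₜ[k] b) (U.functor_regular_act _ _) (U.functor_regular_act _ _)

include hE in
-- The forward hexagon for three regular modules, evaluated at `1 ⊗ 1 ⊗ 1`. The reverse hexagon
-- gives `comul_right_rMatrix`.
lemma comul_left_rMatrix :
    TensorProduct.assoc k _ _ _ (TensorProduct.map Coalgebra.comul LinearMap.id (U.rMatrix E.coevaluation')) =
      Algebra.TensorProduct.map (AlgHom.id k U.carrier) Algebra.TensorProduct.includeRight (U.rMatrix E.coevaluation') *
        Algebra.TensorProduct.includeRight (U.rMatrix E.coevaluation') := by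
  have ρ := Rep₂.some (U.rMatrix E.coevaluation')
  let A := U.carrier
  let b : A ⊗[k] A →ₗ[k] A ⊗[k] A := lin ((rigidBraided E hE).braiding U.regular U.regular).hom.hom
  let b' : A ⊗[k] (A ⊗[k] A) →ₗ[k] (A ⊗[k] A) ⊗[k] A := lin ((rigidBraided E hE).braiding U.regular (U.regular ⊗ U.regular)).hom.hom
  have hb (v w : A) : b (v ⊗ₜ w) = ∑ i, (w * ρ.fst i) ⊗ₜ[k] (v * ρ.snd i) := U.rigidBraided_regular_tmul hE ρ v w
  have hb' (v : A) (w : A ⊗[k] A) : b' (v ⊗ₜ w) = ∑ i, (w * Coalgebra.comul (R := k) (ρ.fst i)) ⊗ₜ[k] (v * ρ.snd i) := by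
    refine (U.rigidBraided_tm hE ρ U.regular (U.regular ⊗ U.regular) v w).trans (Finset.sum_congr rfl fun i _ => ?_)
    exact congrArg₂ (fun a b => a ⊗ₜ[k] b) (U.functor_tensor_regular_act _ _) (U.functor_regular_act _ _)
  have h : TensorProduct.assoc k A A A (b' (1 ⊗ₜ (1 ⊗ₜ 1))) =
      TensorProduct.map LinearMap.id b (TensorProduct.assoc k A A A (b (1 ⊗ₜ 1) ⊗ₜ 1)) :=
    congrArg (fun f => lin f.hom ((1 ⊗ₜ 1) ⊗ₜ 1 : (A ⊗[k] A) ⊗[k] A))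
      ((rigidBraided E hE).hexagon_forward U.regular U.regular U.regular)
  rw [hb', hb, ← Algebra.TensorProduct.one_def] at h
  simp only [one_mul, TensorProduct.sum_tmul, map_sum, TensorProduct.assoc_tmul, TensorProduct.map_tmul, hb,
    LinearMap.id_apply, TensorProduct.tmul_sum] at h
  rw [ρ.tensor_map, map_sum]
  refine h.trans (Eq.symm ?_)
  conv_lhs => enter [1, 2]; rw [ρ.eq]
  conv_lhs => enter [2, 2]; rw [ρ.eq]
  simp only [map_sum, Finset.sum_mul_sum, Algebra.TensorProduct.map_tmul, Algebra.TensorProduct.includeRight_apply,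
    Algebra.TensorProduct.tmul_mul_tmul, AlgHom.id_apply, one_mul, mul_one]

include hE in
lemma comul_right_rMatrix :
    TensorProduct.map LinearMap.id Coalgebra.comul (U.rMatrix E.coevaluation') =
      Algebra.TensorProduct.map (AlgHom.id k U.carrier) Algebra.TensorProduct.includeRight (U.rMatrix E.coevaluation') *
        Algebra.TensorProduct.map (AlgHom.id k U.carrier) Algebra.TensorProduct.includeLeft (U.rMatrix E.coevaluation') := by
  have ρ := Rep₂.some (U.rMatrix E.coevaluation')
  let A := U.carrier
  let b : A ⊗[k] A →ₗ[k] A ⊗[k] A := lin ((rigidBraided E hE).braiding U.regular U.regular).hom.hom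
  let b' : (A ⊗[k] A) ⊗[k] A →ₗ[k] A ⊗[k] (A ⊗[k] A) := lin ((rigidBraided E hE).braiding (U.regular ⊗ U.regular) U.regular).hom.hom
  have hb (v w : A) : b (v ⊗ₜ w) = ∑ i, (w * ρ.fst i) ⊗ₜ[k] (v * ρ.snd i) := U.rigidBraided_regular_tmul hE ρ v w
  have hb' (v : A ⊗[k] A) (w : A) : b' (v ⊗ₜ w) = ∑ i, (w * ρ.fst i) ⊗ₜ[k] (v * Coalgebra.comul (R := k) (ρ.snd i)) := by
    refine (U.rigidBraided_tm hE ρ (U.regular ⊗ U.regular) U.regular v w).trans (Finset.sum_congr rfl fun i _ => ?_)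
    exact congrArg₂ (fun a b => a ⊗ₜ[k] b) (U.functor_regular_act _ _) (U.functor_tensor_regular_act _ _)
  have h : (TensorProduct.assoc k A A A).symm (b' ((1 ⊗ₜ 1) ⊗ₜ 1)) =
      TensorProduct.map b LinearMap.id ((TensorProduct.assoc k A A A).symm (1 ⊗ₜ b (1 ⊗ₜ 1))) :=
    congrArg (fun f => lin f.hom (1 ⊗ₜ (1 ⊗ₜ 1) : A ⊗[k] (A ⊗[k] A)))
      ((rigidBraided E hE).hexagon_reverse U.regular U.regular U.regular)
  rw [hb', hb, ← Algebra.TensorProduct.one_def] at h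
  simp only [one_mul, TensorProduct.tmul_sum, map_sum, TensorProduct.assoc_symm_tmul, TensorProduct.map_tmul, hb,
    LinearMap.id_apply, TensorProduct.sum_tmul] at h
  rw [ρ.tensor_map]
  have h' := congrArg (TensorProduct.assoc k A A A) h
  simp only [map_sum, LinearEquiv.apply_symm_apply, TensorProduct.assoc_tmul] at h'
  refine h'.trans (Eq.symm ?_)
  conv_lhs => enter [1, 2]; rw [ρ.eq]
  conv_lhs => enter [2, 2]; rw [ρ.eq]
  simp only [map_sum, Finset.sum_mul_sum, Algebra.TensorProduct.map_tmul, Algebra.TensorProduct.includeRight_apply,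
    Algebra.TensorProduct.includeLeft_apply,
    Algebra.TensorProduct.tmul_mul_tmul, AlgHom.id_apply, one_mul, mul_one]

include hE in
lemma exists_quasitriangular : ∃ Q : Quasitriangular k U.carrier,
    (Q.R : U.carrier ⊗[k] U.carrier) = U.rMatrix E.coevaluation' := by
  obtain ⟨t, h₁, h₂⟩ := U.exists_inverse_rMatrix E hE
  exact ⟨⟨⟨U.rMatrix E.coevaluation', t, h₁, h₂⟩, U.comul_left_rMatrix hE, U.comul_right_rMatrix hE,
    U.comm_comul_rMatrix E hE⟩, rfl⟩

lemma functor_braided (Q : Quasitriangular k U.carrier)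
    (hQ : (Q.R : U.carrier ⊗[k] U.carrier) = U.rMatrix E.coevaluation') (V W : CrossedBimodule p) :
    Functor.LaxMonoidal.μ U.functor V W ≫ U.functor.map ((rigidBraided E hE).braiding V W).hom =
      (β_ (U.functor.obj V) (U.functor.obj W)).hom ≫ Functor.LaxMonoidal.μ U.functor W V := by
  apply RMod.hom_ext
  apply ModuleCat.hom_ext
  refine LinearMap.ext fun t => ?_
  refine (U.rigidBraided_apply E hE V W t).trans ?_
  rw [← hQ]
  rfl

end DoubleBosonisation
end RMatrix

/-! ### The algebra spanned by ordered triples. -/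

section Algebra
variable {k : Type u} [Field k] {H : Type u} [Ring H] [HopfAlgebra k H] [Quasitriangular k H]
variable {C B : RMod k H} [HopfObj C] [HopfObj B] [IsIso 𝒮[C]] {p : DualPairing C B}
variable {A A' : Type u} [Ring A] [Algebra k A] [Ring A'] [Algebra k A']
variable {iC : C.V →ₗ[k] A} {iH : H →ₐ[k] A} {iB : B.V →ₗ[k] A}

lemma DoubleRel.of_injective (j : A →ₐ[k] A') (hj : Function.Injective j)
    (h : DoubleRel p A' (j.toLinearMap ∘ₗ iC) (j.comp iH) (j.toLinearMap ∘ₗ iB)) : DoubleRel p A iC iH iB where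
  iC_one := hj (h.iC_one.trans (map_one j).symm)
  iC_mul c d := hj ((map_mul j _ _).trans (h.iC_mul c d))
  iH_mul_iC a c x := hj (by
    simpa only [map_sum, map_mul, LinearMap.comp_apply, AlgHom.toLinearMap_apply, AlgHom.comp_apply] using h.iH_mul_iC a c x)
  iB_one := hj (h.iB_one.trans (map_one j).symm)
  iB_mul a b := hj ((map_mul j _ _).trans (h.iB_mul a b))
  iB_mul_iH b a x := hj (by
    simpa only [map_sum, map_mul, LinearMap.comp_apply, AlgHom.toLinearMap_apply, AlgHom.comp_apply] using h.iB_mul_iH b a x)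
  iB_mul_iC b c y x r s := hj (by
    simpa only [map_sum, map_smul, map_mul, LinearMap.comp_apply, AlgHom.toLinearMap_apply, AlgHom.comp_apply] using h.iB_mul_iC b c y x r s)

omit [HopfObj C] [HopfObj B] [Quasitriangular k H] [IsIso 𝒮[C]] in
lemma triple_mem (c : C.V) (h : H) (b : B.V) : iC c * iH h * iB b ∈ LinearMap.range (triple iC iH iB) :=
  ⟨(c ⊗ₜ h) ⊗ₜ b, rfl⟩

omit [HopfObj C] [HopfObj B] [Quasitriangular k H] [IsIso 𝒮[C]] in
lemma range_triple_mul {y : A} (hy : ∀ c h b, iC c * iH h * iB b * y ∈ LinearMap.range (triple iC iH iB)) {x : A}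
    (hx : x ∈ LinearMap.range (triple iC iH iB)) : x * y ∈ LinearMap.range (triple iC iH iB) := by
  obtain ⟨t, rfl⟩ := hx
  induction t with
  | zero => rw [map_zero, zero_mul]; exact zero_mem _
  | add x z hx hz => rw [map_add, add_mul]; exact add_mem hx hz
  | tmul t b =>
    induction t with
    | zero => rw [TensorProduct.zero_tmul, map_zero, zero_mul]; exact zero_mem _
    | add x z hx hz => rw [TensorProduct.add_tmul, map_add, add_mul]; exact add_mem hx hz
    | tmul c h => exact hy c h b

/-- As in `DoubleRel.exists_algHom`, the span of the triples is stable under right multiplication by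
`B`, then by `H`, then by `C`. -/
lemma DoubleRel.mul_mem_range (hA : DoubleRel p A iC iH iB) {x y : A} (hx : x ∈ LinearMap.range (triple iC iH iB))
    (hy : y ∈ LinearMap.range (triple iC iH iB)) : x * y ∈ LinearMap.range (triple iC iH iB) := by
  have hB {x} (hx : x ∈ LinearMap.range (triple iC iH iB)) (b : B.V) : x * iB b ∈ LinearMap.range (triple iC iH iB) := by
    refine range_triple_mul (fun c h b' => ?_) hx
    rw [mul_assoc, hA.iB_mul]
    exact triple_mem _ _ _
  have hH {x} (hx : x ∈ LinearMap.range (triple iC iH iB)) (h : H) : x * iH h ∈ LinearMap.range (triple iC iH iB) := by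
    refine range_triple_mul (fun c h' b' => ?_) hx
    rw [mul_assoc, hA.iB_mul_iH b' h (Rep₂.some _), Finset.mul_sum]
    refine sum_mem fun i _ => ?_
    rw [← mul_assoc, mul_assoc (iC c), ← map_mul]
    exact triple_mem _ _ _
  have hC₀ (c : C.V) (h : H) (d : C.V) : iC c * iH h * iC d ∈ LinearMap.range (triple iC iH iB) := by
    rw [mul_assoc, hA.iH_mul_iC h d (Rep₂.some _), Finset.mul_sum]
    refine sum_mem fun i _ => ?_
    rw [← mul_assoc, hA.iC_mul, ← mul_one (_ * iH _), ← hA.iB_one]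
    exact triple_mem _ _ _
  have hC {x} (hx : x ∈ LinearMap.range (triple iC iH iB)) (d : C.V) : x * iC d ∈ LinearMap.range (triple iC iH iB) := by
    refine range_triple_mul (fun c h b' => ?_) hx
    rw [mul_assoc, hA.iB_mul_iC b' d (Rep₃.some _) (Rep₃.some _) (Rep₂.some _) (Rep₂.some _)]
    simp only [Finset.mul_sum, mul_smul_comm, ← mul_assoc]
    refine sum_mem fun _ _ => sum_mem fun _ _ => sum_mem fun _ _ => sum_mem fun _ _ => sum_mem fun _ _ =>
      sum_mem fun _ _ => Submodule.smul_mem _ _ (hB (hH (hC₀ _ _ _) _) _)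
  obtain ⟨t, rfl⟩ := hy
  induction t with
  | zero => rw [map_zero, mul_zero]; exact zero_mem _
  | add y z hy hz => rw [map_add, mul_add]; exact add_mem hy hz
  | tmul t b =>
    induction t with
    | zero => rw [TensorProduct.zero_tmul, map_zero, mul_zero]; exact zero_mem _
    | add y z hy hz => rw [TensorProduct.add_tmul, map_add, mul_add]; exact add_mem hy hz
    | tmul c h =>
      rw [triple_tmul, ← mul_assoc, ← mul_assoc]
      exact hB (hH (hC hx c) h) b

lemma DoubleRel.one_mem_range (hA : DoubleRel p A iC iH iB) : (1 : A) ∈ LinearMap.range (triple iC iH iB) := by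
  have := triple_mem (iC := iC) (iH := iH) (iB := iB) (unitₗ C 1) 1 (unitₗ B 1)
  rwa [hA.iC_one, hA.iB_one, map_one, one_mul, one_mul] at this

/-- One representation in which the triples are independent suffices: their span is then a
subalgebra with `C ⊗ H ⊗ B` as underlying space. -/
theorem DoubleRel.exists_subalgebra (hA : DoubleRel p A iC iH iB) (hi : Function.Injective (triple iC iH iB)) :
    ∃ (D : Type u) (_ : Ring D) (_ : Algebra k D) (jC : C.V →ₗ[k] D) (jH : H →ₐ[k] D) (jB : B.V →ₗ[k] D),
      DoubleRel p D jC jH jB ∧ Function.Bijective (triple jC jH jB) := by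
  let S : Subalgebra k A := (LinearMap.range (triple iC iH iB)).toSubalgebra hA.one_mem_range fun _ _ => hA.mul_mem_range
  have mC (c) : iC c ∈ S := by
    have := triple_mem (iC := iC) (iH := iH) (iB := iB) c 1 (unitₗ B 1)
    rwa [hA.iB_one, map_one, mul_one, mul_one] at this
  have mH (h) : iH h ∈ S := by
    have := triple_mem (iC := iC) (iH := iH) (iB := iB) (unitₗ C 1) h (unitₗ B 1)
    rwa [hA.iC_one, hA.iB_one, one_mul, mul_one] at this
  have mB (b) : iB b ∈ S := by
    have := triple_mem (iC := iC) (iH := iH) (iB := iB) (unitₗ C 1) 1 b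
    rwa [hA.iC_one, map_one, one_mul, one_mul] at this
  let jC : C.V →ₗ[k] S := iC.codRestrict (Subalgebra.toSubmodule S) mC
  let jH : H →ₐ[k] S := iH.codRestrict S mH
  let jB : B.V →ₗ[k] S := iB.codRestrict (Subalgebra.toSubmodule S) mB
  have e (t) : S.val (triple jC jH jB t) = triple iC iH iB t := by
    induction t with
    | zero => simp
    | add x y hx hy => rw [map_add, map_add, map_add, hx, hy]
    | tmul t b =>
      induction t with
      | zero => simp
      | add x y hx hy => rw [TensorProduct.add_tmul, map_add, map_add, map_add, hx, hy]
      | tmul c h => rfl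
  refine ⟨S, inferInstance, inferInstance, jC, jH, jB,
    .of_injective S.val Subtype.val_injective hA, fun x y h => ?_, fun y => ?_⟩
  · exact hi ((e x).symm.trans ((congrArg _ h).trans (e y)))
  · obtain ⟨t, ht⟩ := y.2
    exact ⟨t, Subtype.val_injective ((e t).trans ht)⟩

end Algebra

/-! ### The induced action on vectors with unit component in `B`. -/

section InducedUnit
variable {𝒞 : Type w} [Category.{v} 𝒞] [MonoidalCategory 𝒞] [BraidedCategory 𝒞]
variable {C B : 𝒞} [HopfObj C] [HopfObj B] (p : DualPairing C B)

lemma conil₁_naturality {X Γ Γ' : 𝒞} (f : 𝟙_ 𝒞 ⟶ X) (g : Γ ⟶ Γ') :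
    conil₁ f Γ ≫ X ◁ g = g ≫ conil₁ f Γ' := by
  simpa [wh] using conil₁_wh f g (𝟙 _)

lemma sw_naturality_right {X Y Γ Γ' : 𝒞} (g : Γ ⟶ Γ') :
    X ◁ Y ◁ g ≫ sw X Y Γ' = sw X Y Γ ≫ Y ◁ X ◁ g := by
  simpa [wh] using (sw_wh (X := X) (Y := Y) g (𝟙 _) (𝟙 _)).symm

lemma conil₁_cobin_comul (Γ : 𝒞) : conil₁ η[B] Γ ≫ cobin Δ[B] Γ = conil₁ η[B] Γ ≫ conil₁ η[B] (B ⊗ Γ) := by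
  simpa using conil₁_comul B (𝟙 (B ⊗ (B ⊗ Γ)))

lemma DualPairing.whisker_one_nil₂ (Γ : 𝒞) : C ◁ conil₁ η[B] Γ ≫ nil₂ p.ev Γ = nil₁ ε[C] Γ := by
  simpa [wh] using p.wh_conil₁_nil₂ (𝟙 Γ)

lemma DualPairing.one_coregB (Γ : 𝒞) :
    C ◁ conil₁ η[B] Γ ≫ bin p.coregB Γ = nil₁ ε[C] Γ ≫ conil₁ η[B] Γ := by
  have e := p.bin_coregB (𝟙 (B ⊗ Γ))
  simp only [wh, Category.comp_id] at e
  rw [e, ← whiskerLeft_comp_assoc, conil₁_cobin_comul, whiskerLeft_comp, Category.assoc,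
    ← Category.assoc (C ◁ conil₁ η[B] (B ⊗ Γ)), whisker_conil₁, conil₁_naturality, ← Category.assoc, whisker_one_nil₂]

lemma DualPairing.one_coregC (Γ : 𝒞) : C ◁ conil₁ η[B] Γ ≫ bin p.coregC Γ = 𝟙 _ := by
  have e := p.bin_coregC (𝟙 (C ⊗ Γ))
  simp only [wh, Category.comp_id] at e
  have n : C ◁ conil₁ η[B] Γ ≫ cobin Δ[C] (B ⊗ Γ) = cobin Δ[C] Γ ≫ C ◁ C ◁ conil₁ η[B] Γ := by
    simpa [wh] using wh_cobin Δ[C] (conil₁ η[B] Γ) (𝟙 _)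
  rw [e, reassoc_of% n, ← whiskerLeft_comp_assoc, whisker_conil₁, whisker_one_nil₂]
  simpa using cobin_nil₁ C (𝟙 (C ⊗ Γ))

lemma DualPairing.one_evR (Y Γ : 𝒞) :
    C ◁ Y ◁ conil₁ η[B] Γ ≫ p.evR Y Γ = C ◁ Y ◁ conil₁ η[B] Γ := by
  have n : C ◁ Y ◁ conil₁ η[B] Γ ≫ cobin Δ[C] (Y ⊗ (B ⊗ Γ)) = cobin Δ[C] (Y ⊗ Γ) ≫ C ◁ C ◁ Y ◁ conil₁ η[B] Γ := by
    simpa [wh] using wh_cobin Δ[C] (Y ◁ conil₁ η[B] Γ) (𝟙 _)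
  have m : sw C Y Γ ≫ Y ◁ nil₁ ε[C] Γ = nil₁ ε[C] (Y ⊗ Γ) := by
    simpa [wh] using sw_wh_nil₁ (Γ := Γ) Y ε[C] (𝟙 _) (𝟙 _)
  have o : cobin Δ[C] (Y ⊗ Γ) ≫ C ◁ nil₁ ε[C] (Y ⊗ Γ) = 𝟙 _ := by
    simpa [wh] using cobin_wh_nil₁ (Γ := Y ⊗ Γ) C (𝟙 _) (𝟙 _)
  have m' : sw C Y Γ ≫ Y ◁ (nil₁ ε[C] Γ ≫ conil₁ η[B] Γ) = nil₁ ε[C] (Y ⊗ Γ) ≫ Y ◁ conil₁ η[B] Γ := by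
    rw [whiskerLeft_comp, reassoc_of% m]
  rw [evR, reassoc_of% n, ← whiskerLeft_comp, ← Category.assoc (C ◁ Y ◁ conil₁ η[B] Γ), sw_naturality_right,
    Category.assoc, ← whiskerLeft_comp, one_coregB, m', whiskerLeft_comp, reassoc_of% o]

lemma DualPairing.one_evL (Y Γ : 𝒞) :
    C ◁ Y ◁ conil₁ η[B] Γ ≫ p.evL Y Γ = C ◁ Y ◁ conil₁ η[B] Γ := by
  have m : Y ◁ (conil₁ η[B] Γ ≫ cobin Δ[B] Γ) ≫ sw Y B (B ⊗ Γ) = Y ◁ conil₁ η[B] Γ ≫ conil₁ η[B] (Y ⊗ (B ⊗ Γ)) := by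
    rw [conil₁_cobin_comul, whiskerLeft_comp, Category.assoc, whisker_conil₁]
  rw [evL, ← whiskerLeft_comp_assoc, ← whiskerLeft_comp_assoc, m, whiskerLeft_comp, Category.assoc, one_coregC,
    Category.comp_id]

/-- The coproduct of the unit of `B` is `1 ⊗ 1` and pairing with `1` is the counit, so `evR` and
`evL` fix such vectors and `C` acts through `Y` alone. -/
lemma DualPairing.one_inducedLeft [IsIso 𝒮[C]] {Y : 𝒞} (l : C ⊗ Y ⟶ Y) :
    C ◁ (Y ◁ conil₁ η[B] (𝟙_ 𝒞)) ≫ p.induced l (𝟙_ 𝒞) = bin l (𝟙_ 𝒞) ≫ Y ◁ conil₁ η[B] (𝟙_ 𝒞) := by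
  have e : C ◁ Y ◁ conil₁ η[B] (𝟙_ 𝒞) ≫ inv (p.evR Y (𝟙_ 𝒞)) = C ◁ Y ◁ conil₁ η[B] (𝟙_ 𝒞) := by
    rw [IsIso.comp_inv_eq, one_evR]
  rw [induced, reassoc_of% e, ← Category.assoc, one_evL]
  simp only [bin, Category.assoc, ← whisker_exchange, associator_inv_naturality_right_assoc]

end InducedUnit

/-! ### A faithful action of the triples on `C ⊗ H ⊗ B`. -/

section Cyclic
variable {k : Type u} [Field k] {H : Type u} [Ring H] [HopfAlgebra k H] [Quasitriangular k H]
variable {C B : RMod k H} [HopfObj C] [HopfObj B]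

lemma act_unitₗ (h : H) : B.act h (unitₗ B 1) = Coalgebra.counit (R := k) h • unitₗ B 1 := by
  have e := lin_act η[B] h (1 : k)
  change unitₗ B (Coalgebra.counit (R := k) h * (1 : k)) = B.act h (unitₗ B 1) at e
  rw [← e, ← smul_eq_mul, map_smul]

lemma act_tm_unit (Y : RMod k H) (h : H) (y : Y.V) :
    (Y ⊗ B).act h (tm Y B y (unitₗ B 1)) = tm Y B (Y.act h y) (unitₗ B 1) := by
  have d := Rep₂.some (Coalgebra.comul (R := k) h)
  rw [act_tm h d]
  conv_rhs => rw [← sum_counit_smul' d]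
  simp only [act_unitₗ, map_smul, map_sum, LinearMap.sum_apply, LinearMap.smul_apply]

lemma lin_mul_one (b : B.V) : lin μ[B] (tm B B (unitₗ B 1) b) = b := by
  have e := congrArg (fun f => lin f (tm (𝟙_ (RMod k H)) B (1 : k) b)) (MonObj.one_mul B)
  exact e.trans (one_smul k b)

lemma lin_mul_one' (b : B.V) : lin μ[B] (tm B B b (unitₗ B 1)) = b := by
  have e := congrArg (fun f => lin f (tm B (𝟙_ (RMod k H)) b (1 : k))) (MonObj.mul_one B)
  exact e.trans (one_smul k b)

variable [IsIso 𝒮[C]] (p : DualPairing C B)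

lemma lin_inducedLeft_one {Y : RMod k H} (l : C ⊗ Y ⟶ Y) (c : C.V) (y : Y.V) :
    lin (p.inducedLeft l) (tm C (Y ⊗ B) c (tm Y B y (unitₗ B 1))) = tm Y B (lin l (tm C Y c y)) (unitₗ B 1) := by
  have e := congrArg (fun f => lin f (tm C (Y ⊗ 𝟙_ (RMod k H)) c (tm Y (𝟙_ (RMod k H)) y (1 : k)))) (p.one_inducedLeft l)
  exact congrArg (lin (Y ◁ (ρ_ B).hom)) e |>.trans (congrArg (fun z => tm Y B (lin l (tm C Y c y)) z) (one_smul k (unitₗ B 1)))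

variable (C) in
/-- The tensor product of `C` and the regular module of `H`. -/
abbrev freeModule : RMod k H := C ⊗ RMod.regular k H

variable (C) in
/-- The left action of `C` on `C ⊗ H` by multiplication. -/
def freeLeft : C ⊗ freeModule C ⟶ freeModule C := (α_ C C (RMod.regular k H)).inv ≫ μ[C] ▷ RMod.regular k H

lemma isCrossedBimodule_free : IsCrossedBimodule p (p.inducedLeft (freeLeft C)) (inducedRight (freeModule C) B) := by
  apply p.isCrossedBimodule_induced
  · have e : η[C] ▷ (C ⊗ RMod.regular k H) ≫ (α_ C C (RMod.regular k H)).inv = (α_ _ _ _).inv ≫ (η[C] ▷ C) ▷ RMod.regular k H := by simp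
    rw [freeLeft, reassoc_of% e, ← comp_whiskerRight, MonObj.one_mul]
    monoidal
  · simp only [freeLeft]
    trans (α_ (C ⊗ C) C (RMod.regular k H)).inv ≫ (μ[C] ▷ C ≫ μ[C]) ▷ RMod.regular k H
    · simp only [comp_whiskerRight, ← associator_inv_naturality_left_assoc]
    · rw [MonObj.mul_assoc]
      simp only [comp_whiskerRight, whiskerLeft_comp, Category.assoc, associator_inv_naturality_middle_assoc]
      monoidal

/-- The map `c ⊗ h ↦ c ◁ f h₁ ⊗ h₂`. -/
def twistAct (C : RMod k H) (f : H →ₗ[k] H) : C.V ⊗[k] H →ₗ[k] C.V ⊗[k] H :=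
  TensorProduct.map (TensorProduct.lift (mk₂ fun c a => C.act (f a) c)) LinearMap.id ∘ₗ
    (TensorProduct.assoc k C.V H H).symm.toLinearMap ∘ₗ TensorProduct.map LinearMap.id Coalgebra.comul

lemma twistAct_tmul (f : H →ₗ[k] H) (c : C.V) (h : H) (d : Rep₂ (Coalgebra.comul (R := k) h)) :
    twistAct C f (c ⊗ₜ h) = ∑ m, C.act (f (d.fst m)) c ⊗ₜ d.snd m := by
  simp only [twistAct, LinearMap.comp_apply, TensorProduct.map_tmul, LinearMap.id_apply]
  conv_lhs => enter [2, 2, 3]; rw [d.eq]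
  simp [TensorProduct.tmul_sum]

lemma twistAct_antipode_twistAct (t : C.V ⊗[k] H) : twistAct C (HopfAlgebra.antipode k) (twistAct C .id t) = t := by
  have D : ∀ h : H, Rep₂ (Coalgebra.comul (R := k) h) := fun _ => Rep₂.some _
  induction t with
  | zero => simp
  | add x y hx hy => rw [map_add, map_add, hx, hy]
  | tmul c h =>
    rw [twistAct_tmul _ c h (D h)]
    simp only [map_sum, twistAct_tmul _ _ _ (D _), LinearMap.id_apply, act_comp]
    have e := sum_coassoc (mk₃ fun x y z => C.act (x * HopfAlgebra.antipode k y) c ⊗ₜ[k] z) D h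
    simp only [mk₃_apply] at e
    rw [e]
    have e₂ (m) : ∑ n, C.act ((D ((D h).fst m)).fst n * HopfAlgebra.antipode k ((D ((D h).fst m)).snd n)) c ⊗ₜ[k] (D h).snd m =
        c ⊗ₜ[k] (Coalgebra.counit (R := k) ((D h).fst m) • (D h).snd m) := by
      simp only [← TensorProduct.sum_tmul, ← LinearMap.sum_apply, ← map_sum, sum_mul_antipode]
      simp [Algebra.algebraMap_eq_smul_one, C.act_one, TensorProduct.smul_tmul]
    simp only [e₂, ← TensorProduct.tmul_sum, sum_counit_smul]

/-- Apply a triple to `v₀ = 1 ⊗ 1 ⊗ 1`. First `c` gives `c ⊗ 1 ⊗ 1`, then `h` gives `c ◁ h₁ ⊗ h₂ ⊗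
1`, and `b` fills the last place. The map `c ⊗ h ↦ c ◁ h₁ ⊗ h₂` is undone by the same formula with
the antipode of `H`. -/
lemma injective_free : Function.Injective (triple (opLeft (p.inducedLeft (freeLeft C)))
    (opAct (freeModule C ⊗ B)) (opRight (inducedRight (freeModule C) B))) := by
  let R := RMod.regular k H
  let v₀ : (freeModule C ⊗ B).V := tm (freeModule C) B (tm C R (unitₗ C 1) (1 : H)) (unitₗ B 1)
  have key (t) : (triple (opLeft (p.inducedLeft (freeLeft C)))
    (opAct (freeModule C ⊗ B)) (opRight (inducedRight (freeModule C) B)) t).unop v₀ =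
      TensorProduct.map (twistAct C .id) LinearMap.id t := by
    induction t with
    | zero => rw [map_zero, map_zero]; rfl
    | add x y hx hy => 
      rw [map_add, map_add]
      exact congrArg₂ (· + ·) hx hy
    | tmul t b =>
      induction t with
      | zero => rw [TensorProduct.zero_tmul, map_zero, map_zero]; rfl
      | add x y hx hy => 
        rw [TensorProduct.add_tmul, map_add, map_add]
        exact congrArg₂ (· + ·) hx hy
      | tmul c h =>
        have d := Rep₂.some (Coalgebra.comul (R := k) h)
        have e₁ : lin (p.inducedLeft (freeLeft C)) (tm C (freeModule C ⊗ B) c v₀) =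
            tm (freeModule C) B (tm C R c (1 : H)) (unitₗ B 1) := by
          refine (lin_inducedLeft_one p (freeLeft C) c _).trans ?_
          exact congrArg (fun z => tm (freeModule C) B (tm C R z (1 : H)) (unitₗ B 1)) (lin_mul_one' c)
        have e₂ : (freeModule C ⊗ B).act h (tm (freeModule C) B (tm C R c (1 : H)) (unitₗ B 1)) =
            tm (freeModule C) B (twistAct C .id (c ⊗ₜ h)) (unitₗ B 1) := by
          rw [act_tm_unit, twistAct_tmul _ c h d]
          refine (congrArg (fun z => tm (freeModule C) B z (unitₗ B 1)) (act_tm (X := C) (Y := R) h d c (1 : H))).trans ?_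
          refine congrArg (fun z => tm (freeModule C) B z (unitₗ B 1)) (Finset.sum_congr rfl fun m _ => ?_)
          exact congrArg (fun z => tm C R (C.act (d.fst m) c) z) (one_mul (d.snd m))
        have e₃ (y : (freeModule C).V) : lin (inducedRight (freeModule C) B) (tm (freeModule C ⊗ B) B (tm (freeModule C) B y (unitₗ B 1)) b) =
            tm (freeModule C) B y b :=
          congrArg (tm (freeModule C) B y) (lin_mul_one b)
        refine Eq.trans ?_ (e₃ _)
        rw [← e₂, ← e₁]
        rfl
  intro x y h
  have e : TensorProduct.map (twistAct C .id) LinearMap.id x = TensorProduct.map (twistAct C .id) (LinearMap.id (M := B.V)) y :=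
    (key x).symm.trans ((congrArg (fun z : (Module.End k (freeModule C ⊗ B).V)ᵐᵒᵖ => z.unop v₀) h).trans (key y))
  have g : TensorProduct.map (twistAct C (HopfAlgebra.antipode k)) (LinearMap.id (M := B.V)) ∘ₗ
      TensorProduct.map (twistAct C .id) LinearMap.id = LinearMap.id := by
    rw [← TensorProduct.map_comp, LinearMap.comp_id, show twistAct C (HopfAlgebra.antipode k) ∘ₗ twistAct C .id = LinearMap.id from
      LinearMap.ext twistAct_antipode_twistAct, TensorProduct.map_id]
  have := congrArg (TensorProduct.map (twistAct C (HopfAlgebra.antipode k)) LinearMap.id) e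
  rwa [← LinearMap.comp_apply, ← LinearMap.comp_apply, g] at this

theorem exists_doubleRel : ∃ (D : Type u) (_ : Ring D) (_ : Algebra k D) (jC : C.V →ₗ[k] D) (jH : H →ₐ[k] D) (jB : B.V →ₗ[k] D),
      DoubleRel p D jC jH jB ∧ Function.Bijective (triple jC jH jB) :=
  (doubleRel_opAct p (isCrossedBimodule_free p)).exists_subalgebra (injective_free p)

end Cyclic

/-! ### The inverse antipode as an antipode for the inverse braiding. -/

section Skew
variable {𝒞 : Type w} [Category.{v} 𝒞] [MonoidalCategory 𝒞] [BraidedCategory 𝒞] (C : 𝒞) [HopfObj C] [IsIso 𝒮[C]]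

lemma braiding_inv_mul_antipode : (β_ C C).inv ≫ μ[C] ≫ 𝒮[C] = (𝒮[C] ⊗ₘ 𝒮[C]) ≫ μ[C] := by
  rw [HopfObj.mul_antipode, BraidedCategory.braiding_naturality_assoc, Iso.inv_hom_id_assoc]

/-- Composing with the antipode turns the product behind the inverse braiding into `(S ⊗ S) ≫ μ`,
and what remains is the ordinary antipode axiom. -/
lemma comul_antipodeInv_left : Δ[C] ≫ inv 𝒮[C] ▷ C ≫ (β_ C C).inv ≫ μ[C] = ε[C] ≫ η[C] := by
  rw [← cancel_mono 𝒮[C]]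
  simp only [Category.assoc, braiding_inv_mul_antipode, MonoidalCategory.tensorHom_def, HopfObj.one_antipode]
  rw [← comp_whiskerRight_assoc, IsIso.inv_hom_id, id_whiskerRight, Category.id_comp, HopfObj.antipode_right]

lemma comul_antipodeInv_right : Δ[C] ≫ C ◁ inv 𝒮[C] ≫ (β_ C C).inv ≫ μ[C] = ε[C] ≫ η[C] := by
  rw [← cancel_mono 𝒮[C]]
  simp only [Category.assoc, braiding_inv_mul_antipode, MonoidalCategory.tensorHom_def', HopfObj.one_antipode]
  rw [← whiskerLeft_comp_assoc, IsIso.inv_hom_id, whiskerLeft_id, Category.id_comp, HopfObj.antipode_left]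

end Skew

/-! ### Antipode identities on the generators. -/

section Antipode
variable {k : Type u} [Field k] {H : Type u} [Ring H] [HopfAlgebra k H] [Quasitriangular k H]
variable {C B X Y : RMod k H} [HopfObj C] [HopfObj B]

lemma lin_braiding_inv (s : Rep₂ (rMatrixInv k H)) (x : X.V) (y : Y.V) :
    lin (β_ X Y).inv (tm Y X y x) = ∑ i, tm X Y (X.act (s.snd i) x) (Y.act (s.fst i) y) := by
  change TensorProduct.comm k Y.V X.V (tensorEnd Y.act X.act (rMatrixInv k H) (y ⊗ₜ x)) = _
  conv_lhs => rw [s.eq]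
  simp only [map_sum, LinearMap.sum_apply, tensorEnd_tmul]
  rfl

lemma sum_mul_inv {M : Type u} [AddCommGroup M] [Module k M] (r : Rep₂ (rMatrix k H)) (s : Rep₂ (rMatrixInv k H))
    (g : H →ₗ[k] H →ₗ[k] M) : ∑ i, ∑ j, g (r.fst i * s.fst j) (r.snd i * s.snd j) = g 1 1 := by
  have h := congrArg (TensorProduct.lift g) (rMatrix_mul_inv k H)
  have e : rMatrix k H * rMatrixInv k H = (∑ i, r.fst i ⊗ₜ r.snd i) * (∑ j, s.fst j ⊗ₜ s.snd j) :=
    congrArg₂ _ r.eq s.eq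
  rw [e, Finset.sum_mul_sum] at h
  simpa [Algebra.TensorProduct.one_def] using h

lemma lin_counit_unit (c : C.V) : lin (ε[C] ≫ η[C]) c = counitₗ C c • unitₗ C 1 := by
  rw [← map_smul, smul_eq_mul, mul_one]; rfl

section
variable [IsIso 𝒮[C]]

/-- The `R⁻¹` in `comulBar` is the one in the inverse braiding, so this is the skew antipode
identity in elements: the inverse antipode of `C` serves as antipode of `C̄`. -/
lemma sum_mul_antipodeInv_fst {c : C.V} (x : Rep₂ (comulBar C c)) :
    ∑ m, lin μ[C] (tm C C (x.snd m) (antipodeInvₗ C (x.fst m))) = counitₗ C c • unitₗ C 1 := by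
  have s := Rep₂.some (rMatrixInv k H)
  have d := Rep₂.some (comulₗ C c)
  have e := sum_comulBar s d x (mk₂ fun a b => lin μ[C] (tm C C b (antipodeInvₗ C a)))
  simp only [mk₂_apply] at e
  rw [e, ← lin_counit_unit, ← comul_antipodeInv_left]
  simp only [lin_comp, lin_comul d, map_sum, lin_whiskerRight, lin_braiding_inv s]
  refine Finset.sum_congr rfl fun m _ => Finset.sum_congr rfl fun i _ => ?_
  rw [← lin_act]; rfl

lemma sum_mul_antipodeInv_snd {c : C.V} (x : Rep₂ (comulBar C c)) :
    ∑ m, lin μ[C] (tm C C (antipodeInvₗ C (x.snd m)) (x.fst m)) = counitₗ C c • unitₗ C 1 := by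
  have s := Rep₂.some (rMatrixInv k H)
  have d := Rep₂.some (comulₗ C c)
  have e := sum_comulBar s d x (mk₂ fun a b => lin μ[C] (tm C C (antipodeInvₗ C b) a))
  simp only [mk₂_apply] at e
  rw [e, ← lin_counit_unit, ← comul_antipodeInv_right]
  simp only [lin_comp, lin_comul d, map_sum, lin_whiskerLeft, lin_braiding_inv s]
  refine Finset.sum_congr rfl fun m _ => Finset.sum_congr rfl fun i _ => ?_
  rw [← lin_act]; rfl

end

lemma sum_antipodeₗ_mul {b : B.V} (x : Rep₂ (comulₗ B b)) :
    ∑ m, lin μ[B] (tm B B (antipodeₗ B (x.fst m)) (x.snd m)) = counitₗ B b • unitₗ B 1 := by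
  rw [← lin_counit_unit, ← HopfObj.antipode_left]
  simp only [lin_comp, lin_comul x, map_sum, lin_whiskerRight]
  rfl

lemma sum_mul_antipodeₗ {b : B.V} (x : Rep₂ (comulₗ B b)) :
    ∑ m, lin μ[B] (tm B B (x.fst m) (antipodeₗ B (x.snd m))) = counitₗ B b • unitₗ B 1 := by
  rw [← lin_counit_unit, ← HopfObj.antipode_right]
  simp only [lin_comp, lin_comul x, map_sum, lin_whiskerLeft]
  rfl

lemma antipodeₗ_act (h : H) (b : B.V) : antipodeₗ B (B.act h b) = B.act h (antipodeₗ B b) := lin_act 𝒮[B] h b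

lemma lin_mul_act (h : H) (d : Rep₂ (Coalgebra.comul (R := k) h)) (a b : B.V) :
    ∑ m, lin μ[B] (tm B B (B.act (d.fst m) a) (B.act (d.snd m) b)) = B.act h (lin μ[B] (tm B B a b)) :=
  isHLinear_curr μ[B] h d a b

variable {A : Type u} [Ring A] [Algebra k A] (iC : C.V →ₗ[k] A) (iH : H →ₐ[k] A) (iB : B.V →ₗ[k] A)

/-- The antipode of the double bosonisation on `B`. -/
def antipodeB : B.V →ₗ[k] A :=
  ∑ i, LinearMap.mulRight k (iH (HopfAlgebra.antipode k ((Rep₂.some (rMatrix k H)).snd i))) ∘ₗ iB ∘ₗ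
    B.act ((Rep₂.some (rMatrix k H)).fst i) ∘ₗ antipodeₗ B

lemma antipodeB_eq (r : Rep₂ (rMatrix k H)) (b : B.V) :
    antipodeB iH iB b = ∑ i, iB (B.act (r.fst i) (antipodeₗ B b)) * iH (HopfAlgebra.antipode k (r.snd i)) := by
  have e := Rep₂.sum_congr (Rep₂.some _) r (mk₂ fun x y => iB (B.act x (antipodeₗ B b)) * iH (HopfAlgebra.antipode k y))
  simp only [mk₂_apply] at e
  rw [← e, antipodeB, LinearMap.sum_apply]
  rfl

/-- The antipode of the double bosonisation on `C`. -/
def antipodeC [IsIso 𝒮[C]] : C.V →ₗ[k] A :=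
  ∑ i, LinearMap.mulLeft k (iH (HopfAlgebra.antipode k ((Rep₂.some (rMatrix k H)).fst i))) ∘ₗ iC ∘ₗ
    C.act ((Rep₂.some (rMatrix k H)).snd i) ∘ₗ antipodeInvₗ C

lemma antipodeC_eq [IsIso 𝒮[C]] (r : Rep₂ (rMatrix k H)) (c : C.V) :
    antipodeC iC iH c = ∑ i, iH (HopfAlgebra.antipode k (r.fst i)) * iC (C.act (r.snd i) (antipodeInvₗ C c)) := by
  have e := Rep₂.sum_congr (Rep₂.some _) r (mk₂ fun x y => iH (HopfAlgebra.antipode k x) * iC (C.act y (antipodeInvₗ C c)))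
  simp only [mk₂_apply] at e
  rw [← e, antipodeC, LinearMap.sum_apply]
  rfl

variable [IsIso 𝒮[C]] {p : DualPairing C B} {iC iH iB} (hA : DoubleRel p A iC iH iB)
variable (r : Rep₂ (rMatrix k H)) (s : Rep₂ (rMatrixInv k H))

set_option maxHeartbeats 1000000 in
-- The factor `S R⁽²⁾` from the antipode meets the `R⁽²⁾` of the coproduct. By the formula for `(id
-- ⊗ Δ) R` they combine to `(S h₁) h₂` and disappear, leaving the antipode axiom of `B`.
lemma DoubleRel.sum_antipodeB_left (hA : DoubleRel p A iC iH iB) {b : B.V} (x : Rep₂ (comulₗ B b)) :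
    ∑ m, ∑ i, antipodeB iH iB (B.act (r.fst i) (x.fst m)) * iH (r.snd i) * iB (x.snd m) = algebraMap k A (counitₗ B b) := by
  have D : ∀ h : H, Rep₂ (Coalgebra.comul (R := k) h) := fun _ => Rep₂.some _
  have h (m) : ∑ i, antipodeB iH iB (B.act (r.fst i) (x.fst m)) * iH (r.snd i) * iB (x.snd m) =
      iB (lin μ[B] (tm B B (antipodeₗ B (x.fst m)) (x.snd m))) := by
    simp only [antipodeB_eq iH iB r, antipodeₗ_act, act_comp, Finset.sum_mul]
    have e := comul_snd_rMatrix r (mk₃ fun a b b' => iB (B.act a (antipodeₗ B (x.fst m))) *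
      iH (HopfAlgebra.antipode k b) * iH b' * iB (x.snd m)) D
    simp only [mk₃_apply] at e
    rw [← e]
    simp only [mul_assoc (iB _) (iH _) (iH _), ← map_mul, ← Finset.sum_mul, ← Finset.mul_sum, ← map_sum, sum_antipode_mul]
    have e₂ (i) : iB (B.act (r.fst i) (antipodeₗ B (x.fst m))) * iH (algebraMap k H (Coalgebra.counit (R := k) (r.snd i))) =
        iB (B.act (Coalgebra.counit (R := k) (r.snd i) • r.fst i) (antipodeₗ B (x.fst m))) := by
      rw [AlgHom.commutes, Algebra.algebraMap_eq_smul_one, mul_smul_comm, mul_one, map_smul, LinearMap.smul_apply, map_smul]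
    simp only [e₂, ← map_sum, ← LinearMap.sum_apply, sum_counit_snd_rMatrix, B.act_one, Module.End.one_apply]
    exact hA.iB_mul _ _
  simp only [h, ← map_sum iB]
  rw [sum_antipodeₗ_mul x, map_smul, hA.iB_one, Algebra.algebraMap_eq_smul_one]

set_option maxHeartbeats 1000000 in
-- Here the two copies of `R` combine through `(Δ ⊗ id) R` into one, acting on the product `b₁ (S
-- b₂)`. That product is a multiple of `1`, on which `H` acts by the counit.
lemma DoubleRel.sum_antipodeB_right (hA : DoubleRel p A iC iH iB) {b : B.V} (x : Rep₂ (comulₗ B b)) :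
    ∑ m, ∑ i, iB (B.act (r.fst i) (x.fst m)) * antipodeB iH iB (x.snd m) * iH (HopfAlgebra.antipode k (r.snd i)) =
      algebraMap k A (counitₗ B b) := by
  have D : ∀ h : H, Rep₂ (Coalgebra.comul (R := k) h) := fun _ => Rep₂.some _
  have h (m) : ∑ i, iB (B.act (r.fst i) (x.fst m)) * antipodeB iH iB (x.snd m) * iH (HopfAlgebra.antipode k (r.snd i)) =
      ∑ i, iB (B.act (r.fst i) (lin μ[B] (tm B B (x.fst m) (antipodeₗ B (x.snd m))))) * iH (HopfAlgebra.antipode k (r.snd i)) := by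
    simp only [antipodeB_eq iH iB r, Finset.mul_sum, Finset.sum_mul]
    have e := comul_fst_rMatrix r (mk₃ fun a b c => iB (lin μ[B] (tm B B (B.act a (x.fst m)) (B.act b (antipodeₗ B (x.snd m))))) *
      iH (HopfAlgebra.antipode k c)) D
    simp only [mk₃_apply] at e
    simp only [← Finset.sum_mul, ← map_sum iB, lin_mul_act] at e
    rw [e]
    refine Finset.sum_congr rfl fun i _ => Finset.sum_congr rfl fun j _ => ?_
    rw [HopfAlgebra.antipode_mul_antidistrib, map_mul, ← mul_assoc, ← mul_assoc, hA.iB_mul]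
    rfl
  simp only [h]
  rw [Finset.sum_comm]
  have e (i) : ∑ m, B.act (r.fst i) (lin μ[B] (tm B B (x.fst m) (antipodeₗ B (x.snd m)))) =
      B.act (r.fst i) (counitₗ B b • unitₗ B 1) := by
    rw [← map_sum, sum_mul_antipodeₗ x]
  simp only [← Finset.sum_mul, ← map_sum iB, e]
  simp only [map_smul, act_unitₗ, hA.iB_one, smul_mul_assoc, one_mul]
  simp only [← map_smul iH, ← map_smul (HopfAlgebra.antipode k), ← Finset.smul_sum, ← map_sum, sum_counit_fst_rMatrix]
  rw [map_smul, map_smul, HopfAlgebra.antipode_one, map_one, Algebra.algebraMap_eq_smul_one]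

set_option maxHeartbeats 1000000 in
lemma DoubleRel.sum_antipodeC_left (hA : DoubleRel p A iC iH iB) {c : C.V} (x : Rep₂ (comulBar C c)) :
    ∑ m, ∑ i, iH (HopfAlgebra.antipode k (s.fst i)) * antipodeC iC iH (x.fst m) * iC (lact C (s.snd i) (x.snd m)) =
      algebraMap k A (counitₗ C c) := by
  have r := Rep₂.some (rMatrix k H)
  have D : ∀ h : H, Rep₂ (Coalgebra.comul (R := k) h) := fun _ => Rep₂.some _
  have h (m) : ∑ i, iH (HopfAlgebra.antipode k (s.fst i)) * antipodeC iC iH (x.fst m) * iC (lact C (s.snd i) (x.snd m)) =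
      ∑ i, iH (HopfAlgebra.antipode k (r.fst i)) * iC (C.act (r.snd i) (lin μ[C] (tm C C (x.snd m) (antipodeInvₗ C (x.fst m))))) := by
    have e₁ := sum_rMatrixInv_antipode r s (mk₂ fun a b => iH (HopfAlgebra.antipode k a) * antipodeC iC iH (x.fst m) *
      iC (C.act b (x.snd m)))
    simp only [mk₂_apply] at e₁
    refine e₁.trans ?_
    simp only [antipodeC_eq iC iH r, Finset.mul_sum, Finset.sum_mul]
    rw [Finset.sum_comm]
    have e := comul_snd_rMatrix r (mk₃ fun a b b' => iH (HopfAlgebra.antipode k a) *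
      iC (lin μ[C] (tm C C (C.act b (x.snd m)) (C.act b' (antipodeInvₗ C (x.fst m)))))) D
    simp only [mk₃_apply] at e
    simp only [← Finset.mul_sum, ← map_sum iC, lin_mul_act] at e
    rw [e]
    refine Finset.sum_congr rfl fun i _ => Finset.sum_congr rfl fun j _ => ?_
    rw [HopfAlgebra.antipode_mul_antidistrib, map_mul, ← mul_assoc, mul_assoc, hA.iC_mul]
    rfl
  simp only [h]
  rw [Finset.sum_comm]
  have e (i) : ∑ m, C.act (r.snd i) (lin μ[C] (tm C C (x.snd m) (antipodeInvₗ C (x.fst m)))) =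
      C.act (r.snd i) (counitₗ C c • unitₗ C 1) := by
    rw [← map_sum, sum_mul_antipodeInv_fst x]
  simp only [← Finset.mul_sum, ← map_sum iC, e]
  simp only [map_smul, act_unitₗ, hA.iC_one, mul_smul_comm, mul_one]
  simp only [← map_smul iH, ← map_smul (HopfAlgebra.antipode k), ← Finset.smul_sum, ← map_sum, sum_counit_snd_rMatrix]
  rw [map_smul, map_smul, HopfAlgebra.antipode_one, map_one, Algebra.algebraMap_eq_smul_one]

set_option maxHeartbeats 1000000 in
-- One copy of `R` comes from the coproduct, since `(id ⊗ S) R⁻¹ = R`. The other, with the antipode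
-- on its first leg, is `R⁻¹` and cancels it, leaving the skew antipode identity of `C`.
lemma DoubleRel.sum_antipodeC_right (hA : DoubleRel p A iC iH iB) {c : C.V} (x : Rep₂ (comulBar C c)) :
    ∑ m, ∑ i, iC (x.fst m) * iH (s.fst i) * antipodeC iC iH (lact C (s.snd i) (x.snd m)) =
      algebraMap k A (counitₗ C c) := by
  have r := Rep₂.some (rMatrix k H)
  have h (m) : ∑ i, iC (x.fst m) * iH (s.fst i) * antipodeC iC iH (lact C (s.snd i) (x.snd m)) =
      iC (lin μ[C] (tm C C (antipodeInvₗ C (x.snd m)) (x.fst m))) := by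
    have e₁ := sum_rMatrixInv_antipode r s (mk₂ fun a b => iC (x.fst m) * iH a * antipodeC iC iH (C.act b (x.snd m)))
    simp only [mk₂_apply] at e₁
    refine e₁.trans ?_
    have e₀ (h : H) (c : C.V) : antipodeInvₗ C (C.act h c) = C.act h (antipodeInvₗ C c) := lin_act (inv 𝒮[C]) h c
    simp only [antipodeC_eq iC iH r, Finset.mul_sum, e₀, act_comp]
    have e₂ (i) := sum_antipode_rMatrix r s (mk₂ fun a b => iC (x.fst m) * iH (r.fst i) * (iH a * iC (C.act (r.snd i * b) (antipodeInvₗ C (x.snd m)))))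
    simp only [mk₂_apply] at e₂
    simp only [e₂]
    have e₃ := sum_mul_inv r s (mk₂ fun a b => iC (x.fst m) * iH a * iC (C.act b (antipodeInvₗ C (x.snd m))))
    simp only [mk₂_apply, map_mul, ← mul_assoc] at e₃ ⊢
    rw [e₃, map_one, mul_one, C.act_one, Module.End.one_apply, hA.iC_mul]
    rfl
  simp only [h, ← map_sum iC]
  rw [sum_mul_antipodeInv_snd x, map_smul, hA.iC_one, Algebra.algebraMap_eq_smul_one]

end Antipode

/-! ### The Hopf algebra structure and existence. -/

section HopfStructure
variable {k : Type u} [Field k] {H : Type u} [Ring H] [HopfAlgebra k H] [Quasitriangular k H]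
variable {C B : RMod k H} [HopfObj C] [HopfObj B] [IsIso 𝒮[C]] {p : DualPairing C B}
variable {A : Type u} [Ring A] [Algebra k A] {iC : C.V →ₗ[k] A} {iH : H →ₐ[k] A} {iB : B.V →ₗ[k] A}

lemma opAct_regular_injective (A : Type u) [Ring A] [Algebra k A] : Function.Injective (opAct (RMod.regular k A)) := fun x y h => by
  have e : (1 : A) * x = 1 * y := congrArg (fun z : (Module.End k A)ᵐᵒᵖ => z.unop (1 : A)) h
  rwa [one_mul, one_mul] at e

lemma DoubleRel.congr {A : Type u} [Ring A] [Algebra k A] {iC jC : C.V →ₗ[k] A} {iH jH : H →ₐ[k] A} {iB jB : B.V →ₗ[k] A}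
    (h : DoubleRel p A iC iH iB) (hC : ∀ c, iC c = jC c) (hH : ∀ h, iH h = jH h) (hB : ∀ b, iB b = jB b) :
    DoubleRel p A jC jH jB := by
  obtain rfl := LinearMap.ext hC
  obtain rfl := AlgHom.ext hH
  obtain rfl := LinearMap.ext hB
  exact h

lemma tensorEnd_eq_map {A A' V W : Type u} [AddCommGroup A] [Module k A] [AddCommGroup A'] [Module k A']
    [AddCommGroup V] [Module k V] [AddCommGroup W] [Module k W] {f : A →ₗ[k] Module.End k V} {g : A' →ₗ[k] Module.End k W}
    {v : V} {w : W} (φ : A →ₗ[k] V) (ψ : A' →ₗ[k] W) (hφ : ∀ a, f a v = φ a) (hψ : ∀ a, g a w = ψ a) (x : A ⊗[k] A') :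
    tensorEnd f g x (v ⊗ₜ w) = TensorProduct.map φ ψ x := by
  induction x with
  | zero => simp
  | add x y hx hy => rw [map_add, LinearMap.add_apply, hx, hy, map_add]
  | tmul a b => rw [tensorEnd_tmul, hφ, hψ, TensorProduct.map_tmul]

section
variable (hA : DoubleRel p A iC iH iB) (hb : Function.Bijective (triple iC iH iB))

/-- The crossed bimodule of the regular module. -/
def DoubleRel.regular : CrossedBimodule p := hA.toCrossed (RMod.regular k A)

lemma DoubleRel.toModule_regular_act (a v : A) : (hA.toModule hb hA.regular).act a v = v * a :=
  hA.toModule_toCrossed_act hb (RMod.regular k A) a v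

lemma DoubleRel.tensorEnd_regular (x t : A ⊗[k] A) :
    tensorEnd (hA.toModule hb hA.regular).act (hA.toModule hb hA.regular).act x t = t * x := by
  have h : (hA.toModule hb hA.regular).act = (LinearMap.mul k A).flip :=
    LinearMap.ext fun a => LinearMap.ext fun v => hA.toModule_regular_act hb a v
  exact (congrArg (fun f : A →ₗ[k] Module.End k A => tensorEnd f f x t) h).trans (tensorEnd_mul_flip x t)

include hA hb in
-- `A ⊗ A` acts faithfully on itself by right multiplication. There the proposed coproducts act as
-- the generators act on the tensor square of the regular crossed bimodule, so the relations hold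
-- because that square is crossed.
lemma DoubleRel.doubleRel_comul : DoubleRel p (A ⊗[k] A) (comulC iC iH) (comulH iH) (comulB iH iB) := by
  refine .of_injective (opAct (RMod.regular k (A ⊗[k] A))) (opAct_regular_injective _) ?_
  refine @DoubleRel.congr k _ H _ _ _ C B _ _ _ p _ _ _ _ _ _ _ _ _
    (doubleRel_opAct p (hA.regular ⊗ hA.regular).isCrossed) (fun c => ?_) (fun h => ?_) (fun b => ?_)
  · refine MulOpposite.unop_injective (LinearMap.ext fun t => ?_)
    exact (hA.tensorEnd_comulC hb hA.regular hA.regular c t).symm.trans (hA.tensorEnd_regular hb _ t)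
  · refine MulOpposite.unop_injective (LinearMap.ext fun t => ?_)
    exact (hA.tensorEnd_comulH hb hA.regular hA.regular h t).symm.trans (hA.tensorEnd_regular hb _ t)
  · refine MulOpposite.unop_injective (LinearMap.ext fun t => ?_)
    exact (hA.tensorEnd_comulB hb hA.regular hA.regular b t).symm.trans (hA.tensorEnd_regular hb _ t)

lemma doubleRel_counit : DoubleRel p k (counitₗ C) (Bialgebra.counitAlgHom k H) (counitₗ B) := by
  refine .of_injective (opAct (RMod.regular k k)) (opAct_regular_injective _) ?_
  refine @DoubleRel.congr k _ H _ _ _ C B _ _ _ p _ _ _ _ _ _ _ _ _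
    (doubleRel_opAct p (𝟙_ (CrossedBimodule p)).isCrossed) (fun c => ?_) (fun h => ?_) (fun b => ?_)
  · refine MulOpposite.unop_injective (LinearMap.ext fun (t : k) => ?_)
    change counitₗ C (t • c) = t * counitₗ C c
    rw [map_smul, smul_eq_mul]
  · refine MulOpposite.unop_injective (LinearMap.ext fun (t : k) => ?_)
    exact mul_comm (Coalgebra.counit (R := k) h) t
  · refine MulOpposite.unop_injective (LinearMap.ext fun (t : k) => ?_)
    change counitₗ B (t • b) = t * counitₗ B b
    rw [map_smul, smul_eq_mul]

variable {δ : A →ₐ[k] A ⊗[k] A} (hC : ∀ c, δ (iC c) = comulC iC iH c)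
    (hH : ∀ h, δ (iH h) = comulH iH h) (hB : ∀ b, δ (iB b) = comulB iH iB b)
variable {e : A →ₐ[k] k} (hC' : ∀ c, e (iC c) = counitₗ C c)
    (hH' : ∀ h, e (iH h) = Coalgebra.counit (R := k) h) (hB' : ∀ b, e (iB b) = counitₗ B b)

include hA hb hC hH hB

lemma DoubleRel.toModule_tensor_regular_act_one (a : A) :
    (hA.toModule hb (hA.regular ⊗ hA.regular)).act a ((1 : A) ⊗ₜ[k] (1 : A)) = δ a :=
  (hA.toModule_tensor_act hb hA.regular hA.regular δ hC hH hB a _).trans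
    ((hA.tensorEnd_regular hb _ _).trans (one_mul (δ a)))

/-- The coproduct of `a` is its action on `1 ⊗ 1`. The two sides are the actions of `a` on the two
bracketings of `1 ⊗ 1 ⊗ 1`, and the associator is linear over `A`. -/
lemma DoubleRel.coassoc_of_comul : (Algebra.TensorProduct.assoc k k k A A A).toAlgHom.comp
      ((Algebra.TensorProduct.map δ (.id k A)).comp δ) = (Algebra.TensorProduct.map (.id k A) δ).comp δ := by
  let G := hA.regular
  have one (a : A) : (hA.toModule hb G).act a (1 : A) = a := (hA.toModule_regular_act hb a 1).trans (one_mul a)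
  have two (a : A) : (hA.toModule hb (G ⊗ G)).act a ((1 : A) ⊗ₜ[k] (1 : A)) = δ a :=
    hA.toModule_tensor_regular_act_one hb hC hH hB a
  refine AlgHom.ext fun a => ?_
  have h₁ : (hA.toModule hb ((G ⊗ G) ⊗ G)).act a (((1 : A) ⊗ₜ[k] (1 : A)) ⊗ₜ[k] (1 : A)) =
      TensorProduct.map δ.toLinearMap LinearMap.id (δ a) :=
    (hA.toModule_tensor_act hb (G ⊗ G) G δ hC hH hB a _).trans
      (tensorEnd_eq_map (V := A ⊗[k] A) (W := A) δ.toLinearMap LinearMap.id two one (δ a))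
  have h₂ : (hA.toModule hb (G ⊗ (G ⊗ G))).act a ((1 : A) ⊗ₜ[k] ((1 : A) ⊗ₜ[k] (1 : A))) =
      TensorProduct.map LinearMap.id δ.toLinearMap (δ a) :=
    (hA.toModule_tensor_act hb G (G ⊗ G) δ hC hH hB a _).trans
      (tensorEnd_eq_map (V := A) (W := A ⊗[k] A) LinearMap.id δ.toLinearMap one two (δ a))
  have h := hom_commute_act ((hA.toModuleFunctor hb).map (α_ G G G).hom) a (((1 : A) ⊗ₜ[k] (1 : A)) ⊗ₜ[k] (1 : A))
  exact (congrArg (TensorProduct.assoc k A A A) h₁).symm.trans (h.trans h₂)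

include hC' hH' hB'

lemma DoubleRel.rTensor_counit_of_comul : (Algebra.TensorProduct.map e (.id k A)).comp δ = (Algebra.TensorProduct.lid k A).symm := by
  let G := hA.regular
  have one (a : A) : (hA.toModule hb G).act a (1 : A) = a := (hA.toModule_regular_act hb a 1).trans (one_mul a)
  have unit (a : A) : (hA.toModule hb (𝟙_ (CrossedBimodule p))).act a (1 : k) = e a :=
    (hA.toModule_unit_act hb e hC' hH' hB' a 1).trans (mul_one (e a))
  refine AlgHom.ext fun a => (TensorProduct.lid k A).injective ?_
  have h₁ : (hA.toModule hb (𝟙_ (CrossedBimodule p) ⊗ G)).act a ((1 : k) ⊗ₜ[k] (1 : A)) =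
      TensorProduct.map e.toLinearMap LinearMap.id (δ a) :=
    (hA.toModule_tensor_act hb (𝟙_ (CrossedBimodule p)) G δ hC hH hB a _).trans
      (tensorEnd_eq_map (V := k) (W := A) e.toLinearMap LinearMap.id unit one (δ a))
  have h := hom_commute_act ((hA.toModuleFunctor hb).map (λ_ G).hom) a ((1 : k) ⊗ₜ[k] (1 : A))
  refine (congrArg (TensorProduct.lid k A) h₁).symm.trans (h.trans ?_)
  refine Eq.trans (congrArg ((hA.toModule hb G).act a) (one_smul k (1 : A))) ((one a).trans ?_)
  exact ((TensorProduct.lid k A).apply_symm_apply a).symm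

lemma DoubleRel.lTensor_counit_of_comul : (Algebra.TensorProduct.map (.id k A) e).comp δ = (Algebra.TensorProduct.rid k k A).symm := by
  let G := hA.regular
  have one (a : A) : (hA.toModule hb G).act a (1 : A) = a := (hA.toModule_regular_act hb a 1).trans (one_mul a)
  have unit (a : A) : (hA.toModule hb (𝟙_ (CrossedBimodule p))).act a (1 : k) = e a :=
    (hA.toModule_unit_act hb e hC' hH' hB' a 1).trans (mul_one (e a))
  refine AlgHom.ext fun a => (TensorProduct.rid k A).injective ?_
  have h₁ : (hA.toModule hb (G ⊗ 𝟙_ (CrossedBimodule p))).act a ((1 : A) ⊗ₜ[k] (1 : k)) =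
      TensorProduct.map LinearMap.id e.toLinearMap (δ a) :=
    (hA.toModule_tensor_act hb G (𝟙_ (CrossedBimodule p)) δ hC hH hB a _).trans
      (tensorEnd_eq_map (V := A) (W := k) LinearMap.id e.toLinearMap one unit (δ a))
  have h := hom_commute_act ((hA.toModuleFunctor hb).map (ρ_ G).hom) a ((1 : A) ⊗ₜ[k] (1 : k))
  refine (congrArg (TensorProduct.rid k A) h₁).symm.trans (h.trans ?_)
  refine Eq.trans (congrArg ((hA.toModule hb G).act a) (one_smul k (1 : A))) ((one a).trans ?_)
  exact ((TensorProduct.rid k A).apply_symm_apply a).symm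

end

section
variable {T : A →ₗ[k] A}

omit [HopfObj C] [HopfObj B] [Quasitriangular k H] [IsIso 𝒮[C]] in
lemma exists_linearMap_of_triple (hb : Function.Bijective (triple iC iH iB)) (f : C.V →ₗ[k] H →ₗ[k] B.V →ₗ[k] A) :
    ∃ T : A →ₗ[k] A, ∀ c h b, T (iC c * iH h * iB b) = f c h b := by
  let i := LinearEquiv.ofBijective _ hb
  refine ⟨TensorProduct.lift (TensorProduct.lift f) ∘ₗ i.symm.toLinearMap, fun c h b => ?_⟩
  have e : i.symm (iC c * iH h * iB b) = (c ⊗ₜ h) ⊗ₜ b := by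
    rw [LinearEquiv.symm_apply_eq]; rfl
  rw [LinearMap.comp_apply, LinearEquiv.coe_coe, e, TensorProduct.lift.tmul, TensorProduct.lift.tmul]

/-- Prescribing the map on ordered triples suffices; the antipode axioms are checked on triples
without first knowing that it reverses arbitrary products. -/
lemma DoubleRel.exists_antipode (hb : Function.Bijective (triple iC iH iB)) : ∃ T : A →ₗ[k] A, ∀ c h b,
    T (iC c * iH h * iB b) = antipodeB iH iB b * iH (HopfAlgebra.antipode k h) * antipodeC iC iH c :=
  exists_linearMap_of_triple hb (mk₃ fun c h b => antipodeB iH iB b * iH (HopfAlgebra.antipode k h) * antipodeC iC iH c)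

lemma comulH_eq {h : H} (d : Rep₂ (Coalgebra.comul (R := k) h)) : comulH iH h = ∑ n, iH (d.fst n) ⊗ₜ[k] iH (d.snd n) :=
  d.tensor_map iH.toLinearMap iH.toLinearMap

variable (hA : DoubleRel p A iC iH iB)
  (hT : ∀ c h b, T (iC c * iH h * iB b) = antipodeB iH iB b * iH (HopfAlgebra.antipode k h) * antipodeC iC iH c)

include hA hT

/-- As the antipode reverses a triple, the factors from `C` meet in the middle. They collapse to a
counit, then those from `H` meet and collapse, and last those from `B`. -/
lemma DoubleRel.mul_rTensor_comul (c : C.V) (h : H) (b : B.V) :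
    LinearMap.mul' k A (T.rTensor A (comulC iC iH c * comulH iH h * comulB iH iB b)) =
      (counitₗ C c * Coalgebra.counit (R := k) h * counitₗ B b) • 1 := by
  have r := Rep₂.some (rMatrix k H)
  have s := Rep₂.some (rMatrixInv k H)
  have d := Rep₂.some (Coalgebra.comul (R := k) h)
  have x := Rep₂.some (comulBar C c)
  have y := Rep₂.some (comulₗ B b)
  have e₁ (u u' : H) (y : B.V) (w : A) : LinearMap.mul' k A (T.rTensor A (comulC iC iH c * (iH u ⊗ₜ iH u') * (iB y ⊗ₜ w))) =
      counitₗ C c • (antipodeB iH iB y * iH (HopfAlgebra.antipode k u * u') * w) := by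
    rw [comulC_eq c x s]
    simp only [Finset.sum_mul, Algebra.TensorProduct.tmul_mul_tmul, map_sum, LinearMap.rTensor_tmul, LinearMap.mul'_apply,
      mul_assoc (iC _) (iH _) (iH _), ← map_mul, hT]
    have e (m i) : antipodeB iH iB y * iH (HopfAlgebra.antipode k (s.fst i * u)) * antipodeC iC iH (x.fst m) *
        (iC (lact C (s.snd i) (x.snd m)) * iH u' * w) = antipodeB iH iB y * iH (HopfAlgebra.antipode k u) *
        (iH (HopfAlgebra.antipode k (s.fst i)) * antipodeC iC iH (x.fst m) * iC (lact C (s.snd i) (x.snd m))) * (iH u' * w) := by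
      rw [HopfAlgebra.antipode_mul_antidistrib, map_mul]
      simp only [mul_assoc]
    simp only [e, ← Finset.sum_mul, ← Finset.mul_sum]
    rw [hA.sum_antipodeC_left s x, Algebra.algebraMap_eq_smul_one, mul_smul_comm, mul_one, smul_mul_assoc, map_mul]
    simp only [mul_assoc]
  have e₂ (y : B.V) (w : A) : LinearMap.mul' k A (T.rTensor A (comulC iC iH c * comulH iH h * (iB y ⊗ₜ w))) =
      (counitₗ C c * Coalgebra.counit (R := k) h) • (antipodeB iH iB y * w) := by
    rw [comulH_eq d, Finset.mul_sum, Finset.sum_mul, map_sum, map_sum]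
    simp only [e₁, ← Finset.smul_sum, ← Finset.sum_mul, ← Finset.mul_sum, ← map_sum iH]
    rw [sum_antipode_mul d, AlgHom.commutes, Algebra.algebraMap_eq_smul_one, mul_smul_comm, mul_one, smul_mul_assoc, smul_smul]
  rw [comulB_eq b y r]
  simp only [Finset.mul_sum, map_sum, e₂, ← Finset.smul_sum, ← mul_assoc]
  rw [hA.sum_antipodeB_left r y, Algebra.algebraMap_eq_smul_one, smul_smul]

/-- On this side the factors from `B` are innermost, so the order of collapse is `B`, `H`, `C`. -/
lemma DoubleRel.mul_lTensor_comul (c : C.V) (h : H) (b : B.V) :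
    LinearMap.mul' k A (T.lTensor A (comulC iC iH c * (comulH iH h * comulB iH iB b))) =
      (counitₗ C c * (Coalgebra.counit (R := k) h * counitₗ B b)) • 1 := by
  have r := Rep₂.some (rMatrix k H)
  have s := Rep₂.some (rMatrixInv k H)
  have d := Rep₂.some (Coalgebra.comul (R := k) h)
  have x := Rep₂.some (comulBar C c)
  have y := Rep₂.some (comulₗ B b)
  have e₁ (u u' : H) (z : C.V) (w : A) : LinearMap.mul' k A (T.lTensor A ((w ⊗ₜ iC z) * ((iH u ⊗ₜ iH u') * comulB iH iB b))) =
      counitₗ B b • (w * iH (u * HopfAlgebra.antipode k u') * antipodeC iC iH z) := by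
    rw [comulB_eq b y r]
    simp only [Finset.mul_sum, Algebra.TensorProduct.tmul_mul_tmul, map_sum, LinearMap.lTensor_tmul, LinearMap.mul'_apply,
      ← mul_assoc]
    have e (m i) : w * iH u * iB (B.act (r.fst i) (y.fst m)) * T (iC z * iH u' * iH (r.snd i) * iB (y.snd m)) =
        w * iH u * (iB (B.act (r.fst i) (y.fst m)) * antipodeB iH iB (y.snd m) * iH (HopfAlgebra.antipode k (r.snd i))) *
          (iH (HopfAlgebra.antipode k u') * antipodeC iC iH z) := by
      rw [mul_assoc (iC z), ← map_mul, hT, HopfAlgebra.antipode_mul_antidistrib, map_mul]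
      simp only [mul_assoc]
    simp only [e, ← Finset.sum_mul, ← Finset.mul_sum]
    rw [hA.sum_antipodeB_right r y, Algebra.algebraMap_eq_smul_one, mul_smul_comm, mul_one, smul_mul_assoc, map_mul]
    simp only [mul_assoc]
  have e₂ (z : C.V) (w : A) : LinearMap.mul' k A (T.lTensor A ((w ⊗ₜ iC z) * (comulH iH h * comulB iH iB b))) =
      (Coalgebra.counit (R := k) h * counitₗ B b) • (w * antipodeC iC iH z) := by
    rw [comulH_eq d, Finset.sum_mul, Finset.mul_sum, map_sum, map_sum]
    simp only [e₁, ← Finset.smul_sum, ← Finset.sum_mul, ← Finset.mul_sum, ← map_sum iH]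
    rw [sum_mul_antipode d, AlgHom.commutes, Algebra.algebraMap_eq_smul_one, mul_smul_comm, mul_one, smul_mul_assoc, smul_smul,
      mul_comm (Coalgebra.counit h)]
  rw [comulC_eq c x s]
  simp only [Finset.sum_mul, map_sum, e₂, ← Finset.smul_sum]
  rw [hA.sum_antipodeC_right s x, Algebra.algebraMap_eq_smul_one, smul_smul, mul_comm (counitₗ C c)]

end

variable (p) in
theorem nonempty_doubleBosonisation : Nonempty (DoubleBosonisation p) := by
  obtain ⟨A, _, _, iC, iH, iB, hA, hb⟩ := exists_doubleRel p
  obtain ⟨δ, hC, hH, hB⟩ := hA.exists_algHom (hA.doubleRel_comul hb) hb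
  obtain ⟨e, hC', hH', hB'⟩ := hA.exists_algHom doubleRel_counit hb
  obtain ⟨T, hT⟩ := DoubleRel.exists_antipode hb
  let bialg : Bialgebra k A := .ofAlgHom δ e (hA.coassoc_of_comul hb hC hH hB)
    (hA.rTensor_counit_of_comul hb hC hH hB hC' hH' hB') (hA.lTensor_counit_of_comul hb hC hH hB hC' hH' hB')
  let hopf : HopfAlgebra k A :=
    { bialg with
      antipode := T
      mul_antipode_rTensor_comul := LinearMap.ext fun a => by
        change LinearMap.mul' k A (T.rTensor A (δ a)) = algebraMap k A (e a)
        induction a using triple_induction hb.2 with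
        | h0 => simp
        | ha x y hx hy => simp only [map_add, hx, hy]
        | hm c h b => rw [map_mul δ, map_mul δ, hC, hH, hB, hA.mul_rTensor_comul hT, map_mul e, map_mul e, hC', hH', hB',
            Algebra.algebraMap_eq_smul_one]; rfl
      mul_antipode_lTensor_comul := LinearMap.ext fun a => by
        change LinearMap.mul' k A (T.lTensor A (δ a)) = algebraMap k A (e a)
        induction a using triple_induction hb.2 with
        | h0 => simp
        | ha x y hx hy => simp only [map_add, hx, hy]
        | hm c h b => rw [mul_assoc, map_mul δ, map_mul δ, hC, hH, hB, hA.mul_lTensor_comul hT, map_mul e, map_mul e, hC', hH', hB',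
            Algebra.algebraMap_eq_smul_one]; rfl }
  let jH : H →ₐc[k] A := .ofAlgHom iH (AlgHom.ext hH') (AlgHom.ext fun h => (hH h).symm)
  exact ⟨{
    carrier := A
    iC := iC
    iH := jH
    iB := iB
    bijective := hb
    iC_one := hA.iC_one
    iC_mul := hA.iC_mul
    iH_mul_iC := hA.iH_mul_iC
    iB_one := hA.iB_one
    iB_mul := hA.iB_mul
    iB_mul_iH := hA.iB_mul_iH
    counit_iC := hC'
    comul_iC := fun c x s => (hC c).trans (comulC_eq c x s)
    counit_iB := hB'
    comul_iB := fun b x r => (hB b).trans (comulB_eq b x r)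
    iB_mul_iC := hA.iB_mul_iC }⟩

end HopfStructure

end

end BraidedDouble

theorem propositionC5 {k : Type u} [Field k] {H : Type u} [Ring H] [HopfAlgebra k H]
    [Quasitriangular k H] (C B : RMod k H) [HopfObj C] [HopfObj B] [IsIso 𝒮[C]]
    (p : DualPairing C B) :
    Nonempty (DoubleBosonisation p) ∧
    (∀ U : DoubleBosonisation p,
      ∃ (F : CrossedBimodule p ⥤ RMod k U.carrier) (_ : F.Monoidal),
        F.IsEquivalence ∧
        (∃ α : F ⋙ RMod.forget k U.carrier ≅ CrossedBimodule.forget p ⋙ RMod.forget k H,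
          NatTrans.IsMonoidal α.hom) ∧
        ∀ E : ExactPairing B C, E.evaluation' = p.ev →
          ∃ (Q : Quasitriangular k U.carrier) (br : BraidedCategory (CrossedBimodule p)),
            (Q.R : U.carrier ⊗[k] U.carrier) = U.rMatrix E.coevaluation' ∧
            (∀ V W : CrossedBimodule p,
              (br.braiding V W).hom.hom = rigidBraiding E.coevaluation' V W) ∧
            ∀ V W : CrossedBimodule p,
              Functor.LaxMonoidal.μ F V W ≫ F.map (br.braiding V W).hom =
                (β_ (F.obj V) (F.obj W)).hom ≫ Functor.LaxMonoidal.μ F W V) ∧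
    ∃ (h : IsCrossedBimodule p (leftCoregular p) (rightAdjoint B))
      (M : MonObj (CrossedBimodule.mk B (leftCoregular p) (rightAdjoint B) h)),
      M.one.hom = η[B] ∧ M.mul.hom = μ[B] := by
  refine ⟨nonempty_doubleBosonisation p, fun U => ⟨U.functor, inferInstance, inferInstance, ⟨U.functorForget, inferInstance⟩, fun E hE => ?_⟩,
    isCrossedBimodule_coregular_adjoint p, coregularMon p, rfl, rfl⟩
  obtain ⟨Q, hQ⟩ := U.exists_quasitriangular hE
  exact ⟨Q, rigidBraided E hE, hQ, fun V W => rfl, fun V W => U.functor_braided hE Q hQ V W⟩
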